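/- **Conventions.** $\Gamma$ is Segal's category: objects are finite sets, a morphism $I\to J$ is a family $(J_i)_{i\in I}$ of pairwise disjoint subsets of $J$; it is *active* if $\bigcup_i J_i=J$ and *inert* if every $J_i$ is a singleton. A *hypermoment category* is a category $\mathcal C$ with two classes of morphisms (active, inert), each closed under composition and containing all isomorphisms, such that every morphism is an active one followed by an inert one, uniquely up to a unique isomorphism, and with a functor $\gamma:\mathcal C\to\Gamma$ preserving active and inert morphisms. A *unit* is an object $U$ with $|\gamma(U)|=1$ such that every active morphism with target $U$ has exactly one inert section. It is required that each element of $\gamma(A)$ (viewed as an inert morphism from a one-element set to $\gamma(A)$) has an inert lift $U\to A$ with $U$ a unit, unique up to a unique isomorphism. $\mathcal C$ is *unital* if every object $A$ receives an active morphism $U\to A$ from a unit, unique up to a unique isomorphism. $\mathrm{el}(A)$ is the (finite) set of isomorphism classes of inert morphisms $U_\alpha\to A$ with $U_\alpha$ a unit. For $f:A\to B$ active and $\alpha\in\mathrm{el}(A)$ let $U_\alpha\xrightarrow{f_\alpha}B_\alpha\to B$ be the active/inert factorisation of $U_\alpha\to A\to B$. Let $\mathcal E$ be a symmetric monoidal category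 with unit $I$. A *$\mathcal C$-operad* in $\mathcal E$ is a functor $O:\mathrm{Iso}(\mathcal C)\to\mathcal E$ with morphisms $\eta_U:I\to O(U)$ for each unit $U$ and $\mu_f:O(A)\otimes\bigotimes_{\alpha\in\mathrm{el}(A)}O(B_\alpha)\to O(B)$ for each active $f:A\to B$, such that: for $f:U\to A$ active with $U$ a unit, $\mu_f(\eta_U\otimes 1)$ is the left unit constraint; $\mu_{1_A}(1\otimes\bigotimes_\alpha\eta_{U_\alpha})$ is the right unit constraint; for $A\xrightarrow{f}B\xrightarrow{g}D$ active, $\mu_g(\mu_f\otimes1)=\mu_{gf}(1\otimes\bigotimes_\alpha\mu_{g_\alpha})$, where $g_\alpha:B_\alpha\to D_\alpha$ is the active part of $B_\alpha\to B\to D$; and the $\mu_f$ are compatible with isomorphisms $\sigma:A\cong A'$, $\rho:B\cong B'$ with $\rho f=f'\sigma$ and the induced $B_\alpha\cong B'_{\sigma\alpha}$. Morphisms are natural transformations commuting with $\eta$ and $\mu$. A *$\mathcal C$-monoid* in $\mathcal E$ assigns to each unit $U$ an object $X(U)$ and to each active $f:U\to B$ with $U$ a unit a morphism $X(f):X(B)\to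 X(U)$, where $X(B):=\bigotimes_{\beta\in\mathrm{el}(B)}X(U_\beta)$, such that, with $X(f):=\bigotimes_{\alpha\in\mathrm{el}(A)}X(f_\alpha)$ for arbitrary active $f:A\to B$, $X$ is a contravariant functor on active morphisms. Morphisms are families $X(U)\to Y(U)$ commuting with all $X(f)$, $Y(f)$. The *plus construction* $\mathcal C^+$ is the category of *$\mathcal C$-trees* $([m],A_\bullet)$: chains $A_0\to\cdots\to A_m$ of active morphisms with $A_0$ a unit. A morphism $([m],A_\bullet)\to([n],B_\bullet)$ is a pair $(\phi,f)$ of a monotone map $\phi:[m]\to[n]$ and a natural transformation $f_i:A_i\to B_{\phi(i)}$ with inert components. It is active if $\phi$ preserves the endpoints and $f$ is invertible, inert if $\phi(i+1)=\phi(i)+1$ for all $i$. The functor $\gamma_{\mathcal C^+}$ sends $([m],A_\bullet)$ to its set of vertices $\coprod_{i<m}\gamma(A_i)$, and $(\phi,f)$ sends a vertex $a\in\gamma(A_i)$ to the set of all vertices $b\in\gamma(B_j)$ with $[j,j+1]\subseteq[\phi(i),\phi(i+1)]$ and $b$ in the image of $a$ under $\gamma(A_i\to B_{\phi(i)}\to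 B_j)$. **Theorem.** Let $\mathcal C$ be a unital hypermoment category. Then $\mathcal C^+$ is a unital hypermoment category, whose units are exactly the $\mathcal C$-trees of height $1$, $([1],U\to A)$. For every symmetric monoidal category $\mathcal E$ there is an equivalence between the category of $\mathcal C^+$-monoids in $\mathcal E$ and the category of $\mathcal C$-operads in $\mathcal E$. If the operad $O$ corresponds to the monoid $X$, there are isomorphisms $O(A)\cong X([1],U\to A)$, natural in $X$ and compatible with isomorphisms of the unit trees $([1],U\to A)$, under which $\eta_U$ corresponds to the action of $([1],1_U)\to([0],U)$, and $\mu_f$, for $f:A\to B$ active and $U\to A$ active with $U$ a unit, corresponds to the action of $([1],U\to B)\to([2],U\to A\xrightarrow{f}B)$. -/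

import Mathlib

open CategoryTheory MonoidalCategory

universe v u v' u'

/-! ## Segal's category `Γ` -/

/-- Objects of Segal's category `Γ`: finite sets (all of them, not only the skeleton
`{1, …, n}`). -/
structure SegalGamma : Type 1 where
  /-- The underlying set. -/
  carrier : Type
  [finite : Finite carrier]

namespace SegalGamma

/-- A morphism `I ⟶ J` in `Γ` is an `I`-indexed family of pairwise disjoint subsets of `J`. -/
@[ext]
structure Hom (I J : SegalGamma) where
  /-- The family of subsets. -/
  sub : I.carrier → Set J.carrier
  disj : ∀ i i' j, j ∈ sub i → j ∈ sub i' → i = i'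

instance : Category SegalGamma where
  Hom := Hom
  id I := ⟨fun i => {i}, by rintro i i' j rfl h; exact h⟩
  comp f g := ⟨fun i => {k | ∃ j ∈ f.sub i, k ∈ g.sub j}, by
    rintro i i' k ⟨j, hj, hk⟩ ⟨j', hj', hk'⟩
    obtain rfl := g.disj _ _ _ hk hk'
    exact f.disj _ _ _ hj hj'⟩
  id_comp f := by
    apply Hom.ext; funext i; ext k; simp
  comp_id f := by
    apply Hom.ext; funext i; ext k; simp
  assoc f g h := by
    apply Hom.ext; funext i; ext k
    exact ⟨fun ⟨b, ⟨a, ha, hb⟩, hk⟩ => ⟨a, ha, b, hb, hk⟩,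
      fun ⟨a, ha, b, hb, hk⟩ => ⟨b, ⟨a, ha, hb⟩, hk⟩⟩

/-- The subset `f(i)` of `J` attached to `i ∈ I` by a morphism `f : I ⟶ J` of `Γ`. -/
def sub {I J : SegalGamma} (f : I ⟶ J) : I.carrier → Set J.carrier := Hom.sub f

theorem hom_ext {I J : SegalGamma} {f g : I ⟶ J} (h : ∀ i, sub f i = sub g i) : f = g :=
  Hom.ext (funext h)

theorem mem_sub_id {I : SegalGamma} (i j : I.carrier) : j ∈ sub (𝟙 I) i ↔ j = i := Iff.rfl

theorem mem_sub_comp {I J K : SegalGamma} (f : I ⟶ J) (g : J ⟶ K) (i : I.carrier)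
    (k : K.carrier) : k ∈ sub (f ≫ g) i ↔ ∃ j ∈ sub f i, k ∈ sub g j := Iff.rfl

/-- A morphism of `Γ` is active if its subsets cover the target. -/
def IsActive {I J : SegalGamma} (f : I ⟶ J) : Prop := ∀ j, ∃ i, j ∈ sub f i

/-- A morphism of `Γ` is inert if all its subsets are singletons. -/
def IsInert {I J : SegalGamma} (f : I ⟶ J) : Prop := ∀ i, ∃ j, sub f i = {j}

end SegalGamma

/-! ## Hypermoment categories -/

/-- The data of a hypermoment category: two classes of morphisms, each containing the identities
and stable under composition, and an augmentation over `Γ`.  The axioms are in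
`IsHypermoment`. -/
class HypermomentData (C : Type u) [Category.{v} C] where
  /-- The active morphisms. -/
  act : MorphismProperty C
  /-- The inert morphisms. -/
  inert : MorphismProperty C
  act_id : ∀ A : C, act (𝟙 A)
  act_comp : ∀ {A B D : C} (f : A ⟶ B) (g : B ⟶ D), act f → act g → act (f ≫ g)
  inert_id : ∀ A : C, inert (𝟙 A)
  inert_comp : ∀ {A B D : C} (f : A ⟶ B) (g : B ⟶ D), inert f → inert g → inert (f ≫ g)
  /-- The augmentation over `Γ`. -/
  aug : C ⥤ SegalGamma

namespace Hypermoment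

open HypermomentData

section

variable {C : Type u} [Category.{v} C] [HypermomentData C]

/-- Each active morphism with target `U` has one and only one inert section. -/
def UnitAxiom (U : C) : Prop :=
  ∀ ⦃A : C⦄ (r : A ⟶ U), act r → ∃! s : U ⟶ A, inert s ∧ s ≫ r = 𝟙 U

/-- Units: objects of cardinality one (i.e. lying over a one-element set) which satisfy the
unit axiom. -/
def IsUnitObj (U : C) : Prop :=
  (∃! _x : ((aug (C := C)).obj U).carrier, True) ∧ UnitAxiom U

end

/-- The axioms of a hypermoment category.  In `lift` and `lift_unique` the inert morphism
`i : U ⟶ A` is a lift of the element `a : 𝟏 ⟶ γ(A)`: since `U` is a unit, `γ(U)` has exactly one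
element `x`, and `γ(i)(x) = {a}`. -/
class IsHypermoment (C : Type u) [Category.{v} C] [HypermomentData C] : Prop where
  act_of_isIso : ∀ {A B : C} (f : A ⟶ B) [IsIso f], act f
  inert_of_isIso : ∀ {A B : C} (f : A ⟶ B) [IsIso f], inert f
  factor : ∀ {A B : C} (f : A ⟶ B), ∃ (Z : C) (g : A ⟶ Z) (h : Z ⟶ B),
    act g ∧ inert h ∧ g ≫ h = f
  factor_unique : ∀ {A B Z Z' : C} (g : A ⟶ Z) (h : Z ⟶ B) (g' : A ⟶ Z') (h' : Z' ⟶ B),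
    act g → inert h → act g' → inert h' → g ≫ h = g' ≫ h' →
      ∃! e : Z ≅ Z', g ≫ e.hom = g' ∧ e.hom ≫ h' = h
  aug_act : ∀ {A B : C} (f : A ⟶ B), act f → SegalGamma.IsActive ((aug (C := C)).map f)
  aug_inert : ∀ {A B : C} (f : A ⟶ B), inert f → SegalGamma.IsInert ((aug (C := C)).map f)
  lift : ∀ (A : C) (a : ((aug (C := C)).obj A).carrier), ∃ (U : C) (i : U ⟶ A),
    IsUnitObj U ∧ inert i ∧ ∀ x, SegalGamma.sub ((aug (C := C)).map i) x = {a}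
  lift_unique : ∀ (A : C) (a : ((aug (C := C)).obj A).carrier) (U U' : C) (i : U ⟶ A)
    (i' : U' ⟶ A), IsUnitObj U → inert i →
      (∀ x, SegalGamma.sub ((aug (C := C)).map i) x = {a}) → IsUnitObj U' → inert i' →
      (∀ x, SegalGamma.sub ((aug (C := C)).map i') x = {a}) → ∃! e : U ≅ U', e.hom ≫ i' = i

/-- A hypermoment category is unital if each object receives an essentially unique active morphism
from a unit. -/
class IsUnitalHypermoment (C : Type u) [Category.{v} C] [HypermomentData C] : Prop
    extends IsHypermoment C where
  unital : ∀ A : C, ∃ (U : C) (f : U ⟶ A), IsUnitObj U ∧ act f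
  unital_unique : ∀ (A U U' : C) (f : U ⟶ A) (f' : U' ⟶ A), IsUnitObj U → act f →
    IsUnitObj U' → act f' → ∃! e : U ≅ U', e.hom ≫ f' = f

/-! ## Elementary inert morphisms -/

section

variable {C : Type u} [Category.{v} C] [HypermomentData C]

/-- An elementary inert morphism into `A`: an inert morphism whose domain is a unit. -/
structure Elem (A : C) where
  /-- The domain. -/
  dom : C
  isUnit : IsUnitObj dom
  /-- The morphism. -/
  hom : dom ⟶ A
  inert : inert hom

/-- Two elementary inert morphisms into `A` represent the same elementary inert subobject. -/
def Elem.Equiv {A : C} (e e' : Elem A) : Prop := ∃ h : e.dom ≅ e'.dom, h.hom ≫ e'.hom = e.hom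

/-- Push an elementary inert morphism forward along an inert morphism. -/
def Elem.push {A B : C} (e : Elem A) (j : A ⟶ B) (hj : HypermomentData.inert j) : Elem B :=
  ⟨e.dom, e.isUnit, e.hom ≫ j, inert_comp _ _ e.inert hj⟩

/-- The identity of a unit. -/
def Elem.refl (U : C) (hU : IsUnitObj U) : Elem U := ⟨U, hU, 𝟙 U, inert_id U⟩

/-- A frame of `A` is a list containing exactly one representative of each elementary inert
subobject of `A`, that is, a choice of representatives together with a linear ordering of the set
`el(A)` of elementary inert subobjects. -/
def IsFrame {A : C} (l : List (Elem A)) : Prop :=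
  (∀ e : Elem A, ∃ e' ∈ l, e.Equiv e') ∧ l.Pairwise (fun e e' => ¬ e.Equiv e')

/-- An active/inert factorisation of a morphism. -/
structure Factor {A B : C} (f : A ⟶ B) where
  /-- The middle object. -/
  mid : C
  /-- The active part. -/
  left : A ⟶ mid
  act : act left
  /-- The inert part. -/
  right : mid ⟶ B
  inert : inert right
  fac : left ≫ right = f

/-- A piece of `f : A ⟶ B` is an elementary inert `α : U ⟶ A` together with an active/inert
factorisation `U ⟶ B_α ⟶ B` of `α ≫ f`. -/
structure Piece {A B : C} (f : A ⟶ B) extends Elem A where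
  /-- The factorisation. -/
  factor : Factor (hom ≫ f)

namespace Piece

variable {A B D : C} {f : A ⟶ B}

/-- The object `B_α`. -/
def cod (p : Piece f) : C := p.factor.mid

/-- The active morphism `f_α : U ⟶ B_α`. -/
def res (p : Piece f) : p.dom ⟶ p.cod := p.factor.left

theorem res_act (p : Piece f) : act p.res := p.factor.act

/-- The inert morphism `B_α ⟶ B`. -/
def incl (p : Piece f) : p.cod ⟶ B := p.factor.right

theorem incl_inert (p : Piece f) : HypermomentData.inert p.incl := p.factor.inert

theorem comm (p : Piece f) : p.res ≫ p.incl = p.hom ≫ f := p.factor.fac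

/-- For `f : U ⟶ A` active with `U` a unit: the piece of `f` given by the identity of `U`, so that
`A_α = A`. -/
def whole {U A : C} (hU : IsUnitObj U) (f : U ⟶ A) (hf : act f) : Piece f where
  toElem := Elem.refl U hU
  factor := ⟨A, f, hf, 𝟙 A, inert_id A, by simp [Elem.refl]⟩

/-- For an elementary inert `α : U ⟶ A`: the piece of the identity of `A` with `A_α = U`. -/
def ofElem (e : Elem A) : Piece (𝟙 A) where
  toElem := e
  factor := ⟨e.dom, 𝟙 _, act_id _, e.hom, e.inert, by simp⟩

/-- A piece `U ⟶ B_α ⟶ B` of `f : A ⟶ B` and a factorisation `B_α ⟶ D_α ⟶ D` of `B_α ⟶ B ⟶ D`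
define a piece `U ⟶ D_α ⟶ D` of `f ≫ g`. -/
def comp (p : Piece f) {g : B ⟶ D} (q : Factor (p.incl ≫ g)) : Piece (f ≫ g) where
  toElem := p.toElem
  factor := ⟨q.mid, p.res ≫ q.left, act_comp _ _ p.res_act q.act, q.right, q.inert, by
    rw [Category.assoc, q.fac, ← Category.assoc, p.comm, Category.assoc]⟩

/-- A piece `V ⟶ D' ⟶ D_α` of the active part `B_α ⟶ D_α` of `B_α ⟶ B ⟶ D` defines a piece
`V ⟶ D' ⟶ D` of `g : B ⟶ D`. -/
def push (p : Piece f) {g : B ⟶ D} {q : Factor (p.incl ≫ g)} (r : Piece q.left) : Piece g where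
  toElem := r.toElem.push p.incl p.incl_inert
  factor := ⟨r.cod, r.res, r.res_act, r.incl ≫ q.right, inert_comp _ _ r.incl_inert q.inert, by
    have h : r.res ≫ r.incl ≫ q.right = (r.hom ≫ p.incl) ≫ g := by
      rw [← Category.assoc, r.comm, Category.assoc, q.fac, Category.assoc]
    exact h⟩

end Piece

/-- Given isomorphisms `σ : A ≅ A'` and `ρ : B ≅ B'`, an isomorphism between a piece
`U ⟶ B_α ⟶ B` of `f : A ⟶ B` and a piece `U' ⟶ B'_α' ⟶ B'` of `f' : A' ⟶ B'` over `σ` and `ρ`. -/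
structure PieceIso {A B A' B' : C} {f : A ⟶ B} {f' : A' ⟶ B'} (σ : A ≅ A') (ρ : B ≅ B')
    (p : Piece f) (p' : Piece f') where
  /-- The isomorphism of units. -/
  domIso : p.dom ≅ p'.dom
  /-- The isomorphism `B_α ≅ B'_α'`. -/
  codIso : p.cod ≅ p'.cod
  hom_comm : domIso.hom ≫ p'.hom = p.hom ≫ σ.hom
  res_comm : domIso.hom ≫ p'.res = p.res ≫ codIso.hom
  incl_comm : codIso.hom ≫ p'.incl = p.incl ≫ ρ.hom

end

/-! ## Iterated tensor products

Unordered tensor products `⨂_{α ∈ I}` over a finite set `I` are treated by means of all linear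
orderings of `I`, with invariance under transposition of two consecutive factors. -/

section Tensor

variable {E : Type u'} [Category.{v'} E] [MonoidalCategory E]

/-- The tensor product of the family `F` over a list. -/
def tens {ι : Type*} (F : ι → E) : List ι → E
  | [] => 𝟙_ E
  | a :: l => F a ⊗ tens F l

/-- The tensor product of morphisms `F a ⟶ G a` over a list. -/
def tensHom {ι : Type*} {F G : ι → E} (φ : ∀ a, F a ⟶ G a) : ∀ l : List ι, tens F l ⟶ tens G l
  | [] => 𝟙 (𝟙_ E)
  | a :: l => φ a ⊗ₘ tensHom φ l

theorem tensHom_id {ι : Type*} (F : ι → E) (l : List ι) :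
    tensHom (fun a => 𝟙 (F a)) l = 𝟙 (tens F l) := by
  induction l with
  | nil => rfl
  | cons a l ih => simp [tensHom, tens, ih]

theorem tensHom_comp {ι : Type*} {F G H : ι → E} (φ : ∀ a, F a ⟶ G a) (ψ : ∀ a, G a ⟶ H a)
    (l : List ι) : tensHom (fun a => φ a ≫ ψ a) l = tensHom φ l ≫ tensHom ψ l := by
  induction l with
  | nil => exact (Category.id_comp (𝟙 (𝟙_ E))).symm
  | cons a l ih =>
    exact (congrArg (fun x => (φ a ≫ ψ a) ⊗ₘ x) ih).trans
      (tensorHom_comp_tensorHom (φ a) (tensHom φ l) (ψ a) (tensHom ψ l)).symm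

/-- The tensor product of morphisms `F a ⟶ G (c a)` over a list. -/
def tensMap {ι κ : Type*} {F : ι → E} {G : κ → E} (c : ι → κ) (φ : ∀ a, F a ⟶ G (c a)) :
    ∀ l : List ι, tens F l ⟶ tens G (l.map c)
  | [] => 𝟙 (𝟙_ E)
  | a :: l => φ a ⊗ₘ tensMap c φ l

/-- The canonical isomorphism between the tensor product over `l.map c` and the tensor product of
the reindexed family over `l`. -/
def tensReindex {ι κ : Type*} (G : κ → E) (c : ι → κ) :
    ∀ l : List ι, tens G (l.map c) ⟶ tens (fun a => G (c a)) l
  | [] => 𝟙 (𝟙_ E)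
  | a :: l => G (c a) ◁ tensReindex G c l

/-- The canonical isomorphism `𝟙 ⊗ ⋯ ⊗ 𝟙 ⟶ 𝟙`. -/
def tensUnit {ι : Type*} : ∀ l : List ι, tens (fun _ => 𝟙_ E) l ⟶ 𝟙_ E
  | [] => 𝟙 (𝟙_ E)
  | _ :: l => (λ_ (tens (fun _ => 𝟙_ E) l)).hom ≫ tensUnit l

/-- The canonical isomorphism splitting the tensor product over a concatenation. -/
def tensAppend {ι : Type*} (F : ι → E) (l' : List ι) :
    ∀ l : List ι, tens F (l ++ l') ⟶ tens F l ⊗ tens F l'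
  | [] => (λ_ (tens F l')).inv
  | a :: l => F a ◁ tensAppend F l' l ≫ (α_ (F a) (tens F l) (tens F l')).inv

/-- The tensor product of morphisms `φ a : ⨂_{b ∈ m a} G (h a b) ⟶ F (c a)`, whose source is the
tensor product over the concatenation of the lists `(m a).map (h a)`. -/
def tensFlat {ι κ μ : Type*} {β : ι → Type*} (G : κ → E) (F : μ → E) (c : ι → μ)
    (m : ∀ a, List (β a)) (h : ∀ a, β a → κ)
    (φ : ∀ a, tens (fun b => G (h a b)) (m a) ⟶ F (c a)) :
    ∀ l : List ι, tens G (l.flatMap fun a => (m a).map (h a)) ⟶ tens F (l.map c)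
  | [] => 𝟙 (𝟙_ E)
  | a :: l => tensAppend G (l.flatMap fun a => (m a).map (h a)) ((m a).map (h a)) ≫
      ((tensReindex G (h a) (m a) ≫ φ a) ⊗ₘ tensFlat G F c m h φ l)

variable [SymmetricCategory E]

/-- The symmetry exchanging two consecutive factors `x`, `y` of a tensor product. -/
def tensSwap {ι : Type*} (F : ι → E) (x y : ι) (l₂ : List ι) :
    ∀ l₁ : List ι, tens F (l₁ ++ x :: y :: l₂) ⟶ tens F (l₁ ++ y :: x :: l₂)
  | [] => (α_ (F x) (F y) (tens F l₂)).inv ≫ (β_ (F x) (F y)).hom ▷ tens F l₂ ≫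
      (α_ (F y) (F x) (tens F l₂)).hom
  | a :: l₁ => F a ◁ tensSwap F x y l₂ l₁

/-- Given morphisms `φ a : K a ⊗ ⨂_{b ∈ m a} G (h a b) ⟶ F (c a)`, the morphism
`(⨂_a K a) ⊗ (⨂_a ⨂_{b ∈ m a} G (h a b)) ⟶ ⨂_a F (c a)` obtained by permuting the factors and
tensoring the `φ a`. -/
def tensZip {ι κ μ : Type*} {β : ι → Type*} (K : ι → E) (G : κ → E) (F : μ → E) (c : ι → μ)
    (m : ∀ a, List (β a)) (h : ∀ a, β a → κ)
    (φ : ∀ a, K a ⊗ tens (fun b => G (h a b)) (m a) ⟶ F (c a)) :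
    ∀ l : List ι,
      tens K l ⊗ tens G (l.flatMap fun a => (m a).map (h a)) ⟶ tens F (l.map c)
  | [] => (λ_ (𝟙_ E)).hom
  | a :: l => ((K a ⊗ tens K l) ◁
        (tensAppend G (l.flatMap fun a => (m a).map (h a)) ((m a).map (h a)) ≫
          tensReindex G (h a) (m a) ▷ _)) ≫
      tensorμ (K a) (tens K l) (tens (fun b => G (h a b)) (m a))
        (tens G (l.flatMap fun a => (m a).map (h a))) ≫
      (φ a ⊗ₘ tensZip K G F c m h φ l)

end Tensor

/-! ## Operads and monoids -/

section

variable (C : Type u) [Category.{v} C] [HypermomentData C]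
variable (E : Type u') [Category.{v'} E] [MonoidalCategory E] [SymmetricCategory E]

/-- A `C`-operad in the symmetric monoidal category `E`. -/
structure Operad where
  /-- The underlying `C`-collection. -/
  coll : Core C ⥤ E
  /-- The units `I ⟶ O(U)`. -/
  unit : ∀ U : C, IsUnitObj U → (𝟙_ E ⟶ coll.obj ⟨U⟩)
  /-- The multiplications `μ_f : O(A) ⊗ ⨂_{α ∈ el(A)} O(B_α) ⟶ O(B)` for `f : A ⟶ B` active, one
  for each choice of representatives and of an ordering of the tensor factors. -/
  mul : ∀ {A B : C} (f : A ⟶ B), act f → ∀ l : List (Piece f), IsFrame (l.map Piece.toElem) →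
    (coll.obj ⟨A⟩ ⊗ tens (fun p : Piece f => coll.obj ⟨p.cod⟩) l ⟶ coll.obj ⟨B⟩)
  /-- The multiplications do not depend on the ordering of the tensor factors. -/
  mul_swap : ∀ {A B : C} (f : A ⟶ B) (hf : act f) (l₁ l₂ : List (Piece f)) (x y : Piece f)
    (h : IsFrame ((l₁ ++ x :: y :: l₂).map Piece.toElem))
    (h' : IsFrame ((l₁ ++ y :: x :: l₂).map Piece.toElem)),
    mul f hf (l₁ ++ x :: y :: l₂) h =
      coll.obj ⟨A⟩ ◁ tensSwap (fun p : Piece f => coll.obj ⟨p.cod⟩) x y l₂ l₁ ≫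
        mul f hf (l₁ ++ y :: x :: l₂) h'
  /-- Left unit axiom. -/
  left_unit : ∀ {U A : C} (hU : IsUnitObj U) (f : U ⟶ A) (hf : act f)
    (h : IsFrame ([Piece.whole hU f hf].map Piece.toElem)),
    unit U hU ▷ (coll.obj ⟨A⟩ ⊗ 𝟙_ E) ≫ mul f hf [Piece.whole hU f hf] h =
      (λ_ (coll.obj ⟨A⟩ ⊗ 𝟙_ E)).hom ≫ (ρ_ (coll.obj ⟨A⟩)).hom
  /-- Right unit axiom. -/
  right_unit : ∀ (A : C) (l : List (Elem A))
    (h : IsFrame ((l.map Piece.ofElem).map Piece.toElem)),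
    coll.obj ⟨A⟩ ◁ tensMap (F := fun _ => 𝟙_ E)
        (G := fun p : Piece (𝟙 A) => coll.obj ⟨p.cod⟩) Piece.ofElem
        (fun e : Elem A => unit e.dom e.isUnit) l ≫
      mul (𝟙 A) (act_id A) (l.map Piece.ofElem) h =
    coll.obj ⟨A⟩ ◁ tensUnit l ≫ (ρ_ (coll.obj ⟨A⟩)).hom
  /-- Associativity axiom, for `f : A ⟶ B` and `g : B ⟶ D` active.  For each piece
  `U_α ⟶ B_α ⟶ B` of `f` one has the factorisation `B_α ⟶ D_α ⟶ D` of `B_α ⟶ B ⟶ D`, with active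
  part `g_α`, and the pieces of all `g_α` form together the pieces of `g`. -/
  assoc : ∀ {A B D : C} (f : A ⟶ B) (g : B ⟶ D) (hf : act f) (hg : act g)
    (l : List (Piece f)) (q : ∀ p : Piece f, Factor (p.incl ≫ g))
    (m : ∀ p : Piece f, List (Piece (q p).left))
    (hl : IsFrame (l.map Piece.toElem)) (hm : ∀ p, IsFrame ((m p).map Piece.toElem))
    (hl' : IsFrame ((l.flatMap fun p => (m p).map p.push).map Piece.toElem))
    (hl'' : IsFrame ((l.map fun p => p.comp (q p)).map Piece.toElem)),
    (α_ _ _ _).inv ≫ mul f hf l hl ▷ _ ≫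
        mul g hg (l.flatMap fun p => (m p).map p.push) hl' =
      coll.obj ⟨A⟩ ◁ tensZip (fun p : Piece f => coll.obj ⟨p.cod⟩)
          (fun r : Piece g => coll.obj ⟨r.cod⟩)
          (fun s : Piece (f ≫ g) => coll.obj ⟨s.cod⟩) (fun p => p.comp (q p)) m
          (fun p => p.push) (fun p => mul (q p).left (q p).act (m p) (hm p)) l ≫
        mul (f ≫ g) (act_comp f g hf hg) (l.map fun p => p.comp (q p)) hl''
  /-- Equivariance axiom: compatibility of the multiplications with isomorphisms
  `σ : A ≅ A'`, `ρ : B ≅ B'` and `B_α ≅ B'_α'`. -/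
  equivariance : ∀ {A B A' B' : C} (f : A ⟶ B) (f' : A' ⟶ B') (hf : act f) (hf' : act f')
    (σ : A ≅ A') (ρ : B ≅ B'), f ≫ ρ.hom = σ.hom ≫ f' →
    ∀ (c : Piece f → Piece f') (τ : ∀ p, PieceIso σ ρ p (c p)) (l : List (Piece f))
      (h : IsFrame (l.map Piece.toElem)) (h' : IsFrame ((l.map c).map Piece.toElem)),
    mul f hf l h ≫ coll.map ⟨ρ⟩ =
      (coll.map ⟨σ⟩ ⊗ₘ tensMap (F := fun p : Piece f => coll.obj ⟨p.cod⟩)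
          (G := fun p : Piece f' => coll.obj ⟨p.cod⟩) c
          (fun p => coll.map ⟨(τ p).codIso⟩) l) ≫
        mul f' hf' (l.map c) h'

/-- A `C`-monoid `X` in `E`.  It assigns an object `X(U)` to each unit `U`, whence
`X(A) = ⨂_{α ∈ el(A)} X(U_α)` for an arbitrary object `A`, and a morphism `X(f) : X(B) ⟶ X(U)` to
each active `f : U ⟶ B` with `U` a unit, whence `X(f) = ⨂_{α ∈ el(A)} X(f_α)` for an arbitrary
active `f : A ⟶ B`; this has to be contravariantly functorial. -/
structure Mon where
  /-- The values on units. -/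
  obj : ∀ U : C, IsUnitObj U → E
  /-- The morphisms `X(f)`, one for each choice of representatives and of an ordering of the tensor
  factors. -/
  map : ∀ {U B : C} (hU : IsUnitObj U) (f : U ⟶ B), act f → ∀ l : List (Elem B), IsFrame l →
    (tens (fun e : Elem B => obj e.dom e.isUnit) l ⟶ obj U hU)
  /-- The morphisms `X(f)` do not depend on the ordering of the tensor factors. -/
  map_swap : ∀ {U B : C} (hU : IsUnitObj U) (f : U ⟶ B) (hf : act f) (l₁ l₂ : List (Elem B))
    (x y : Elem B) (h : IsFrame (l₁ ++ x :: y :: l₂)) (h' : IsFrame (l₁ ++ y :: x :: l₂)),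
    map hU f hf (l₁ ++ x :: y :: l₂) h =
      tensSwap (fun e : Elem B => obj e.dom e.isUnit) x y l₂ l₁ ≫
        map hU f hf (l₁ ++ y :: x :: l₂) h'
  /-- `X` preserves identities. -/
  map_id : ∀ (U : C) (hU : IsUnitObj U) (h : IsFrame [Elem.refl U hU]),
    map hU (𝟙 U) (act_id U) [Elem.refl U hU] h = (ρ_ (obj U hU)).hom
  /-- `X` preserves compositions: `X(f ≫ g) = X(g) ≫ X(f)`, where `X(g)` is the tensor product of
  the `X(g_α)`, `α ∈ el(A)`. -/
  map_comp : ∀ {U A B : C} (hU : IsUnitObj U) (f : U ⟶ A) (g : A ⟶ B) (hf : act f) (hg : act g)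
    (l : List (Piece g)) (m : ∀ p : Piece g, List (Elem p.cod))
    (hl : IsFrame (l.map Piece.toElem)) (hm : ∀ p, IsFrame (m p))
    (hl' : IsFrame (l.flatMap fun p => (m p).map fun e => e.push p.incl p.incl_inert)),
    map hU (f ≫ g) (act_comp f g hf hg)
        (l.flatMap fun p => (m p).map fun e => e.push p.incl p.incl_inert) hl' =
      tensFlat (fun e : Elem B => obj e.dom e.isUnit) (fun e : Elem A => obj e.dom e.isUnit)
          Piece.toElem m (fun p e => e.push p.incl p.incl_inert)
          (fun p => map p.isUnit p.res p.res_act (m p) (hm p)) l ≫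
        map hU f hf (l.map Piece.toElem) hl

variable {C E}

/-- Morphisms of `C`-operads: maps of collections commuting with units and multiplications. -/
@[ext]
structure Operad.Hom (O P : Operad C E) where
  /-- The underlying map of collections. -/
  app : O.coll ⟶ P.coll
  unit_app : ∀ (U : C) (hU : IsUnitObj U), O.unit U hU ≫ app.app ⟨U⟩ = P.unit U hU
  mul_app : ∀ {A B : C} (f : A ⟶ B) (hf : act f) (l : List (Piece f))
    (h : IsFrame (l.map Piece.toElem)),
    O.mul f hf l h ≫ app.app ⟨B⟩ =
      (app.app ⟨A⟩ ⊗ₘ tensHom (fun p : Piece f => app.app ⟨p.cod⟩) l) ≫ P.mul f hf l h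

/-- Morphisms of `C`-monoids: families of morphisms on units, natural with respect to active
morphisms. -/
@[ext]
structure Mon.Hom (X Y : Mon C E) where
  /-- The components. -/
  app : ∀ (U : C) (hU : IsUnitObj U), X.obj U hU ⟶ Y.obj U hU
  naturality : ∀ {U B : C} (hU : IsUnitObj U) (f : U ⟶ B) (hf : act f) (l : List (Elem B))
    (h : IsFrame l),
    X.map hU f hf l h ≫ app U hU =
      tensHom (fun e : Elem B => app e.dom e.isUnit) l ≫ Y.map hU f hf l h

/-- The category of `C`-operads in `E`. -/
instance : Category (Operad C E) where
  Hom := Operad.Hom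
  id O := ⟨𝟙 _, fun U hU => by simp, fun f hf l h => by
    simp only [NatTrans.id_app, tensHom_id]; simp⟩
  comp φ ψ := ⟨φ.app ≫ ψ.app, fun U hU => by
      rw [NatTrans.comp_app, ← Category.assoc, φ.unit_app, ψ.unit_app], fun f hf l h => by
      simp only [NatTrans.comp_app]
      rw [← Category.assoc, φ.mul_app, Category.assoc, ψ.mul_app, tensHom_comp,
        MonoidalCategory.tensorHom_comp_tensorHom_assoc]⟩
  id_comp φ := Operad.Hom.ext (Category.id_comp φ.app)
  comp_id φ := Operad.Hom.ext (Category.comp_id φ.app)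
  assoc φ ψ χ := Operad.Hom.ext (Category.assoc φ.app ψ.app χ.app)

/-- The category of `C`-monoids in `E`. -/
instance : Category (Mon C E) where
  Hom := Mon.Hom
  id X := ⟨fun U hU => 𝟙 _, fun hU f hf l h => by rw [tensHom_id]; simp⟩
  comp φ ψ := ⟨fun U hU => φ.app U hU ≫ ψ.app U hU, fun hU f hf l h => by
    rw [← Category.assoc, φ.naturality, Category.assoc, ψ.naturality, tensHom_comp,
      Category.assoc]⟩
  id_comp φ := Mon.Hom.ext (funext fun U => funext fun hU => Category.id_comp (φ.app U hU))
  comp_id φ := Mon.Hom.ext (funext fun U => funext fun hU => Category.comp_id (φ.app U hU))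
  assoc φ ψ χ := Mon.Hom.ext (funext fun U => funext fun hU =>
    Category.assoc (φ.app U hU) (ψ.app U hU) (χ.app U hU))

/-- The component of a morphism of `C`-operads at an object `A`. -/
def Operad.Hom.at {O P : Operad C E} (φ : O ⟶ P) (A : C) :
    O.coll.obj ⟨A⟩ ⟶ P.coll.obj ⟨A⟩ :=
  (Operad.Hom.app φ).app ⟨A⟩

/-- The component of a morphism of `C`-monoids at a unit `U`. -/
def Mon.Hom.at {X Y : Mon C E} (φ : X ⟶ Y) (U : C) (hU : IsUnitObj U) :
    X.obj U hU ⟶ Y.obj U hU :=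
  Mon.Hom.app φ U hU

end

/-! ## The plus construction -/

theorem CTree.comp_aux {C : Type u} [Category.{v} C] {X Y X' Y' X'' Y'' : C} {a : X ⟶ Y} {f : Y ⟶ Y'} {f' : X ⟶ X'} {b : X' ⟶ Y'}
    {g : Y' ⟶ Y''} {g' : X' ⟶ X''} {c : X'' ⟶ Y''} (h : a ≫ f = f' ≫ b) (h' : b ≫ g = g' ≫ c) :
    a ≫ f ≫ g = (f' ≫ g') ≫ c := by
  rw [← Category.assoc, h, Category.assoc, h', Category.assoc]

section Plus

variable (C : Type u) [Category.{v} C] [HypermomentData C]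

/-- A `C`-tree: a chain `A_0 ⟶ ⋯ ⟶ A_m` of active morphisms of `C` starting with a unit. -/
structure CTree where
  /-- The height `m`. -/
  height : ℕ
  /-- The functor `[m] ⥤ C`. -/
  arrows : ComposableArrows C height
  act_map : ∀ {i j : Fin (height + 1)} (h : i ⟶ j), act (arrows.map h)
  isUnit_root : IsUnitObj (arrows.obj 0)

variable {C}

namespace CTree

/-- A morphism of `C`-trees: a morphism `φ : [m] ⟶ [n]` of the simplex category together with a
natural transformation `A ⟶ B ∘ φ` all of whose components are inert. -/
@[ext]
structure Hom (A B : CTree C) where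
  /-- The simplicial operator. -/
  idx : Fin (A.height + 1) →o Fin (B.height + 1)
  /-- The components of the natural transformation. -/
  app : ∀ i, A.arrows.obj i ⟶ B.arrows.obj (idx i)
  inert_app : ∀ i, inert (app i)
  naturality : ∀ (i j : Fin (A.height + 1)) (h : i ≤ j),
    A.arrows.map (homOfLE h) ≫ app j = app i ≫ B.arrows.map (homOfLE (idx.monotone h))

/-- The plus construction: the category of `C`-trees. -/
instance : Category (CTree C) where
  Hom := Hom
  id A := ⟨OrderHom.id, fun i => 𝟙 (A.arrows.obj i), fun _ => inert_id _, fun _ _ h =>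
    (Category.comp_id (A.arrows.map (homOfLE h))).trans
      (Category.id_comp (A.arrows.map (homOfLE h))).symm⟩
  comp f g := ⟨g.idx.comp f.idx, fun i => f.app i ≫ g.app (f.idx i),
    fun i => inert_comp _ _ (f.inert_app i) (g.inert_app _), fun i j h =>
      comp_aux (f.naturality i j h) (g.naturality (f.idx i) (f.idx j) (f.idx.monotone h))⟩
  id_comp f := Hom.ext rfl (heq_of_eq (funext fun i => Category.id_comp (f.app i)))
  comp_id f := Hom.ext rfl (heq_of_eq (funext fun i => Category.comp_id (f.app i)))
  assoc f g h := Hom.ext rfl (heq_of_eq (funext fun i =>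
    Category.assoc (f.app i) (g.app (f.idx i)) (h.app (g.idx (f.idx i)))))

/-- The simplicial operator of a morphism of `C`-trees. -/
def idx {A B : CTree C} (f : A ⟶ B) : Fin (A.height + 1) →o Fin (B.height + 1) := Hom.idx f

/-- The components of a morphism of `C`-trees. -/
def app {A B : CTree C} (f : A ⟶ B) (i : Fin (A.height + 1)) :
    A.arrows.obj i ⟶ B.arrows.obj (idx f i) :=
  Hom.app f i

/-- A morphism `(φ, f)` of `C`-trees is active if `φ` is active, i.e. preserves the endpoints, and
`f` is invertible. -/
def IsAct {A B : CTree C} (f : A ⟶ B) : Prop :=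
  idx f 0 = 0 ∧ idx f (Fin.last _) = Fin.last _ ∧ ∀ i, IsIso (app f i)

/-- A morphism `(φ, f)` of `C`-trees is inert if `φ` is inert, i.e. preserves distances. -/
def IsInert {A B : CTree C} (f : A ⟶ B) : Prop :=
  ∀ i : Fin A.height, (idx f i.succ : ℕ) = idx f i.castSucc + 1

/-- A vertex of a `C`-tree is an elementary inert subobject of some `A_i`, `i < m`; the
elementary inert subobjects of `A_i` are given by the elements of `γ(A_i)`. -/
structure Vertex (A : CTree C) where
  /-- The height `i` of the vertex. -/
  level : Fin A.height
  /-- The element of `γ(A_i)`. -/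
  elt : ((aug (C := C)).obj (A.arrows.obj level.castSucc)).carrier

instance (A : CTree C) : Finite A.Vertex :=
  haveI := fun i : Fin A.height =>
    ((aug (C := C)).obj (A.arrows.obj i.castSucc)).finite
  Finite.of_injective
    (fun x : A.Vertex => (⟨x.level, x.elt⟩ :
      Σ i : Fin A.height, ((aug (C := C)).obj (A.arrows.obj i.castSucc)).carrier))
    (by rintro ⟨i, a⟩ ⟨j, b⟩ h; cases h; rfl)

/-- The subset of the vertices of `B` attached to a vertex `(i, a)` of `A` by a morphism
`(φ, f) : A ⟶ B` of `C`-trees: all `(j, b)` with `[j, j+1] ⊆ [φ(i), φ(i+1)]` such that `b` belongs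
to the image of `a` under `γ(A_i ⟶ B_{φ(i)} ⟶ B_j)`. -/
def vertexSub {A B : CTree C} (f : A ⟶ B) (x : A.Vertex) : Set B.Vertex :=
  {y | ∃ h : idx f x.level.castSucc ≤ y.level.castSucc, y.level.succ ≤ idx f x.level.succ ∧
    y.elt ∈ SegalGamma.sub
      ((aug (C := C)).map (app f x.level.castSucc ≫ B.arrows.map (homOfLE h))) x.elt}

theorem mem_vertexSub {A B : CTree C} (f : A ⟶ B) (x : A.Vertex) (y : B.Vertex) :
    y ∈ vertexSub f x ↔ ∃ h : idx f x.level.castSucc ≤ y.level.castSucc,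
      y.level.succ ≤ idx f x.level.succ ∧ y.elt ∈ SegalGamma.sub
      ((aug (C := C)).map (app f x.level.castSucc ≫ B.arrows.map (homOfLE h))) x.elt := Iff.rfl

theorem vertexSub_disj {A B : CTree C} (f : A ⟶ B) (x x' : A.Vertex) (y : B.Vertex)
    (hx : y ∈ vertexSub f x) (hx' : y ∈ vertexSub f x') : x = x' := by
  obtain ⟨i, a⟩ := x
  obtain ⟨i', a'⟩ := x'
  obtain ⟨h1, h2, h3⟩ := hx
  obtain ⟨h1', h2', h3'⟩ := hx'
  dsimp only at h1 h2 h3 h1' h2' h3'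
  have key : ∀ k k' : Fin A.height, idx f k.castSucc ≤ y.level.castSucc →
      y.level.succ ≤ idx f k'.succ → k ≤ k' := by
    intro k k' h h'
    by_contra hlt
    have hle : k'.succ ≤ k.castSucc := by
      rw [not_le] at hlt
      exact Fin.succ_le_castSucc_iff.mpr hlt
    have := (h'.trans ((idx f).monotone hle)).trans h
    exact absurd this (not_le.mpr Fin.castSucc_lt_succ)
  obtain rfl : i = i' := le_antisymm (key _ _ h1 h2') (key _ _ h1' h2)
  obtain rfl := SegalGamma.Hom.disj _ _ _ _ h3 h3'
  rfl

theorem vertexSub_id (A : CTree C) (x y : A.Vertex) : y ∈ vertexSub (𝟙 A) x ↔ y = x := by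
  obtain ⟨i, a⟩ := x
  obtain ⟨j, b⟩ := y
  have e : ∀ (h : i.castSucc ≤ i.castSucc), (aug (C := C)).map
      (𝟙 (A.arrows.obj i.castSucc) ≫ A.arrows.map (homOfLE h)) =
      𝟙 ((aug (C := C)).obj (A.arrows.obj i.castSucc)) := by
    intro h
    rw [Category.id_comp, show homOfLE h = 𝟙 _ from rfl, A.arrows.map_id, CategoryTheory.Functor.map_id]
  constructor
  · rintro ⟨h1, h2, h3⟩
    have h1' : i.castSucc ≤ j.castSucc := h1
    have h2' : j.succ ≤ i.succ := h2
    obtain rfl : i = j := le_antisymm (by simpa using h1') (by simpa using h2')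
    have h3' : b ∈ SegalGamma.sub ((aug (C := C)).map
      (𝟙 (A.arrows.obj i.castSucc) ≫ A.arrows.map (homOfLE h1'))) a := h3
    rw [e, SegalGamma.mem_sub_id] at h3'
    rw [h3']
  · intro h
    cases h
    refine ⟨le_refl i.castSucc, le_refl i.succ, ?_⟩
    change a ∈ SegalGamma.sub ((aug (C := C)).map
      (𝟙 (A.arrows.obj i.castSucc) ≫ A.arrows.map (homOfLE (le_refl i.castSucc)))) a
    rw [e]
    rfl

/-- A monotone map `[m] ⟶ [n]` is such that each `[k, k+1] ⊆ [φ(p), φ(q)]` is contained in some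
`[φ(j), φ(j+1)]` with `[j, j+1] ⊆ [p, q]`. -/
theorem exists_level {m n : ℕ} (φ : Fin (m + 1) →o Fin (n + 1)) (p q : Fin (m + 1)) (k : Fin n)
    (hp : φ p ≤ k.castSucc) (hq : k.succ ≤ φ q) :
    ∃ j : Fin m, p ≤ j.castSucc ∧ j.succ ≤ q ∧ φ j.castSucc ≤ k.castSucc ∧ k.succ ≤ φ j.succ := by
  induction q using Fin.induction with
  | zero =>
    have := (hq.trans (φ.monotone (Fin.zero_le p))).trans hp
    exact absurd this (not_le.mpr Fin.castSucc_lt_succ)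
  | succ j ih =>
    by_cases hj : k.succ ≤ φ j.castSucc
    · obtain ⟨j', h1, h2, h3⟩ := ih hj
      exact ⟨j', h1, h2.trans Fin.castSucc_lt_succ.le, h3⟩
    · have hj' : φ j.castSucc ≤ k.castSucc := by
        rw [not_le] at hj
        exact Fin.le_castSucc_iff.mpr hj
      refine ⟨j, ?_, le_refl _, hj', hq⟩
      by_contra hlt
      rw [not_le] at hlt
      have := (hq.trans (φ.monotone (Fin.castSucc_lt_iff_succ_le.mp hlt))).trans hp
      exact absurd this (not_le.mpr Fin.castSucc_lt_succ)

theorem vertexSub_comp {A B D : CTree C} (f : A ⟶ B) (g : B ⟶ D) (x : A.Vertex) (z : D.Vertex) :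
    z ∈ vertexSub (f ≫ g) x ↔ ∃ y ∈ vertexSub f x, z ∈ vertexSub g y := by
  have e : ∀ (i : Fin (A.height + 1)) (j : Fin (B.height + 1)) (k : Fin (D.height + 1))
      (h1 : idx f i ≤ j) (h2 : idx g j ≤ k) (h3 : idx g (idx f i) ≤ k),
      (app f i ≫ B.arrows.map (homOfLE h1)) ≫ app g j ≫ D.arrows.map (homOfLE h2) =
        (app f i ≫ app g (idx f i)) ≫ D.arrows.map (homOfLE h3) := by
    intro i j k h1 h2 h3
    have hn := Hom.naturality g (idx f i) j h1
    have hn' : B.arrows.map (homOfLE h1) ≫ app g j =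
      app g (idx f i) ≫ D.arrows.map (homOfLE ((idx g).monotone h1)) := hn
    rw [Category.assoc, ← Category.assoc (B.arrows.map (homOfLE h1)), hn']
    simp only [Category.assoc, ← Functor.map_comp]
    rfl
  constructor
  · rintro ⟨h1, h2, h3⟩
    have h1' : idx g (idx f x.level.castSucc) ≤ z.level.castSucc := h1
    have h2' : z.level.succ ≤ idx g (idx f x.level.succ) := h2
    have h3' : z.elt ∈ SegalGamma.sub ((aug (C := C)).map
      ((app f x.level.castSucc ≫ app g (idx f x.level.castSucc)) ≫
        D.arrows.map (homOfLE h1'))) x.elt := h3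
    obtain ⟨j, hj1, hj2, hj3, hj4⟩ := exists_level (idx g) _ _ _ h1' h2'
    rw [← e _ _ _ hj1 hj3 h1', Functor.map_comp, SegalGamma.mem_sub_comp] at h3'
    obtain ⟨b, hb, hb'⟩ := h3'
    exact ⟨⟨j, b⟩, ⟨hj1, hj2, hb⟩, ⟨hj3, hj4, hb'⟩⟩
  · rintro ⟨y, ⟨h1, h2, h3⟩, ⟨h1', h2', h3'⟩⟩
    have hle : idx g (idx f x.level.castSucc) ≤ z.level.castSucc :=
      ((idx g).monotone h1).trans h1'
    refine ⟨hle, h2'.trans ((idx g).monotone h2), ?_⟩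
    change z.elt ∈ SegalGamma.sub ((aug (C := C)).map
      ((app f x.level.castSucc ≫ app g (idx f x.level.castSucc)) ≫
        D.arrows.map (homOfLE hle))) x.elt
    rw [← e _ _ _ h1 h1' hle, Functor.map_comp, SegalGamma.mem_sub_comp]
    exact ⟨_, h3, h3'⟩

/-- The augmentation of the plus construction takes a `C`-tree to its set of vertices. -/
def augPlus : CTree C ⥤ SegalGamma where
  obj A := ⟨A.Vertex⟩
  map f := (⟨vertexSub f, vertexSub_disj f⟩ : SegalGamma.Hom ⟨_⟩ ⟨_⟩)
  map_id A := SegalGamma.hom_ext fun x => Set.ext fun y => vertexSub_id A x y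
  map_comp f g := SegalGamma.hom_ext fun x => Set.ext fun z => vertexSub_comp f g x z

theorem isAct_id (A : CTree C) : IsAct (𝟙 A) :=
  ⟨rfl, rfl, fun i => inferInstanceAs (IsIso (𝟙 (A.arrows.obj i)))⟩

theorem isAct_comp {A B D : CTree C} (f : A ⟶ B) (g : B ⟶ D) (hf : IsAct f) (hg : IsAct g) :
    IsAct (f ≫ g) := by
  refine ⟨(congrArg (idx g) hf.1).trans hg.1, (congrArg (idx g) hf.2.1).trans hg.2.1, fun i => ?_⟩
  have := hf.2.2 i
  have := hg.2.2 (idx f i)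
  exact inferInstanceAs (IsIso (app f i ≫ app g (idx f i)))

theorem isInert_id (A : CTree C) : IsInert (𝟙 A) := fun _ => rfl

theorem isInert_comp {A B D : CTree C} (f : A ⟶ B) (g : B ⟶ D) (hf : IsInert f)
    (hg : IsInert g) : IsInert (f ≫ g) := by
  intro i
  have h1 := hf i
  have hlt : (idx f i.castSucc : ℕ) < B.height := by
    have := (idx f i.succ).isLt
    omega
  have e1 : idx f i.castSucc = (⟨_, hlt⟩ : Fin B.height).castSucc := rfl
  have e2 : idx f i.succ = (⟨_, hlt⟩ : Fin B.height).succ := Fin.ext h1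
  have h2 := hg ⟨_, hlt⟩
  rw [← e1, ← e2] at h2
  exact h2

/-- The hypermoment structure on the plus construction. -/
instance : HypermomentData (CTree C) where
  act := fun _ _ f => IsAct f
  inert := fun _ _ f => IsInert f
  act_id := isAct_id
  act_comp := isAct_comp
  inert_id := isInert_id
  inert_comp := isInert_comp
  aug := augPlus

/-! ### Trees of height at most two -/

/-- The `C`-tree `([0], U)`. -/
def edge (U : C) (hU : IsUnitObj U) : CTree C where
  height := 0
  arrows := ComposableArrows.mk₀ U
  act_map _ := act_id U
  isUnit_root := hU

/-- The `C`-tree `([1], U ⟶ A)`. -/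
def corolla {U A : C} (hU : IsUnitObj U) (u : U ⟶ A) (hu : act u) : CTree C where
  height := 1
  arrows := ComposableArrows.mk₁ u
  act_map := by
    intro i j h
    have hij := leOfHom h
    fin_cases i <;> fin_cases j
    · exact act_id U
    · exact hu
    · exact absurd (show (1 : Fin 2) ≤ 0 from hij) (by decide)
    · exact act_id A
  isUnit_root := hU

/-- The `C`-tree `([2], U ⟶ A ⟶ B)`. -/
def triangle {U A B : C} (hU : IsUnitObj U) (u : U ⟶ A) (f : A ⟶ B) (hu : act u) (hf : act f) :
    CTree C where
  height := 2
  arrows := ComposableArrows.mk₂ u f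
  act_map := by
    intro i j h
    have hij := leOfHom h
    fin_cases i <;> fin_cases j
    · exact act_id U
    · exact hu
    · exact act_comp u f hu hf
    · exact absurd (show (1 : Fin 3) ≤ 0 from hij) (by decide)
    · exact act_id A
    · exact hf
    · exact absurd (show (2 : Fin 3) ≤ 0 from hij) (by decide)
    · exact absurd (show (2 : Fin 3) ≤ 1 from hij) (by decide)
    · exact act_id B
  isUnit_root := hU

/-- The morphism `(φ, (a, b)) : ([1], U ⟶ A) ⟶ T` of `C`-trees with `φ(0) = k` and `φ(1) = l`. -/
def ofCorolla {U A : C} (hU : IsUnitObj U) (u : U ⟶ A) (hu : act u) (T : CTree C)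
    (k l : Fin (T.height + 1)) (hkl : k ≤ l) (a : U ⟶ T.arrows.obj k) (b : A ⟶ T.arrows.obj l)
    (ha : inert a) (hb : inert b) (w : u ≫ b = a ≫ T.arrows.map (homOfLE hkl)) :
    corolla hU u hu ⟶ T :=
  show Hom _ _ from
  { idx := ⟨fun i : Fin 2 => match i with
        | 0 => k
        | 1 => l, by
      intro i j hij
      fin_cases i <;> fin_cases j
      · exact le_refl k
      · exact hkl
      · exact absurd (show (1 : Fin 2) ≤ 0 from hij) (by decide)
      · exact le_refl l⟩
    app := fun i : Fin 2 => match i with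
      | 0 => a
      | 1 => b
    inert_app := fun i : Fin 2 => match i with
      | 0 => ha
      | 1 => hb
    naturality := by
      intro i j h
      fin_cases i <;> fin_cases j
      · exact (Category.id_comp a).trans
          ((Category.comp_id a).symm.trans (congrArg (a ≫ ·) (T.arrows.map_id k).symm))
      · exact w
      · exact absurd (show (1 : Fin 2) ≤ 0 from h) (by decide)
      · exact (Category.id_comp b).trans
          ((Category.comp_id b).symm.trans (congrArg (b ≫ ·) (T.arrows.map_id l).symm)) }

theorem ofCorolla_isInert {U A : C} (hU : IsUnitObj U) (u : U ⟶ A) (hu : act u) (T : CTree C)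
    (k l : Fin (T.height + 1)) (hkl : k ≤ l) (a : U ⟶ T.arrows.obj k) (b : A ⟶ T.arrows.obj l)
    (ha : inert a) (hb : inert b) (w : u ≫ b = a ≫ T.arrows.map (homOfLE hkl))
    (h : (l : ℕ) = k + 1) : IsInert (ofCorolla hU u hu T k l hkl a b ha hb w) := by
  intro i
  obtain rfl : i = (0 : Fin 1) := Subsingleton.elim (α := Fin 1) _ _
  exact h

theorem ofCorolla_isAct {U A : C} (hU : IsUnitObj U) (u : U ⟶ A) (hu : act u) (T : CTree C)
    (k l : Fin (T.height + 1)) (hkl : k ≤ l) (a : U ⟶ T.arrows.obj k) (b : A ⟶ T.arrows.obj l)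
    (ha : inert a) (hb : inert b) (w : u ≫ b = a ≫ T.arrows.map (homOfLE hkl))
    (hk : k = 0) (hl : l = Fin.last _) (hia : IsIso a) (hib : IsIso b) :
    IsAct (ofCorolla hU u hu T k l hkl a b ha hb w) :=
  ⟨hk, hl, fun i : Fin 2 => match i with
    | 0 => hia
    | 1 => hib⟩

/-- The morphism `([1], 𝟙 U) ⟶ ([0], U)`. -/
def degeneracy {U : C} (hU : IsUnitObj U) : corolla hU (𝟙 U) (act_id U) ⟶ edge U hU :=
  ofCorolla hU (𝟙 U) (act_id U) (edge U hU) (0 : Fin 1) (0 : Fin 1) (le_refl _) (𝟙 U) (𝟙 U)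
    (inert_id U) (inert_id U) rfl

theorem degeneracy_act {U : C} (hU : IsUnitObj U) : act (degeneracy hU) :=
  ofCorolla_isAct _ _ _ _ _ _ _ _ _ _ _ _ rfl rfl
    (inferInstanceAs (IsIso (𝟙 U))) (inferInstanceAs (IsIso (𝟙 U)))

/-- The morphism `([1], U ⟶ B) ⟶ ([2], U ⟶ A ⟶ B)`. -/
def innerFace {U A B : C} (hU : IsUnitObj U) (u : U ⟶ A) (f : A ⟶ B) (hu : act u) (hf : act f) :
    corolla hU (u ≫ f) (act_comp u f hu hf) ⟶ triangle hU u f hu hf :=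
  ofCorolla hU (u ≫ f) (act_comp u f hu hf) (triangle hU u f hu hf) (0 : Fin 3) (2 : Fin 3)
    (show (0 : Fin 3) ≤ 2 by decide) (𝟙 U) (𝟙 B) (inert_id U) (inert_id B)
    ((Category.comp_id (u ≫ f)).trans (Category.id_comp (u ≫ f)).symm)

theorem innerFace_act {U A B : C} (hU : IsUnitObj U) (u : U ⟶ A) (f : A ⟶ B) (hu : act u)
    (hf : act f) : act (innerFace hU u f hu hf) :=
  ofCorolla_isAct _ _ _ _ _ _ _ _ _ _ _ _ rfl rfl
    (inferInstanceAs (IsIso (𝟙 U))) (inferInstanceAs (IsIso (𝟙 B)))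

/-- The isomorphism `([1], U ⟶ A) ⟶ ([1], U' ⟶ A')` given by isomorphisms `U ≅ U'` and
`A ≅ A'`. -/
def corollaMap [IsHypermoment C] {U A U' A' : C} (hU : IsUnitObj U) (u : U ⟶ A) (hu : act u)
    (hU' : IsUnitObj U') (u' : U' ⟶ A') (hu' : act u') (s : U ≅ U') (t : A ≅ A')
    (w : u ≫ t.hom = s.hom ≫ u') : corolla hU u hu ⟶ corolla hU' u' hu' :=
  ofCorolla hU u hu (corolla hU' u' hu') (0 : Fin 2) (1 : Fin 2)
    (show (0 : Fin 2) ≤ 1 by decide) s.hom t.hom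
    (IsHypermoment.inert_of_isIso s.hom) (IsHypermoment.inert_of_isIso t.hom) w

theorem corollaMap_act [IsHypermoment C] {U A U' A' : C} (hU : IsUnitObj U) (u : U ⟶ A)
    (hu : act u) (hU' : IsUnitObj U') (u' : U' ⟶ A') (hu' : act u') (s : U ≅ U') (t : A ≅ A')
    (w : u ≫ t.hom = s.hom ≫ u') : act (corollaMap hU u hu hU' u' hu' s t w) :=
  ofCorolla_isAct _ _ _ _ _ _ _ _ _ _ _ _ rfl rfl
    (inferInstanceAs (IsIso s.hom)) (inferInstanceAs (IsIso t.hom))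

/-- The vertex `([1], U ⟶ A) ⟶ ([2], U ⟶ A ⟶ B)` of height `0`. -/
def rootVertex {U A B : C} (hU : IsUnitObj U) (u : U ⟶ A) (f : A ⟶ B) (hu : act u) (hf : act f)
    (h : IsUnitObj (corolla hU u hu)) : Elem (triangle hU u f hu hf) where
  dom := corolla hU u hu
  isUnit := h
  hom := ofCorolla hU u hu (triangle hU u f hu hf) (0 : Fin 3) (1 : Fin 3)
    (show (0 : Fin 3) ≤ 1 by decide) (𝟙 U) (𝟙 A) (inert_id U) (inert_id A) ((Category.comp_id u).trans (Category.id_comp u).symm)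
  inert := ofCorolla_isInert _ _ _ _ _ _ _ _ _ _ _ _ rfl

/-- The vertex `([1], U_α ⟶ B_α) ⟶ ([2], U ⟶ A ⟶ B)` of height `1` given by a piece
`U_α ⟶ B_α ⟶ B` of `f : A ⟶ B`. -/
def pieceVertex {U A B : C} (hU : IsUnitObj U) (u : U ⟶ A) (f : A ⟶ B) (hu : act u) (hf : act f)
    (p : Piece f) (h : IsUnitObj (corolla p.isUnit p.res p.res_act)) :
    Elem (triangle hU u f hu hf) where
  dom := corolla p.isUnit p.res p.res_act
  isUnit := h
  hom := ofCorolla p.isUnit p.res p.res_act (triangle hU u f hu hf) (1 : Fin 3) (2 : Fin 3)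
    (show (1 : Fin 3) ≤ 2 by decide) p.hom p.incl p.inert p.incl_inert p.comm
  inert := ofCorolla_isInert _ _ _ _ _ _ _ _ _ _ _ _ rfl

end CTree

/-- An equivalence between the categories of monoids over the plus construction of `C` and of
`C`-operads, identifying the values `O(A)` of an operad with the values `X([1], U ⟶ A)` of a monoid
at the unit `C`-trees, the multiplications `μ_f` with the action of the morphisms
`([1], U ⟶ B) ⟶ ([2], U ⟶ A ⟶ B)`, and the units of an operad with the action of the morphisms
`([1], 𝟙 U) ⟶ ([0], U)`. -/
structure PlusEquivalence [IsHypermoment C]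
    (hc : ∀ T : CTree C, IsUnitObj T ↔ T.height = 1)
    (E : Type u') [Category.{v'} E] [MonoidalCategory E] [SymmetricCategory E] where
  /-- The equivalence. -/
  equiv : Mon (CTree C) E ≌ Operad C E
  /-- The isomorphisms `O(A) ≅ X([1], U ⟶ A)`. -/
  iso : ∀ (X : Mon (CTree C) E) {U A : C} (hU : IsUnitObj U) (u : U ⟶ A) (hu : act u),
    (equiv.functor.obj X).coll.obj ⟨A⟩ ≅ X.obj (CTree.corolla hU u hu) ((hc _).2 rfl)
  iso_natural : ∀ {X Y : Mon (CTree C) E} (φ : X ⟶ Y) {U A : C} (hU : IsUnitObj U) (u : U ⟶ A)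
    (hu : act u), Operad.Hom.at (equiv.functor.map φ) A ≫ (iso Y hU u hu).hom =
      (iso X hU u hu).hom ≫ Mon.Hom.at φ (CTree.corolla hU u hu) ((hc _).2 rfl)
  iso_equivariant : ∀ (X : Mon (CTree C) E) {U A U' A' : C} (hU : IsUnitObj U) (u : U ⟶ A)
    (hu : act u) (hU' : IsUnitObj U') (u' : U' ⟶ A') (hu' : act u') (s : U ≅ U') (t : A ≅ A')
    (w : u ≫ t.hom = s.hom ≫ u'),
    ∃ h : IsFrame [Elem.refl (CTree.corolla hU' u' hu') ((hc _).2 rfl)],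
      (equiv.functor.obj X).coll.map ⟨t⟩ ≫ (iso X hU' u' hu').hom ≫ (ρ_ _).inv ≫
        X.map ((hc _).2 rfl) (CTree.corollaMap hU u hu hU' u' hu' s t w)
          (CTree.corollaMap_act hU u hu hU' u' hu' s t w) _ h = (iso X hU u hu).hom
  iso_unit : ∀ (X : Mon (CTree C) E) {U : C} (hU : IsUnitObj U),
    ∃ h : IsFrame ([] : List (Elem (CTree.edge U hU))),
      (equiv.functor.obj X).unit U hU ≫ (iso X hU (𝟙 U) (act_id U)).hom =
        X.map ((hc _).2 rfl) (CTree.degeneracy hU) (CTree.degeneracy_act hU) [] h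
  iso_mul : ∀ (X : Mon (CTree C) E) {U A B : C} (hU : IsUnitObj U) (u : U ⟶ A) (f : A ⟶ B)
    (hu : act u) (hf : act f) (l : List (Piece f)) (hl : IsFrame (l.map Piece.toElem)),
    ∃ h : IsFrame (CTree.rootVertex hU u f hu hf ((hc _).2 rfl) ::
        l.map fun p => CTree.pieceVertex hU u f hu hf p ((hc _).2 rfl)),
      (equiv.functor.obj X).mul f hf l hl ≫
          (iso X hU (u ≫ f) (act_comp u f hu hf)).hom =
        ((iso X hU u hu).hom ⊗ₘ
          tensMap (F := fun p : Piece f => (equiv.functor.obj X).coll.obj ⟨p.cod⟩)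
            (G := fun e : Elem (CTree.triangle hU u f hu hf) => X.obj e.dom e.isUnit)
            (fun p => CTree.pieceVertex hU u f hu hf p ((hc _).2 rfl))
            (fun p => (iso X p.isUnit p.res p.res_act).hom) l) ≫
          X.map ((hc _).2 rfl) (CTree.innerFace hU u f hu hf)
            (CTree.innerFace_act hU u f hu hf) _ h

end Plus

end Hypermoment

/-! The plus construction is again a hypermoment category because everything about trees can be read
off at the root. An inert morphism of trees is a translation on indices, and for an active `A ⟶ Z`
each composite `A_0 ⟶ Z_j` is active in `C`. So the unique lifting of active against inert morphisms
in `C` gives the same property for trees (`CTree.existsUnique_lift`), and this yields uniqueness of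
factorisations. A factorisation of `(φ, f) : A ⟶ B` is obtained by restricting `B` to the interval
`[φ(0), φ(m)]` and taking at each level the middle object of `A_0 ⟶ B_j` (`CTree.exists_factor`).
Units have height one: a tree with a vertex receives an active morphism from its total corolla `A_0
⟶ A_m`, and an inert section of it forces `m = 1`. Conversely, an active morphism onto a tree of
height one advances at a single step, and this step is the only possible image of a section.

For the equivalence, unitality of `C` is decisive: active morphisms from a unit tree to a tree
correspond to isomorphisms between the last objects (`CTree.exists_topIso_eq`,
`CTree.eq_of_topIso_eq`). So every monoid is isomorphic to one whose value at `([1], U ⟶ A)` is a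
functor of `A` alone; these normalised monoids form `TreeMon`, and `TreeMon.toMon` is an
equivalence. A normalised monoid gives an operad (`TreeMon.ext`): `η` is the action of the
degeneracy and `μ` that of the inner face. The unit laws express functoriality for the two
degenerate triangles (`TreeMon.left_unitT`, `TreeMon.right_unitT`). Associativity compares two
decompositions of a tree of height three (`TreeMon.assocT`).

`TreeMon.ext` is full because a tree of height at least two can be cut at its penultimate level, so
that compatibility with all actions follows by induction on the height from compatibility with `η`
and `μ` (`TreeMon.natOn_of_hom`). It is essentially surjective because an operad can be evaluated on
a tree: start with the unit at the root and apply, for each `k`, the multiplication of `B_k ⟶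
B_{k+1}` to what has been obtained so far (`Operad.evalTo`). For an active `g : A ⟶ B` over `φ`, the
levels of `B` between `φ(K)` and `φ(K+1)` are distributed over the trees `B_α`, where `α` runs
through the vertices of `A` of height `K`. Associativity collects the multiplications inside the
`B_α` first, which is functoriality (`Operad.evalTo_decomp`, `Operad.evalTo_act`).

All tensor products over finite sets are presented by lists, so each step comes with reorderings and
rebracketings. They are controlled by a coherence theorem, `Canon.unique`: two canonical morphisms
between formal tensor products agree as soon as the labels of the factors are pairwise different. It
applies throughout since frames have no repetitions. Hence structure maps are extended from lists to
arbitrary formal tensor products (`Mon.mapW`, `Operad.mulW`), where every canonical morphism may be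
absorbed. -/

open CategoryTheory MonoidalCategory

universe w w'

namespace Hypermoment

/-! ## Coherence for iterated tensor products -/

section Coherence

variable {E : Type u'} [Category.{v'} E] [MonoidalCategory E]

/-- The canonical isomorphism joining two tensor products over lists. -/
def tensCat {ι : Type w} (F : ι → E) (l' : List ι) :
    ∀ l : List ι, tens F l ⊗ tens F l' ⟶ tens F (l ++ l')
  | [] => (λ_ (tens F l')).hom
  | a :: l => (α_ (F a) (tens F l) (tens F l')).hom ≫ F a ◁ tensCat F l' l

theorem tensAppend_tensCat {ι : Type w} (F : ι → E) (l' l : List ι) :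
    tensAppend F l' l ≫ tensCat F l' l = 𝟙 _ := by
  induction l with
  | nil => exact (λ_ (tens F l')).inv_hom_id
  | cons a l ih =>
    change (F a ◁ tensAppend F l' l ≫ (α_ _ _ _).inv) ≫ (α_ _ _ _).hom ≫ F a ◁ tensCat F l' l = 𝟙 _
    rw [Category.assoc, Iso.inv_hom_id_assoc, ← MonoidalCategory.whiskerLeft_comp, ih,
      MonoidalCategory.whiskerLeft_id]

theorem tensCat_tensAppend {ι : Type w} (F : ι → E) (l' l : List ι) :
    tensCat F l' l ≫ tensAppend F l' l = 𝟙 _ := by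
  induction l with
  | nil => exact (λ_ (tens F l')).hom_inv_id
  | cons a l ih =>
    change ((α_ _ _ _).hom ≫ F a ◁ tensCat F l' l) ≫ F a ◁ tensAppend F l' l ≫ (α_ _ _ _).inv = 𝟙 _
    rw [Category.assoc, ← MonoidalCategory.whiskerLeft_comp_assoc, ih,
      MonoidalCategory.whiskerLeft_id, Category.id_comp, Iso.hom_inv_id]

instance {ι : Type w} (F : ι → E) (l' l : List ι) : IsIso (tensCat F l' l) :=
  ⟨tensAppend F l' l, tensCat_tensAppend F l' l, tensAppend_tensCat F l' l⟩

variable [SymmetricCategory E]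

/-- The morphisms between tensor products over lists generated by the symmetries. -/
inductive IsPerm {ι : Type w} (F : ι → E) : ∀ l l' : List ι, (tens F l ⟶ tens F l') → Prop
  | refl (l : List ι) : IsPerm F l l (𝟙 _)
  | step {l : List ι} (l₁ : List ι) (x y : ι) (l₂ : List ι) (φ : tens F l ⟶ tens F (l₁ ++ x :: y :: l₂)) :
      IsPerm F l (l₁ ++ x :: y :: l₂) φ →
      IsPerm F l (l₁ ++ y :: x :: l₂) (φ ≫ tensSwap F x y l₂ l₁)

namespace IsPerm

variable {ι : Type w} {F : ι → E}

theorem perm {l l' : List ι} {φ : tens F l ⟶ tens F l'} (h : IsPerm F l l' φ) : l.Perm l' := by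
  induction h with
  | refl => exact List.Perm.refl l
  | step l₁ x y l₂ φ _ ih => exact ih.trans (List.Perm.append_left l₁ (List.Perm.swap y x l₂))

theorem swap (l₁ : List ι) (x y : ι) (l₂ : List ι) :
    IsPerm F (l₁ ++ x :: y :: l₂) (l₁ ++ y :: x :: l₂) (tensSwap F x y l₂ l₁) := by
  simpa using step l₁ x y l₂ (𝟙 _) (refl (F := F) _)

theorem comp {l l' l'' : List ι} {φ : tens F l ⟶ tens F l'} {ψ : tens F l' ⟶ tens F l''}
    (h : IsPerm F l l' φ) (h' : IsPerm F l' l'' ψ) : IsPerm F l l'' (φ ≫ ψ) := by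
  revert φ
  induction h' with
  | refl =>
    intro φ h
    simpa using h
  | step l₁ x y l₂ ψ _ ih =>
    intro φ h
    rw [← Category.assoc]
    exact step l₁ x y l₂ _ (ih h)

theorem cons (a : ι) {l l' : List ι} {φ : tens F l ⟶ tens F l'} (h : IsPerm F l l' φ) :
    IsPerm F (a :: l) (a :: l') (F a ◁ φ) := by
  induction h with
  | refl =>
    rw [MonoidalCategory.whiskerLeft_id]
    exact refl _
  | step l₁ x y l₂ ψ _ ih =>
    rw [MonoidalCategory.whiskerLeft_comp]
    exact step (a :: l₁) x y l₂ _ ih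

theorem swap_swap (l₁ : List ι) (x y : ι) (l₂ : List ι) :
    tensSwap F x y l₂ l₁ ≫ tensSwap F y x l₂ l₁ = 𝟙 _ := by
  induction l₁ with
  | nil =>
    change ((α_ (F x) (F y) (tens F l₂)).inv ≫ (β_ (F x) (F y)).hom ▷ tens F l₂ ≫
      (α_ (F y) (F x) (tens F l₂)).hom) ≫ ((α_ (F y) (F x) (tens F l₂)).inv ≫
      (β_ (F y) (F x)).hom ▷ tens F l₂ ≫ (α_ (F x) (F y) (tens F l₂)).hom) = 𝟙 _
    simp only [Category.assoc, Iso.hom_inv_id_assoc, ← comp_whiskerRight_assoc,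
      SymmetricCategory.symmetry, id_whiskerRight, Category.id_comp, Iso.inv_hom_id]
  | cons a l₁ ih =>
    change F a ◁ tensSwap F x y l₂ l₁ ≫ F a ◁ tensSwap F y x l₂ l₁ = 𝟙 _
    rw [← MonoidalCategory.whiskerLeft_comp, ih, MonoidalCategory.whiskerLeft_id]

theorem exists_inv {l l' : List ι} {φ : tens F l ⟶ tens F l'} (h : IsPerm F l l' φ) :
    ∃ ψ, IsPerm F l' l ψ ∧ φ ≫ ψ = 𝟙 _ ∧ ψ ≫ φ = 𝟙 _ := by
  induction h with
  | refl => exact ⟨𝟙 _, refl _, by simp, by simp⟩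
  | step l₁ x y l₂ φ _ ih =>
    obtain ⟨ψ, h1, h2, h3⟩ := ih
    refine ⟨tensSwap F y x l₂ l₁ ≫ ψ, (swap l₁ y x l₂).comp h1, ?_, ?_⟩
    · rw [Category.assoc, ← Category.assoc (tensSwap F x y l₂ l₁), swap_swap, Category.id_comp, h2]
    · rw [Category.assoc, ← Category.assoc ψ, h3, Category.id_comp, swap_swap]

theorem exists_of_perm {l l' : List ι} (h : l.Perm l') : ∃ φ, IsPerm F l l' φ := by
  induction h with
  | nil => exact ⟨_, refl []⟩
  | cons a _ ih => exact ⟨_, ih.choose_spec.cons a⟩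
  | swap x y l => exact ⟨_, swap [] y x l⟩
  | trans _ _ ih ih' => exact ⟨_, ih.choose_spec.comp ih'.choose_spec⟩

end IsPerm

/-- The morphisms moving one factor of a tensor product to the front. -/
inductive IsPull {ι : Type w} (F : ι → E) (a : ι) :
    ∀ l l' : List ι, (tens F l ⟶ F a ⊗ tens F l') → Prop
  | head (l : List ι) : IsPull F a (a :: l) l (𝟙 _)
  | tail (b : ι) {l l' : List ι} (φ : tens F l ⟶ F a ⊗ tens F l') : IsPull F a l l' φ →
      IsPull F a (b :: l) (b :: l') (F b ◁ φ ≫ (α_ (F b) (F a) (tens F l')).inv ≫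
        (β_ (F b) (F a)).hom ▷ tens F l' ≫ (α_ (F a) (F b) (tens F l')).hom)

namespace IsPull

variable {ι : Type w} {F : ι → E} {a : ι}

theorem mem {l l' : List ι} {φ : tens F l ⟶ F a ⊗ tens F l'} (h : IsPull F a l l' φ) : a ∈ l := by
  induction h with
  | head l => simp
  | tail b φ _ ih => simp [ih]

theorem perm {l l' : List ι} {φ : tens F l ⟶ F a ⊗ tens F l'} (h : IsPull F a l l' φ) :
    l.Perm (a :: l') := by
  induction h with
  | head l => exact List.Perm.refl _
  | tail b φ _ ih => exact (ih.cons b).trans (List.Perm.swap _ _ _)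

/-- The route to the front is forced by the position of `a`, and `a` has only one position. The
hypothesis excludes the cases in which one derivation stops at a head and the other goes on. -/
theorem unique {l l' l'' : List ι} {φ : tens F l ⟶ F a ⊗ tens F l'}
    {ψ : tens F l ⟶ F a ⊗ tens F l''} (hl : l.Nodup) (h : IsPull F a l l' φ)
    (h' : IsPull F a l l'' ψ) : l' = l'' ∧ HEq φ ψ := by
  induction h generalizing l'' with
  | head l =>
    cases h' with
    | head => exact ⟨rfl, HEq.rfl⟩
    | tail b φ h => exact absurd h.mem (List.nodup_cons.mp hl).1
  | tail b φ h ih =>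
    cases h' with
    | head => exact absurd h.mem (List.nodup_cons.mp hl).1
    | tail _ ψ h' =>
      obtain ⟨rfl, h2⟩ := ih (List.nodup_cons.mp hl).2 h'
      cases h2
      exact ⟨rfl, HEq.rfl⟩

theorem swap_naturality (X Y : E) {T T' : E} (χ : T ⟶ T') :
    X ◁ Y ◁ χ ≫ (α_ X Y T').inv ≫ (β_ X Y).hom ▷ T' ≫ (α_ Y X T').hom =
      ((α_ X Y T).inv ≫ (β_ X Y).hom ▷ T ≫ (α_ Y X T).hom) ≫ Y ◁ X ◁ χ := by
  simp only [Category.assoc, associator_inv_naturality_right_assoc, whisker_exchange_assoc,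
    associator_naturality_right]

/-- This is the Yang–Baxter equation, with a spectator factor `T`. It covers the case of moving a
factor past both of the factors that are being exchanged. -/
theorem swap_hexagon (X Y A T : E) :
    ((α_ X Y (A ⊗ T)).inv ≫ (β_ X Y).hom ▷ (A ⊗ T) ≫ (α_ Y X (A ⊗ T)).hom) ≫
        Y ◁ ((α_ X A T).inv ≫ (β_ X A).hom ▷ T ≫ (α_ A X T).hom) ≫
          (α_ Y A (X ⊗ T)).inv ≫ (β_ Y A).hom ▷ (X ⊗ T) ≫ (α_ A Y (X ⊗ T)).hom =
      (X ◁ ((α_ Y A T).inv ≫ (β_ Y A).hom ▷ T ≫ (α_ A Y T).hom) ≫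
          (α_ X A (Y ⊗ T)).inv ≫ (β_ X A).hom ▷ (Y ⊗ T) ≫ (α_ A X (Y ⊗ T)).hom) ≫
        A ◁ ((α_ X Y T).inv ≫ (β_ X Y).hom ▷ T ≫ (α_ Y X T).hom) := by
  have h := BraidedCategory.yang_baxter X Y A
  have h1 : ((α_ X Y (A ⊗ T)).inv ≫ (β_ X Y).hom ▷ (A ⊗ T) ≫ (α_ Y X (A ⊗ T)).hom) ≫
        Y ◁ ((α_ X A T).inv ≫ (β_ X A).hom ▷ T ≫ (α_ A X T).hom) ≫
          (α_ Y A (X ⊗ T)).inv ≫ (β_ Y A).hom ▷ (X ⊗ T) ≫ (α_ A Y (X ⊗ T)).hom =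
      𝟙 _ ⊗≫ (((α_ X Y A).inv ≫ (β_ X Y).hom ▷ A ≫ (α_ Y X A).hom ≫ Y ◁ (β_ X A).hom ≫
        (α_ Y A X).inv ≫ (β_ Y A).hom ▷ X ≫ (α_ A Y X).hom) ▷ T) ⊗≫ 𝟙 _ := by monoidal
  rw [h1, h]
  monoidal

/-- The position of `a` decides what remains of the swap. If `a` is one of the exchanged factors,
nothing remains. If `a` stands before them, the whole swap remains. If `a` stands behind them, the
swap is carried over by Yang–Baxter and naturality. -/
theorem square {l₁ : List ι} {x y : ι} {l₂ m' : List ι}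
    {ψ' : tens F (l₁ ++ y :: x :: l₂) ⟶ F a ⊗ tens F m'}
    (h : IsPull F a (l₁ ++ y :: x :: l₂) m' ψ') :
    ∃ (m : List ι) (ψ : tens F (l₁ ++ x :: y :: l₂) ⟶ F a ⊗ tens F m) (χ : tens F m ⟶ tens F m'),
      IsPull F a (l₁ ++ x :: y :: l₂) m ψ ∧ IsPerm F m m' χ ∧
        tensSwap F x y l₂ l₁ ≫ ψ' = ψ ≫ F a ◁ χ := by
  induction l₁ generalizing m' with
  | nil =>
    cases h with
    | head =>
      refine ⟨_, _, 𝟙 _, .tail x _ (.head l₂), .refl _, ?_⟩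
      -- Here and below, such auxiliary equations are stated for arbitrary objects, because the
      -- tensor products over lists take the displayed binary form only after unfolding.
      have e : ∀ (X Y T : E) (f : X ⊗ Y ⊗ T ⟶ Y ⊗ X ⊗ T),
          f ≫ 𝟙 _ = (X ◁ 𝟙 (Y ⊗ T) ≫ f) ≫ Y ◁ 𝟙 (X ⊗ T) := by simp
      exact e _ _ _ _
    | tail _ ψ' h =>
      cases h with
      | head =>
        refine ⟨_, _, 𝟙 _, .head _, .refl _, ?_⟩
        have e : ∀ (X Y T : E) (f : X ⊗ Y ⊗ T ⟶ Y ⊗ X ⊗ T) (g : Y ⊗ X ⊗ T ⟶ X ⊗ Y ⊗ T),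
          f ≫ g = 𝟙 _ → f ≫ Y ◁ 𝟙 (X ⊗ T) ≫ g = 𝟙 _ ≫ X ◁ 𝟙 (Y ⊗ T) := by
          intro X Y T f g h; simp [h]
        exact e _ _ _ _ _ (IsPerm.swap_swap (F := F) [] a y l₂)
      | tail _ φ h =>
        refine ⟨_, _, _, .tail x _ (.tail y _ h), .swap [] x y _, ?_⟩
        have e : ∀ (X Y A S T : E) (f : S ⟶ A ⊗ T),
            ((α_ X Y S).inv ≫ (β_ X Y).hom ▷ S ≫ (α_ Y X S).hom) ≫
              Y ◁ (X ◁ f ≫ (α_ X A T).inv ≫ (β_ X A).hom ▷ T ≫ (α_ A X T).hom) ≫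
                (α_ Y A (X ⊗ T)).inv ≫ (β_ Y A).hom ▷ (X ⊗ T) ≫ (α_ A Y (X ⊗ T)).hom =
            (X ◁ (Y ◁ f ≫ (α_ Y A T).inv ≫ (β_ Y A).hom ▷ T ≫ (α_ A Y T).hom) ≫
              (α_ X A (Y ⊗ T)).inv ≫ (β_ X A).hom ▷ (Y ⊗ T) ≫ (α_ A X (Y ⊗ T)).hom) ≫
              A ◁ ((α_ X Y T).inv ≫ (β_ X Y).hom ▷ T ≫ (α_ Y X T).hom) := by
          intro X Y A S T f
          have h1 := swap_naturality X Y f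
          have h2 := swap_hexagon X Y A T
          generalize (α_ X A T).inv ≫ (β_ X A).hom ▷ T ≫ (α_ A X T).hom = k at *
          generalize (α_ Y A T).inv ≫ (β_ Y A).hom ▷ T ≫ (α_ A Y T).hom = k' at *
          simp only [Category.assoc, MonoidalCategory.whiskerLeft_comp] at h1 h2 ⊢
          rw [← reassoc_of% h1, h2]
        exact e _ _ _ _ _ φ
  | cons b l₁ ih =>
    cases h with
    | head =>
      refine ⟨_, _, tensSwap F x y l₂ l₁, .head _, .swap _ _ _ _, ?_⟩
      have e : ∀ (X Y T : E) (f : X ⟶ Y), f ≫ 𝟙 _ = 𝟙 _ ≫ f := by simp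
      exact e _ _ (tens F l₂) _
    | tail _ ψ' h =>
      obtain ⟨m, ψ, χ, h1, h2, h3⟩ := ih h
      refine ⟨_, _, _, .tail b _ h1, h2.cons b, ?_⟩
      have e : ∀ {B A S S' T T' : E} {s : S ⟶ S'} {p' : S' ⟶ A ⊗ T'} {p : S ⟶ A ⊗ T} {c : T ⟶ T'},
          s ≫ p' = p ≫ A ◁ c →
          B ◁ s ≫ B ◁ p' ≫ (α_ B A T').inv ≫ (β_ B A).hom ▷ T' ≫ (α_ A B T').hom =
          (B ◁ p ≫ (α_ B A T).inv ≫ (β_ B A).hom ▷ T ≫ (α_ A B T).hom) ≫ A ◁ B ◁ c := by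
        intro B A S S' T T' s p' p c h
        rw [← MonoidalCategory.whiskerLeft_comp_assoc, h, MonoidalCategory.whiskerLeft_comp,
          Category.assoc, swap_naturality]
        simp only [Category.assoc]
      exact e h3

theorem square_isPerm {l l' m' : List ι} {φ : tens F l ⟶ tens F l'} (h : IsPerm F l l' φ)
    {ψ' : tens F l' ⟶ F a ⊗ tens F m'} (h' : IsPull F a l' m' ψ') :
    ∃ (m : List ι) (ψ : tens F l ⟶ F a ⊗ tens F m) (χ : tens F m ⟶ tens F m'),
      IsPull F a l m ψ ∧ IsPerm F m m' χ ∧ φ ≫ ψ' = ψ ≫ F a ◁ χ := by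
  induction h generalizing m' with
  | refl => exact ⟨_, ψ', 𝟙 _, h', .refl _, by simp⟩
  | step l₁ x y l₂ φ _ ih =>
    obtain ⟨m₁, ψ₁, χ₁, h1, h2, h3⟩ := square h'
    obtain ⟨m, ψ, χ, h4, h5, h6⟩ := ih h1
    refine ⟨m, ψ, χ ≫ χ₁, h4, h5.comp h2, ?_⟩
    rw [Category.assoc, h3, reassoc_of% h6, MonoidalCategory.whiskerLeft_comp]

end IsPull

theorem IsPerm.eq_of_nil {ι : Type w} {F : ι → E} {l l' : List ι} {φ : tens F l ⟶ tens F l'}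
    (h : IsPerm F l l' φ) (hl : l' = []) : ∃ e : l = l', φ = eqToHom (by rw [e]) := by
  cases h with
  | refl => exact ⟨rfl, rfl⟩
  | step => simp at hl

/-- A composite of symmetries is determined by the underlying permutation, if the factors are
pairwise different. -/
theorem IsPerm.unique {ι : Type w} {F : ι → E} {l l' : List ι} (hl : l.Nodup)
    {φ ψ : tens F l ⟶ tens F l'} (h : IsPerm F l l' φ) (h' : IsPerm F l l' ψ) : φ = ψ := by
  induction l' generalizing l with
  | nil =>
    obtain ⟨_, h1⟩ := h.eq_of_nil rfl
    obtain ⟨_, h2⟩ := h'.eq_of_nil rfl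
    rw [h1, h2]
  | cons a l' ih =>
    -- The head of the target list is traced back through both composites. The two resulting pulls
    -- coincide by `IsPull.unique`, and the residual permutations agree by induction on the target
    -- list.
    obtain ⟨m, p, χ, h1, h2, h3⟩ := IsPull.square_isPerm h (.head l')
    obtain ⟨m', p', χ', h1', h2', h3'⟩ := IsPull.square_isPerm h' (.head l')
    obtain ⟨rfl, h4⟩ := IsPull.unique hl h1 h1'
    cases h4
    obtain rfl := ih (List.nodup_cons.mp (h1.perm.nodup_iff.mp hl)).2 h2 h2'
    exact (Category.comp_id φ).symm.trans ((h3.trans h3'.symm).trans (Category.comp_id ψ))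

end Coherence

/-! ## Formal tensor products -/

/-- Formal iterated tensor products with factors labelled by `ι`. -/
inductive Word (ι : Type w) : Type (w + 1)
  | one : Word ι
  | of (a : ι) : Word ι
  | mul (X Y : Word ι) : Word ι
  | big {κ : Type w} (l : List κ) (S : κ → Word ι) : Word ι

namespace Word

variable {ι : Type w}

/-- The labels of the factors of a formal tensor product. -/
def labels : Word ι → List ι
  | one => []
  | of a => [a]
  | mul X Y => labels X ++ labels Y
  | big l S => l.flatMap fun i => labels (S i)

/-- The formal tensor product over a list. -/
def list {κ : Type w} (c : κ → ι) (l : List κ) : Word ι := big l fun i => of (c i)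

theorem labels_list {κ : Type w} (c : κ → ι) (l : List κ) : labels (list c l) = l.map c := by
  induction l with
  | nil => rfl
  | cons a l ih => exact congrArg (c a :: ·) ih

/-- Substitution of formal tensor products for the factors. -/
def subst {ι' : Type w} (R : ι → Word ι') : Word ι → Word ι'
  | one => one
  | of a => R a
  | mul X Y => mul (subst R X) (subst R Y)
  | big l S => big l fun i => subst R (S i)

theorem labels_subst {ι' : Type w} (R : ι → Word ι') (X : Word ι) :
    labels (subst R X) = (labels X).flatMap fun a => labels (R a) := by
  induction X with
  | one => rfl
  | of a => simp [labels, subst]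
  | mul X Y hX hY => simp [labels, subst, hX, hY]
  | big l S ih => simp [labels, subst, ih, List.flatMap_assoc]

/-- Relabelling of the factors. -/
def map {ι' : Type w} (c : ι → ι') (X : Word ι) : Word ι' :=
  subst (fun a => of (c a)) X

theorem labels_map {ι' : Type w} (c : ι → ι') (X : Word ι) :
    labels (map c X) = (labels X).map c := by
  rw [map, labels_subst]
  exact List.flatMap_pure_eq_map c _

end Word

section Canon

variable {E : Type u'} [Category.{v'} E] [MonoidalCategory E]

/-- The tensor product denoted by a formal tensor product. -/
def Word.eval {ι : Type w} (F : ι → E) : Word ι → E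
  | .one => 𝟙_ E
  | .of a => F a
  | .mul X Y => eval F X ⊗ eval F Y
  | .big l S => tens (fun i => eval F (S i)) l

open Word

/-- The canonical morphism from an iterated tensor product of tensor products over lists. -/
def tensFlatten {ι : Type w} (F : ι → E) {κ : Type w} {G : κ → E} {L : κ → List ι}
    (φ : ∀ i, G i ⟶ tens F (L i)) : ∀ l : List κ, tens G l ⟶ tens F (l.flatMap L)
  | [] => 𝟙 (𝟙_ E)
  | a :: l => (φ a ⊗ₘ tensFlatten F φ l) ≫ tensCat F (l.flatMap L) (L a)

theorem tensFlatten_isIso {ι : Type w} (F : ι → E) {κ : Type w} {G : κ → E} {L : κ → List ι}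
    (φ : ∀ i, G i ⟶ tens F (L i)) (h : ∀ i, IsIso (φ i)) (l : List κ) :
    IsIso (tensFlatten F φ l) := by
  induction l with
  | nil => exact inferInstanceAs (IsIso (𝟙 (𝟙_ E)))
  | cons a l ih =>
    exact inferInstanceAs (IsIso ((φ a ⊗ₘ tensFlatten F φ l) ≫ tensCat F (l.flatMap L) (L a)))

/-- The canonical morphism to the tensor product over the list of labels. -/
def Word.normal {ι : Type w} (F : ι → E) : ∀ X : Word ι, eval F X ⟶ tens F X.labels
  | .one => 𝟙 (𝟙_ E)
  | .of a => (ρ_ (F a)).inv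
  | .mul X Y => (normal F X ⊗ₘ normal F Y) ≫ tensCat F Y.labels X.labels
  | .big l S => tensFlatten F (fun i => normal F (S i)) l

theorem Word.normal_isIso {ι : Type w} (F : ι → E) (X : Word ι) : IsIso (X.normal F) := by
  induction X with
  | one => exact inferInstanceAs (IsIso (𝟙 (𝟙_ E)))
  | of a => exact inferInstanceAs (IsIso (ρ_ (F a)).inv)
  | mul X Y hX hY =>
    exact inferInstanceAs (IsIso ((normal F X ⊗ₘ normal F Y) ≫ tensCat F Y.labels X.labels))
  | big l S ih => exact tensFlatten_isIso F _ ih l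

variable [SymmetricCategory E]

/-- The canonical morphisms between formal tensor products. -/
inductive Canon {ι : Type w} (F : ι → E) :
    ∀ X Y : Word ι, (X.eval F ⟶ Y.eval F) → Prop
  | id (X) : Canon F X X (𝟙 _)
  | comp {X Y Z} {φ : X.eval F ⟶ Y.eval F} {ψ : Y.eval F ⟶ Z.eval F} :
      Canon F X Y φ → Canon F Y Z ψ → Canon F X Z (φ ≫ ψ)
  | tensor {X Y X' Y'} {φ : X.eval F ⟶ Y.eval F} {ψ : X'.eval F ⟶ Y'.eval F} :
      Canon F X Y φ → Canon F X' Y' ψ → Canon F (.mul X X') (.mul Y Y') (φ ⊗ₘ ψ)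
  | assoc (X Y Z : Word ι) : Canon F (.mul (.mul X Y) Z) (.mul X (.mul Y Z))
      (α_ (X.eval F) (Y.eval F) (Z.eval F)).hom
  | assocInv (X Y Z : Word ι) : Canon F (.mul X (.mul Y Z)) (.mul (.mul X Y) Z)
      (α_ (X.eval F) (Y.eval F) (Z.eval F)).inv
  | leftUnit (X : Word ι) : Canon F (.mul .one X) X (λ_ (X.eval F)).hom
  | leftUnitInv (X : Word ι) : Canon F X (.mul .one X) (λ_ (X.eval F)).inv
  | rightUnit (X : Word ι) : Canon F (.mul X .one) X (ρ_ (X.eval F)).hom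
  | rightUnitInv (X : Word ι) : Canon F X (.mul X .one) (ρ_ (X.eval F)).inv
  | braid (X Y : Word ι) : Canon F (.mul X Y) (.mul Y X) (β_ (X.eval F) (Y.eval F)).hom
  | nil {κ : Type w} (S : κ → Word ι) : Canon F (.big [] S) .one (𝟙 (𝟙_ E))
  | nilInv {κ : Type w} (S : κ → Word ι) : Canon F .one (.big [] S) (𝟙 (𝟙_ E))
  | cons {κ : Type w} (a : κ) (l : List κ) (S : κ → Word ι) :
      Canon F (.big (a :: l) S) (.mul (S a) (.big l S))
        (𝟙 (eval F (S a) ⊗ tens (fun i => eval F (S i)) l))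
  | consInv {κ : Type w} (a : κ) (l : List κ) (S : κ → Word ι) :
      Canon F (.mul (S a) (.big l S)) (.big (a :: l) S)
        (𝟙 (eval F (S a) ⊗ tens (fun i => eval F (S i)) l))

/-! ### Structural morphisms as permutations of the lists of labels -/

namespace IsPerm

variable {ι : Type w} {F : ι → E}

/-- This lemma and the following ones express the generators of `Canon` by adjacent symmetries,
after both sides have been flattened with `tensCat`. -/
theorem exists_swap_append (l₁ : List ι) (x y : ι) (l₂ r : List ι) :
    ∃ θ, IsPerm F ((l₁ ++ x :: y :: l₂) ++ r) ((l₁ ++ y :: x :: l₂) ++ r) θ ∧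
      tensCat F r _ ≫ θ = tensSwap F x y l₂ l₁ ▷ _ ≫ tensCat F r _ := by
  induction l₁ with
  | nil =>
    refine ⟨_, swap [] x y (l₂ ++ r), ?_⟩
    have e : ∀ {X Y T R T' : E} (f : T ⊗ R ⟶ T'),
        ((α_ X (Y ⊗ T) R).hom ≫ X ◁ ((α_ Y T R).hom ≫ Y ◁ f)) ≫
          (α_ X Y T').inv ≫ (β_ X Y).hom ▷ T' ≫ (α_ Y X T').hom =
        ((α_ X Y T).inv ≫ (β_ X Y).hom ▷ T ≫ (α_ Y X T).hom) ▷ R ≫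
          (α_ Y (X ⊗ T) R).hom ≫ Y ◁ ((α_ X T R).hom ≫ X ◁ f) := by
      intro X Y T R T' f
      rw [MonoidalCategory.whiskerLeft_comp, Category.assoc, Category.assoc,
        IsPull.swap_naturality, MonoidalCategory.whiskerLeft_comp]
      simp only [← Category.assoc]
      congr 1
      simp only [Category.assoc]
      monoidal
    exact e _
  | cons b l₁ ih =>
    obtain ⟨θ, h1, h2⟩ := ih
    refine ⟨_, h1.cons b, ?_⟩
    have e : ∀ {B S T R V W : E} {f : S ⊗ R ⟶ V} {f' : T ⊗ R ⟶ W} {t : V ⟶ W} {s : S ⟶ T},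
        f ≫ t = s ▷ R ≫ f' →
        ((α_ B S R).hom ≫ B ◁ f) ≫ B ◁ t = (B ◁ s) ▷ R ≫ (α_ B T R).hom ≫ B ◁ f' := by
      intro B S T R V W f f' t s h
      rw [Category.assoc, ← MonoidalCategory.whiskerLeft_comp, h]
      simp
    exact e h2

theorem exists_append_right {l l' : List ι} {θ : tens F l ⟶ tens F l'} (h : IsPerm F l l' θ)
    (r : List ι) : ∃ θ', IsPerm F (l ++ r) (l' ++ r) θ' ∧
      tensCat F r l ≫ θ' = θ ▷ _ ≫ tensCat F r l' := by
  induction h with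
  | refl => exact ⟨𝟙 _, refl _, by simp⟩
  | step l₁ x y l₂ φ _ ih =>
    obtain ⟨θ', h1, h2⟩ := ih
    obtain ⟨θ'', h3, h4⟩ := exists_swap_append (F := F) l₁ x y l₂ r
    refine ⟨θ' ≫ θ'', h1.comp h3, ?_⟩
    rw [reassoc_of% h2, h4, comp_whiskerRight, Category.assoc]

theorem exists_append_left {r r' : List ι} {θ : tens F r ⟶ tens F r'} (h : IsPerm F r r' θ)
    (l : List ι) : ∃ θ', IsPerm F (l ++ r) (l ++ r') θ' ∧
      tensCat F r l ≫ θ' = _ ◁ θ ≫ tensCat F r' l := by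
  induction l with
  | nil => exact ⟨θ, h, (leftUnitor_naturality θ).symm⟩
  | cons a l ih =>
    obtain ⟨θ', h1, h2⟩ := ih
    refine ⟨_, h1.cons a, ?_⟩
    have e : ∀ {B S R R' V W : E} {f : S ⊗ R ⟶ V} {f' : S ⊗ R' ⟶ W} {t : V ⟶ W} {s : R ⟶ R'},
        f ≫ t = S ◁ s ≫ f' →
        ((α_ B S R).hom ≫ B ◁ f) ≫ B ◁ t = (B ⊗ S) ◁ s ≫ (α_ B S R').hom ≫ B ◁ f' := by
      intro B S R R' V W f f' t s h
      rw [Category.assoc, ← MonoidalCategory.whiskerLeft_comp, h]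
      simp
    exact e h2

theorem exists_append {l l' r r' : List ι} {θ : tens F l ⟶ tens F l'}
    {χ : tens F r ⟶ tens F r'} (h : IsPerm F l l' θ) (h' : IsPerm F r r' χ) :
    ∃ θ', IsPerm F (l ++ r) (l' ++ r') θ' ∧ tensCat F r l ≫ θ' = (θ ⊗ₘ χ) ≫ tensCat F r' l' := by
  obtain ⟨θ₁, h1, h2⟩ := h.exists_append_right r
  obtain ⟨θ₂, h3, h4⟩ := h'.exists_append_left l'
  refine ⟨θ₁ ≫ θ₂, h1.comp h3, ?_⟩
  rw [reassoc_of% h2, h4, MonoidalCategory.tensorHom_def, Category.assoc]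

theorem exists_assoc (l r s : List ι) : ∃ θ, IsPerm F ((l ++ r) ++ s) (l ++ (r ++ s)) θ ∧
    tensCat F r l ▷ _ ≫ tensCat F s (l ++ r) ≫ θ =
      (α_ _ _ _).hom ≫ _ ◁ tensCat F s r ≫ tensCat F (r ++ s) l := by
  induction l with
  | nil =>
    refine ⟨𝟙 _, refl _, ?_⟩
    have e : ∀ {R S V : E} (f : R ⊗ S ⟶ V), (λ_ R).hom ▷ S ≫ f ≫ 𝟙 _ =
      (α_ (𝟙_ E) R S).hom ≫ (𝟙_ E) ◁ f ≫ (λ_ V).hom := by intros; simp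
    exact e _
  | cons a l ih =>
    obtain ⟨θ, h1, h2⟩ := ih
    refine ⟨_, h1.cons a, ?_⟩
    have e : ∀ {A L R S LR RS LRS LRS' : E} {f : L ⊗ R ⟶ LR} {g : LR ⊗ S ⟶ LRS}
        {t : LRS ⟶ LRS'} {h : R ⊗ S ⟶ RS} {k : L ⊗ RS ⟶ LRS'},
        f ▷ S ≫ g ≫ t = (α_ L R S).hom ≫ L ◁ h ≫ k →
        ((α_ A L R).hom ≫ A ◁ f) ▷ S ≫ ((α_ A LR S).hom ≫ A ◁ g) ≫ A ◁ t =
          (α_ (A ⊗ L) R S).hom ≫ (A ⊗ L) ◁ h ≫ (α_ A L RS).hom ≫ A ◁ k := by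
      intro A L R S LR RS LRS LRS' f g t h k H
      have := congrArg (fun x => (α_ A L R).hom ▷ S ≫ (α_ A (L ⊗ R) S).hom ≫ A ◁ x) H
      simpa using this
    exact e h2

theorem exists_append_nil (l : List ι) : ∃ θ, IsPerm F (l ++ []) l θ ∧
    tensCat F [] l ≫ θ = (ρ_ (tens F l)).hom := by
  induction l with
  | nil => exact ⟨𝟙 _, refl _, by rw [Category.comp_id]; exact unitors_equal⟩
  | cons a l ih =>
    obtain ⟨θ, h1, h2⟩ := ih
    refine ⟨_, h1.cons a, ?_⟩
    have e : ∀ {A L R : E} {f : L ⊗ 𝟙_ E ⟶ R} {t : R ⟶ L}, f ≫ t = (ρ_ L).hom →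
        ((α_ A L (𝟙_ E)).hom ≫ A ◁ f) ≫ A ◁ t = (ρ_ (A ⊗ L)).hom := by
      intro A L R f t h
      rw [Category.assoc, ← MonoidalCategory.whiskerLeft_comp, h]
      simp
    exact e h2

/-- By the hexagon identity, braiding `F a` with a tensor product over `l` amounts to passing the
factors of `l` one at a time. -/
theorem exists_shift (a : ι) (l r : List ι) : ∃ θ, IsPerm F (a :: (l ++ r)) (l ++ a :: r) θ ∧
    F a ◁ tensCat F r l ≫ θ = ((α_ _ _ _).inv ≫ (β_ (F a) (tens F l)).hom ▷ _ ≫ (α_ _ _ _).hom) ≫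
      tensCat F (a :: r) l := by
  induction l with
  | nil =>
    refine ⟨𝟙 _, refl _, ?_⟩
    have e : ∀ {A R : E}, A ◁ (λ_ R).hom ≫ 𝟙 _ = ((α_ A (𝟙_ E) R).inv ≫
      (β_ A (𝟙_ E)).hom ▷ R ≫ (α_ _ _ _).hom) ≫ (λ_ (A ⊗ R)).hom := by
      intros; simp
    exact e
  | cons b l ih =>
    obtain ⟨θ, h1, h2⟩ := ih
    refine ⟨_, (swap [] a b (l ++ r)).comp (h1.cons b), ?_⟩
    have e : ∀ {A B L R V W : E} {f : L ⊗ R ⟶ V} {t : A ⊗ V ⟶ W} {f' : L ⊗ (A ⊗ R) ⟶ W},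
        A ◁ f ≫ t = ((α_ A L R).inv ≫ (β_ A L).hom ▷ R ≫ (α_ _ _ _).hom) ≫ f' →
        A ◁ ((α_ B L R).hom ≫ B ◁ f) ≫
          ((α_ A B V).inv ≫ (β_ A B).hom ▷ V ≫ (α_ B A V).hom) ≫ B ◁ t =
        ((α_ A (B ⊗ L) R).inv ≫ (β_ A (B ⊗ L)).hom ▷ R ≫ (α_ _ _ _).hom) ≫
          (α_ B L (A ⊗ R)).hom ≫ B ◁ f' := by
      intro A B L R V W f t f' h
      have h1 := congrArg (fun x => x ≫ B ◁ t) (IsPull.swap_naturality A B f)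
      have h3 := congrArg (fun x => B ◁ x) h
      simp only [Category.assoc, MonoidalCategory.whiskerLeft_comp] at h1 h3
      rw [h3] at h1
      simp only [MonoidalCategory.whiskerLeft_comp, Category.assoc, h1,
        BraidedCategory.braiding_tensor_right_hom]
      monoidal
    exact e h2

theorem exists_braid (l r : List ι) : ∃ θ, IsPerm F (l ++ r) (r ++ l) θ ∧
    tensCat F r l ≫ θ = (β_ (tens F l) (tens F r)).hom ≫ tensCat F l r := by
  induction l with
  | nil =>
    obtain ⟨θ, h1, h2⟩ := exists_append_nil (F := F) r
    obtain ⟨θ', h3, h4, h5⟩ := h1.exists_inv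
    refine ⟨θ', h3, ?_⟩
    have e : ∀ {R V : E} {t : R ⟶ V} {t' : V ⟶ R} {f : R ⊗ 𝟙_ E ⟶ V}, f ≫ t' = (ρ_ R).hom →
        t' ≫ t = 𝟙 _ → (λ_ R).hom ≫ t = (β_ (𝟙_ E) R).hom ≫ f := by
      intro R V t t' f h h'
      rw [← braiding_rightUnitor, ← h, Category.assoc, Category.assoc, h', Category.comp_id]
    exact e h2 h4
  | cons a l ih =>
    obtain ⟨θ, h1, h2⟩ := ih
    obtain ⟨θ', h3, h4⟩ := exists_shift (F := F) a r l
    refine ⟨_, (h1.cons a).comp h3, ?_⟩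
    have e : ∀ {A L R V W Z : E} {f : L ⊗ R ⟶ V} {t : V ⟶ W} {f' : R ⊗ L ⟶ W} {s : A ⊗ W ⟶ Z}
        {g : R ⊗ (A ⊗ L) ⟶ Z}, f ≫ t = (β_ L R).hom ≫ f' →
        A ◁ f' ≫ s = ((α_ A R L).inv ≫ (β_ A R).hom ▷ L ≫ (α_ _ _ _).hom) ≫ g →
        ((α_ A L R).hom ≫ A ◁ f) ≫ A ◁ t ≫ s = (β_ (A ⊗ L) R).hom ≫ g := by
      intro A L R V W Z f t f' s g h h'
      rw [Category.assoc, ← MonoidalCategory.whiskerLeft_comp_assoc, h,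
        MonoidalCategory.whiskerLeft_comp, Category.assoc, h']
      simp
    exact e h2 h4

end IsPerm

namespace Canon

variable {ι : Type w} {F : ι → E}

/-- Conjugation with the isomorphisms `normal` turns each generator into a product of adjacent
symmetries. This reduces coherence for arbitrary bracketings to `IsPerm.unique`. -/
theorem exists_isPerm {X Y : Word ι} {φ : X.eval F ⟶ Y.eval F} (h : Canon F X Y φ) :
    ∃ θ, IsPerm F X.labels Y.labels θ ∧ X.normal F ≫ θ = φ ≫ Y.normal F := by
  induction h with
  | id X => exact ⟨𝟙 _, .refl _, by simp⟩
  | comp _ _ ih ih' =>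
    obtain ⟨θ, h1, h2⟩ := ih
    obtain ⟨θ', h3, h4⟩ := ih'
    exact ⟨θ ≫ θ', h1.comp h3, by rw [reassoc_of% h2, h4, Category.assoc]⟩
  | tensor _ _ ih ih' =>
    obtain ⟨θ, h1, h2⟩ := ih
    obtain ⟨θ', h3, h4⟩ := ih'
    obtain ⟨θ'', h5, h6⟩ := h1.exists_append h3
    refine ⟨θ'', h5, ?_⟩
    have e : ∀ {A A' B B' P P' Q Q' V W : E} {f : A ⟶ P} {f' : A' ⟶ P'} {a : A ⟶ B} {a' : A' ⟶ B'}
        {g : B ⟶ Q} {g' : B' ⟶ Q'} {t : P ⟶ Q} {t' : P' ⟶ Q'} {c : P ⊗ P' ⟶ V} {d : Q ⊗ Q' ⟶ W}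
        {s : V ⟶ W}, f ≫ t = a ≫ g → f' ≫ t' = a' ≫ g' → c ≫ s = (t ⊗ₘ t') ≫ d →
        ((f ⊗ₘ f') ≫ c) ≫ s = (a ⊗ₘ a') ≫ (g ⊗ₘ g') ≫ d := by
      intro A A' B B' P P' Q Q' V W f f' a a' g g' t t' c d s h h' h''
      rw [Category.assoc, h'', tensorHom_comp_tensorHom_assoc, h, h', tensorHom_comp_tensorHom_assoc]
    exact e h2 h4 h6
  | assoc X Y Z =>
    obtain ⟨θ, h1, h2⟩ := IsPerm.exists_assoc (F := F) X.labels Y.labels Z.labels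
    refine ⟨θ, h1, ?_⟩
    have e : ∀ {A B C P Q R PQ QR V W : E} {f : A ⟶ P} {g : B ⟶ Q} {h : C ⟶ R} {c : P ⊗ Q ⟶ PQ}
        {c' : PQ ⊗ R ⟶ V} {t : V ⟶ W} {d : Q ⊗ R ⟶ QR} {d' : P ⊗ QR ⟶ W},
        c ▷ R ≫ c' ≫ t = (α_ P Q R).hom ≫ P ◁ d ≫ d' →
        ((((f ⊗ₘ g) ≫ c) ⊗ₘ h) ≫ c') ≫ t =
          (α_ A B C).hom ≫ (f ⊗ₘ ((g ⊗ₘ h) ≫ d)) ≫ d' := by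
      intro A B C P Q R PQ QR V W f g h c c' t d d' H
      have := congrArg (fun x => ((f ⊗ₘ g) ⊗ₘ h) ≫ x) H
      simp only [associator_naturality_assoc] at this
      rw [← Category.comp_id h, ← tensorHom_comp_tensorHom, Category.assoc, Category.assoc,
        tensorHom_id, this, Category.comp_id, ← Category.comp_id f, ← tensorHom_comp_tensorHom,
        Category.comp_id, id_tensorHom, Category.assoc]
    exact e h2
  | assocInv X Y Z =>
    obtain ⟨θ, h1, h2⟩ := IsPerm.exists_assoc (F := F) X.labels Y.labels Z.labels
    obtain ⟨θ', h3, h4, h5⟩ := h1.exists_inv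
    refine ⟨θ', h3, ?_⟩
    have e : ∀ {A B C P Q R PQ QR V W : E} {f : A ⟶ P} {g : B ⟶ Q} {h : C ⟶ R} {c : P ⊗ Q ⟶ PQ}
        {c' : PQ ⊗ R ⟶ V} {t : V ⟶ W} {t' : W ⟶ V} {d : Q ⊗ R ⟶ QR} {d' : P ⊗ QR ⟶ W},
        c ▷ R ≫ c' ≫ t = (α_ P Q R).hom ≫ P ◁ d ≫ d' → t ≫ t' = 𝟙 _ →
        ((f ⊗ₘ ((g ⊗ₘ h) ≫ d)) ≫ d') ≫ t' =
          (α_ A B C).inv ≫ (((f ⊗ₘ g) ≫ c) ⊗ₘ h) ≫ c' := by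
      intro A B C P Q R PQ QR V W f g h c c' t t' d d' H H'
      have := congrArg (fun x => ((f ⊗ₘ g) ⊗ₘ h) ≫ x ≫ t') H
      simp only [Category.assoc, H', Category.comp_id, associator_naturality_assoc] at this
      rw [← Category.comp_id h, ← tensorHom_comp_tensorHom, Category.assoc, Category.assoc,
        tensorHom_id, this, Category.comp_id, ← Category.comp_id f, ← tensorHom_comp_tensorHom,
        Category.comp_id, id_tensorHom, Category.assoc, Iso.inv_hom_id_assoc]
    exact e h2 h4
  | leftUnit X =>
    refine ⟨𝟙 _, .refl _, ?_⟩
    have e : ∀ {A P : E} {f : A ⟶ P}, ((𝟙 (𝟙_ E) ⊗ₘ f) ≫ (λ_ P).hom) ≫ 𝟙 _ = (λ_ A).hom ≫ f := by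
      intros; simp
    exact e
  | leftUnitInv X =>
    refine ⟨𝟙 _, .refl _, ?_⟩
    have e : ∀ {A P : E} {f : A ⟶ P}, f ≫ 𝟙 _ = (λ_ A).inv ≫ (𝟙 (𝟙_ E) ⊗ₘ f) ≫ (λ_ P).hom := by
      intros; simp
    exact e
  | rightUnit X =>
    obtain ⟨θ, h1, h2⟩ := IsPerm.exists_append_nil (F := F) X.labels
    refine ⟨θ, h1, ?_⟩
    have e : ∀ {A P V : E} {f : A ⟶ P} {c : P ⊗ 𝟙_ E ⟶ V} {t : V ⟶ P}, c ≫ t = (ρ_ P).hom →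
        ((f ⊗ₘ 𝟙 (𝟙_ E)) ≫ c) ≫ t = (ρ_ A).hom ≫ f := by
      intro A P V f c t h
      rw [Category.assoc, h]; simp
    exact e h2
  | rightUnitInv X =>
    obtain ⟨θ, h1, h2⟩ := IsPerm.exists_append_nil (F := F) X.labels
    obtain ⟨θ', h3, h4, h5⟩ := h1.exists_inv
    refine ⟨θ', h3, ?_⟩
    have e : ∀ {A P V : E} {f : A ⟶ P} {c : P ⊗ 𝟙_ E ⟶ V} {t : V ⟶ P} {t' : P ⟶ V},
        c ≫ t = (ρ_ P).hom → t ≫ t' = 𝟙 _ →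
        f ≫ t' = (ρ_ A).inv ≫ (f ⊗ₘ 𝟙 (𝟙_ E)) ≫ c := by
      intro A P V f c t t' h h'
      have : c = (ρ_ P).hom ≫ t' := by rw [← h, Category.assoc, h', Category.comp_id]
      rw [this]; simp
    exact e h2 h4
  | braid X Y =>
    obtain ⟨θ, h1, h2⟩ := IsPerm.exists_braid (F := F) X.labels Y.labels
    refine ⟨θ, h1, ?_⟩
    have e : ∀ {A B P Q V W : E} {f : A ⟶ P} {g : B ⟶ Q} {c : P ⊗ Q ⟶ V} {t : V ⟶ W}
        {c' : Q ⊗ P ⟶ W}, c ≫ t = (β_ P Q).hom ≫ c' →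
        ((f ⊗ₘ g) ≫ c) ≫ t = (β_ A B).hom ≫ (g ⊗ₘ f) ≫ c' := by
      intro A B P Q V W f g c t c' h
      rw [Category.assoc, h, BraidedCategory.braiding_naturality_assoc]
    exact e h2
  | nil S => exact ⟨𝟙 _, .refl _, rfl⟩
  | nilInv S => exact ⟨𝟙 _, .refl _, rfl⟩
  | cons a l S => exact ⟨𝟙 _, .refl _, (Category.comp_id _).trans (Category.id_comp _).symm⟩
  | consInv a l S => exact ⟨𝟙 _, .refl _, (Category.comp_id _).trans (Category.id_comp _).symm⟩

theorem perm {X Y : Word ι} {φ : X.eval F ⟶ Y.eval F} (h : Canon F X Y φ) :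
    X.labels.Perm Y.labels :=
  h.exists_isPerm.choose_spec.1.perm

/-- Coherence: canonical morphisms between formal tensor products whose factors have pairwise
different labels are equal. -/
theorem unique {X Y : Word ι} (hX : X.labels.Nodup) {φ ψ : X.eval F ⟶ Y.eval F}
    (h : Canon F X Y φ) (h' : Canon F X Y ψ) : φ = ψ := by
  obtain ⟨θ, h1, h2⟩ := h.exists_isPerm
  obtain ⟨θ', h3, h4⟩ := h'.exists_isPerm
  obtain rfl := h1.unique hX h3
  have := Y.normal_isIso F
  rw [← cancel_mono (Y.normal F), ← h2, h4]

theorem exists_inv {X Y : Word ι} {φ : X.eval F ⟶ Y.eval F} (h : Canon F X Y φ) :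
    ∃ ψ, Canon F Y X ψ ∧ φ ≫ ψ = 𝟙 _ ∧ ψ ≫ φ = 𝟙 _ := by
  induction h with
  | id X => exact ⟨_, .id X, by simp, by simp⟩
  | comp _ _ ih ih' =>
    obtain ⟨ψ, h1, h2, h3⟩ := ih
    obtain ⟨ψ', h4, h5, h6⟩ := ih'
    refine ⟨_, h4.comp h1, ?_, ?_⟩
    · rw [Category.assoc, reassoc_of% h5, h2]
    · rw [Category.assoc, reassoc_of% h3, h6]
  | tensor _ _ ih ih' =>
    obtain ⟨ψ, h1, h2, h3⟩ := ih
    obtain ⟨ψ', h4, h5, h6⟩ := ih'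
    have e : ∀ {A B A' B' : E} {f : A ⟶ B} {g : B ⟶ A} {f' : A' ⟶ B'} {g' : B' ⟶ A'},
        f ≫ g = 𝟙 _ → f' ≫ g' = 𝟙 _ → (f ⊗ₘ f') ≫ (g ⊗ₘ g') = 𝟙 (A ⊗ A') := by
      intro A B A' B' f g f' g' h h'
      rw [tensorHom_comp_tensorHom, h, h', id_tensorHom_id]
    exact ⟨_, h1.tensor h4, e h2 h5, e h3 h6⟩
  | assoc X Y Z => exact ⟨_, .assocInv X Y Z, Iso.hom_inv_id _, Iso.inv_hom_id _⟩
  | assocInv X Y Z => exact ⟨_, .assoc X Y Z, Iso.inv_hom_id _, Iso.hom_inv_id _⟩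
  | leftUnit X => exact ⟨_, .leftUnitInv X, Iso.hom_inv_id _, Iso.inv_hom_id _⟩
  | leftUnitInv X => exact ⟨_, .leftUnit X, Iso.inv_hom_id _, Iso.hom_inv_id _⟩
  | rightUnit X => exact ⟨_, .rightUnitInv X, Iso.hom_inv_id _, Iso.inv_hom_id _⟩
  | rightUnitInv X => exact ⟨_, .rightUnit X, Iso.inv_hom_id _, Iso.hom_inv_id _⟩
  | braid X Y => exact ⟨_, .braid Y X, SymmetricCategory.symmetry _ _, SymmetricCategory.symmetry _ _⟩
  | nil S => exact ⟨_, .nilInv S, Category.comp_id _, Category.comp_id _⟩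
  | nilInv S => exact ⟨_, .nil S, Category.comp_id _, Category.comp_id _⟩
  | cons a l S => exact ⟨_, .consInv a l S, Category.comp_id _, Category.comp_id _⟩
  | consInv a l S => exact ⟨_, .cons a l S, Category.comp_id _, Category.comp_id _⟩

end Canon

end Canon

section Canon

variable {E : Type u'} [Category.{v'} E] [MonoidalCategory E]

open Word

/-- The morphism induced by a family of morphisms from the formal tensor products substituted for
the factors. -/
def Word.substMap {ι ι' : Type w} {F : ι → E} {F' : ι' → E} (R : ι → Word ι')
    (ψ : ∀ a, (R a).eval F' ⟶ F a) : ∀ X : Word ι, (X.subst R).eval F' ⟶ X.eval F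
  | .one => 𝟙 (𝟙_ E)
  | .of a => ψ a
  | .mul X Y => substMap R ψ X ⊗ₘ substMap R ψ Y
  | .big l S => tensHom (fun i => substMap R ψ (S i)) l

/-- The comparison between the values of a formal tensor product and of its relabelling. -/
def Word.mapMap {ι ι' : Type w} (F : ι' → E) (c : ι → ι') (X : Word ι) :
    (X.map c).eval F ⟶ X.eval fun a => F (c a) :=
  substMap (fun a => of (c a)) (fun a => 𝟙 (F (c a))) X

/-- Functoriality of formal tensor products in the factors. -/
def Word.evalMap {ι : Type w} {F G : ι → E} (α : ∀ a, F a ⟶ G a) :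
    ∀ X : Word ι, X.eval F ⟶ X.eval G
  | .one => 𝟙 (𝟙_ E)
  | .of a => α a
  | .mul X Y => evalMap α X ⊗ₘ evalMap α Y
  | .big l S => tensHom (fun i => evalMap α (S i)) l

/-- For a list, relabelling does not even change the underlying object, so comparison maps that
appear in functoriality statements can be dropped. -/
theorem Word.mapMap_list {ι ι' κ : Type w} (F : ι' → E) (c : ι → ι') (d : κ → ι) (l : List κ) :
    mapMap F c (list d l) = 𝟙 (tens (fun i => F (c (d i))) l) :=
  tensHom_id _ l

theorem tensHom_isIso {ι : Type*} {F G : ι → E} (φ : ∀ a, F a ⟶ G a) (h : ∀ a, IsIso (φ a))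
    (l : List ι) : IsIso (tensHom φ l) := by
  induction l with
  | nil => exact inferInstanceAs (IsIso (𝟙 (𝟙_ E)))
  | cons a l ih => exact inferInstanceAs (IsIso (φ a ⊗ₘ tensHom φ l))

theorem Word.substMap_isIso {ι ι' : Type w} {F : ι → E} {F' : ι' → E} (R : ι → Word ι')
    (ψ : ∀ a, (R a).eval F' ⟶ F a) (h : ∀ a, IsIso (ψ a)) (X : Word ι) :
    IsIso (substMap R ψ X) := by
  induction X with
  | one => exact inferInstanceAs (IsIso (𝟙 (𝟙_ E)))
  | of a => exact h a
  | mul X Y hX hY => exact inferInstanceAs (IsIso (substMap R ψ X ⊗ₘ substMap R ψ Y))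
  | big l S ih => exact tensHom_isIso _ ih l

theorem Word.mapMap_isIso {ι ι' : Type w} (F : ι' → E) (c : ι → ι') (X : Word ι) :
    IsIso (mapMap F c X) :=
  substMap_isIso _ _ (fun a => inferInstanceAs (IsIso (𝟙 (F (c a))))) X

theorem tensMap_eq {ι κ : Type*} {F : ι → E} {G : κ → E} (c : ι → κ) (φ : ∀ a, F a ⟶ G (c a))
    (l : List ι) : tensMap c φ l = tensHom φ l ≫ tensMap c (fun a => 𝟙 (G (c a))) l := by
  induction l with
  | nil => exact (Category.comp_id _).symm
  | cons a l ih =>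
    have e : ∀ {A B P Q R : E} {f : A ⟶ B} {g : P ⟶ R} {h : P ⟶ Q} {k : Q ⟶ R}, g = h ≫ k →
        f ⊗ₘ g = (f ⊗ₘ h) ≫ (𝟙 B ⊗ₘ k) := by
      intro A B P Q R f g h k H
      rw [tensorHom_comp_tensorHom, H, Category.comp_id]
    exact e ih

variable [SymmetricCategory E]

namespace Canon

variable {ι : Type w} {F : ι → E}

theorem of_eq {X Y : Word ι} {φ ψ : X.eval F ⟶ Y.eval F} (h : Canon F X Y φ) (e : φ = ψ) :
    Canon F X Y ψ :=
  e ▸ h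

theorem whiskerLeft (W : Word ι) {X Y : Word ι} {φ : X.eval F ⟶ Y.eval F} (h : Canon F X Y φ) :
    Canon F (.mul W X) (.mul W Y) (W.eval F ◁ φ) := by
  rw [← id_tensorHom]
  exact (Canon.id W).tensor h

theorem whiskerRight (W : Word ι) {X Y : Word ι} {φ : X.eval F ⟶ Y.eval F} (h : Canon F X Y φ) :
    Canon F (.mul X W) (.mul Y W) (φ ▷ W.eval F) := by
  rw [← tensorHom_id]
  exact h.tensor (Canon.id W)

/-- Cancelling the identities in the constructors `cons`, `consInv`. -/
theorem consTensor {κ : Type w} {a : κ} {l : List κ} {S : κ → Word ι} {X Y : Word ι}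
    {φ : (S a).eval F ⟶ X.eval F} {ψ : (big l S).eval F ⟶ Y.eval F}
    (h : Canon F (S a) X φ) (h' : Canon F (big l S) Y ψ) :
    Canon F (big (a :: l) S) (.mul X Y) (φ ⊗ₘ ψ) := by
  have := (Canon.cons (F := F) a l S).comp (h.tensor h')
  have e : 𝟙 (eval F (S a) ⊗ tens (fun i => eval F (S i)) l) ≫ (φ ⊗ₘ ψ) = φ ⊗ₘ ψ :=
    Category.id_comp _
  exact e ▸ this

theorem tensorCons {κ : Type w} {a : κ} {l : List κ} {S : κ → Word ι} {X Y : Word ι}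
    {φ : X.eval F ⟶ (S a).eval F} {ψ : Y.eval F ⟶ (big l S).eval F}
    (h : Canon F X (S a) φ) (h' : Canon F Y (big l S) ψ) :
    Canon F (.mul X Y) (big (a :: l) S) (φ ⊗ₘ ψ) := by
  have := (h.tensor h').comp (Canon.consInv (F := F) a l S)
  have e : (φ ⊗ₘ ψ) ≫ 𝟙 (eval F (S a) ⊗ tens (fun i => eval F (S i)) l) = φ ⊗ₘ ψ :=
    Category.comp_id _
  exact e ▸ this

/-- The constructors `cons` and `consInv`, for composites. -/
theorem compCons {κ : Type w} {a : κ} {l : List κ} {S : κ → Word ι} {X : Word ι}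
    {φ : X.eval F ⟶ eval F (S a) ⊗ tens (fun i => eval F (S i)) l}
    (h : Canon F X (.mul (S a) (big l S)) φ) : Canon F X (big (a :: l) S) φ := by
  have := h.comp (Canon.consInv (F := F) a l S)
  have e : φ ≫ 𝟙 (eval F (S a) ⊗ tens (fun i => eval F (S i)) l) = φ := Category.comp_id _
  exact e ▸ this

theorem consComp {κ : Type w} {a : κ} {l : List κ} {S : κ → Word ι} {X : Word ι}
    {φ : eval F (S a) ⊗ tens (fun i => eval F (S i)) l ⟶ X.eval F}
    (h : Canon F (.mul (S a) (big l S)) X φ) : Canon F (big (a :: l) S) X φ := by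
  have := (Canon.cons (F := F) a l S).comp h
  have e : 𝟙 (eval F (S a) ⊗ tens (fun i => eval F (S i)) l) ≫ φ = φ := Category.id_comp _
  exact e ▸ this

theorem compNil {κ : Type w} {S : κ → Word ι} {X : Word ι} {φ : X.eval F ⟶ 𝟙_ E}
    (h : Canon F X .one φ) : Canon F X (big [] S) φ := by
  have := h.comp (Canon.nilInv (F := F) S)
  have e : φ ≫ 𝟙 (𝟙_ E) = φ := Category.comp_id _
  exact e ▸ this

theorem nilComp {κ : Type w} {S : κ → Word ι} {X : Word ι} {φ : 𝟙_ E ⟶ X.eval F}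
    (h : Canon F .one X φ) : Canon F (big [] S) X φ := by
  have := (Canon.nil (F := F) S).comp h
  have e : 𝟙 (𝟙_ E) ≫ φ = φ := Category.id_comp _
  exact e ▸ this

theorem bigCongr {κ : Type w} {S S' : κ → Word ι} {φ : ∀ i, (S i).eval F ⟶ (S' i).eval F}
    (l : List κ) (h : ∀ i ∈ l, Canon F (S i) (S' i) (φ i)) :
    Canon F (big l S) (big l S') (tensHom φ l) := by
  induction l with
  | nil => exact nilComp (compNil (.id _))
  | cons a l ih =>
    exact (consTensor (X := S' a) (Y := big l S') (φ := φ a) (ψ := tensHom φ l) (h a (by simp))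
      (ih fun i hi => h i (by simp [hi]))).compCons

/-- This lemma and the following ones place the list morphisms from the definitions of monoids and
operads among the canonical morphisms, so that coherence applies to them. -/
theorem bigMap {κ κ' : Type w} (c : κ → κ') (S : κ' → Word ι) (l : List κ) :
    Canon F (big l fun i => S (c i)) (big (l.map c) S)
      (tensMap (G := fun j => (S j).eval F) c (fun i => 𝟙 ((S (c i)).eval F)) l) := by
  induction l with
  | nil => exact nilComp (compNil (.id _))
  | cons a l ih =>
    exact consTensor (φ := 𝟙 ((S (c a)).eval F)) (S := fun i => S (c i)) (.id _) ih |>.compCons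

theorem bigReindex {κ κ' : Type w} (c : κ → κ') (S : κ' → Word ι) (l : List κ) :
    Canon F (big (l.map c) S) (big l fun i => S (c i))
      (tensReindex (fun j => (S j).eval F) c l) := by
  induction l with
  | nil => exact nilComp (compNil (.id _))
  | cons a l ih => exact (ih.whiskerLeft (S (c a))).compCons.consComp

theorem bigAppend {κ : Type w} (S : κ → Word ι) (l' l : List κ) :
    Canon F (big (l ++ l') S) (.mul (big l S) (big l' S))
      (tensAppend (fun j => (S j).eval F) l' l) := by
  induction l with
  | nil =>
    have e : ∀ {X : E} (f : X ⟶ 𝟙_ E ⊗ X), f ≫ (𝟙 (𝟙_ E) ▷ X) = f := by intros; simp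
    exact ((Canon.leftUnitInv (F := F) (big l' S)).comp
      ((nilInv S).whiskerRight (big l' S))).of_eq (e _)
  | cons a l ih =>
    refine consComp ?_
    have e : ∀ {X Y Z : E} (f : X ⟶ Y ⊗ Z), f ≫ (𝟙 Y ▷ Z) = f := by intros; simp
    exact (((ih.whiskerLeft (S a)).comp (Canon.assocInv _ _ _)).comp
      ((consInv (F := F) a l S).whiskerRight _)).of_eq (e _)

theorem bigCat {κ : Type w} (S : κ → Word ι) (l' l : List κ) :
    Canon F (.mul (big l S) (big l' S)) (big (l ++ l') S)
      (tensCat (fun j => (S j).eval F) l' l) := by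
  obtain ⟨ψ, h1, h2, h3⟩ := (bigAppend (F := F) S l' l).exists_inv
  have e : ∀ {X Y : E} {f : X ⟶ Y} {g g' : Y ⟶ X}, f ≫ g' = 𝟙 _ → g ≫ f = 𝟙 _ → g = g' := by
    intro X Y f g g' h h'
    rw [← Category.comp_id g, ← h, reassoc_of% h']
  exact h1.of_eq (e (tensAppend_tensCat (fun j => (S j).eval F) l' l) h3)

theorem bigSwap {κ : Type w} (S : κ → Word ι) (x y : κ) (l₂ l₁ : List κ) :
    Canon F (big (l₁ ++ x :: y :: l₂) S) (big (l₁ ++ y :: x :: l₂) S)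
      (tensSwap (fun j => (S j).eval F) x y l₂ l₁) := by
  induction l₁ with
  | nil =>
    have h1 := ((Canon.assocInv (S x) (S y) (big l₂ S)).comp
      ((Canon.braid (F := F) (S x) (S y)).whiskerRight _)).comp (Canon.assoc _ _ _)
    have h2 := ((cons (F := F) y l₂ S).whiskerLeft (S x)).comp
      (h1.comp ((consInv (F := F) x l₂ S).whiskerLeft (S y)))
    have e : ∀ {X Y T T' T'' Z : E} (f : X ⊗ T ⟶ Z) (g : Z ⟶ T') (k : T' ⟶ Y ⊗ T''),
        X ◁ 𝟙 T ≫ ((f ≫ g) ≫ k) ≫ Y ◁ 𝟙 T'' = f ≫ g ≫ k := by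
      intros; simp
    exact h2.compCons.consComp.of_eq (e _ _ _)
  | cons a l ih => exact (ih.whiskerLeft (S a)).compCons.consComp

end Canon

theorem IsPerm.canon {ι κ : Type w} {F : ι → E} (S : κ → Word ι) {l l' : List κ}
    {θ : tens (fun i => (S i).eval F) l ⟶ tens (fun i => (S i).eval F) l'}
    (h : IsPerm (fun i => (S i).eval F) l l' θ) : Canon F (big l S) (big l' S) θ := by
  induction h with
  | refl => exact .id _
  | step l₁ x y l₂ φ _ ih => exact ih.comp (.bigSwap S x y l₂ l₁)

end Canon

section Canon

variable {E : Type u'} [Category.{v'} E] [MonoidalCategory E] [SymmetricCategory E]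

open Word

namespace Canon

variable {ι : Type w} {F : ι → E}

theorem exists_list (X : Word ι) :
    ∃ φ : X.eval F ⟶ (list (fun i => i) X.labels).eval F, Canon F X _ φ := by
  induction X with
  | one => exact ⟨_, .nilInv _⟩
  | of a =>
    exact ⟨_, ((Canon.rightUnitInv (F := F) (of a)).comp ((nilInv fun i => of i).whiskerLeft (of a))).comp
      (consInv a [] fun i => of i)⟩
  | mul X Y hX hY =>
    obtain ⟨φ, h⟩ := hX
    obtain ⟨ψ, h'⟩ := hY
    exact ⟨_, (h.tensor h').comp (bigCat (fun i => of i) Y.labels X.labels)⟩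
  | big l S ih =>
    induction l with
    | nil => exact ⟨_, (nil S).comp (nilInv fun i => of i)⟩
    | cons a l ih' =>
      obtain ⟨φ, h⟩ := ih a
      obtain ⟨ψ, h'⟩ := ih'
      exact ⟨_, ((cons a l S).comp (h.tensor h')).comp
        (bigCat (fun i => of i) (labels (big l S)) (S a).labels)⟩

/-- Both words are canonically isomorphic to the tensor products over their lists of labels, and a
permutation of lists is a product of adjacent transpositions. -/
theorem exists_of_perm {X Y : Word ι} (h : X.labels.Perm Y.labels) : ∃ φ, Canon F X Y φ := by
  obtain ⟨φ, h1⟩ := exists_list (F := F) X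
  obtain ⟨ψ, h2⟩ := exists_list (F := F) Y
  obtain ⟨ψ', h3, -⟩ := h2.exists_inv
  obtain ⟨θ, h4⟩ := IsPerm.exists_of_perm (F := F) h
  exact ⟨_, (h1.comp (h4.canon fun i => of i)).comp h3⟩

/-- Canonical morphisms are compatible with substitution. -/
theorem exists_subst {ι' : Type w} {F' : ι' → E} (R : ι → Word ι')
    (ψ : ∀ a, (R a).eval F' ⟶ F a) {X Y : Word ι} {φ : X.eval F ⟶ Y.eval F} (h : Canon F X Y φ) :
    ∃ φ', Canon F' (X.subst R) (Y.subst R) φ' ∧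
      φ' ≫ substMap R ψ Y = substMap R ψ X ≫ φ := by
  induction h with
  | id X => exact ⟨_, .id _, by simp⟩
  | comp _ _ ih ih' =>
    obtain ⟨θ, h1, h2⟩ := ih
    obtain ⟨θ', h3, h4⟩ := ih'
    exact ⟨_, h1.comp h3, by rw [Category.assoc, h4, reassoc_of% h2]⟩
  | tensor _ _ ih ih' =>
    obtain ⟨θ, h1, h2⟩ := ih
    obtain ⟨θ', h3, h4⟩ := ih'
    have e : ∀ {A B C D A' B' C' D' : E} {f : A ⟶ B} {g : B ⟶ D} {h : A ⟶ C} {k : C ⟶ D}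
        {f' : A' ⟶ B'} {g' : B' ⟶ D'} {h' : A' ⟶ C'} {k' : C' ⟶ D'}, f ≫ g = h ≫ k →
        f' ≫ g' = h' ≫ k' → (f ⊗ₘ f') ≫ (g ⊗ₘ g') = (h ⊗ₘ h') ≫ (k ⊗ₘ k') := by
      intro A B C D A' B' C' D' f g h k f' g' h' k' H H'
      rw [tensorHom_comp_tensorHom, tensorHom_comp_tensorHom, H, H']
    exact ⟨_, h1.tensor h3, e h2 h4⟩
  | assoc X Y Z => exact ⟨_, .assoc _ _ _, (associator_naturality _ _ _).symm⟩
  | assocInv X Y Z => exact ⟨_, .assocInv _ _ _, (associator_inv_naturality _ _ _).symm⟩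
  | leftUnit X =>
    have e : ∀ {A B : E} (f : A ⟶ B), (λ_ A).hom ≫ f = (𝟙 _ ⊗ₘ f) ≫ (λ_ B).hom := by intros; simp
    exact ⟨_, .leftUnit _, e _⟩
  | leftUnitInv X =>
    have e : ∀ {A B : E} (f : A ⟶ B), (λ_ A).inv ≫ (𝟙 _ ⊗ₘ f) = f ≫ (λ_ B).inv := by intros; simp
    exact ⟨_, .leftUnitInv _, e _⟩
  | rightUnit X =>
    have e : ∀ {A B : E} (f : A ⟶ B), (ρ_ A).hom ≫ f = (f ⊗ₘ 𝟙 _) ≫ (ρ_ B).hom := by intros; simp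
    exact ⟨_, .rightUnit _, e _⟩
  | rightUnitInv X =>
    have e : ∀ {A B : E} (f : A ⟶ B), (ρ_ A).inv ≫ (f ⊗ₘ 𝟙 _) = f ≫ (ρ_ B).inv := by intros; simp
    exact ⟨_, .rightUnitInv _, e _⟩
  | braid X Y =>
    exact ⟨_, .braid _ _, (BraidedCategory.braiding_naturality _ _).symm⟩
  | nil S => exact ⟨_, .nil _, rfl⟩
  | nilInv S => exact ⟨_, .nilInv _, rfl⟩
  | cons a l S => exact ⟨_, .cons _ _ _, (Category.id_comp _).trans (Category.comp_id _).symm⟩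
  | consInv a l S =>
    exact ⟨_, .consInv a l fun i => subst R (S i),
      (Category.id_comp _).trans (Category.comp_id _).symm⟩

/-- Canonical morphisms are natural in the factors. -/
theorem exists_evalMap {G : ι → E} (α : ∀ a, F a ⟶ G a) {X Y : Word ι}
    {φ : X.eval F ⟶ Y.eval F} (h : Canon F X Y φ) :
    ∃ φ', Canon G X Y φ' ∧ φ ≫ evalMap α Y = evalMap α X ≫ φ' := by
  induction h with
  | id X => exact ⟨_, .id _, by simp⟩
  | comp _ _ ih ih' =>
    obtain ⟨θ, h1, h2⟩ := ih
    obtain ⟨θ', h3, h4⟩ := ih'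
    exact ⟨_, h1.comp h3, by rw [Category.assoc, h4, reassoc_of% h2]⟩
  | tensor _ _ ih ih' =>
    obtain ⟨θ, h1, h2⟩ := ih
    obtain ⟨θ', h3, h4⟩ := ih'
    have e : ∀ {A B C D A' B' C' D' : E} {f : A ⟶ B} {g : B ⟶ D} {h : A ⟶ C} {k : C ⟶ D}
        {f' : A' ⟶ B'} {g' : B' ⟶ D'} {h' : A' ⟶ C'} {k' : C' ⟶ D'}, f ≫ g = h ≫ k →
        f' ≫ g' = h' ≫ k' → (f ⊗ₘ f') ≫ (g ⊗ₘ g') = (h ⊗ₘ h') ≫ (k ⊗ₘ k') := by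
      intro A B C D A' B' C' D' f g h k f' g' h' k' H H'
      rw [tensorHom_comp_tensorHom, tensorHom_comp_tensorHom, H, H']
    exact ⟨_, h1.tensor h3, e h2 h4⟩
  | assoc X Y Z => exact ⟨_, .assoc _ _ _, (associator_naturality _ _ _).symm⟩
  | assocInv X Y Z => exact ⟨_, .assocInv _ _ _, (associator_inv_naturality _ _ _).symm⟩
  | leftUnit X =>
    have e : ∀ {A B : E} (f : A ⟶ B), (λ_ A).hom ≫ f = (𝟙 _ ⊗ₘ f) ≫ (λ_ B).hom := by intros; simp
    exact ⟨_, .leftUnit _, e _⟩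
  | leftUnitInv X =>
    have e : ∀ {A B : E} (f : A ⟶ B), (λ_ A).inv ≫ (𝟙 _ ⊗ₘ f) = f ≫ (λ_ B).inv := by intros; simp
    exact ⟨_, .leftUnitInv _, e _⟩
  | rightUnit X =>
    have e : ∀ {A B : E} (f : A ⟶ B), (ρ_ A).hom ≫ f = (f ⊗ₘ 𝟙 _) ≫ (ρ_ B).hom := by intros; simp
    exact ⟨_, .rightUnit _, e _⟩
  | rightUnitInv X =>
    have e : ∀ {A B : E} (f : A ⟶ B), (ρ_ A).inv ≫ (f ⊗ₘ 𝟙 _) = f ≫ (ρ_ B).inv := by intros; simp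
    exact ⟨_, .rightUnitInv _, e _⟩
  | braid X Y =>
    exact ⟨_, .braid _ _, (BraidedCategory.braiding_naturality _ _).symm⟩
  | nil S => exact ⟨_, .nil _, rfl⟩
  | nilInv S => exact ⟨_, .nilInv _, rfl⟩
  | cons a l S => exact ⟨_, .cons _ _ _, (Category.id_comp _).trans (Category.comp_id _).symm⟩
  | consInv a l S => exact ⟨_, .consInv _ _ _, (Category.id_comp _).trans (Category.comp_id _).symm⟩

end Canon

/-- The canonical morphism between two formal tensor products with the same factors. -/
noncomputable def can {ι : Type w} (F : ι → E) {X Y : Word ι} (h : X.labels.Perm Y.labels) :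
    X.eval F ⟶ Y.eval F :=
  (Canon.exists_of_perm h).choose

theorem can_canon {ι : Type w} (F : ι → E) {X Y : Word ι} (h : X.labels.Perm Y.labels) :
    Canon F X Y (can F h) :=
  (Canon.exists_of_perm h).choose_spec

theorem Canon.isIso {ι : Type w} {F : ι → E} {X Y : Word ι} {φ : X.eval F ⟶ Y.eval F}
    (h : Canon F X Y φ) : IsIso φ :=
  ⟨h.exists_inv.choose, h.exists_inv.choose_spec.2⟩

/-- Canonical morphisms are compatible with relabelling. -/
theorem Canon.exists_map {ι ι' : Type w} {F : ι' → E} (c : ι → ι') {X Y : Word ι}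
    {φ : X.eval (fun a => F (c a)) ⟶ Y.eval fun a => F (c a)} (h : Canon (fun a => F (c a)) X Y φ) :
    ∃ φ', Canon F (X.map c) (Y.map c) φ' ∧ φ' ≫ mapMap F c Y = mapMap F c X ≫ φ :=
  h.exists_subst _ _

/-- The canonical morphism from a tensor product of tensor products of pairs. -/
def tensDistrib {κ : Type*} (K R : κ → E) : ∀ l : List κ,
    tens K l ⊗ tens R l ⟶ tens (fun i => K i ⊗ R i) l
  | [] => (λ_ (𝟙_ E)).hom
  | a :: l => tensorμ (K a) (tens K l) (R a) (tens R l) ≫ (K a ⊗ R a) ◁ tensDistrib K R l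

theorem tensDistrib_naturality {κ : Type*} {K K' R R' : κ → E} (φ : ∀ i, K i ⟶ K' i)
    (χ : ∀ i, R i ⟶ R' i) (l : List κ) :
    (tensHom φ l ⊗ₘ tensHom χ l) ≫ tensDistrib K' R' l =
      tensDistrib K R l ≫ tensHom (fun i => φ i ⊗ₘ χ i) l := by
  induction l with
  | nil =>
    have e : ∀ {A : E} (f : A ⟶ 𝟙_ E), (𝟙 (𝟙_ E) ⊗ₘ 𝟙 (𝟙_ E)) ≫ (λ_ (𝟙_ E)).hom =
      (λ_ (𝟙_ E)).hom ≫ 𝟙 _ := by intros; simp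
    exact e (𝟙 _)
  | cons a l ih =>
    have e : ∀ {A A' B B' C C' D D' Z Z' : E} {f : A ⟶ A'} {g : B ⟶ B'} {h : C ⟶ C'} {k : D ⟶ D'}
        {s : B ⊗ D ⟶ Z} {t : B' ⊗ D' ⟶ Z'} {z : Z ⟶ Z'}, (g ⊗ₘ k) ≫ t = s ≫ z →
        ((f ⊗ₘ g) ⊗ₘ (h ⊗ₘ k)) ≫ tensorμ A' B' C' D' ≫ (A' ⊗ C') ◁ t =
          (tensorμ A B C D ≫ (A ⊗ C) ◁ s) ≫ ((f ⊗ₘ h) ⊗ₘ z) := by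
      intro A A' B B' C C' D D' Z Z' f g h k s t z H
      rw [tensorμ_natural_assoc, ← id_tensorHom, tensorHom_comp_tensorHom, H, Category.assoc,
        ← id_tensorHom, tensorHom_comp_tensorHom, Category.id_comp, Category.comp_id]
    exact e ih

theorem Canon.distrib {ι κ : Type w} {F : ι → E} (S T : κ → Word ι) (l : List κ) :
    Canon F (.mul (big l S) (big l T)) (big l fun i => .mul (S i) (T i))
      (tensDistrib (fun i => (S i).eval F) (fun i => (T i).eval F) l) := by
  induction l with
  | nil => exact (((nil S).tensor (nil T)).comp (leftUnit _)).compNil.of_eq (by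
      have e : (𝟙 (𝟙_ E) ⊗ₘ 𝟙 (𝟙_ E)) ≫ (λ_ (𝟙_ E)).hom = (λ_ (𝟙_ E)).hom := by simp
      exact e)
  | cons a l ih =>
    have h : ∀ A B C D : Word ι, Canon F (.mul (.mul A B) (.mul C D)) (.mul (.mul A C) (.mul B D))
        (tensorμ (A.eval F) (B.eval F) (C.eval F) (D.eval F)) := fun A B C D =>
      (Canon.assoc A B (.mul C D)).comp ((whiskerLeft A ((Canon.assocInv B C D).comp
        (((Canon.braid B C).whiskerRight D).comp (Canon.assoc C B D)))).comp
          (Canon.assocInv A C (.mul B D))) |>.of_eq (by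
            have e : ∀ {A B C D : E}, (α_ A B (C ⊗ D)).hom ≫
              A ◁ ((α_ B C D).inv ≫ (β_ B C).hom ▷ D ≫ (α_ C B D).hom) ≫
                (α_ A C (B ⊗ D)).inv = tensorμ A B C D := by
              intros; simp [tensorμ]
            exact e)
    have h2 := (h (S a) (big l S) (T a) (big l T)).comp (ih.whiskerLeft (.mul (S a) (T a)))
    have h3 := (((Canon.cons a l S).tensor (Canon.cons a l T)).comp h2).compCons
      (S := fun i => .mul (S i) (T i))
    refine h3.of_eq ?_
    have e : ∀ {A B C D : E} (f : A ⊗ B ⟶ C), (𝟙 A ⊗ₘ 𝟙 B) ≫ f = f := by intros; simp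
    exact e (D := 𝟙_ E) _

end Canon

/-! ## Generalities on hypermoment categories -/

open HypermomentData

section Basics

variable {C : Type u} [Category.{v} C] [HypermomentData C] [IsHypermoment C]

/-- Both `f ≫ 𝟙` and `𝟙 ≫ f` are active/inert factorisations of `f`; the isomorphism that compares
them is an inverse of `f`. -/
theorem isIso_of_act_of_inert {A B : C} {f : A ⟶ B} (h : act f) (h' : inert f) : IsIso f := by
  obtain ⟨e, ⟨h1, h2⟩, -⟩ := IsHypermoment.factor_unique f (𝟙 B) (𝟙 A) f h (inert_id B) (act_id A)
    h' (by simp)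
  exact ⟨e.hom, h1, h2⟩

/-- If `g = g1 ≫ g2` is a factorisation, then `(f ≫ g1, g2)` and `(f ≫ g, 𝟙)` factorise the same
morphism, whence `g2` is invertible. The next lemma is the dual argument. -/
theorem act_of_comp {A B D : C} {f : A ⟶ B} {g : B ⟶ D} (h : act f) (h' : act (f ≫ g)) :
    act g := by
  obtain ⟨Z, g1, g2, h1, h2, rfl⟩ := IsHypermoment.factor g
  obtain ⟨e, ⟨h3, h4⟩, -⟩ := IsHypermoment.factor_unique (f ≫ g1) g2 (f ≫ g1 ≫ g2) (𝟙 D)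
    (act_comp _ _ h h1) h2 h' (inert_id D) (by simp)
  rw [Category.comp_id] at h4
  rw [← h4]
  exact act_comp _ _ h1 (IsHypermoment.act_of_isIso e.hom)

theorem inert_of_comp {A B D : C} {f : A ⟶ B} {g : B ⟶ D} (h : inert g) (h' : inert (f ≫ g)) :
    inert f := by
  obtain ⟨Z, f1, f2, h1, h2, rfl⟩ := IsHypermoment.factor f
  obtain ⟨e, ⟨h3, h4⟩, -⟩ := IsHypermoment.factor_unique (𝟙 A) ((f1 ≫ f2) ≫ g) f1 (f2 ≫ g)
    (act_id A) h' h1 (inert_comp _ _ h2 h) (by simp)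
  rw [Category.id_comp] at h3
  rw [← h3]
  exact inert_comp _ _ (IsHypermoment.inert_of_isIso e.hom) h2

/-- The unique lifting property of active morphisms against inert morphisms. -/
theorem existsUnique_lift {A Z Z' B : C} {a : A ⟶ Z} {g : Z ⟶ B} {f : A ⟶ Z'} {h : Z' ⟶ B}
    (ha : act a) (hh : inert h) (w : a ≫ g = f ≫ h) : ∃! d : Z ⟶ Z', a ≫ d = f ∧ d ≫ h = g := by
  obtain ⟨F, f1, f2, hf1, hf2, rfl⟩ := IsHypermoment.factor f
  obtain ⟨G, g1, g2, hg1, hg2, rfl⟩ := IsHypermoment.factor g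
  obtain ⟨e, ⟨h1, h2⟩, he⟩ := IsHypermoment.factor_unique (a ≫ g1) g2 f1 (f2 ≫ h)
    (act_comp _ _ ha hg1) hg2 hf1 (inert_comp _ _ hf2 hh) (by simpa using w)
  refine ⟨g1 ≫ e.hom ≫ f2, ⟨by rw [← h1]; simp, by simp only [Category.assoc, h2]⟩, ?_⟩
  rintro d ⟨hd1, hd2⟩
  -- A competing lift is factorised as well. Comparing its two halves with the factorisations of `f`
  -- and `g` gives an isomorphism of the middle objects with the same properties as `e`, and `e` is
  -- unique.
  obtain ⟨W, d1, d2, hd3, hd4, rfl⟩ := IsHypermoment.factor d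
  obtain ⟨e1, ⟨h3, h4⟩, -⟩ := IsHypermoment.factor_unique (a ≫ d1) d2 f1 f2
    (act_comp _ _ ha hd3) hd4 hf1 hf2 (by simpa using hd1)
  obtain ⟨e2, ⟨h5, h6⟩, -⟩ := IsHypermoment.factor_unique d1 (d2 ≫ h) g1 g2
    hd3 (inert_comp _ _ hd4 hh) hg1 hg2 (by simpa using hd2)
  have := he (e2.symm ≪≫ e1) ⟨by simp [← h5, ← h3], by simp [reassoc_of% h4, ← h6]⟩
  rw [← this]
  simp [← h5, h4]

/-- The uniqueness half of the lifting property. Equations between morphisms of trees will be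
checked with it: at the root, and after an inclusion. -/
theorem lift_eq {A Z Z' B : C} {a : A ⟶ Z} {h : Z' ⟶ B} (ha : act a) (hh : inert h)
    {d d' : Z ⟶ Z'} (w : a ≫ d = a ≫ d') (w' : d ≫ h = d' ≫ h) : d = d' :=
  (existsUnique_lift ha hh (show a ≫ d ≫ h = (a ≫ d) ≫ h by simp)).unique ⟨rfl, rfl⟩
    ⟨w.symm, w'.symm⟩

/-- The element of `γ(A)` represented by an elementary inert morphism into `A`. -/
theorem Elem.exists_pt {A : C} (e : Elem A) :
    ∃ a : ((aug (C := C)).obj A).carrier,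
      ∀ x, SegalGamma.sub ((aug (C := C)).map e.hom) x = {a} := by
  obtain ⟨x, -, hx⟩ := e.isUnit.1
  obtain ⟨a, ha⟩ := IsHypermoment.aug_inert e.hom e.inert x
  exact ⟨a, fun y => by rw [hx y trivial, ha]⟩

/-- The element of `γ(A)` represented by an elementary inert morphism into `A`. -/
noncomputable def Elem.pt {A : C} (e : Elem A) : ((aug (C := C)).obj A).carrier :=
  e.exists_pt.choose

theorem Elem.sub_hom {A : C} (e : Elem A) (x) :
    SegalGamma.sub ((aug (C := C)).map e.hom) x = {e.pt} :=
  e.exists_pt.choose_spec x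

theorem Elem.exists_mem_dom {A : C} (e : Elem A) :
    ∃ x : ((aug (C := C)).obj e.dom).carrier, ∀ y, y = x :=
  let ⟨x, _, hx⟩ := e.isUnit.1
  ⟨x, fun y => hx y trivial⟩

theorem Elem.pt_eq {A : C} (e : Elem A) {x a} (h : a ∈ SegalGamma.sub ((aug (C := C)).map e.hom) x) :
    e.pt = a := by
  rw [e.sub_hom] at h
  exact h.symm

theorem Elem.existsUnique_iso {A : C} {e e' : Elem A} (h : e.pt = e'.pt) :
    ∃! i : e.dom ≅ e'.dom, i.hom ≫ e'.hom = e.hom :=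
  IsHypermoment.lift_unique A e.pt _ _ e.hom e'.hom e.isUnit e.inert e.sub_hom e'.isUnit e'.inert
    (by rw [h]; exact e'.sub_hom)

theorem Elem.pt_push {A B : C} (e : Elem A) (j : A ⟶ B) (hj : HypermomentData.inert j) :
    SegalGamma.sub ((aug (C := C)).map j) e.pt = {(e.push j hj).pt} := by
  obtain ⟨x, hx⟩ := e.exists_mem_dom
  obtain ⟨b, hb⟩ := IsHypermoment.aug_inert j hj e.pt
  rw [hb, (e.push j hj).pt_eq (x := x) (a := b)]
  change b ∈ SegalGamma.sub ((aug (C := C)).map (e.hom ≫ j)) x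
  rw [Functor.map_comp, SegalGamma.mem_sub_comp]
  exact ⟨e.pt, by rw [e.sub_hom]; rfl, by rw [hb]; rfl⟩

/-- Existence and uniqueness of inert lifts identify `el(A)` with `γ(A)`, so that questions about
frames become questions about lists of elements of a finite set. -/
theorem Elem.equiv_iff {A : C} (e e' : Elem A) : e.Equiv e' ↔ e.pt = e'.pt := by
  constructor
  · rintro ⟨i, hi⟩
    obtain ⟨x, hx⟩ := e.exists_mem_dom
    refine e.pt_eq (x := x) ?_
    rw [← hi, Functor.map_comp, SegalGamma.mem_sub_comp]
    obtain ⟨y, hy⟩ := IsHypermoment.aug_inert i.hom (IsHypermoment.inert_of_isIso i.hom) x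
    exact ⟨y, by rw [hy]; rfl, by rw [e'.sub_hom]; rfl⟩
  · intro h
    obtain ⟨i, hi, -⟩ := Elem.existsUnique_iso h
    exact ⟨i, hi⟩

theorem Elem.exists_of_pt {A : C} (a : ((aug (C := C)).obj A).carrier) : ∃ e : Elem A, e.pt = a := by
  obtain ⟨U, i, hU, hi, h⟩ := IsHypermoment.lift A a
  let e : Elem A := ⟨U, hU, i, hi⟩
  obtain ⟨x, hx⟩ := e.exists_mem_dom
  refine ⟨e, e.pt_eq (x := x) ?_⟩
  change a ∈ SegalGamma.sub ((aug (C := C)).map i) x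
  rw [h]
  rfl

/-- Inert morphisms are monomorphic on elementary inert morphisms. -/
theorem Elem.hom_eq {U A B : C} (hU : IsUnitObj U) {i j : U ⟶ A} (hi : HypermomentData.inert i)
    (hj : HypermomentData.inert j)
    {f : A ⟶ B} (hf : HypermomentData.inert f) (h : i ≫ f = j ≫ f) : i = j := by
  let e : Elem A := ⟨U, hU, i, hi⟩
  let e' : Elem A := ⟨U, hU, j, hj⟩
  have h1 : e.push f hf = e'.push f hf := by
    simp only [Elem.push, e, e', h]
  have h2 : e.pt = e'.pt := by
    have h3 := e.pt_push f hf
    have h4 := e'.pt_push f hf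
    rw [h1] at h3
    exact SegalGamma.Hom.disj ((aug (C := C)).map f) _ _ (e'.push f hf).pt
      (show _ ∈ SegalGamma.sub _ _ by rw [h3]; rfl) (show _ ∈ SegalGamma.sub _ _ by rw [h4]; rfl)
  obtain ⟨k, hk, -⟩ := Elem.existsUnique_iso h2
  have hk' : k.hom ≫ j = i := hk
  obtain ⟨k', -, hk'2⟩ := Elem.existsUnique_iso (e := e.push f hf) (e' := e'.push f hf) (by rw [h1])
  -- Over `B`, both `k` and the identity of `U` compare the two pushed elements, which are equal;
  -- uniqueness gives that `k` is the identity.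
  have := (hk'2 k (by
    change k.hom ≫ j ≫ f = i ≫ f
    rw [reassoc_of% hk'])).trans (hk'2 (Iso.refl U) (by
    change 𝟙 U ≫ j ≫ f = i ≫ f
    rw [Category.id_comp, h])).symm
  rw [← hk', this]
  exact Category.id_comp j

theorem isFrame_iff {A : C} (l : List (Elem A)) :
    IsFrame l ↔ (∀ a, ∃ e ∈ l, e.pt = a) ∧ (l.map Elem.pt).Nodup := by
  simp only [IsFrame, Elem.equiv_iff, List.Nodup, List.pairwise_map]
  constructor
  · rintro ⟨h, h'⟩
    refine ⟨fun a => ?_, h'⟩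
    obtain ⟨e, rfl⟩ := Elem.exists_of_pt a
    obtain ⟨e', h1, h2⟩ := h e
    exact ⟨e', h1, h2.symm⟩
  · rintro ⟨h, h'⟩
    refine ⟨fun e => ?_, h'⟩
    obtain ⟨e', h1, h2⟩ := h e.pt
    exact ⟨e', h1, h2.symm⟩

theorem IsFrame.nodup {A : C} {l : List (Elem A)} (h : IsFrame l) : l.Nodup :=
  ((isFrame_iff l).1 h).2.of_map _

theorem IsFrame.perm {A : C} {l l' : List (Elem A)} (h : IsFrame l) (hl : l.Perm l') :
    IsFrame l' := by
  rw [isFrame_iff] at h ⊢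
  exact ⟨fun a => by simpa [hl.mem_iff] using h.1 a, (hl.map _).nodup_iff.1 h.2⟩

theorem exists_isFrame (A : C) : ∃ l : List (Elem A), IsFrame l := by
  classical
  have := ((aug (C := C)).obj A).finite
  have := Fintype.ofFinite ((aug (C := C)).obj A).carrier
  choose e he using Elem.exists_of_pt (C := C) (A := A)
  refine ⟨Finset.univ.toList.map e, (isFrame_iff _).2 ⟨fun a => ⟨e a, ?_, he a⟩, ?_⟩⟩
  · simp
  · have : Elem.pt ∘ e = id := funext he
    rw [List.map_map, this, List.map_id]
    exact Finset.nodup_toList _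

/-- Frames with the same elements of `γ(A)`. -/
theorem IsFrame.of_map_pt {A : C} {l l' : List (Elem A)} (h : IsFrame l)
    (hl : (l.map Elem.pt).Perm (l'.map Elem.pt)) : IsFrame l' := by
  rw [isFrame_iff] at h ⊢
  refine ⟨fun a => ?_, hl.nodup_iff.1 h.2⟩
  obtain ⟨e, h1, h2⟩ := h.1 a
  have : a ∈ l'.map Elem.pt := hl.mem_iff.1 (List.mem_map.2 ⟨e, h1, h2⟩)
  exact List.mem_map.1 this

theorem isFrame_refl {U : C} (hU : IsUnitObj U) : IsFrame [Elem.refl U hU] := by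
  rw [isFrame_iff]
  obtain ⟨x, -, hx⟩ := hU.1
  exact ⟨fun a => ⟨_, List.mem_singleton_self _, (hx _ trivial).trans (hx _ trivial).symm⟩, by simp⟩

theorem Factor.exists {A B : C} (f : A ⟶ B) : Nonempty (Factor f) := by
  obtain ⟨Z, g, h, h1, h2, h3⟩ := IsHypermoment.factor f
  exact ⟨⟨Z, g, h1, h, h2, h3⟩⟩

theorem sub_comm {A B D D' : C} {f : A ⟶ B} {g : B ⟶ D} {f' : A ⟶ D'} {g' : D' ⟶ D}
    (h : f ≫ g = f' ≫ g') {x b y} (hb : b ∈ SegalGamma.sub ((aug (C := C)).map f) x)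
    (hy : y ∈ SegalGamma.sub ((aug (C := C)).map g) b) :
    ∃ c ∈ SegalGamma.sub ((aug (C := C)).map f') x, y ∈ SegalGamma.sub ((aug (C := C)).map g') c := by
  rw [← SegalGamma.mem_sub_comp, ← Functor.map_comp, ← h, Functor.map_comp, SegalGamma.mem_sub_comp]
  exact ⟨b, hb, hy⟩

/-- The elementary inert subobjects of `B` are those of the `B_α`, for an active `f : A ⟶ B`. -/
theorem isFrame_flatMap {A B : C} {f : A ⟶ B} (hf : act f) {κ : Type*} (π : κ → Piece f)
    (l : List κ) (hl : IsFrame (l.map fun i => (π i).toElem))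
    (m : ∀ i, List (Elem (π i).cod)) (hm : ∀ i ∈ l, IsFrame (m i)) :
    IsFrame (l.flatMap fun i => (m i).map fun e => e.push (π i).incl (π i).incl_inert) := by
  -- The elements coming from the piece at `α` lie in `γ(f)(α)`. Since these subsets are disjoint,
  -- different pieces contribute different elements; within one piece, disjointness is that of the
  -- singletons of the inert `γ(B_α ⟶ B)`.
  have key : ∀ i, ∀ e ∈ m i, (e.push (π i).incl (π i).incl_inert).pt ∈
      SegalGamma.sub ((aug (C := C)).map f) (π i).pt := by
    intro i e he
    obtain ⟨x, hx⟩ := (π i).exists_mem_dom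
    obtain ⟨z, hz⟩ := IsHypermoment.aug_act _ (π i).res_act e.pt
    have h1 := e.pt_push (π i).incl (π i).incl_inert
    obtain ⟨c, h2, h3⟩ := sub_comm (π i).comm hz
      (show (e.push (π i).incl (π i).incl_inert).pt ∈ _ by rw [h1]; rfl)
    rw [Elem.sub_hom] at h2
    obtain rfl : c = (π i).pt := h2
    exact h3
  rw [isFrame_iff] at hl ⊢
  constructor
  · intro b
    obtain ⟨a, ha⟩ := IsHypermoment.aug_act f hf b
    obtain ⟨p, hp, rfl⟩ := hl.1 a
    obtain ⟨i, hi, rfl⟩ := List.mem_map.1 hp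
    obtain ⟨x, hx⟩ := (π i).exists_mem_dom
    obtain ⟨c, h1, h2⟩ := sub_comm (π i).comm.symm (x := x) (b := (π i).pt) (y := b)
      (by rw [Elem.sub_hom]; rfl) ha
    obtain ⟨e, he, rfl⟩ := ((isFrame_iff _).1 (hm i hi)).1 c
    refine ⟨_, List.mem_flatMap.2 ⟨i, hi, List.mem_map.2 ⟨e, he, rfl⟩⟩, ?_⟩
    rw [e.pt_push (π i).incl (π i).incl_inert] at h2
    exact h2.symm
  · rw [List.map_flatMap, List.nodup_flatMap]
    constructor
    · intro i hi
      rw [List.map_map]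
      have h1 := ((isFrame_iff _).1 (hm i hi)).2
      refine List.Nodup.map_on ?_ ((h1.of_map _))
      intro e he e' he' h
      have h2 := e.pt_push (π i).incl (π i).incl_inert
      have h3 := e'.pt_push (π i).incl (π i).incl_inert
      have h : (e.push (π i).incl (π i).incl_inert).pt = (e'.push (π i).incl (π i).incl_inert).pt := h
      refine List.inj_on_of_nodup_map h1 he he' (SegalGamma.Hom.disj _ _ _
        (e.push (π i).incl (π i).incl_inert).pt (show _ ∈ SegalGamma.sub _ _ by rw [h2]; rfl)
        (show _ ∈ SegalGamma.sub _ _ by rw [h, h3]; rfl))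
    · have h2 := hl.2
      rw [List.map_map, List.Nodup, List.pairwise_map] at h2
      refine h2.imp ?_
      intro i j hij
      rw [Function.onFun, List.disjoint_left]
      intro b hb hb'
      simp only [List.mem_map] at hb hb'
      obtain ⟨_, ⟨e, he, rfl⟩, rfl⟩ := hb
      obtain ⟨_, ⟨e', he', rfl⟩, h⟩ := hb'
      exact hij (SegalGamma.Hom.disj _ _ _ _ (key i e he) (h ▸ key j e' he'))

end Basics

open HypermomentData

/-! ## The plus construction is a unital hypermoment category -/

/-- Two factorisations can be lifted against each other in both directions, and uniqueness of lifts
makes the two lifts mutually inverse. For trees, lifting is easier to establish directly than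
uniqueness of factorisations. -/
theorem existsUnique_iso_of_lift {D : Type*} [Category* D] [HypermomentData D]
    (H : ∀ {A Z Z' B : D} {a : A ⟶ Z} {g : Z ⟶ B} {f : A ⟶ Z'} {h : Z' ⟶ B}, act a →
      HypermomentData.inert h → a ≫ g = f ≫ h → ∃! d : Z ⟶ Z', a ≫ d = f ∧ d ≫ h = g)
    {A B Z Z' : D} {g : A ⟶ Z} {h : Z ⟶ B} {g' : A ⟶ Z'} {h' : Z' ⟶ B} (hg : act g)
    (hh : HypermomentData.inert h) (hg' : act g') (hh' : HypermomentData.inert h')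
    (w : g ≫ h = g' ≫ h') : ∃! e : Z ≅ Z', g ≫ e.hom = g' ∧ e.hom ≫ h' = h := by
  obtain ⟨d, ⟨h1, h2⟩, h3⟩ := H hg hh' w
  obtain ⟨d', ⟨h1', h2'⟩, -⟩ := H hg' hh w.symm
  refine ⟨⟨d, d', ?_, ?_⟩, ⟨h1, h2⟩, fun e he => Iso.ext (h3 _ he)⟩
  · exact (H hg hh rfl).unique ⟨by rw [reassoc_of% h1, h1'], by rw [Category.assoc, h2', h2]⟩
      ⟨Category.comp_id _, Category.id_comp _⟩
  · exact (H hg' hh' rfl).unique ⟨by rw [reassoc_of% h1', h1], by rw [Category.assoc, h2, h2']⟩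
      ⟨Category.comp_id _, Category.id_comp _⟩

theorem isUnitObj_of_iso {C : Type u} [Category.{v} C] [HypermomentData C] [IsHypermoment C]
    {U U' : C} (e : U ≅ U') (hU : IsUnitObj U) : IsUnitObj U' := by
  obtain ⟨⟨x, -, hx⟩, h⟩ := hU
  constructor
  · obtain ⟨y, hy⟩ := IsHypermoment.aug_inert e.hom (IsHypermoment.inert_of_isIso _) x
    refine ⟨y, trivial, fun z _ => ?_⟩
    have hz : z ∈ SegalGamma.sub ((aug (C := C)).map (e.inv ≫ e.hom)) z := by
      rw [e.inv_hom_id, CategoryTheory.Functor.map_id]; rfl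
    rw [CategoryTheory.Functor.map_comp, SegalGamma.mem_sub_comp] at hz
    obtain ⟨x', -, hz⟩ := hz
    rw [hx x' trivial, hy] at hz
    exact hz
  · intro A r hr
    obtain ⟨s, ⟨h1, h2⟩, h3⟩ := h (r ≫ e.inv) (act_comp _ _ hr (IsHypermoment.act_of_isIso _))
    refine ⟨e.inv ≫ s, ⟨inert_comp _ _ (IsHypermoment.inert_of_isIso _) h1, ?_⟩, ?_⟩
    · have := congrArg (fun t => e.inv ≫ t ≫ e.hom) h2
      simpa using this
    · rintro s' ⟨h4, h5⟩
      rw [← h3 (e.hom ≫ s') ⟨inert_comp _ _ (IsHypermoment.inert_of_isIso _) h4, by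
        rw [Category.assoc, reassoc_of% h5, e.hom_inv_id]⟩, e.inv_hom_id_assoc]

namespace CTree

section

variable {C : Type u} [Category.{v} C] [HypermomentData C]

/-- The morphism `A_i ⟶ A_j` of a `C`-tree. -/
def mp (A : CTree C) {i j : Fin (A.height + 1)} (h : i ≤ j) : A.arrows.obj i ⟶ A.arrows.obj j :=
  A.arrows.map (homOfLE h)

theorem mp_act (A : CTree C) {i j : Fin (A.height + 1)} (h : i ≤ j) : act (A.mp h) := A.act_map _

@[simp]
theorem mp_refl (A : CTree C) {i : Fin (A.height + 1)} (h : i ≤ i) : A.mp h = 𝟙 _ :=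
  A.arrows.map_id i

@[simp]
theorem mp_mp (A : CTree C) {i j k : Fin (A.height + 1)} (h : i ≤ j) (h' : j ≤ k) :
    A.mp h ≫ A.mp h' = A.mp (h.trans h') :=
  (A.arrows.map_comp _ _).symm

@[simp]
theorem mp_mp_assoc (A : CTree C) {i j k : Fin (A.height + 1)} (h : i ≤ j) (h' : j ≤ k) {X : C}
    (f : A.arrows.obj k ⟶ X) : A.mp h ≫ A.mp h' ≫ f = A.mp (h.trans h') ≫ f := by
  rw [← Category.assoc, mp_mp]

theorem mp_isIso (A : CTree C) {i j : Fin (A.height + 1)} (h : i = j) : IsIso (A.mp h.le) := by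
  subst h
  rw [mp_refl]
  infer_instance

theorem mp_app {A B : CTree C} (f : A ⟶ B) {i j : Fin (A.height + 1)} (h : i ≤ j) :
    A.mp h ≫ app f j = app f i ≫ B.mp ((idx f).monotone h) :=
  Hom.naturality f i j h

theorem mp_app_assoc {A B : CTree C} (f : A ⟶ B) {i j : Fin (A.height + 1)} (h : i ≤ j) {X : C}
    (x : B.arrows.obj (idx f j) ⟶ X) :
    A.mp h ≫ app f j ≫ x = app f i ≫ B.mp ((idx f).monotone h) ≫ x := by
  rw [← Category.assoc, mp_app, Category.assoc]

theorem app_inert {A B : CTree C} (f : A ⟶ B) (i : Fin (A.height + 1)) :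
    HypermomentData.inert (app f i) :=
  Hom.inert_app f i

theorem idx_comp {A B D : CTree C} (f : A ⟶ B) (g : B ⟶ D) (i : Fin (A.height + 1)) :
    idx (f ≫ g) i = idx g (idx f i) := rfl

theorem app_comp {A B D : CTree C} (f : A ⟶ B) (g : B ⟶ D) (i : Fin (A.height + 1)) :
    app (f ≫ g) i = app f i ≫ app g (idx f i) := rfl

theorem idx_id (A : CTree C) (i : Fin (A.height + 1)) : idx (𝟙 A) i = i := rfl

/-- When two indices are merely provably equal, the components have different targets. Composing
with the structure map `B.mp` of the equality brings them to the same target without a cast. -/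
theorem hom_ext {A B : CTree C} {f g : A ⟶ B} (h : ∀ i, idx f i = idx g i)
    (h' : ∀ i, app f i ≫ B.mp (h i).le = app g i) : f = g := by
  obtain ⟨φ, a, ha, na⟩ := f
  obtain ⟨ψ, b, hb, nb⟩ := g
  obtain rfl : φ = ψ := OrderHom.ext _ _ (funext h)
  have : a = b := funext fun i => by
    exact ((congrArg (a i ≫ ·) (B.mp_refl (le_refl _))).trans
      (Category.comp_id _)).symm.trans (h' i)
  subst this
  rfl

theorem app_eq {A B : CTree C} {f g : A ⟶ B} (h : f = g) (i : Fin (A.height + 1))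
    (h' : idx f i = idx g i) : app f i ≫ B.mp h'.le = app g i := by
  subst h
  rw [mp_refl, Category.comp_id]

theorem app_mp {A B : CTree C} {f g : A ⟶ B} (h : f = g) (i : Fin (A.height + 1)) {k}
    (h' : idx f i ≤ k) (h'' : idx g i ≤ k) : app f i ≫ B.mp h' = app g i ≫ B.mp h'' := by
  subst h
  rfl

theorem comp_app {A B D : CTree C} {f : A ⟶ B} {g : B ⟶ D} {h : A ⟶ D} (e : f ≫ g = h)
    (i : Fin (A.height + 1)) (h' : idx g (idx f i) = idx h i) :
    app f i ≫ app g (idx f i) ≫ D.mp h'.le = app h i :=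
  (Category.assoc _ _ _).symm.trans (app_eq e i h')

theorem comp_app_mp {A B D : CTree C} {f : A ⟶ B} {g : B ⟶ D} {h : A ⟶ D} (e : f ≫ g = h)
    (i : Fin (A.height + 1)) {k} (h' : idx g (idx f i) ≤ k) (h'' : idx h i ≤ k) :
    app f i ≫ app g (idx f i) ≫ D.mp h' = app h i ≫ D.mp h'' :=
  (Category.assoc _ _ _).symm.trans (app_mp e i h' h'')

theorem comp_app_comp_mp {A B B' D : CTree C} {f : A ⟶ B} {g : B ⟶ D} {f' : A ⟶ B'} {g' : B' ⟶ D}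
    (e : f ≫ g = f' ≫ g') (i : Fin (A.height + 1)) {k} (h' : idx g (idx f i) ≤ k)
    (h'' : idx g' (idx f' i) ≤ k) :
    app f i ≫ app g (idx f i) ≫ D.mp h' = app f' i ≫ app g' (idx f' i) ≫ D.mp h'' :=
  (comp_app_mp e i h' h'').trans (Category.assoc _ _ _)

/-- Preserving consecutive distances means being a translation. -/
theorem isInert_idx {A B : CTree C} {f : A ⟶ B} (hf : IsInert f) (i : Fin (A.height + 1)) :
    (idx f i : ℕ) = idx f 0 + i := by
  induction i using Fin.induction with
  | zero => simp
  | succ i ih => rw [hf i, ih, Fin.val_succ, Fin.val_castSucc]; ring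

/-- The morphisms from a `C`-tree of height one are given by their values at the two ends. -/
theorem exists_hom {T A : CTree C} (hT : T.height = 1) {k l : Fin (A.height + 1)} (hkl : k ≤ l)
    (a : T.arrows.obj 0 ⟶ A.arrows.obj k) (b : T.arrows.obj (Fin.last _) ⟶ A.arrows.obj l)
    (ha : HypermomentData.inert a) (hb : HypermomentData.inert b)
    (w : T.mp (Fin.zero_le _) ≫ b = a ≫ A.mp hkl) :
    ∃ (f : T ⟶ A) (h0 : idx f 0 = k) (h1 : idx f (Fin.last _) = l),
      app f 0 ≫ A.mp h0.le = a ∧ app f (Fin.last _) ≫ A.mp h1.le = b := by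
  obtain ⟨h, arr, am, iu⟩ := T
  obtain rfl : h = 1 := hT
  let T : CTree C := ⟨1, arr, am, iu⟩
  let f : T ⟶ A := show Hom _ _ from
    { idx := ⟨fun i : Fin 2 => match i with
        | 0 => k
        | 1 => l, by
          intro i j hij
          fin_cases i <;> fin_cases j
          · exact le_refl k
          · exact hkl
          · exact absurd (show (1 : Fin 2) ≤ 0 from hij) (by decide)
          · exact le_refl l⟩
      app := fun i : Fin 2 => match i with
        | 0 => a
        | 1 => b
      inert_app := fun i : Fin 2 => match i with
        | 0 => ha
        | 1 => hb
      naturality := by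
        intro i j h
        fin_cases i <;> fin_cases j
        · exact (congrArg (· ≫ a) (T.mp_refl h)).trans ((Category.id_comp a).trans
            ((Category.comp_id a).symm.trans (congrArg (a ≫ ·) (A.arrows.map_id k).symm)))
        · exact w
        · exact absurd (show (1 : Fin 2) ≤ 0 from h) (by decide)
        · exact (congrArg (· ≫ b) (T.mp_refl h)).trans ((Category.id_comp b).trans
            ((Category.comp_id b).symm.trans (congrArg (b ≫ ·) (A.arrows.map_id l).symm))) }
  refine ⟨f, rfl, rfl, ?_, ?_⟩
  · exact (congrArg (a ≫ ·) (A.mp_refl (le_refl k))).trans (Category.comp_id a)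
  · exact (congrArg (b ≫ ·) (A.mp_refl (le_refl l))).trans (Category.comp_id b)

theorem eq_zero_or_last {T : CTree C} (hT : T.height = 1) (i : Fin (T.height + 1)) :
    i = 0 ∨ i = Fin.last _ := by
  rcases Nat.lt_or_ge i.1 1 with h | h
  · exact Or.inl (Fin.ext (by simpa using h))
  · exact Or.inr (Fin.ext (by have := i.2; simp; omega))

theorem hom_ext_one {T A : CTree C} (hT : T.height = 1) {f g : T ⟶ A} (h0 : idx f 0 = idx g 0)
    (h1 : idx f (Fin.last _) = idx g (Fin.last _)) (h0' : app f 0 ≫ A.mp h0.le = app g 0)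
    (h1' : app f (Fin.last _) ≫ A.mp h1.le = app g (Fin.last _)) : f = g := by
  have h : ∀ i, idx f i = idx g i := by
    intro i
    obtain rfl | rfl := eq_zero_or_last hT i
    exacts [h0, h1]
  refine hom_ext h fun i => ?_
  obtain rfl | rfl := eq_zero_or_last hT i
  exacts [h0', h1']

theorem isAct_of_isIso {A B : CTree C} (f : A ⟶ B) [IsIso f] : IsAct f := by
  have hfg : ∀ i, idx (inv f) (idx f i) = i := fun i => by
    rw [← idx_comp, IsIso.hom_inv_id, idx_id]
  have hgf : ∀ i, idx f (idx (inv f) i) = i := fun i => by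
    rw [← idx_comp, IsIso.inv_hom_id, idx_id]
  refine ⟨?_, ?_, fun i => ?_⟩
  · have := (idx f).monotone (Fin.zero_le (idx (inv f) 0))
    rw [hgf] at this
    exact le_antisymm this (Fin.zero_le _)
  · have := (idx f).monotone (Fin.le_last (idx (inv f) (Fin.last _)))
    rw [hgf] at this
    exact le_antisymm (Fin.le_last _) this
  · refine ⟨app (inv f) (idx f i) ≫ A.mp (hfg i).le, ?_, ?_⟩
    · exact comp_app (IsIso.hom_inv_id f) i (hfg i)
    · have h := comp_app (IsIso.inv_hom_id f) (idx f i) (hgf _)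
      rw [Category.assoc, mp_app]
      exact h

theorem isInert_of_isIso {A B : CTree C} (f : A ⟶ B) [IsIso f] : IsInert f := by
  have hfg : ∀ i, idx (inv f) (idx f i) = i := fun i => by
    rw [← idx_comp, IsIso.hom_inv_id, idx_id]
  have hgf : ∀ i, idx f (idx (inv f) i) = i := fun i => by
    rw [← idx_comp, IsIso.inv_hom_id, idx_id]
  intro i
  have h1 : idx f i.castSucc < idx f i.succ := by
    refine lt_of_le_of_ne ((idx f).monotone Fin.castSucc_lt_succ.le) fun h => ?_
    have := congrArg (idx (inv f)) h
    rw [hfg, hfg] at this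
    exact absurd this Fin.castSucc_lt_succ.ne
  by_contra h2
  have h3 : (idx f i.castSucc : ℕ) + 1 < idx f i.succ := by
    have : (idx f i.castSucc : ℕ) < idx f i.succ := h1
    omega
  -- If the step from `i` to `i + 1` skipped a value, the preimage of the first skipped value would
  -- lie strictly between `i` and `i + 1`.
  let c : Fin (B.height + 1) := ⟨idx f i.castSucc + 1, h3.trans (idx f i.succ).2⟩
  have h4 : i.castSucc < idx (inv f) c := by
    by_contra h
    have := (idx f).monotone (not_lt.1 h)
    rw [hgf] at this
    exact absurd (show (c : ℕ) ≤ idx f i.castSucc from this) (by simp [c])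
  have h5 : idx (inv f) c < i.succ := by
    by_contra h
    have := (idx f).monotone (not_lt.1 h)
    rw [hgf] at this
    have : (idx f i.succ : ℕ) ≤ c := this
    simp [c] at this
    omega
  have h4' : (i : ℕ) < idx (inv f) c := h4
  have h5' : (idx (inv f) c : ℕ) < i + 1 := h5
  omega

variable [IsHypermoment C]

/-- On indices, `h` is a translation onto an interval, and this interval contains the image of `g`
because `a` preserves the endpoints; so the index part of the lift is forced. On objects, `A_0 ⟶
Z_j` is active for every `j`, and the lifting property in `C` gives the component at `j`. -/
theorem existsUnique_lift {A Z Z' B : CTree C} {a : A ⟶ Z} {g : Z ⟶ B} {f : A ⟶ Z'} {h : Z' ⟶ B}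
    (ha : act a) (hh : HypermomentData.inert h) (w : a ≫ g = f ≫ h) :
    ∃! d : Z ⟶ Z', a ≫ d = f ∧ d ≫ h = g := by
  have ha : IsAct a := ha
  have hh : IsInert h := hh
  have hidx := isInert_idx hh
  have hinj : ∀ {k l}, idx h k = idx h l → k = l := by
    intro k l e
    have := congrArg Fin.val e
    rw [hidx k, hidx l] at this
    exact Fin.ext (by omega)
  have wi : ∀ i, idx g (idx a i) = idx h (idx f i) := fun i => by
    rw [← idx_comp, w, idx_comp]
  have hlow : ∀ j, (idx h 0 : ℕ) ≤ idx g j := by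
    intro j
    have h1 : idx g (idx a 0) ≤ idx g j := (idx g).monotone (by rw [ha.1]; exact Fin.zero_le _)
    rw [wi] at h1
    exact ((idx h).monotone (Fin.zero_le _)).trans h1
  have hhigh : ∀ j, (idx g j : ℕ) - idx h 0 < Z'.height + 1 := by
    intro j
    have h1 : idx g j ≤ idx g (idx a (Fin.last _)) :=
      (idx g).monotone (by rw [ha.2.1]; exact Fin.le_last _)
    rw [wi] at h1
    have h2 : (idx g j : ℕ) ≤ idx h (Fin.last _) := h1.trans ((idx h).monotone (Fin.le_last _))
    rw [hidx, Fin.val_last] at h2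
    omega
  -- The truncated subtraction is a true difference by `hlow`.
  let φ : Fin (Z.height + 1) → Fin (Z'.height + 1) := fun j => ⟨idx g j - idx h 0, hhigh j⟩
  have hφ : ∀ j, idx g j = idx h (φ j) := by
    intro j
    have := hlow j
    apply Fin.ext
    rw [hidx]
    simp only [φ]
    omega
  have hmono : Monotone φ := by
    intro i j hij
    have : (idx g i : ℕ) ≤ idx g j := (idx g).monotone hij
    exact Nat.sub_le_sub_right this _
  have h0 : ∀ j, idx a 0 ≤ j := fun j => by rw [ha.1]; exact Fin.zero_le _
  have hφ0 : ∀ j, idx f 0 ≤ φ j := by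
    intro j
    have h1 := (idx g).monotone (h0 j)
    rw [wi, hφ] at h1
    have h2 : (idx h (idx f 0) : ℕ) ≤ idx h (φ j) := h1
    rw [hidx, hidx (φ j)] at h2
    exact Fin.le_def.2 (by omega)
  -- A level `j` of `Z` need not be in the image of `a`, so the lifting problems start at the root
  -- of `A`, from which all levels can be reached.
  let α : ∀ j, A.arrows.obj 0 ⟶ Z.arrows.obj j := fun j => app a 0 ≫ Z.mp (h0 j)
  have hα : ∀ j, act (α j) := fun j => by
    have := ha.2.2 0
    exact act_comp _ _ (IsHypermoment.act_of_isIso _) (Z.mp_act _)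
  have hαmp : ∀ {i j} (hij : i ≤ j), α i ≫ Z.mp hij = α j := fun hij => by simp [α]
  have sq : ∀ j, α j ≫ app g j ≫ B.mp (hφ j).le =
      (app f 0 ≫ Z'.mp (hφ0 j)) ≫ app h (φ j) := by
    intro j
    have h1 := comp_app_comp_mp w 0 (k := idx h (φ j)) (by
      rw [← hφ]; exact (idx g).monotone (h0 j)) ((idx h).monotone (hφ0 j))
    simp only [α, Category.assoc, mp_app_assoc, mp_app, mp_mp]
    exact h1
  choose d hd using fun j => (Hypermoment.existsUnique_lift (hα j) (app_inert h (φ j)) (sq j)).exists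
  have dn : ∀ {i j} (hij : i ≤ j), Z.mp hij ≫ d j = d i ≫ Z'.mp (hmono hij) := by
    intro i j hij
    refine lift_eq (hα i) (app_inert h (φ j)) ?_ ?_
    · rw [← Category.assoc, hαmp hij, (hd j).1, ← Category.assoc, (hd i).1, Category.assoc, mp_mp]
    · rw [Category.assoc, (hd j).2, Category.assoc, mp_app, ← Category.assoc (d i), (hd i).2,
        mp_app_assoc]
      simp
  let D : Z ⟶ Z' := show Hom _ _ from
    { idx := ⟨φ, hmono⟩
      app := d
      inert_app := fun j => inert_of_comp (app_inert h (φ j)) (by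
        rw [(hd j).2]
        have := B.mp_isIso (hφ j)
        exact inert_comp _ _ (app_inert g j) (IsHypermoment.inert_of_isIso _))
      naturality := fun i j hij => dn hij }
  refine ⟨D, ⟨?_, ?_⟩, ?_⟩
  · have hi : ∀ i, φ (idx a i) = idx f i := fun i => hinj (by rw [← hφ, wi])
    refine hom_ext hi fun i => ?_
    change (app a i ≫ d (idx a i)) ≫ Z'.mp (hi i).le = app f i
    refine lift_eq (A.mp_act (Fin.zero_le i)) (app_inert h (idx f i)) ?_ ?_
    · rw [Category.assoc, mp_app_assoc]
      have h1 := (hd (idx a i)).1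
      simp only [α, Category.assoc] at h1
      rw [reassoc_of% h1, mp_mp, mp_app]
    · have h1 := comp_app w i (wi i)
      rw [app_comp] at h1
      rw [← h1, Category.assoc, Category.assoc, mp_app, ← Category.assoc (d _), (hd _).2]
      simp
      rfl
  · refine hom_ext (fun j => (hφ j).symm) fun j => ?_
    change (d j ≫ app h (φ j)) ≫ B.mp (hφ j).symm.le = app g j
    rw [(hd j).2]
    simp
  · rintro D' ⟨h1, h2⟩
    have hi : ∀ j, idx D' j = φ j := fun j => hinj (by rw [← idx_comp, h2, hφ])
    refine hom_ext hi fun j => ?_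
    change app D' j ≫ Z'.mp (hi j).le = d j
    refine lift_eq (hα j) (app_inert h (φ j)) ?_ ?_
    · rw [(hd j).1]
      have h3 := comp_app_mp h1 0 (k := φ j) (by
        rw [← hi]; exact (idx D').monotone (h0 j)) (hφ0 j)
      simp only [α, Category.assoc, mp_app_assoc, mp_mp]
      exact h3
    · rw [(hd j).2, Category.assoc, mp_app]
      exact comp_app_mp h2 j (k := idx h (φ j)) (by rw [hi]) (hφ j).le

end

end CTree

/-! ### Factorisations, units and vertices of trees -/

namespace CTree

section

variable {C : Type u} [Category.{v} C] [HypermomentData C]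

/-- A unit has a vertex, so its height is positive. The total corolla of `T` maps to `T` by an
active morphism, and an inert section embeds `[m]` into `[1]` by a translation. -/
theorem height_of_isUnitObj {T : CTree C} (hT : IsUnitObj T) : T.height = 1 := by
  obtain ⟨⟨⟨i, -⟩, -, -⟩, h⟩ := hT
  have h0 : 0 < T.height := i.pos
  let r := ofCorolla T.isUnit_root (T.mp (Fin.zero_le (Fin.last _))) (T.mp_act _) T 0 (Fin.last _)
    (Fin.zero_le _) (𝟙 _) (𝟙 _) (inert_id _) (inert_id _)
    ((Category.comp_id _).trans (Category.id_comp _).symm)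
  have hr : IsAct r := ofCorolla_isAct _ _ _ _ _ _ _ _ _ _ _ _ rfl rfl inferInstance inferInstance
  obtain ⟨s, ⟨hs, -⟩, -⟩ := h r hr
  have h1 := isInert_idx (f := s) hs (Fin.last _)
  have h2 : (idx s (Fin.last _) : ℕ) < 1 + 1 := (idx s (Fin.last _)).2
  rw [Fin.val_last] at h1
  omega

theorem eq_of_over_of_act {A U U' : CTree C} {f' : U' ⟶ A} (hU : U.height = 1) (hf' : IsAct f')
    {d d' : U ⟶ U'} (h0 : idx d 0 = idx d' 0) (h1 : idx d (Fin.last _) = idx d' (Fin.last _))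
    (h : d ≫ f' = d' ≫ f') : d = d' := by
  have hc : ∀ i (hi : idx d i = idx d' i), app d i ≫ U'.mp hi.le = app d' i := by
    intro i hi
    have := hf'.2.2 (idx d' i)
    rw [← cancel_mono (app f' (idx d' i)), Category.assoc, mp_app]
    have := comp_app_comp_mp h i (k := idx f' (idx d' i)) (by rw [hi]) (le_refl _)
    rw [this]
    simp
  exact hom_ext_one hU h0 h1 (hc _ h0) (hc _ h1)

variable [IsHypermoment C]

/-- The middle tree lives on the interval `[φ(0), φ(m)]`. Its objects are the middle objects of the
factorisations of `A_0 ⟶ B_j`, and its structure maps are lifts, hence functorial by uniqueness. -/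
theorem exists_factor {A B : CTree C} (f : A ⟶ B) : ∃ (Z : CTree C) (g : A ⟶ Z) (h : Z ⟶ B),
    act g ∧ HypermomentData.inert h ∧ g ≫ h = f := by
  have hle : ∀ i, (idx f 0 : ℕ) ≤ idx f i := fun i => (idx f).monotone (Fin.zero_le i)
  have hle' : ∀ i, (idx f i : ℕ) ≤ idx f (Fin.last _) := fun i => (idx f).monotone (Fin.le_last i)
  have hlast := (idx f (Fin.last _)).2
  obtain ⟨n, hn⟩ : ∃ n, (idx f (Fin.last _) : ℕ) = idx f 0 + n := ⟨_, (Nat.add_sub_cancel' (hle _)).symm⟩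
  let lvl : Fin (n + 1) → Fin (B.height + 1) := fun j => ⟨idx f 0 + j, by have := j.2; omega⟩
  have lvl_mono : Monotone lvl := fun i j hij => Nat.add_le_add_left hij _
  have hlvl : ∀ j, idx f 0 ≤ lvl j := fun j => Nat.le_add_right (idx f 0 : ℕ) j
  let F : ∀ j, Factor (app f 0 ≫ B.mp (hlvl j)) := fun j => (Factor.exists _).some
  have sq : ∀ {i j} (hij : i ≤ j), (F i).left ≫ (F i).right ≫ B.mp (lvl_mono hij) =
      (F j).left ≫ (F j).right := by
    intro i j hij
    rw [(F j).fac, ← Category.assoc, (F i).fac, Category.assoc, mp_mp]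
  let z : ∀ {i j}, i ≤ j → ((F i).mid ⟶ (F j).mid) := fun {i j} hij =>
    (Hypermoment.existsUnique_lift (F i).act (F j).inert (sq hij)).choose
  have hz : ∀ {i j} (hij : i ≤ j), (F i).left ≫ z hij = (F j).left ∧
      z hij ≫ (F j).right = (F i).right ≫ B.mp (lvl_mono hij) := fun {i j} hij =>
    (Hypermoment.existsUnique_lift (F i).act (F j).inert (sq hij)).choose_spec.1
  let Z : CTree C :=
    { height := n
      arrows :=
        { obj := fun j => (F j).mid
          map := fun h => z (leOfHom h)
          map_id := fun i => lift_eq (F i).act (F i).inert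
            ((hz (le_refl i)).1.trans (Category.comp_id _).symm) (by
              rw [(hz (le_refl i)).2, mp_refl]; exact (Category.comp_id _).trans (Category.id_comp _).symm)
          map_comp := fun {i j k} h h' => lift_eq (F i).act (F k).inert (by
              rw [(hz (leOfHom (h ≫ h'))).1, ← Category.assoc, (hz (leOfHom h)).1,
                (hz (leOfHom h')).1]) (by
              rw [(hz (leOfHom (h ≫ h'))).2, Category.assoc, (hz (leOfHom h')).2, ← Category.assoc,
                (hz (leOfHom h)).2, Category.assoc, mp_mp]) }
      act_map := fun {i j} h => act_of_comp (F i).act (by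
        rw [(hz (leOfHom h)).1]; exact (F j).act)
      -- At level `0` the morphism to be factorised is inert already; its active part is therefore
      -- inert too, so it is invertible and the new root is a unit along with `A_0`.
      isUnit_root := by
        have : IsIso (F 0).left := isIso_of_act_of_inert (F 0).act (inert_of_comp (F 0).inert (by
          rw [(F 0).fac]
          have := B.mp_isIso (i := idx f 0) (j := lvl 0) rfl
          exact inert_comp _ _ (app_inert f 0) (IsHypermoment.inert_of_isIso _)))
        exact isUnitObj_of_iso (asIso (F 0).left) A.isUnit_root }
  let φ : Fin (A.height + 1) → Fin (n + 1) := fun i => ⟨idx f i - idx f 0, by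
    have := hle' i; omega⟩
  have hφ : ∀ i, idx f i = lvl (φ i) := fun i => Fin.ext (Nat.add_sub_cancel' (hle i)).symm
  have φ_mono : Monotone φ := fun i j hij =>
    Nat.sub_le_sub_right (show (idx f i : ℕ) ≤ idx f j from (idx f).monotone hij) _
  have sq' : ∀ i, A.mp (Fin.zero_le i) ≫ app f i ≫ B.mp (hφ i).le =
      (F (φ i)).left ≫ (F (φ i)).right := by
    intro i
    rw [(F _).fac, mp_app_assoc, mp_mp]
  choose c hc using fun i => (Hypermoment.existsUnique_lift (A.mp_act (Fin.zero_le i)) (F (φ i)).inert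
    (sq' i)).exists
  -- Each component is active by cancellation on the left and inert by cancellation on the right.
  have c_iso : ∀ i, IsIso (c i) := fun i => by
    refine isIso_of_act_of_inert (act_of_comp (A.mp_act (Fin.zero_le i)) ?_)
      (inert_of_comp (F (φ i)).inert ?_)
    · rw [(hc i).1]
      exact (F _).act
    · rw [(hc i).2]
      have := B.mp_isIso (hφ i)
      exact inert_comp _ _ (app_inert f i) (IsHypermoment.inert_of_isIso _)
  let g : A ⟶ Z := show Hom _ _ from
    { idx := ⟨φ, φ_mono⟩
      app := c
      inert_app := fun i => have := c_iso i; IsHypermoment.inert_of_isIso _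
      naturality := fun i j hij => by
        change A.mp hij ≫ c j = c i ≫ z (φ_mono hij)
        refine lift_eq (A.mp_act (Fin.zero_le i)) (F (φ j)).inert ?_ ?_
        · rw [mp_mp_assoc, (hc j).1, ← Category.assoc, (hc i).1, (hz (φ_mono hij)).1]
        · rw [Category.assoc, (hc j).2, Category.assoc, (hz (φ_mono hij)).2, ← Category.assoc (c i), (hc i).2,
            mp_app_assoc, Category.assoc, mp_mp, mp_mp] }
  let h : Z ⟶ B := show Hom _ _ from
    { idx := ⟨lvl, lvl_mono⟩
      app := fun j => (F j).right
      inert_app := fun j => (F j).inert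
      naturality := fun i j hij => (hz hij).2 }
  refine ⟨Z, g, h, (⟨?_, ?_, c_iso⟩ : IsAct g), (?_ : IsInert h), ?_⟩
  · exact Fin.ext (Nat.sub_self _)
  · exact Fin.ext (show (idx f (Fin.last _) : ℕ) - idx f 0 = n by omega)
  · exact fun i => (Nat.add_assoc _ _ _).symm
  · refine hom_ext (fun i => (hφ i).symm) fun i => ?_
    change (c i ≫ (F (φ i)).right) ≫ B.mp (hφ i).symm.le = app f i
    rw [(hc i).2]
    simp

/-- As `φ(i+1) = φ(i) + 1`, only the level `φ(i)` is available, and there the image is that of `γ`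
of an inert component. -/
theorem vertexSub_of_isInert {A B : CTree C} {f : A ⟶ B} (hf : IsInert f) (x : A.Vertex) :
    ∃ y, vertexSub f x = {y} := by
  obtain ⟨b, hb⟩ := IsHypermoment.aug_inert _ (app_inert f x.level.castSucc) x.elt
  have h1 := hf x.level
  let k : Fin B.height := ⟨idx f x.level.castSucc, by have := (idx f x.level.succ).2; omega⟩
  have e : ∀ h : idx f x.level.castSucc ≤ k.castSucc,
      app f x.level.castSucc ≫ B.mp h = app f x.level.castSucc := fun h =>
    (congrArg (app f x.level.castSucc ≫ ·) (B.mp_refl (le_refl _))).trans (Category.comp_id _)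
  refine ⟨⟨k, b⟩, Set.ext fun z => ?_⟩
  obtain ⟨l, d⟩ := z
  constructor
  · rintro ⟨h2, h3, h4⟩
    have h2' : (idx f x.level.castSucc : ℕ) ≤ l := h2
    have h3' : (l : ℕ) + 1 ≤ idx f x.level.succ := h3
    obtain rfl : l = k := Fin.ext (show (l : ℕ) = idx f x.level.castSucc by omega)
    have h4' : d ∈ SegalGamma.sub ((aug (C := C)).map (app f x.level.castSucc ≫ B.mp h2)) x.elt := h4
    rw [e h2] at h4'
    have h5 : d ∈ ({b} : Set _) := hb ▸ h4'
    rw [Set.mem_singleton_iff.1 h5]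
    rfl
  · intro h
    cases h
    refine ⟨le_refl _, (show (idx f x.level.castSucc : ℕ) + 1 ≤ idx f x.level.succ by omega), ?_⟩
    change b ∈ SegalGamma.sub ((aug (C := C)).map (app f x.level.castSucc ≫ B.mp (le_refl k.castSucc))) x.elt
    rw [e]
    exact hb ▸ Set.mem_singleton b

/-- The endpoints being preserved, the level of `y` falls into some `[φ(j), φ(j+1)]`. The morphism
from `A_j` to the object at this level is active, so the sets attached to the elements of `γ(A_j)`
cover. -/
theorem exists_mem_vertexSub {A B : CTree C} {f : A ⟶ B} (hf : IsAct f) (y : B.Vertex) :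
    ∃ x, y ∈ vertexSub f x := by
  obtain ⟨j, -, -, h1, h2⟩ := exists_level (idx f) 0 (Fin.last _) y.level
    (by rw [hf.1]; exact Fin.zero_le _) (by rw [hf.2.1]; exact Fin.le_last _)
  have := hf.2.2 j.castSucc
  obtain ⟨x, hx⟩ := IsHypermoment.aug_act (app f j.castSucc ≫ B.mp h1)
    (act_comp _ _ (IsHypermoment.act_of_isIso _) (B.mp_act _)) y.elt
  exact ⟨⟨j, x⟩, h1, h2, hx⟩

/-- An active `r : A ⟶ T` is constant on indices except for one step `[j, j+1]`, which it maps onto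
`[0, 1]`. A section must select this step, and its components are then the inverses of those of `r`.
-/
theorem isUnitObj_of_height {T : CTree C} (hT : T.height = 1) : IsUnitObj T := by
  obtain ⟨⟨x, -, hx⟩, -⟩ := T.isUnit_root
  have h0 : 0 < T.height := hT ▸ one_pos
  have hlev : ∀ k : Fin T.height, k = ⟨0, h0⟩ := fun k => Fin.ext (by have := k.2; simp; omega)
  refine ⟨⟨⟨⟨0, h0⟩, x⟩, trivial, ?_⟩, ?_⟩
  · rintro ⟨k, y⟩ -
    obtain rfl := hlev k
    rw [hx y trivial]
  · intro A r hr
    have hr : IsAct r := hr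
    obtain ⟨j, -, -, h1, h2⟩ := exists_level (idx r) 0 (Fin.last _) ⟨0, h0⟩
      (by rw [hr.1]; exact Fin.zero_le _) (by rw [hr.2.1]; exact Fin.le_last _)
    have h1 : idx r j.castSucc = 0 := le_antisymm h1 (Fin.zero_le _)
    have h2 : idx r j.succ = Fin.last _ := le_antisymm (Fin.le_last _) (by
      refine le_trans (Fin.le_def.2 ?_) h2
      simp [hT])
    have := hr.2.2
    have := T.mp_isIso h1
    have := T.mp_isIso h2
    have i1 : IsIso (app r j.castSucc ≫ T.mp h1.le) := inferInstance
    have i2 : IsIso (app r j.succ ≫ T.mp h2.le) := inferInstance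
    obtain ⟨s, hs0, hs1, hs0', hs1'⟩ := exists_hom (A := A) hT (Fin.castSucc_lt_succ (i := j)).le
      (inv (app r j.castSucc ≫ T.mp h1.le)) (inv (app r j.succ ≫ T.mp h2.le))
      (IsHypermoment.inert_of_isIso _) (IsHypermoment.inert_of_isIso _) (by
        rw [IsIso.comp_inv_eq, Category.assoc, mp_app_assoc, IsIso.eq_inv_comp, Category.assoc]
        simp)
    -- A section starting below or above `j` would lie in a range on which `r` is constant, whereas
    -- its composite with `r` separates the two ends of `T`.
    have key : ∀ s' : T ⟶ A, IsInert s' → s' ≫ r = 𝟙 T → idx s' 0 = j.castSucc ∧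
        idx s' (Fin.last _) = j.succ := by
      intro s' hs' e
      have e0 : idx r (idx s' 0) = 0 := by rw [← idx_comp, e, idx_id]
      have e1 : idx r (idx s' (Fin.last _)) = Fin.last _ := by rw [← idx_comp, e, idx_id]
      have e2 := isInert_idx hs' (Fin.last _)
      replace e2 := e2.trans (congrArg (_ + ·) hT)
      have hne : (0 : Fin (T.height + 1)) ≠ Fin.last _ := fun h => by
        have := congrArg Fin.val h
        simp at this
        omega
      have e3 : (idx s' 0 : ℕ) = j := by
        rcases lt_trichotomy (idx s' 0 : ℕ) j with h | h | h
        · have := (idx r).monotone (show idx s' (Fin.last _) ≤ j.castSucc from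
            Fin.le_def.2 (by rw [e2]; exact h))
          rw [h1, e1] at this
          exact absurd (le_antisymm this (Fin.zero_le _)).symm hne
        · exact h
        · have := (idx r).monotone (show j.succ ≤ idx s' 0 from Fin.le_def.2 h)
          rw [h2, e0] at this
          exact absurd (le_antisymm (Fin.zero_le _) this) hne
      exact ⟨Fin.ext e3, Fin.ext (by rw [e2, e3]; rfl)⟩
    refine ⟨s, ⟨?_, ?_⟩, ?_⟩
    · intro i
      obtain rfl : i = ⟨0, h0⟩ := hlev i
      have e0 : (⟨0, h0⟩ : Fin T.height).castSucc = 0 := rfl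
      have e1 : (⟨0, h0⟩ : Fin T.height).succ = Fin.last _ := Fin.ext (by simp [hT])
      rw [e0, e1, hs0, hs1]
      rfl
    · refine hom_ext_one hT (by rw [idx_comp, hs0, h1, idx_id]) (by rw [idx_comp, hs1, h2, idx_id])
        ?_ ?_
      · have := congrArg (· ≫ app r j.castSucc ≫ T.mp h1.le) hs0'
        simp only [IsIso.inv_hom_id] at this
        rw [Category.assoc, mp_app_assoc, mp_mp] at this
        exact (Category.assoc _ _ _).trans this
      · have := congrArg (· ≫ app r j.succ ≫ T.mp h2.le) hs1'
        simp only [IsIso.inv_hom_id] at this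
        rw [Category.assoc, mp_app_assoc, mp_mp] at this
        exact (Category.assoc _ _ _).trans this
    · rintro s' ⟨hs', e⟩
      obtain ⟨e0, e1⟩ := key s' hs' e
      refine hom_ext_one hT (e0.trans hs0.symm) (e1.trans hs1.symm) ?_ ?_
      · have a0 : idx r (idx s' 0) = 0 := by rw [e0, h1]
        have := comp_app e 0 a0
        have := A.mp_isIso hs0
        rw [← cancel_mono (A.mp hs0.le), Category.assoc, mp_mp, hs0',
          ← cancel_mono (app r j.castSucc ≫ T.mp h1.le), IsIso.inv_hom_id, Category.assoc,
          mp_app_assoc, mp_mp]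
        assumption
      · have a0 : idx r (idx s' (Fin.last _)) = Fin.last _ := by rw [e1, h2]
        have := comp_app e (Fin.last _) a0
        have := A.mp_isIso hs1
        rw [← cancel_mono (A.mp hs1.le), Category.assoc, mp_mp, hs1',
          ← cancel_mono (app r j.succ ≫ T.mp h2.le), IsIso.inv_hom_id, Category.assoc,
          mp_app_assoc, mp_mp]
        assumption

/-- A vertex at level `k` is represented by some `U_α ⟶ A_k`; the active part of `U_α ⟶ A_k ⟶
A_{k+1}` is the corolla sought. -/
theorem exists_lift (A : CTree C) (a : A.Vertex) : ∃ (U : CTree C) (i : U ⟶ A),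
    IsUnitObj U ∧ IsInert i ∧ ∀ x, vertexSub i x = {a} := by
  obtain ⟨k, a⟩ := a
  obtain ⟨e, rfl⟩ := Elem.exists_of_pt a
  obtain ⟨F⟩ := Factor.exists (e.hom ≫ A.mp (Fin.castSucc_lt_succ (i := k)).le)
  let i := ofCorolla e.isUnit F.left F.act A k.castSucc k.succ Fin.castSucc_lt_succ.le e.hom F.right
    e.inert F.inert F.fac
  have hi : IsInert i := ofCorolla_isInert _ _ _ _ _ _ _ _ _ _ _ _ rfl
  refine ⟨_, i, isUnitObj_of_height rfl, hi, fun x => ?_⟩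
  obtain ⟨y, hy⟩ := vertexSub_of_isInert hi x
  obtain ⟨l, x⟩ := x
  obtain rfl : l = (0 : Fin 1) := Subsingleton.elim (α := Fin 1) _ _
  have h : (⟨k, e.pt⟩ : A.Vertex) ∈ vertexSub i ⟨(0 : Fin 1), x⟩ := by
    refine ⟨le_refl k.castSucc, le_refl k.succ, ?_⟩
    change e.pt ∈ SegalGamma.sub ((aug (C := C)).map (e.hom ≫ A.mp (le_refl k.castSucc))) x
    rw [mp_refl, Category.comp_id]
    exact (e.sub_hom x).ge rfl
  rw [hy] at h ⊢
  rw [Set.mem_singleton_iff.1 h]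

/-- Both trees are placed at the level of `a`. The roots are compared by uniqueness of inert lifts
in `C`, and the tops by lifting the active morphism of `U` against the inert top component of `i'`.
-/
theorem exists_over {A U U' : CTree C} {a : A.Vertex} {i : U ⟶ A} {i' : U' ⟶ A}
    (hU : U.height = 1) (hi : IsInert i) (h : ∀ x, vertexSub i x = {a}) (hU' : U'.height = 1)
    (hi' : IsInert i') (h' : ∀ x, vertexSub i' x = {a}) : ∃ d : U ⟶ U', d ≫ i' = i := by
  have key : ∀ {V : CTree C} {j : V ⟶ A}, V.height = 1 → IsInert j → (∀ x, vertexSub j x = {a}) →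
      ∃ (h0 : idx j 0 = a.level.castSucc) (_ : idx j (Fin.last _) = a.level.succ),
        ∀ x, SegalGamma.sub ((aug (C := C)).map (app j 0 ≫ A.mp h0.le)) x = {a.elt} := by
    intro V j hV hj hj'
    let lev : Fin V.height := ⟨0, hV ▸ one_pos⟩
    have e1 : lev.succ = Fin.last _ := Fin.ext (by simp [hV, lev])
    have key : ∀ x, ∃ h : idx j 0 ≤ a.level.castSucc, a.level.succ ≤ idx j (Fin.last _) ∧
        a.elt ∈ SegalGamma.sub ((aug (C := C)).map (app j 0 ≫ A.mp h)) x := by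
      intro x
      obtain ⟨h1, h2, h3⟩ : a ∈ vertexSub j ⟨lev, x⟩ := by rw [hj']; rfl
      exact ⟨h1, e1 ▸ h2, h3⟩
    obtain ⟨x, -, hx⟩ := V.isUnit_root.1
    obtain ⟨h1, h2, h3⟩ := key x
    have h1' : (idx j 0 : ℕ) ≤ a.level := h1
    have h2' : (a.level : ℕ) + 1 ≤ idx j (Fin.last _) := h2
    have h4 := isInert_idx hj (Fin.last _)
    replace h4 := h4.trans (congrArg (_ + ·) hV)
    have e0 : idx j 0 = a.level.castSucc := Fin.ext (show (idx j 0 : ℕ) = a.level by omega)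
    refine ⟨e0, Fin.ext (show (idx j (Fin.last _) : ℕ) = a.level + 1 by omega), fun y => ?_⟩
    have := A.mp_isIso e0
    obtain ⟨b, hb⟩ := IsHypermoment.aug_inert (app j 0 ≫ A.mp e0.le)
      (inert_comp _ _ (app_inert j 0) (IsHypermoment.inert_of_isIso _)) x
    rw [hb] at h3
    rw [hx y trivial, hb, Set.mem_singleton_iff.1 h3]
  obtain ⟨p0, p1, p⟩ := key hU hi h
  obtain ⟨p0', p1', p'⟩ := key hU' hi' h'
  have := A.mp_isIso p0
  have := A.mp_isIso p0'
  have := A.mp_isIso p1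
  have := A.mp_isIso p1'
  obtain ⟨e, he, -⟩ := IsHypermoment.lift_unique (A.arrows.obj a.level.castSucc) a.elt _ _ _ _
    U.isUnit_root (inert_comp _ _ (app_inert i 0) (IsHypermoment.inert_of_isIso _)) p
    U'.isUnit_root (inert_comp _ _ (app_inert i' 0) (IsHypermoment.inert_of_isIso _)) p'
  have in1' := inert_comp _ _ (app_inert i' (Fin.last _)) (IsHypermoment.inert_of_isIso (A.mp p1'.le))
  obtain ⟨d, hd, -⟩ := Hypermoment.existsUnique_lift (U.mp_act (Fin.zero_le (Fin.last _))) in1'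
    (g := app i (Fin.last _) ≫ A.mp p1.le) (f := e.hom ≫ U'.mp (Fin.zero_le _)) (by
      have := congrArg (· ≫ A.mp (Fin.castSucc_lt_succ (i := a.level)).le) he
      simp only [Category.assoc, mp_mp] at this
      rw [mp_app_assoc, mp_mp, Category.assoc, mp_app_assoc, mp_mp]
      exact this.symm)
  obtain ⟨s, s0, s1, s0', s1'⟩ := exists_hom (A := U') hU (Fin.zero_le (Fin.last _)) e.hom d
    (IsHypermoment.inert_of_isIso _) (inert_of_comp in1' (by
      rw [hd.2]
      exact inert_comp _ _ (app_inert i _) (IsHypermoment.inert_of_isIso _))) hd.1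
  refine ⟨s, hom_ext_one hU (by rw [idx_comp, s0, p0, p0']) (by rw [idx_comp, s1, p1, p1']) ?_ ?_⟩
  · rw [← cancel_mono (A.mp p0.le), ← he, ← s0', Category.assoc, Category.assoc, mp_app_assoc]
    simp only [mp_mp, app_comp]
    exact Category.assoc _ _ _
  · rw [← cancel_mono (A.mp p1.le), ← hd.2, ← s1', Category.assoc, Category.assoc, mp_app_assoc]
    simp only [mp_mp, app_comp]
    exact Category.assoc _ _ _

/-- Translations are injective, which settles the indices. At the root, `Elem.hom_eq` cancels the
inert component; the top component is then determined by `lift_eq`. -/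
theorem eq_of_over {A U U' : CTree C} {i' : U' ⟶ A} (hU : U.height = 1) (hi' : IsInert i')
    {d d' : U ⟶ U'} (h : d ≫ i' = d' ≫ i') : d = d' := by
  have hidx : ∀ i, idx d i = idx d' i := fun i => by
    have h1 := congrArg Fin.val (show idx i' (idx d i) = idx i' (idx d' i) by
      rw [← idx_comp, h, idx_comp])
    rw [isInert_idx hi' (idx d i), isInert_idx hi' (idx d' i)] at h1
    exact Fin.ext (by omega)
  have hc : ∀ i, (app d i ≫ U'.mp (hidx i).le) ≫ app i' (idx d' i) = app d' i ≫ app i' (idx d' i) := by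
    intro i
    rw [Category.assoc, mp_app]
    have := comp_app_comp_mp h i (k := idx i' (idx d' i)) (by rw [hidx]) (le_refl _)
    rw [this]
    simp
  have h0 : app d 0 ≫ U'.mp (hidx 0).le = app d' 0 := by
    have := U'.mp_isIso (hidx 0)
    exact Elem.hom_eq U.isUnit_root
      (inert_comp _ _ (app_inert d 0) (IsHypermoment.inert_of_isIso _)) (app_inert d' 0)
      (app_inert i' _) (hc 0)
  refine hom_ext_one hU (hidx 0) (hidx _) h0 ?_
  refine lift_eq (U.mp_act (Fin.zero_le _)) (app_inert i' _) ?_ (hc _)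
  rw [mp_app_assoc, mp_app, ← h0]
  simp

/-- At each of the two ends the components of `f'` are invertible and can be divided out. -/
theorem exists_over_of_act {A U U' : CTree C} {f : U ⟶ A} {f' : U' ⟶ A} (hU : U.height = 1)
    (hf : IsAct f) (hf' : IsAct f') :
    ∃ d : U ⟶ U', idx d 0 = 0 ∧ idx d (Fin.last _) = Fin.last _ ∧ d ≫ f' = f := by
  obtain ⟨h0, h1, h⟩ := hf
  obtain ⟨h0', h1', h'⟩ := hf'
  have e0 : idx f' 0 = idx f 0 := h0'.trans h0.symm
  have e1 : idx f' (Fin.last _) = idx f (Fin.last _) := h1'.trans h1.symm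
  have := A.mp_isIso e0
  have := A.mp_isIso e1
  have := h' 0
  have := h' (Fin.last _)
  have i0 : IsIso (app f' 0 ≫ A.mp e0.le) := inferInstance
  have i1 : IsIso (app f' (Fin.last _) ≫ A.mp e1.le) := inferInstance
  have := h 0
  have := h (Fin.last _)
  obtain ⟨d, d0, d1, d0', d1'⟩ := exists_hom (A := U') hU (Fin.zero_le (Fin.last _))
    (app f 0 ≫ inv (app f' 0 ≫ A.mp e0.le))
    (app f (Fin.last _) ≫ inv (app f' (Fin.last _) ≫ A.mp e1.le))
    (IsHypermoment.inert_of_isIso _) (IsHypermoment.inert_of_isIso _) (by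
      rw [← cancel_mono (app f' (Fin.last _) ≫ A.mp e1.le)]
      simp only [Category.assoc, IsIso.inv_hom_id, Category.comp_id]
      rw [mp_app_assoc, mp_mp, mp_app]
      have := congrArg (app f 0 ≫ · ≫ A.mp ((idx f).monotone (Fin.zero_le (Fin.last _))))
        (IsIso.inv_hom_id (app f' 0 ≫ A.mp e0.le))
      simp only [Category.assoc, mp_mp, Category.id_comp] at this
      exact this.symm)
  refine ⟨d, d0, d1, hom_ext_one hU (by rw [idx_comp, d0, e0]) (by rw [idx_comp, d1, e1]) ?_ ?_⟩
  · have := congrArg (· ≫ app f' 0 ≫ A.mp e0.le) d0'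
    simp only [Category.assoc, IsIso.inv_hom_id, Category.comp_id, mp_app_assoc, mp_mp] at this
    exact (Category.assoc _ _ _).trans this
  · have := congrArg (· ≫ app f' (Fin.last _) ≫ A.mp e1.le) d1'
    simp only [Category.assoc, IsIso.inv_hom_id, Category.comp_id, mp_app_assoc, mp_mp] at this
    exact (Category.assoc _ _ _).trans this

end

section

variable {C : Type u} [Category.{v} C] [HypermomentData C]

theorem isUnitObj_iff [IsHypermoment C] (T : CTree C) : IsUnitObj T ↔ T.height = 1 :=
  ⟨height_of_isUnitObj, isUnitObj_of_height⟩

instance [IsHypermoment C] : IsHypermoment (CTree C) where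
  act_of_isIso f _ := isAct_of_isIso f
  inert_of_isIso f _ := isInert_of_isIso f
  factor := exists_factor
  factor_unique _ _ _ _ hg hh hg' hh' w := existsUnique_iso_of_lift existsUnique_lift hg hh hg' hh' w
  aug_act _ hf y := exists_mem_vertexSub hf y
  aug_inert _ hf x := vertexSub_of_isInert hf x
  lift := exists_lift
  lift_unique A a U U' i i' hU hi h hU' hi' h' := by
    have hU := height_of_isUnitObj hU
    have hU' := height_of_isUnitObj hU'
    obtain ⟨d, hd⟩ := exists_over hU hi h hU' hi' h'
    obtain ⟨d', hd'⟩ := exists_over hU' hi' h' hU hi h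
    exact ⟨⟨d, d', eq_of_over hU hi (by rw [Category.assoc, hd', hd, Category.id_comp]),
      eq_of_over hU' hi' (by rw [Category.assoc, hd, hd', Category.id_comp])⟩, hd,
      fun e he => Iso.ext (eq_of_over hU hi' (he.trans hd.symm))⟩

instance [IsUnitalHypermoment C] : IsUnitalHypermoment (CTree C) where
  unital A := by
    refine ⟨_, ofCorolla A.isUnit_root (A.mp (Fin.zero_le (Fin.last _))) (A.mp_act _) A 0 (Fin.last _)
      (Fin.zero_le _) (𝟙 _) (𝟙 _) (inert_id _) (inert_id _)
      ((Category.comp_id _).trans (Category.id_comp _).symm), isUnitObj_of_height rfl, ?_⟩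
    exact ofCorolla_isAct _ _ _ _ _ _ _ _ _ _ _ _ rfl rfl inferInstance inferInstance
  unital_unique A U U' f f' hU hf hU' hf' := by
    have hU := height_of_isUnitObj hU
    have hU' := height_of_isUnitObj hU'
    obtain ⟨d, d0, d1, hd⟩ := exists_over_of_act hU hf hf'
    obtain ⟨d', d0', d1', hd'⟩ := exists_over_of_act hU' hf' hf
    refine ⟨⟨d, d', eq_of_over_of_act hU hf ?_ ?_ ?_, eq_of_over_of_act hU' hf' ?_ ?_ ?_⟩, hd,
      fun e he => Iso.ext (eq_of_over_of_act hU hf' ?_ ?_ (he.trans hd.symm))⟩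
    · rw [idx_comp, d0, d0', idx_id]
    · rw [idx_comp, d1, d1', idx_id]
    · rw [Category.assoc, hd', hd, Category.id_comp]
    · rw [idx_comp, d0', d0, idx_id]
    · rw [idx_comp, d1', d1, idx_id]
    · rw [Category.assoc, hd, hd', Category.id_comp]
    · rw [d0, (isAct_of_isIso e.hom).1]
    · rw [d1, (isAct_of_isIso e.hom).2.1]

end

end CTree

/-! ## The structural morphisms in terms of formal tensor products -/

section Flat

variable {E : Type u'} [Category.{v'} E] [MonoidalCategory E]

open Word

/-- The morphism induced by morphisms from formal tensor products `R a` to the factors of a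
relabelled formal tensor product. -/
def Word.substTo {ι ι' κ : Type w} {F : κ → E} {F' : ι' → E} (R : ι → Word ι') (c : ι → κ)
    (ψ : ∀ a, (R a).eval F' ⟶ F (c a)) : ∀ X : Word ι, (X.subst R).eval F' ⟶ (X.map c).eval F
  | .one => 𝟙 (𝟙_ E)
  | .of a => ψ a
  | .mul X Y => substTo R c ψ X ⊗ₘ substTo R c ψ Y
  | .big l S => tensHom (fun i => substTo R c ψ (S i)) l

theorem Word.substTo_mapMap {ι ι' κ : Type w} {F : κ → E} {F' : ι' → E} (R : ι → Word ι')
    (c : ι → κ) (ψ : ∀ a, (R a).eval F' ⟶ F (c a)) (X : Word ι) :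
    substTo R c ψ X ≫ mapMap F c X = substMap (F := fun a => F (c a)) R ψ X := by
  induction X with
  | one => exact Category.comp_id _
  | of a => exact Category.comp_id _
  | mul X Y hX hY =>
    exact (tensorHom_comp_tensorHom _ _ _ _).trans (congrArg₂ (· ⊗ₘ ·) hX hY)
  | big l S ih =>
    exact (tensHom_comp _ _ l).symm.trans
      (congrArg (fun φ : ∀ i, _ ⟶ _ => tensHom φ l) (funext ih))

variable [SymmetricCategory E]

/-- Canonical morphisms are compatible with substitution. -/
theorem Canon.exists_substTo {ι ι' κ : Type w} {F : κ → E} {F' : ι' → E} (R : ι → Word ι')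
    (c : ι → κ) (ψ : ∀ a, (R a).eval F' ⟶ F (c a)) {X Y : Word ι} (h : X.labels.Perm Y.labels) :
    ∃ φ φ', Canon F' (X.subst R) (Y.subst R) φ ∧ Canon F (X.map c) (Y.map c) φ' ∧
      φ ≫ substTo R c ψ Y = substTo R c ψ X ≫ φ' := by
  obtain ⟨θ, hθ⟩ := Canon.exists_of_perm (F := fun a => F (c a)) h
  obtain ⟨φ, h1, h2⟩ := hθ.exists_subst R ψ
  obtain ⟨φ', h3, h4⟩ := hθ.exists_map (F := F) c
  refine ⟨φ, φ', h1, h3, ?_⟩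
  have := mapMap_isIso F c Y
  rw [← cancel_mono (mapMap F c Y), Category.assoc, substTo_mapMap, h2, Category.assoc, h4,
    ← Category.assoc, substTo_mapMap]

/-- The recursive morphism of the monoid axiom is, up to canonical morphisms, a plain tensor product
of morphisms. What `J` and `J'` are explicitly does not matter, by coherence. The reparametrisation
`P` admits families with an index type of their own; `exists_tensZip` does the same for the
associativity axiom of operads. -/
theorem exists_tensFlat {ι κ μ ν : Type w} {β : ι → Type w} (G : κ → E) (F : μ → E) (c : ι → μ)
    (m : ∀ a, List (β a)) (h : ∀ a, β a → κ)
    (φ : ∀ a, tens (fun b => G (h a b)) (m a) ⟶ F (c a)) (P : ν → ι) (l : List ν) :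
    ∃ J J', Canon G (list (fun i => i) ((l.map P).flatMap fun a => (m a).map (h a)))
        (big l fun i => list (h (P i)) (m (P i))) J ∧
      Canon F (list (fun i => c (P i)) l) (list (fun i => i) ((l.map P).map c)) J' ∧
      tensFlat G F c m h φ (l.map P) = J ≫ tensHom (fun i => φ (P i)) l ≫ J' := by
  induction l with
  | nil =>
    exact ⟨𝟙 _, 𝟙 _, .nilComp (.compNil (.id _)), .nilComp (.compNil (.id _)),
      ((Category.id_comp _).trans (Category.comp_id _)).symm⟩
  | cons a l ih =>
    obtain ⟨J, J', h1, h2, h3⟩ := ih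
    refine ⟨tensAppend G _ _ ≫ (tensReindex G (h (P a)) (m (P a)) ⊗ₘ J), 𝟙 (F (c (P a))) ⊗ₘ J', ?_,
      (Canon.consTensor (X := .of (c (P a))) (φ := 𝟙 (F (c (P a)))) (S := fun i => of (c (P i)))
        (.id _) h2).compCons (S := fun i => of i), ?_⟩
    · exact ((Canon.bigAppend (fun i => of i) _ _).comp
        ((Canon.bigReindex (h (P a)) (fun i => of i) (m (P a))).tensor h1)).compCons
          (S := fun i => list (h (P i)) (m (P i)))
    · have e : ∀ {A B C B' C' C'' D D' D'' : E} {s : A ⟶ B ⊗ C} {r : B ⟶ B'} {p : B' ⟶ D} {j : C ⟶ C'}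
          {f : C' ⟶ C''} {j' : C'' ⟶ D'} {t : C ⟶ D'}, t = j ≫ f ≫ j' →
          s ≫ ((r ≫ p) ⊗ₘ t) = (s ≫ (r ⊗ₘ j)) ≫ (p ⊗ₘ f) ≫ (𝟙 _ ⊗ₘ j') := by
        intro A B C B' C' C'' D D' D'' s r p j f j' t H
        rw [H, Category.assoc, tensorHom_comp_tensorHom, tensorHom_comp_tensorHom, Category.comp_id]
      exact e (D'' := 𝟙_ E) h3

theorem exists_tensZip {ι κ μ ν : Type w} {β : ι → Type w} (K : ι → E) (G : κ → E) (F : μ → E)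
    (c : ι → μ) (m : ∀ a, List (β a)) (h : ∀ a, β a → κ)
    (φ : ∀ a, K a ⊗ tens (fun b => G (h a b)) (m a) ⟶ F (c a)) (P : ν → ι) (l : List ν) :
    ∃ JK J J', Canon K (list (fun i => i) (l.map P)) (list P l) JK ∧
      Canon G (list (fun i => i) ((l.map P).flatMap fun a => (m a).map (h a)))
        (big l fun i => list (h (P i)) (m (P i))) J ∧
      Canon F (list (fun i => c (P i)) l) (list (fun i => i) ((l.map P).map c)) J' ∧
      tensZip K G F c m h φ (l.map P) =
        (JK ⊗ₘ J) ≫ tensDistrib (fun i => K (P i)) (fun i => tens (fun b => G (h (P i) b)) (m (P i))) l ≫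
          tensHom (fun i => φ (P i)) l ≫ J' := by
  induction l with
  | nil =>
    refine ⟨𝟙 _, 𝟙 _, 𝟙 _, .nilComp (.compNil (.id _)), .nilComp (.compNil (.id _)),
      .nilComp (.compNil (.id _)), ?_⟩
    have e : (λ_ (𝟙_ E)).hom = (𝟙 (𝟙_ E) ⊗ₘ 𝟙 (𝟙_ E)) ≫ (λ_ (𝟙_ E)).hom ≫ 𝟙 _ ≫ 𝟙 _ := by simp
    exact e
  | cons a l ih =>
    obtain ⟨JK, J, J', h0, h1, h2, h3⟩ := ih
    refine ⟨𝟙 (K (P a)) ⊗ₘ JK, tensAppend G _ _ ≫ (tensReindex G (h (P a)) (m (P a)) ⊗ₘ J),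
      𝟙 (F (c (P a))) ⊗ₘ J', (Canon.consTensor (X := .of (P a)) (φ := 𝟙 (K (P a)))
        (S := fun i => of i) (.id _) h0).compCons (S := fun i => of (P i)), ?_,
      (Canon.consTensor (X := .of (c (P a))) (φ := 𝟙 (F (c (P a)))) (S := fun i => of (c (P i)))
        (.id _) h2).compCons (S := fun i => of i), ?_⟩
    · exact ((Canon.bigAppend (fun i => of i) _ _).comp
        ((Canon.bigReindex (h (P a)) (fun i => of i) (m (P a))).tensor h1)).compCons
          (S := fun i => list (h (P i)) (m (P i)))
    · have e : ∀ {K1 K2 K2' A B C B' C' D D' Z Z' : E} {k : K2 ⟶ K2'} {s : A ⟶ B ⊗ C} {r : B ⟶ B'}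
          {p : K1 ⊗ B' ⟶ D} {j : C ⟶ C'} {d : K2' ⊗ C' ⟶ Z} {f : Z ⟶ Z'} {j' : Z' ⟶ D'}
          {t : K2 ⊗ C ⟶ D'}, t = (k ⊗ₘ j) ≫ d ≫ f ≫ j' →
          (K1 ⊗ K2) ◁ (s ≫ r ▷ C) ≫ tensorμ K1 K2 B' C ≫ (p ⊗ₘ t) =
            ((𝟙 K1 ⊗ₘ k) ⊗ₘ (s ≫ (r ⊗ₘ j))) ≫ (tensorμ K1 K2' B' C' ≫ (K1 ⊗ B') ◁ d) ≫ (p ⊗ₘ f) ≫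
              (𝟙 _ ⊗ₘ j') := by
        intro K1 K2 K2' A B C B' C' D D' Z Z' k s r p j d f j' t H
        have h4 : (𝟙 K1 ⊗ₘ k) ⊗ₘ (s ≫ (r ⊗ₘ j)) =
            (K1 ⊗ K2) ◁ (s ≫ r ▷ C) ≫ ((𝟙 K1 ⊗ₘ k) ⊗ₘ (𝟙 B' ⊗ₘ j)) := by
          rw [← id_tensorHom, tensorHom_comp_tensorHom, Category.id_comp, Category.assoc,
            ← tensorHom_id, tensorHom_comp_tensorHom, Category.comp_id, Category.id_comp]
        rw [h4, Category.assoc, Category.assoc, tensorμ_natural_assoc, H]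
        congr 2
        simp only [← id_tensorHom, tensorHom_comp_tensorHom,
          id_tensorHom_id, Category.id_comp, Category.comp_id]
      exact e h3

end Flat

/-! ### The action of a monoid on formal tensor products -/

section MonWords

variable {C : Type u} [Category.{v} C] [HypermomentData C] [IsHypermoment C]
variable {E : Type u'} [Category.{v'} E] [MonoidalCategory E] [SymmetricCategory E]

open Word

theorem comp_comp_eq {D : Type*} [Category* D] {P Q R S Z : D} {φ : P ⟶ Q} {c : Q ⟶ R} {x : R ⟶ Z}
    {c' : P ⟶ S} {θ : S ⟶ R} {y : S ⟶ Z} (h : φ ≫ c = c' ≫ θ) (h' : θ ≫ x = y) :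
    φ ≫ c ≫ x = c' ≫ y := by
  rw [reassoc_of% h, h']

namespace Mon

variable (X : Mon C E)

/-- The factors of the value of a monoid on `A`. -/
abbrev val {A : C} (e : Elem A) : E := X.obj e.dom e.isUnit

theorem isPerm_map {U B : C} (hU : IsUnitObj U) (f : U ⟶ B) (hf : act f) {l l' : List (Elem B)}
    (hl : IsFrame l) (hl' : IsFrame l') {θ : tens X.val l ⟶ tens X.val l'}
    (h : IsPerm X.val l l' θ) : θ ≫ X.map hU f hf l' hl' = X.map hU f hf l hl := by
  induction h with
  | refl => exact Category.id_comp _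
  | step l₁ x y l₂ φ h ih =>
    rw [Category.assoc, ← ih (hl.perm h.perm), X.map_swap hU f hf l₁ l₂ x y _ hl']

/-- The action of an active morphism, on a formal tensor product of the factors. -/
noncomputable def mapW {U B : C} (hU : IsUnitObj U) (f : U ⟶ B) (hf : act f) (W : Word (Elem B))
    (h : IsFrame W.labels) : W.eval X.val ⟶ X.obj U hU :=
  can X.val (X := W) (Y := list (fun e => e) W.labels) (by simp [labels_list]) ≫
    X.map hU f hf W.labels h

variable {X}

/-- Frames have no repetitions, so the canonical morphism equals a product of adjacent symmetries
between the lists of labels, and `map_swap` absorbs these. -/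
theorem canon_mapW {U B : C} {hU : IsUnitObj U} {f : U ⟶ B} {hf : act f} {W W' : Word (Elem B)}
    {φ : W.eval X.val ⟶ W'.eval X.val} (hφ : Canon X.val W W' φ) (h : IsFrame W.labels)
    (h' : IsFrame W'.labels) : φ ≫ X.mapW hU f hf W' h' = X.mapW hU f hf W h := by
  obtain ⟨θ, hθ⟩ := IsPerm.exists_of_perm (F := X.val) hφ.perm
  exact comp_comp_eq (Canon.unique h.nodup (hφ.comp (can_canon _ _))
    ((can_canon _ _).comp (hθ.canon fun e => of e))) (isPerm_map X hU f hf h h' hθ)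

theorem canon_map {U B : C} {hU : IsUnitObj U} {f : U ⟶ B} {hf : act f} {W : Word (Elem B)}
    {l : List (Elem B)} {φ : W.eval X.val ⟶ tens X.val l}
    (hφ : Canon X.val W (list (fun e => e) l) φ) (h : IsFrame W.labels) (h' : IsFrame l) :
    φ ≫ X.map hU f hf l h' = X.mapW hU f hf W h := by
  have hp : W.labels.Perm l := by simpa [labels_list] using hφ.perm
  obtain ⟨θ, hθ⟩ := IsPerm.exists_of_perm (F := X.val) hp
  refine Eq.trans ?_ (congrArg (can X.val _ ≫ ·) (isPerm_map X hU f hf h h' hθ))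
  exact (congrArg (· ≫ X.map hU f hf l h')
    (Canon.unique h.nodup hφ ((can_canon _ _).comp (hθ.canon fun e => of e)))).trans
      (Category.assoc _ _ _)

theorem mapW_list {U B : C} {hU : IsUnitObj U} {f : U ⟶ B} {hf : act f} {l : List (Elem B)}
    (h : IsFrame l) :
    X.mapW hU f hf (list (fun e => e) l) (by rwa [labels_list, List.map_id']) =
      X.map hU f hf l h :=
  (canon_map (.id _) _ h).symm.trans (Category.id_comp _)

end Mon

end MonWords

section MonComp

variable {C : Type u} [Category.{v} C] [HypermomentData C] [IsHypermoment C]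
variable {E : Type u'} [Category.{v'} E] [MonoidalCategory E] [SymmetricCategory E]

open Word

/-- The axioms of monoids and operads require choices for all pieces, whereas arguments provide them
only for the pieces of a given family. An injective family lets these choices be extended. -/
theorem exists_extension {ι κ : Type*} {T : ι → Type*} [∀ i, Nonempty (T i)] {P : κ → ι}
    (hP : Function.Injective P) (x : ∀ k, T (P k)) : ∃ y : ∀ i, T i, ∀ k, y (P k) = x k := by
  classical
  refine ⟨fun i => if h : ∃ k, P k = i then h.choose_spec ▸ x h.choose else Classical.arbitrary _,
    fun k => ?_⟩
  have h : ∃ k', P k' = P k := ⟨k, rfl⟩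
  refine (dif_pos h).trans ?_
  have e : ∀ (k' : κ) (e : P k' = P k), (e ▸ x k' : T (P k)) = x k := by
    intro k' e
    obtain rfl := hP e
    rfl
  exact e _ _

/-- Pieces of `g` together with frames of their targets give frames of the target of `g`. -/
theorem isFrame_labels_subst {A B : C} {g : A ⟶ B} (hg : act g) {κ : Type (max u v)}
    (P : κ → Piece g) (W : Word κ) (hW : IsFrame (W.labels.map fun i => (P i).toElem))
    (s : ∀ i, Word (Elem (P i).cod)) (hs : ∀ i, IsFrame (s i).labels) :
    IsFrame (W.subst fun i => (s i).map fun e => e.push (P i).incl (P i).incl_inert).labels := by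
  simp only [labels_subst, labels_map]
  exact isFrame_flatMap hg P W.labels hW (fun i => (s i).labels) fun i _ => hs i

namespace Mon

variable {X : Mon C E}

theorem mapW_comp_of_injective {U A B : C} {hU : IsUnitObj U} {f : U ⟶ A} {g : A ⟶ B} {hf : act f}
    {hg : act g} {κ : Type (max u v)} {P : κ → Piece g} (hP : Function.Injective P) (l : List κ)
    (hl : IsFrame (list (fun i => (P i).toElem) l).labels) (m : ∀ i, List (Elem (P i).cod))
    (hm : ∀ i, IsFrame (m i))
    (hl' : IsFrame (big l fun i => list (fun e => e.push (P i).incl (P i).incl_inert) (m i)).labels) :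
    X.mapW hU (f ≫ g) (act_comp f g hf hg)
        (big l fun i => list (fun e => e.push (P i).incl (P i).incl_inert) (m i)) hl' =
      tensHom (fun i => X.map (P i).isUnit (P i).res (P i).res_act (m i) (hm i)) l ≫
        X.mapW hU f hf (list (fun i => (P i).toElem) l) hl := by
  have : ∀ p : Piece g, Nonempty {L : List (Elem p.cod) // IsFrame L} := fun p =>
    let ⟨L, hL⟩ := exists_isFrame p.cod; ⟨⟨L, hL⟩⟩
  obtain ⟨y, hy⟩ := exists_extension (T := fun p : Piece g => {L : List (Elem p.cod) // IsFrame L})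
    hP fun i => ⟨m i, hm i⟩
  obtain rfl : m = fun i => (y (P i)).1 := funext fun i => by rw [hy]
  obtain ⟨J, J', h1, h2, h3⟩ := exists_tensFlat (fun e : Elem B => X.obj e.dom e.isUnit)
    (fun e : Elem A => X.obj e.dom e.isUnit) Piece.toElem (fun p => (y p).1)
    (fun (p : Piece g) e => e.push p.incl p.incl_inert)
    (fun p => X.map p.isUnit p.res p.res_act (y p).1 (y p).2) P l
  have hlP : IsFrame ((l.map P).map Piece.toElem) := by
    have := hl.perm h2.perm
    rwa [labels_list, List.map_id'] at this
  have hflat : IsFrame ((l.map P).flatMap fun p =>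
      (y p).1.map fun e => e.push p.incl p.incl_inert) := by
    have := hl'.perm h1.perm.symm
    rwa [labels_list, List.map_id'] at this
  have h4 := X.map_comp hU f g hf hg (l.map P) (fun p => (y p).1) hlP (fun p => (y p).2) hflat
  have h5 := canon_mapW (X := X) (hU := hU) (hf := act_comp f g hf hg) h1
    (by rwa [labels_list, List.map_id']) hl'
  have h6 := canon_map (X := X) (hU := hU) (hf := hf) h2 hl hlP
  have := h1.isIso
  rw [mapW_list hflat] at h5
  rw [h3] at h4
  have e : ∀ {P Q R S Z : E} {j : P ⟶ Q} [IsIso j] {a : Q ⟶ Z} {b : P ⟶ Z} {t : Q ⟶ R} {j' : R ⟶ S}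
      {x : S ⟶ Z} {y : R ⟶ Z}, j ≫ a = b → b = (j ≫ t ≫ j') ≫ x → j' ≫ x = y → a = t ≫ y := by
    intro P Q R S Z j _ a b t j' x y H1 H2 H3
    rw [← cancel_epi j, H1, H2, ← H3]
    simp
  exact e h5 h4 h6

/-- Compatibility of a monoid with composition. -/
theorem mapW_comp {U A B : C} {hU : IsUnitObj U} {f : U ⟶ A} {g : A ⟶ B} {hf : act f}
    {hg : act g} {κ : Type (max u v)} (P : κ → Piece g) (W : Word κ)
    (hW : IsFrame (W.map fun i => (P i).toElem).labels) (s : ∀ i, Word (Elem (P i).cod))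
    (hs : ∀ i, IsFrame (s i).labels)
    (hW' : IsFrame (W.subst fun i => (s i).map fun e => e.push (P i).incl (P i).incl_inert).labels) :
    X.mapW hU (f ≫ g) (act_comp f g hf hg)
        (W.subst fun i => (s i).map fun e => e.push (P i).incl (P i).incl_inert) hW' =
      substTo _ _ (fun i => mapMap X.val _ (s i) ≫
          X.mapW (P i).isUnit (P i).res (P i).res_act (s i) (hs i)) W ≫
        X.mapW hU f hf (W.map fun i => (P i).toElem) hW := by
  set R : ∀ i, Word (Elem B) := fun i => (s i).map fun e => e.push (P i).incl (P i).incl_inert with hR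
  let ψ : ∀ i, (R i).eval X.val ⟶ X.val (P i).toElem := fun i => mapMap X.val _ (s i) ≫
    X.mapW (P i).isUnit (P i).res (P i).res_act (s i) (hs i)
  change _ = substTo R _ ψ W ≫ _
  have hnd : (W.labels.map fun i => (P i).toElem).Nodup := by
    rw [labels_map] at hW
    exact hW.nodup
  -- `P` need not be injective on `κ`, but it is injective on the labels occurring in `W`, since
  -- these give a frame; restricting to them makes `mapW_comp_of_injective` applicable.
  let κ' : Type (max u v) := {i // i ∈ W.labels}
  let P' : κ' → Piece g := fun i => P i.1
  have hP' : Function.Injective P' := fun i j h =>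
    Subtype.ext (List.inj_on_of_nodup_map hnd i.2 j.2 (congrArg Piece.toElem h))
  let l : List κ' := W.labels.attach
  have hl : (list Subtype.val l).labels = W.labels := by
    rw [labels_list, List.attach_map_subtype_val]
  obtain ⟨φ, φ', h1, h2, h3⟩ := Canon.exists_substTo (F := X.val) R (fun i => (P i).toElem) ψ
    (X := list Subtype.val l) (Y := W) (by rw [hl])
  have i1 := h1.isIso
  have f1 : IsFrame ((list Subtype.val l).subst R).labels := hW'.perm h1.perm.symm
  have f2 : IsFrame ((list Subtype.val l).map fun i => (P i).toElem).labels := hW.perm h2.perm.symm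
  have e1 := canon_mapW (X := X) (hU := hU) (hf := act_comp f g hf hg) h1 f1 hW'
  have e2 := canon_mapW (X := X) (hU := hU) (hf := hf) h2 f2 hW
  have key : X.mapW hU (f ≫ g) (act_comp f g hf hg) (big l fun i => R i.1) f1 =
      tensHom (fun i => ψ i.1) l ≫ X.mapW hU f hf (list (fun i => (P' i).toElem) l) f2 := by
    have hex : ∀ i, ∃ θ, Canon X.val (R i) ((list (fun e => e) (s i).labels).map
        fun e => e.push (P i).incl (P i).incl_inert) θ ∧
        θ ≫ X.map (P i).isUnit (P i).res (P i).res_act (s i).labels (hs i) = ψ i := by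
      intro i
      obtain ⟨θ, k1, k2⟩ := Canon.exists_map (F := X.val)
        (fun e : Elem (P i).cod => e.push (P i).incl (P i).incl_inert)
        (can_canon (fun e : Elem (P i).cod => X.val (e.push (P i).incl (P i).incl_inert)) (X := s i)
          (Y := list (fun e => e) (s i).labels) (by simp [labels_list]))
      refine ⟨θ, k1, ?_⟩
      have e : ∀ {P Q S Z : E} {t : P ⟶ Q} {m : Q ⟶ Q} {m' : P ⟶ S} {c : S ⟶ Q} {x : Q ⟶ Z},
          t ≫ m = m' ≫ c → m = 𝟙 _ → t ≫ x = m' ≫ c ≫ x := by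
        intro P Q S Z t m m' c x H H'
        rw [← reassoc_of% H, H', Category.id_comp]
      exact e k2 (mapMap_list _ _ _ _)
    choose θ hθ hθ' using hex
    have h4 : Canon X.val (big l fun i => R i.1) (big l fun i =>
        list (fun e : Elem (P' i).cod => e.push (P' i).incl (P' i).incl_inert) (s i.1).labels)
        (tensHom (fun i : κ' => θ i.1) l) := Canon.bigCongr (S' := fun i : κ' =>
          list (fun e : Elem (P' i).cod => e.push (P' i).incl (P' i).incl_inert) (s i.1).labels) l fun i _ => hθ i.1
    have h5 := canon_mapW (X := X) (hU := hU) (hf := act_comp f g hf hg) h4 f1 (f1.perm h4.perm)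
    have h6 := mapW_comp_of_injective (X := X) (hU := hU) (hf := hf) (hg := hg) hP' l f2
      (fun i => (s i.1).labels) (fun i => hs i.1) (f1.perm h4.perm)
    rw [h6] at h5
    have h7 := (tensHom_comp (fun i : κ' => θ i.1) (fun i : κ' => X.map (P i.1).isUnit (P i.1).res
      (P i.1).res_act (s i.1).labels (hs i.1)) l).symm.trans
      (congrArg (fun φ : ∀ i : κ', _ ⟶ _ => tensHom φ l) (funext fun i : κ' => hθ' i.1))
    have e : ∀ {P Q S Z : E} {a : P ⟶ Q} {b : Q ⟶ S} {x : S ⟶ Z} {y : P ⟶ Z} {c : P ⟶ S},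
        a ≫ b ≫ x = y → a ≫ b = c → y = c ≫ x := by
      intro P Q S Z a b x y c H H'
      rw [← H, reassoc_of% H']
    exact e h5 h7
  have e : ∀ {P Q S S' Z : E} {φ : P ⟶ Q} [IsIso φ] {a : Q ⟶ Z} {b : P ⟶ Z} {s : P ⟶ S} {s' : Q ⟶ S'}
      {φ' : S ⟶ S'} {x : S ⟶ Z} {y : S' ⟶ Z}, φ ≫ a = b → b = s ≫ x → φ ≫ s' = s ≫ φ' → φ' ≫ y = x →
      a = s' ≫ y := by
    intro P Q S S' Z φ _ a b s s' φ' x y H1 H2 H3 H4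
    rw [← cancel_epi φ, H1, H2, reassoc_of% H3, H4]
  exact e e1 key h3 e2

end Mon

end MonComp

/-! ### The action of morphisms between units -/

section MonUnary

variable {C : Type u} [Category.{v} C] [HypermomentData C] [IsHypermoment C]
variable {E : Type u'} [Category.{v'} E] [MonoidalCategory E] [SymmetricCategory E]

open Word

theorem Canon.singleton {ι κ : Type w} (F : ι → E) (c : κ → ι) (a : κ) :
    Canon F (of (c a)) (list c [a]) (ρ_ (F (c a))).inv := by
  have e : ∀ {X Y : E} (f : X ⟶ Y ⊗ 𝟙_ E), f ≫ Y ◁ 𝟙 (𝟙_ E) = f := by intros; simp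
  exact (((Canon.rightUnitInv (F := F) (of (c a))).comp
    ((nilInv (F := F) fun i => of (c i)).whiskerLeft (of (c a)))).of_eq (e _)).compCons
      (S := fun i => of (c i))

namespace Mon

variable {X : Mon C E}

variable (X) in
/-- The action of an active morphism between units. -/
noncomputable def act1 {U U' : C} (hU : IsUnitObj U) (hU' : IsUnitObj U') (g : U ⟶ U')
    (hg : act g) : X.obj U' hU' ⟶ X.obj U hU :=
  X.mapW hU g hg (of (Elem.refl U' hU')) (isFrame_refl hU')

theorem act1_eq {U U' : C} (hU : IsUnitObj U) (hU' : IsUnitObj U') (g : U ⟶ U')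
    (hg : act g) (h : IsFrame [Elem.refl U' hU']) :
    X.act1 hU hU' g hg = (ρ_ (X.obj U' hU')).inv ≫ X.map hU g hg [Elem.refl U' hU'] h :=
  (canon_map (Canon.singleton X.val (fun e => e) (Elem.refl U' hU')) _ h).symm

theorem act1_id {U : C} (hU : IsUnitObj U) (g : U ⟶ U) (hg : act g) (e : g = 𝟙 U) :
    X.act1 hU hU g hg = 𝟙 _ := by
  subst e
  rw [act1_eq hU hU _ _ (isFrame_refl hU), X.map_id]
  exact (ρ_ (X.obj U hU)).inv_hom_id

/-- Compatibility with composition, for pieces which are morphisms of units. -/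
theorem mapW_unary {U A B : C} {hU : IsUnitObj U} {f : U ⟶ A} {g : A ⟶ B} {hf : act f}
    {hg : act g} {k : U ⟶ B} {hk : act k} (hfg : f ≫ g = k) {κ : Type (max u v)} (W : Word κ)
    (c : κ → Elem A) {V : κ → C} {hV : ∀ i, IsUnitObj (V i)}
    {h : ∀ i, V i ⟶ B} {hh : ∀ i, HypermomentData.inert (h i)} (j : ∀ i, (c i).dom ⟶ V i)
    (hj : ∀ i, act (j i)) (w : ∀ i, j i ≫ h i = (c i).hom ≫ g) (hW : IsFrame (W.map c).labels)
    (hW' : IsFrame (W.map fun i => (⟨V i, hV i, h i, hh i⟩ : Elem B)).labels) :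
    X.mapW hU k hk (W.map fun i => (⟨V i, hV i, h i, hh i⟩ : Elem B)) hW' =
      substTo (F := X.val) (F' := X.val) (fun i => of (⟨V i, hV i, h i, hh i⟩ : Elem B)) c
        (fun i => X.act1 (c i).isUnit (hV i) (j i) (hj i)) W ≫ X.mapW hU f hf (W.map c) hW := by
  subst hfg
  let P : κ → Piece g := fun i => ⟨c i, ⟨V i, j i, hj i, h i, hh i, w i⟩⟩
  -- Functoriality produces the inclusions in the form `𝟙 ≫ h`. As the source of the equation
  -- depends on the inclusions, the whole statement is made a predicate of them, and then `𝟙 ≫ h` is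
  -- replaced by `h`.
  let S : (∀ i, V i ⟶ B) → Prop := fun h' => ∀ (hh' : ∀ i, HypermomentData.inert (h' i))
    (hW' : IsFrame (W.map fun i => (⟨V i, hV i, h' i, hh' i⟩ : Elem B)).labels),
    X.mapW hU (f ≫ g) hk (W.map fun i => (⟨V i, hV i, h' i, hh' i⟩ : Elem B)) hW' =
      substTo (F := X.val) (F' := X.val) (fun i => of (⟨V i, hV i, h' i, hh' i⟩ : Elem B)) c
        (fun i => X.act1 (c i).isUnit (hV i) (j i) (hj i)) W ≫ X.mapW hU f hf (W.map c) hW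
  have key : S fun i => 𝟙 (V i) ≫ h i := by
    intro hh' hW'
    have := mapW_comp (X := X) (hU := hU) (hf := hf) (hg := hg) P W hW
      (fun i => of (Elem.refl (V i) (hV i))) (fun i => isFrame_refl (hV i)) hW'
    refine this.trans (congrArg (· ≫ X.mapW hU f hf (W.map c) hW) ?_)
    refine congrArg (fun ψ : ∀ i, X.obj (V i) (hV i) ⟶ X.val (c i) =>
      substTo (F := X.val) (F' := X.val)
        (fun i => of (⟨V i, hV i, 𝟙 (V i) ≫ h i, hh' i⟩ : Elem B)) c ψ W) ?_
    exact funext fun i => Category.id_comp _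
  have e : (fun i => 𝟙 (V i) ≫ h i) = h := funext fun i => Category.id_comp _
  exact (e ▸ key : S h) hh hW'

theorem mapW_precomp_list {U U' B : C} {hU : IsUnitObj U} {b : U ⟶ U'} {f : U' ⟶ B} {hb : act b}
    {hf : act f} {k : U ⟶ B} {hk : act k} (hbf : b ≫ f = k) (hU' : IsUnitObj U')
    {κ : Type (max u v)} (l : List κ) {V : κ → C} {hV : ∀ i, IsUnitObj (V i)}
    {h : ∀ i, V i ⟶ B} {hh : ∀ i, HypermomentData.inert (h i)}
    (hl : IsFrame (list (fun i => (⟨V i, hV i, h i, hh i⟩ : Elem B)) l).labels) :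
    X.mapW hU k hk (list (fun i => (⟨V i, hV i, h i, hh i⟩ : Elem B)) l) hl =
      X.mapW hU' f hf (list (fun i => (⟨V i, hV i, h i, hh i⟩ : Elem B)) l) hl ≫
        X.act1 hU hU' b hb := by
  subst hbf
  let S : (∀ i, V i ⟶ B) → Prop := fun h' => ∀ (hh' : ∀ i, HypermomentData.inert (h' i))
    (hl' : IsFrame (list (fun i => (⟨V i, hV i, h' i, hh' i⟩ : Elem B)) l).labels),
    X.mapW hU (b ≫ f) hk (list (fun i => (⟨V i, hV i, h' i, hh' i⟩ : Elem B)) l) hl' =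
      X.mapW hU' f hf (list (fun i => (⟨V i, hV i, h i, hh i⟩ : Elem B)) l) hl ≫
        X.act1 hU hU' b hb
  have key : S fun i => h i ≫ 𝟙 B := by
    intro hh' hl'
    have := mapW_comp (X := X) (hU := hU) (hf := hb) (hg := hf) (κ := PUnit)
      (fun _ => Piece.whole hU' f hf) (of ⟨⟩) (isFrame_refl hU')
      (fun _ => list (fun i => (⟨V i, hV i, h i, hh i⟩ : Elem B)) l) (fun _ => hl) hl'
    refine this.trans ?_
    have e : ∀ {P Q R : E} {m : P ⟶ P} {x : P ⟶ Q} {y : Q ⟶ R}, m = 𝟙 _ → (m ≫ x) ≫ y = x ≫ y := by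
      intro P Q R m x y H
      rw [H, Category.id_comp]
    exact e (mapMap_list _ _ _ _)
  have e : (fun i => h i ≫ 𝟙 B) = h := funext fun i => Category.comp_id _
  exact (e ▸ key : S h) hh hl

/-- Compatibility with composition with a morphism of units on the left. -/
theorem mapW_precomp {U U' B : C} {hU : IsUnitObj U} {b : U ⟶ U'} {f : U' ⟶ B} {hb : act b}
    {hf : act f} {k : U ⟶ B} {hk : act k} (hbf : b ≫ f = k) (hU' : IsUnitObj U')
    (W : Word (Elem B)) (h : IsFrame W.labels) :
    X.mapW hU k hk W h = X.mapW hU' f hf W h ≫ X.act1 hU hU' b hb := by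
  have hc := can_canon X.val (X := W) (Y := list (fun e => e) W.labels) (by simp [labels_list])
  have h' := h.perm hc.perm
  rw [← canon_mapW hc h h', ← canon_mapW hc h h', Category.assoc]
  exact congrArg (can X.val _ ≫ ·) (mapW_precomp_list (V := Elem.dom) (hV := Elem.isUnit)
    (h := Elem.hom) (hh := Elem.inert) hbf hU' W.labels h')

theorem act1_comp {U U' U'' : C} {hU : IsUnitObj U} {hU' : IsUnitObj U'} {hU'' : IsUnitObj U''}
    {g : U ⟶ U'} {hg : act g} {g' : U' ⟶ U''} {hg' : act g'} {k : U ⟶ U''} {hk : act k}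
    (h : g ≫ g' = k) :
    X.act1 hU' hU'' g' hg' ≫ X.act1 hU hU' g hg = X.act1 hU hU'' k hk :=
  (mapW_precomp h hU' _ _).symm

/-- The action of an isomorphism of units. -/
noncomputable def actIso (X : Mon C E) {U U' : C} (hU : IsUnitObj U) (hU' : IsUnitObj U')
    (g : U ≅ U') : X.obj U' hU' ≅ X.obj U hU where
  hom := X.act1 hU hU' g.hom (IsHypermoment.act_of_isIso _)
  inv := X.act1 hU' hU g.inv (IsHypermoment.act_of_isIso _)
  hom_inv_id := (act1_comp g.inv_hom_id).trans (act1_id (hg := act_id _) _ _ rfl)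
  inv_hom_id := (act1_comp g.hom_inv_id).trans (act1_id (hg := act_id _) _ _ rfl)

end Mon

end MonUnary

/-! ### Naturality over lists and transport of monoid structures -/

section Transport

variable {E : Type u'} [Category.{v'} E] [MonoidalCategory E]

theorem tensReindex_naturality {ι κ : Type*} {G G' : κ → E} (α : ∀ k, G k ⟶ G' k) (c : ι → κ)
    (l : List ι) : tensHom α (l.map c) ≫ tensReindex G' c l =
      tensReindex G c l ≫ tensHom (fun i => α (c i)) l := by
  induction l with
  | nil => rfl
  | cons a l ih =>
    have e : ∀ {A A' B B' D D' : E} {f : A ⟶ A'} {g : B ⟶ B'} {h : B' ⟶ D'} {k : B ⟶ D} {m : D ⟶ D'},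
        g ≫ h = k ≫ m → (f ⊗ₘ g) ≫ A' ◁ h = A ◁ k ≫ (f ⊗ₘ m) := by
      intro A A' B B' D D' f g h k m H
      rw [← id_tensorHom, ← id_tensorHom, tensorHom_comp_tensorHom, tensorHom_comp_tensorHom, H]
      simp
    exact e ih

theorem tensAppend_naturality {ι : Type*} {F F' : ι → E} (α : ∀ i, F i ⟶ F' i) (l' l : List ι) :
    tensHom α (l ++ l') ≫ tensAppend F' l' l =
      tensAppend F l' l ≫ (tensHom α l ⊗ₘ tensHom α l') := by
  induction l with
  | nil =>
    have e : ∀ {A B : E} (f : A ⟶ B), f ≫ (λ_ B).inv = (λ_ A).inv ≫ (𝟙 _ ⊗ₘ f) := by intros; simp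
    exact e _
  | cons a l ih =>
    have e : ∀ {A A' B B' C C' D D' : E} {f : A ⟶ A'} {g : B ⟶ B'} {h : B' ⟶ C' ⊗ D'}
        {k : B ⟶ C ⊗ D} {m : C ⟶ C'} {n : D ⟶ D'}, g ≫ h = k ≫ (m ⊗ₘ n) →
        (f ⊗ₘ g) ≫ A' ◁ h ≫ (α_ A' C' D').inv =
          (A ◁ k ≫ (α_ A C D).inv) ≫ ((f ⊗ₘ m) ⊗ₘ n) := by
      intro A A' B B' C C' D D' f g h k m n H
      rw [← id_tensorHom, ← id_tensorHom, tensorHom_comp_tensorHom_assoc, H, Category.assoc,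
        ← associator_inv_naturality, tensorHom_comp_tensorHom_assoc]
      simp
    exact e ih

theorem tensFlat_naturality {ι κ μ : Type*} {β : ι → Type*} {G G' : κ → E} {F F' : μ → E}
    (α : ∀ k, G k ⟶ G' k) (ζ : ∀ j, F j ⟶ F' j) (c : ι → μ) (m : ∀ a, List (β a))
    (h : ∀ a, β a → κ) {φ : ∀ a, tens (fun b => G (h a b)) (m a) ⟶ F (c a)}
    {φ' : ∀ a, tens (fun b => G' (h a b)) (m a) ⟶ F' (c a)}
    (H : ∀ a, φ a ≫ ζ (c a) = tensHom (fun b => α (h a b)) (m a) ≫ φ' a) (l : List ι) :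
    tensFlat G F c m h φ l ≫ tensHom ζ (l.map c) =
      tensHom α (l.flatMap fun a => (m a).map (h a)) ≫ tensFlat G' F' c m h φ' l := by
  induction l with
  | nil => rfl
  | cons a l ih =>
    have e : ∀ {P P' A A' B B' R R' D D' T T' : E} {s : P ⟶ A ⊗ B} {s' : P' ⟶ A' ⊗ B'} {x : P ⟶ P'}
        {y : A ⟶ A'} {z : B ⟶ B'} {r : A ⟶ R} {r' : A' ⟶ R'} {y' : R ⟶ R'} {f : R ⟶ D} {f' : R' ⟶ D'}
        {d : D ⟶ D'} {t : B ⟶ T} {t' : B' ⟶ T'} {q : T ⟶ T'}, x ≫ s' = s ≫ (y ⊗ₘ z) →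
        y ≫ r' = r ≫ y' → f ≫ d = y' ≫ f' → t ≫ q = z ≫ t' →
        (s ≫ ((r ≫ f) ⊗ₘ t)) ≫ (d ⊗ₘ q) = x ≫ s' ≫ ((r' ≫ f') ⊗ₘ t') := by
      intro P P' A A' B B' R R' D D' T T' s s' x y z r r' y' f f' d t t' q H1 H2 H3 H4
      rw [reassoc_of% H1, Category.assoc, tensorHom_comp_tensorHom, tensorHom_comp_tensorHom,
        reassoc_of% H2, Category.assoc, H3, H4]
    have hr := tensReindex_naturality α (h a) (m a)
    exact e (tensAppend_naturality α _ _) hr (H a) ih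

variable [SymmetricCategory E]

theorem tensSwap_naturality {ι : Type*} {F F' : ι → E} (α : ∀ i, F i ⟶ F' i) (x y : ι)
    (l₂ l₁ : List ι) : tensHom α (l₁ ++ x :: y :: l₂) ≫ tensSwap F' x y l₂ l₁ =
      tensSwap F x y l₂ l₁ ≫ tensHom α (l₁ ++ y :: x :: l₂) := by
  induction l₁ with
  | nil =>
    have e : ∀ {A A' B B' D D' : E} (f : A ⟶ A') (g : B ⟶ B') (h : D ⟶ D'),
        (f ⊗ₘ g ⊗ₘ h) ≫ (α_ A' B' D').inv ≫ (β_ A' B').hom ▷ D' ≫ (α_ B' A' D').hom =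
          ((α_ A B D).inv ≫ (β_ A B).hom ▷ D ≫ (α_ B A D).hom) ≫ (g ⊗ₘ f ⊗ₘ h) := by
      intro A A' B B' D D' f g h
      simp only [Category.assoc, ← associator_naturality]
      rw [associator_inv_naturality_assoc, ← tensorHom_id, ← tensorHom_id,
        tensorHom_comp_tensorHom_assoc, tensorHom_comp_tensorHom_assoc,
        BraidedCategory.braiding_naturality]
      simp
    exact e _ _ _
  | cons a l ih =>
    have e : ∀ {A A' B B' D D' : E} {f : A ⟶ A'} {g : B ⟶ B'} {h : B' ⟶ D'} {k : B ⟶ D} {m : D ⟶ D'},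
        g ≫ h = k ≫ m → (f ⊗ₘ g) ≫ A' ◁ h = A ◁ k ≫ (f ⊗ₘ m) := by
      intro A A' B B' D D' f g h k m H
      rw [← id_tensorHom, ← id_tensorHom, tensorHom_comp_tensorHom, tensorHom_comp_tensorHom, H]
      simp
    exact e ih

variable (C : Type u) [Category.{v} C] [HypermomentData C]

/-- The structure of a monoid on a family of objects indexed by the units. -/
structure MonStr (obj : ∀ U : C, IsUnitObj U → E) where
  /-- The action of the active morphisms. -/
  map : ∀ {U B : C} (hU : IsUnitObj U) (f : U ⟶ B), act f → ∀ l : List (Elem B), IsFrame l →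
    (tens (fun e : Elem B => obj e.dom e.isUnit) l ⟶ obj U hU)
  map_swap : ∀ {U B : C} (hU : IsUnitObj U) (f : U ⟶ B) (hf : act f) (l₁ l₂ : List (Elem B))
    (x y : Elem B) (h : IsFrame (l₁ ++ x :: y :: l₂)) (h' : IsFrame (l₁ ++ y :: x :: l₂)),
    map hU f hf (l₁ ++ x :: y :: l₂) h =
      tensSwap (fun e : Elem B => obj e.dom e.isUnit) x y l₂ l₁ ≫
        map hU f hf (l₁ ++ y :: x :: l₂) h'
  map_id : ∀ (U : C) (hU : IsUnitObj U) (h : IsFrame [Elem.refl U hU]),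
    map hU (𝟙 U) (act_id U) [Elem.refl U hU] h = (ρ_ (obj U hU)).hom
  map_comp : ∀ {U A B : C} (hU : IsUnitObj U) (f : U ⟶ A) (g : A ⟶ B) (hf : act f) (hg : act g)
    (l : List (Piece g)) (m : ∀ p : Piece g, List (Elem p.cod))
    (hl : IsFrame (l.map Piece.toElem)) (hm : ∀ p, IsFrame (m p))
    (hl' : IsFrame (l.flatMap fun p => (m p).map fun e => e.push p.incl p.incl_inert)),
    map hU (f ≫ g) (act_comp f g hf hg)
        (l.flatMap fun p => (m p).map fun e => e.push p.incl p.incl_inert) hl' =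
      tensFlat (fun e : Elem B => obj e.dom e.isUnit) (fun e : Elem A => obj e.dom e.isUnit)
          Piece.toElem m (fun p e => e.push p.incl p.incl_inert)
          (fun p => map p.isUnit p.res p.res_act (m p) (hm p)) l ≫
        map hU f hf (l.map Piece.toElem) hl

variable {C}

/-- The monoid given by a structure of a monoid. -/
abbrev MonStr.toMon {obj : ∀ U : C, IsUnitObj U → E} (S : MonStr C obj) : Mon C E :=
  ⟨obj, S.map, S.map_swap, S.map_id, S.map_comp⟩

/-- Transport of the structure of a monoid along isomorphisms. -/
def Mon.transport (X : Mon C E) {obj : ∀ U : C, IsUnitObj U → E}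
    (θ : ∀ U hU, obj U hU ≅ X.obj U hU) : MonStr C obj where
  map hU f hf l hl := tensHom (fun e : Elem _ => (θ e.dom e.isUnit).hom) l ≫ X.map hU f hf l hl ≫
    (θ _ hU).inv
  map_swap hU f hf l₁ l₂ x y h h' := by
    rw [X.map_swap hU f hf l₁ l₂ x y h h', Category.assoc, ← Category.assoc, tensSwap_naturality,
      Category.assoc]
  map_id U hU h := by
    rw [X.map_id]
    have e : ∀ {A B : E} (i : A ≅ B), (i.hom ⊗ₘ 𝟙 (𝟙_ E)) ≫ (ρ_ B).hom ≫ i.inv = (ρ_ A).hom := by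
      intros; simp
    exact e _
  map_comp hU f g hf hg l m hl hm hl' := by
    have h1 := tensFlat_naturality (fun e : Elem _ => (θ e.dom e.isUnit).hom)
      (fun e : Elem _ => (θ e.dom e.isUnit).hom) Piece.toElem m
      (fun (p : Piece g) e => e.push p.incl p.incl_inert)
      (φ := fun p => tensHom (fun e : Elem _ => (θ e.dom e.isUnit).hom) (m p) ≫
        X.map p.isUnit p.res p.res_act (m p) (hm p) ≫ (θ _ p.isUnit).inv)
      (φ' := fun p => X.map p.isUnit p.res p.res_act (m p) (hm p)) (fun p => by
        have e : ∀ {P Q R S : E} {a : P ⟶ Q} {b : Q ⟶ R} {i : S ≅ R},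
          (a ≫ b ≫ i.inv) ≫ i.hom = a ≫ b := by intros; simp
        exact e) l
    rw [X.map_comp hU f g hf hg l m hl hm hl', Category.assoc, ← Category.assoc, ← h1,
      Category.assoc]
    rfl

/-- The transported monoid is isomorphic to the original one. -/
def Mon.transportIso (X : Mon C E) {obj : ∀ U : C, IsUnitObj U → E}
    (θ : ∀ U hU, obj U hU ≅ X.obj U hU) : (X.transport θ).toMon ≅ X where
  hom := show Mon.Hom _ _ from ⟨fun U hU => (θ U hU).hom, fun hU f hf l h => by
    change (tensHom _ l ≫ X.map hU f hf l h ≫ (θ _ hU).inv) ≫ (θ _ hU).hom = _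
    rw [Category.assoc, Category.assoc, Iso.inv_hom_id, Category.comp_id]⟩
  inv := show Mon.Hom _ _ from ⟨fun U hU => (θ U hU).inv, fun hU f hf l h => by
    change _ = tensHom _ l ≫ tensHom _ l ≫ X.map hU f hf l h ≫ (θ _ hU).inv
    have e := tensHom_comp (fun e : Elem _ => (θ e.dom e.isUnit).inv)
      (fun e : Elem _ => (θ e.dom e.isUnit).hom) l
    rw [← Category.assoc, ← e]
    simp only [Iso.inv_hom_id, tensHom_id]
    exact (Category.id_comp _).symm⟩
  hom_inv_id := Mon.Hom.ext (funext fun U => funext fun hU => (θ U hU).hom_inv_id)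
  inv_hom_id := Mon.Hom.ext (funext fun U => funext fun hU => (θ U hU).inv_hom_id)

end Transport

/-! ### Active morphisms of trees and last objects -/

namespace CTree

section

variable {C : Type u} [Category.{v} C] [HypermomentData C]

/-- The last object of a `C`-tree. -/
abbrev top (T : CTree C) : C := T.arrows.obj (Fin.last _)

/-- The action of an active morphism on the last objects. -/
def topMap {A B : CTree C} (f : A ⟶ B) (hf : IsAct f) : A.top ⟶ B.top :=
  app f (Fin.last _) ≫ B.mp hf.2.1.le

instance {A B : CTree C} (f : A ⟶ B) (hf : IsAct f) : IsIso (topMap f hf) := by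
  have := hf.2.2 (Fin.last _)
  have := B.mp_isIso hf.2.1
  exact inferInstanceAs (IsIso (app f (Fin.last _) ≫ B.mp hf.2.1.le))

/-- The isomorphism between the last objects given by an active morphism. -/
noncomputable def topIso {A B : CTree C} (f : A ⟶ B) (hf : IsAct f) : A.top ≅ B.top :=
  asIso (topMap f hf)

theorem topMap_comp {A B D : CTree C} (f : A ⟶ B) (g : B ⟶ D) (hf : IsAct f) (hg : IsAct g)
    (h : IsAct (f ≫ g)) : topMap (f ≫ g) h = topMap f hf ≫ topMap g hg := by
  simp only [topMap, app_comp, Category.assoc, mp_app_assoc, mp_mp]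
  exact Category.assoc _ _ _

theorem topMap_id (A : CTree C) (h : IsAct (𝟙 A)) : topMap (𝟙 A) h = 𝟙 _ := by
  exact (Category.id_comp _).trans (A.mp_refl (le_refl _))

theorem topIso_comp {A B D : CTree C} (f : A ⟶ B) (g : B ⟶ D) (hf : IsAct f) (hg : IsAct g)
    (h : IsAct (f ≫ g)) : topIso (f ≫ g) h = topIso f hf ≪≫ topIso g hg :=
  Iso.ext (topMap_comp f g hf hg h)

theorem topIso_id (A : CTree C) (h : IsAct (𝟙 A)) : topIso (𝟙 A) h = Iso.refl _ :=
  Iso.ext (topMap_id A h)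

end

section

variable {C : Type u} [Category.{v} C] [HypermomentData C] [IsUnitalHypermoment C]

/-- After `t`, both roots are units with active morphisms to the same object, so unitality gives an
isomorphism of the roots compatible with `t`; the pair is the active morphism. -/
theorem exists_topIso_eq {T T' : CTree C} (hT : T.height = 1)
    (t : T.top ≅ T'.top) : ∃ (k : T ⟶ T') (hk : IsAct k), topIso k hk = t := by
  obtain ⟨e, he, -⟩ := IsUnitalHypermoment.unital_unique T'.top _ _
    (T.mp (Fin.zero_le (Fin.last _)) ≫ t.hom) (T'.mp (Fin.zero_le (Fin.last _))) T.isUnit_root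
    (act_comp _ _ (T.mp_act _) (IsHypermoment.act_of_isIso _)) T'.isUnit_root (T'.mp_act _)
  obtain ⟨k, k0, k1, k0', k1'⟩ := exists_hom (A := T') hT (Fin.zero_le (Fin.last _)) e.hom t.hom
    (IsHypermoment.inert_of_isIso _) (IsHypermoment.inert_of_isIso _) he.symm
  have := T'.mp_isIso k0
  have := T'.mp_isIso k1
  have hk : IsAct k := by
    refine ⟨k0, k1, fun i => ?_⟩
    obtain rfl | rfl := eq_zero_or_last hT i
    · have : IsIso (app k 0 ≫ T'.mp k0.le) := by rw [k0']; infer_instance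
      exact IsIso.of_isIso_comp_right (app k 0) (T'.mp k0.le)
    · have : IsIso (app k (Fin.last _) ≫ T'.mp k1.le) := by rw [k1']; infer_instance
      exact IsIso.of_isIso_comp_right (app k (Fin.last _)) (T'.mp k1.le)
  exact ⟨k, hk, Iso.ext k1'⟩

/-- The root component is an isomorphism of units over the last object of `T'`, and unitality
permits only one. -/
theorem eq_of_topIso_eq {T T' : CTree C} (hT : T.height = 1)
    {k k' : T ⟶ T'} (hk : IsAct k) (hk' : IsAct k') (h : topIso k hk = topIso k' hk') : k = k' := by
  have h1 : topMap k hk = topMap k' hk' := congrArg Iso.hom h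
  have h0 : ∀ (k : T ⟶ T') (hk : IsAct k), (app k 0 ≫ T'.mp hk.1.le) ≫ T'.mp (Fin.zero_le _) =
      T.mp (Fin.zero_le (Fin.last _)) ≫ topMap k hk := by
    intro k hk
    rw [topMap, Category.assoc, mp_mp, mp_app_assoc, mp_mp]
  have hiso : ∀ (k : T ⟶ T') (hk : IsAct k), IsIso (app k 0 ≫ T'.mp hk.1.le) := by
    intro k hk
    have := hk.2.2 0
    have := T'.mp_isIso hk.1
    infer_instance
  have := hiso k hk
  have := hiso k' hk'
  have h2 := (IsUnitalHypermoment.unital_unique T'.top _ _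
    (T.mp (Fin.zero_le (Fin.last _)) ≫ topMap k hk) (T'.mp (Fin.zero_le (Fin.last _))) T.isUnit_root
    (act_comp _ _ (T.mp_act _) (IsHypermoment.act_of_isIso _)) T'.isUnit_root
    (T'.mp_act _)).unique (y₁ := asIso (app k 0 ≫ T'.mp hk.1.le))
    (y₂ := asIso (app k' 0 ≫ T'.mp hk'.1.le)) (h0 k hk) ((h0 k' hk').trans (by rw [h1]))
  have h3 : app k 0 ≫ T'.mp hk.1.le = app k' 0 ≫ T'.mp hk'.1.le := congrArg Iso.hom h2
  have e0 : idx k 0 = idx k' 0 := hk.1.trans hk'.1.symm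
  have e1 : idx k (Fin.last _) = idx k' (Fin.last _) := hk.2.1.trans hk'.2.1.symm
  refine hom_ext_one hT e0 e1 ?_ ?_
  · have := T'.mp_isIso hk'.1
    rw [← cancel_mono (T'.mp hk'.1.le), Category.assoc, mp_mp, h3]
  · have := T'.mp_isIso hk'.2.1
    rw [← cancel_mono (T'.mp hk'.2.1.le), Category.assoc, mp_mp]
    exact h1

end

end CTree

/-! ### Monoids normalised to depend on the last object only -/

section TreeMon

open Word

namespace Mon.Hom

variable {C : Type u} [Category.{v} C] [HypermomentData C] [IsHypermoment C]
variable {E : Type u'} [Category.{v'} E] [MonoidalCategory E] [SymmetricCategory E]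

theorem mapW_naturality {X Y : Mon C E} (φ : X ⟶ Y) {U B : C} (hU : IsUnitObj U) (f : U ⟶ B)
    (hf : act f) (W : Word (Elem B)) (h : IsFrame W.labels) :
    X.mapW hU f hf W h ≫ Mon.Hom.at φ U hU =
      evalMap (fun e : Elem B => Mon.Hom.at φ e.dom e.isUnit) W ≫ Y.mapW hU f hf W h := by
  have hc := can_canon X.val (X := W) (Y := list (fun e => e) W.labels) (by simp [labels_list])
  obtain ⟨θ, h1, h2⟩ := hc.exists_evalMap (G := Y.val)
    fun e : Elem B => Mon.Hom.at φ e.dom e.isUnit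
  have h3 := Mon.canon_map (X := Y) (hU := hU) (hf := hf) h1 h h
  have h4 := Mon.Hom.naturality φ hU f hf W.labels h
  have e : ∀ {P Q R S Z : E} {a : P ⟶ Q} {t : Q ⟶ S} {d : S ⟶ Z} {x : P ⟶ R} {θ : R ⟶ S} {y : R ⟶ Z},
      a ≫ t = x ≫ θ → θ ≫ d = y → a ≫ t ≫ d = x ≫ y := by
    intro P Q R S Z a t d x θ y H H'
    rw [reassoc_of% H, H']
  exact ((Category.assoc _ _ _).trans (congrArg (can X.val _ ≫ ·) h4)).trans (e h2 h3)

theorem act1_naturality {X Y : Mon C E} (φ : X ⟶ Y) {U U' : C} (hU : IsUnitObj U)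
    (hU' : IsUnitObj U') (g : U ⟶ U') (hg : act g) :
    X.act1 hU hU' g hg ≫ Mon.Hom.at φ U hU = Mon.Hom.at φ U' hU' ≫ Y.act1 hU hU' g hg :=
  mapW_naturality φ hU g hg _ _

end Mon.Hom

variable (C : Type u) [Category.{v} C] [HypermomentData C] [IsUnitalHypermoment C]
variable (E : Type u') [Category.{v'} E] [MonoidalCategory E] [SymmetricCategory E]

/-- Monoids over the plus construction whose values on the units only depend on the last object
of the unit. -/
structure TreeMon where
  /-- The values. -/
  coll : Core C ⥤ E
  /-- The action of the active morphisms. -/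
  str : MonStr (E := E) (CTree C) fun T _ => coll.obj ⟨T.top⟩
  act1_eq : ∀ {T T' : CTree C} (hT : IsUnitObj T) (hT' : IsUnitObj T') (g : T ⟶ T') (hg : act g),
    str.toMon.act1 hT hT' g hg = coll.map ⟨(CTree.topIso g hg).symm⟩

variable {C E}

namespace TreeMon

/-- Morphisms of normalized monoids. -/
@[ext]
structure Hom (S S' : TreeMon C E) where
  /-- The underlying natural transformation. -/
  app : S.coll ⟶ S'.coll
  naturality : ∀ {U B : CTree C} (hU : IsUnitObj U) (f : U ⟶ B) (hf : act f) (l : List (Elem B))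
    (h : IsFrame l), S.str.map hU f hf l h ≫ app.app ⟨U.top⟩ =
      tensHom (fun e : Elem B => app.app ⟨e.dom.top⟩) l ≫ S'.str.map hU f hf l h

instance : Category (TreeMon C E) where
  Hom := Hom
  id S := ⟨𝟙 _, fun hU f hf l h => by simp only [NatTrans.id_app, tensHom_id]; simp⟩
  comp φ ψ := ⟨φ.app ≫ ψ.app, fun hU f hf l h => by
    simp only [NatTrans.comp_app]
    rw [← Category.assoc, φ.naturality, Category.assoc, ψ.naturality, tensHom_comp,
      Category.assoc]⟩
  id_comp φ := Hom.ext (Category.id_comp φ.app)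
  comp_id φ := Hom.ext (Category.comp_id φ.app)
  assoc φ ψ χ := Hom.ext (Category.assoc φ.app ψ.app χ.app)

/-- The underlying monoid of a normalized monoid. -/
def toMon : TreeMon C E ⥤ Mon (CTree C) E where
  obj S := S.str.toMon
  map φ := show Mon.Hom _ _ from ⟨fun T _ => (Hom.app φ).app ⟨T.top⟩, Hom.naturality φ⟩

theorem exists_corolla (A : C) : ∃ (U : C) (_ : IsUnitObj U) (u : U ⟶ A), act u :=
  let ⟨U, f, hU, hf⟩ := IsUnitalHypermoment.unital A
  ⟨U, hU, f, hf⟩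

/-- A unit with last object `A`. -/
noncomputable def cor (A : C) : CTree C :=
  CTree.corolla (exists_corolla A).choose_spec.choose
    (exists_corolla A).choose_spec.choose_spec.choose
    (exists_corolla A).choose_spec.choose_spec.choose_spec

theorem cor_isUnit (A : C) : IsUnitObj (cor A) := CTree.isUnitObj_of_height rfl

/-- Each isomorphism of last objects is realised by an active morphism of unit trees, for which
naturality of `φ` is known. The action is contravariant, whence the passage to `t.symm`. -/
theorem hom_naturality {S S' : TreeMon C E} (φ : toMon.obj S ⟶ toMon.obj S') {T T' : CTree C}
    (hT : IsUnitObj T) (hT' : IsUnitObj T') (t : T.top ≅ T'.top) :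
    S.coll.map ⟨t⟩ ≫ Mon.Hom.app φ T' hT' = Mon.Hom.app φ T hT ≫ S'.coll.map ⟨t⟩ := by
  obtain ⟨k, hk, h⟩ := CTree.exists_topIso_eq (CTree.height_of_isUnitObj hT')
    t.symm
  have h1 := Mon.Hom.act1_naturality φ hT' hT k hk
  have h2 := S.act1_eq hT' hT k hk
  have h3 := S'.act1_eq hT' hT k hk
  rw [h] at h2 h3
  exact (congrArg (· ≫ Mon.Hom.app φ T' hT') h2).symm.trans
    (h1.trans (congrArg (Mon.Hom.app φ T hT ≫ ·) h3))

instance : (toMon : TreeMon C E ⥤ _).Faithful where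
  map_injective {S S'} φ ψ h := by
    refine Hom.ext (NatTrans.ext (funext fun A => ?_))
    exact congrFun (congrFun (congrArg Mon.Hom.app h) (cor A.of)) (cor_isUnit A.of)

/-- By naturality for the identity of the last object, the component at `T` equals the one at the
chosen corolla `cor T.top`, so the components form a natural transformation on `Core C`. -/
instance : (toMon : TreeMon C E ⥤ _).Full where
  map_surjective {S S'} φ := by
    have key : ∀ (T : CTree C) (hT : IsUnitObj T),
        Mon.Hom.app φ (cor T.top) (cor_isUnit _) = Mon.Hom.app φ T hT := by
      intro T hT
      have := hom_naturality φ (cor_isUnit T.top) hT (Iso.refl T.top)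
      have e1 : S.coll.map ⟨Iso.refl T.top⟩ = 𝟙 _ := S.coll.map_id ⟨T.top⟩
      have e2 : S'.coll.map ⟨Iso.refl T.top⟩ = 𝟙 _ := S'.coll.map_id ⟨T.top⟩
      exact ((congrArg (Mon.Hom.app φ (cor T.top) (cor_isUnit _) ≫ ·) e2).trans
        (Category.comp_id _)).symm.trans (this.symm.trans
          ((congrArg (· ≫ Mon.Hom.app φ T hT) e1).trans (Category.id_comp _)))
    refine ⟨(⟨⟨fun A => Mon.Hom.app φ (cor A.of) (cor_isUnit _), fun A A' t =>
      hom_naturality φ (cor_isUnit A.of) (cor_isUnit A'.of) t.iso⟩, ?_⟩ : Hom S S'), ?_⟩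
    · intro U B hU f hf l h
      have := Mon.Hom.naturality φ hU f hf l h
      simp only [key U hU]
      refine this.trans ?_
      refine congrArg (fun ζ : ∀ e : Elem B, _ ⟶ _ => tensHom ζ l ≫ S'.str.map hU f hf l h) ?_
      exact funext fun e => (key e.dom e.isUnit).symm
    · exact Mon.Hom.ext (funext fun T => funext fun hT => key T hT)

/-- The collection underlying a monoid over the plus construction. -/
noncomputable def collOf (X : Mon (CTree C) E) : Core C ⥤ E where
  obj A := X.obj (cor A.of) (cor_isUnit _)
  map {A B} t := X.act1 (cor_isUnit B.of) (cor_isUnit A.of)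
    (CTree.exists_topIso_eq (T := cor B.of) (T' := cor A.of) rfl t.iso.symm).choose
    (CTree.exists_topIso_eq (T := cor B.of) (T' := cor A.of) rfl t.iso.symm).choose_spec.choose
  map_id A := by
    refine Mon.act1_id _ _ _ ?_
    generalize_proofs h
    refine CTree.eq_of_topIso_eq rfl h.choose_spec.choose (CTree.isAct_id _) ?_
    rw [h.choose_spec.choose_spec, CTree.topIso_id]
    rfl
  map_comp {A B D} t t' := by
    refine (Mon.act1_comp ?_).symm
    generalize_proofs h h1 h2
    refine CTree.eq_of_topIso_eq rfl (CTree.isAct_comp _ _ h.choose_spec.choose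
      h1.choose_spec.choose) h2.choose_spec.choose ?_
    rw [CTree.topIso_comp _ _ h.choose_spec.choose h1.choose_spec.choose, h.choose_spec.choose_spec, h1.choose_spec.choose_spec,
      h2.choose_spec.choose_spec]
    rfl

/-- The choice in `collOf` is harmless: an active morphism between unit trees is determined by its
effect on last objects. -/
theorem collOf_map (X : Mon (CTree C) E) {A B : Core C} (t : A ⟶ B) (k : cor B.of ⟶ cor A.of)
    (hk : CTree.IsAct k) (h : CTree.topIso k hk = t.iso.symm) :
    (collOf X).map t = X.act1 (cor_isUnit B.of) (cor_isUnit A.of) k hk := by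
  have e := (CTree.exists_topIso_eq (T := cor B.of) (T' := cor A.of) rfl t.iso.symm).choose_spec
  have : (CTree.exists_topIso_eq (T := cor B.of) (T' := cor A.of) rfl t.iso.symm).choose = k :=
    CTree.eq_of_topIso_eq rfl e.choose hk (e.choose_spec.trans h.symm)
  simp only [collOf, this]

theorem exists_iso_cor (T : CTree C) (hT : IsUnitObj T) : ∃ (e : T ≅ cor T.top),
    CTree.topIso e.hom (CTree.isAct_of_isIso _) = Iso.refl _ ∧
    CTree.topIso e.inv (CTree.isAct_of_isIso _) = Iso.refl _ := by
  have hT := CTree.height_of_isUnitObj hT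
  obtain ⟨k, hk, h⟩ := CTree.exists_topIso_eq (T' := cor T.top) hT (Iso.refl _)
  obtain ⟨k', hk', h'⟩ := CTree.exists_topIso_eq (T := cor T.top) (T' := T) rfl (Iso.refl _)
  refine ⟨⟨k, k', ?_, ?_⟩, h, h'⟩
  · refine CTree.eq_of_topIso_eq hT (CTree.isAct_comp _ _ hk hk') (CTree.isAct_id _) ?_
    rw [CTree.topIso_comp _ _ hk hk', h, h', CTree.topIso_id]
    exact Iso.refl_trans _
  · refine CTree.eq_of_topIso_eq rfl (CTree.isAct_comp _ _ hk' hk) (CTree.isAct_id _) ?_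
    rw [CTree.topIso_comp _ _ hk' hk, h, h', CTree.topIso_id]
    exact Iso.refl_trans _

/-- Each unit tree has an isomorphism to the chosen corolla with the same last object that is the
identity on last objects. Transporting `X` along these makes its values depend on last objects only.
-/
instance : (toMon : TreeMon C E ⥤ _).EssSurj where
  mem_essImage X := by
    let e : ∀ (T : CTree C) (hT : IsUnitObj T), T ≅ cor T.top := fun T hT =>
      (exists_iso_cor T hT).choose
    have he : ∀ (T : CTree C) (hT : IsUnitObj T),
        CTree.topIso (e T hT).hom (CTree.isAct_of_isIso _) = Iso.refl _ ∧
        CTree.topIso (e T hT).inv (CTree.isAct_of_isIso _) = Iso.refl _ := fun T hT =>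
      (exists_iso_cor T hT).choose_spec
    let θ : ∀ (T : CTree C) (hT : IsUnitObj T), (collOf X).obj ⟨T.top⟩ ≅ X.obj T hT := fun T hT =>
      X.actIso hT (cor_isUnit _) (e T hT)
    let S : TreeMon C E :=
      { coll := collOf X
        str := X.transport θ
        act1_eq := by
          intro T T' hT hT' g hg
          have h1 := Mon.Hom.act1_naturality (X.transportIso θ).hom hT hT' g hg
          have h1' : (X.transport θ).toMon.act1 hT hT' g hg ≫ (θ T hT).hom =
            (θ T' hT').hom ≫ X.act1 hT hT' g hg := h1
          have h2 : (X.transport θ).toMon.act1 hT hT' g hg =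
              ((θ T' hT').hom ≫ X.act1 hT hT' g hg) ≫ (θ T hT).inv := by
            rw [← h1', Category.assoc, Iso.hom_inv_id, Category.comp_id]
          have a1 := CTree.isAct_of_isIso (e T hT).inv
          have a2 : CTree.IsAct ((e T hT).inv ≫ g) := CTree.isAct_comp _ _ a1 hg
          have a3 := CTree.isAct_of_isIso (e T' hT').hom
          have a4 : CTree.IsAct (((e T hT).inv ≫ g) ≫ (e T' hT').hom) := CTree.isAct_comp _ _ a2 a3
          rw [h2, collOf_map X _ (((e T hT).inv ≫ g) ≫ (e T' hT').hom) a4 ?_]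
          · have h3 := Mon.act1_comp (X := X) (hU := hT) (hU' := hT') (hU'' := cor_isUnit _)
              (g := g) (hg := hg) (g' := (e T' hT').hom) (hg' := a3) (k := g ≫ (e T' hT').hom)
              (hk := act_comp _ _ hg a3) rfl
            have h4 := Mon.act1_comp (X := X) (hU := cor_isUnit _) (hU' := hT)
              (hU'' := cor_isUnit _) (g := (e T hT).inv) (hg := a1) (g' := g ≫ (e T' hT').hom)
              (hg' := act_comp _ _ hg a3) (k := ((e T hT).inv ≫ g) ≫ (e T' hT').hom) (hk := a4)
              (Category.assoc _ _ _).symm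
            exact (congrArg (· ≫ (θ T hT).inv) h3).trans h4
          · rw [CTree.topIso_comp _ _ a2 a3, CTree.topIso_comp _ _ a1 hg, (he T hT).2, (he T' hT').1]
            exact (Iso.trans_refl _).trans (Iso.refl_trans _) }
    exact ⟨S, ⟨X.transportIso θ⟩⟩

instance : (toMon : TreeMon C E ⥤ _).IsEquivalence where

end TreeMon

end TreeMon

/-! ### Vertices of trees of small height -/

namespace CTree

section

variable {C : Type u} [Category.{v} C] [HypermomentData C] [IsHypermoment C]

/-- The elementary inert morphism into the source of a vertex. -/
def levelElem {T : CTree C} (e : Elem T) (k : Fin (T.height + 1)) (h : idx e.hom 0 = k) :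
    Elem (T.arrows.obj k) where
  dom := e.dom.arrows.obj 0
  isUnit := e.dom.isUnit_root
  hom := app e.hom 0 ≫ T.mp h.le
  inert := inert_comp _ _ (app_inert _ _)
    (haveI := T.mp_isIso h; IsHypermoment.inert_of_isIso _)

theorem idx_last_of_elem {T : CTree C} (e : Elem T) :
    (idx e.hom (Fin.last _) : ℕ) = idx e.hom 0 + 1 := by
  have h := isInert_idx e.inert (Fin.last _)
  have h' := height_of_isUnitObj e.isUnit
  exact h.trans (congrArg ((idx e.hom 0 : ℕ) + ·) h')

theorem idx_zero_lt {T : CTree C} (e : Elem T) : (idx e.hom 0 : ℕ) < T.height := by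
  have h1 := idx_last_of_elem e
  have h2 := (idx e.hom (Fin.last _)).isLt
  omega

/-- An elementary inert morphism into a tree is classified by its level together with its root
component, which is elementary inert into `T_k`. This reduces frames of a tree to frames of its
objects. -/
theorem pt_eq_of_level {T : CTree C} (e : Elem T) (k : Fin T.height)
    (h : idx e.hom 0 = k.castSucc) : e.pt = (⟨k, (levelElem e k.castSucc h).pt⟩ : T.Vertex) := by
  obtain ⟨⟨m, arr, hact, root⟩, hU, hom, hom_inert⟩ := e
  obtain rfl : m = 1 := height_of_isUnitObj hU
  obtain ⟨x, hx⟩ := Elem.exists_mem_dom (levelElem ⟨⟨1, arr, hact, root⟩, hU, hom, hom_inert⟩ _ h)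
  refine Elem.pt_eq _ (x := (⟨(0 : Fin 1), x⟩ : Vertex ⟨1, arr, hact, root⟩)) ?_
  have h1 : (idx hom (Fin.last 1) : ℕ) = idx hom 0 + 1 := idx_last_of_elem
    (T := T) ⟨⟨1, arr, hact, root⟩, hU, hom, hom_inert⟩
  refine ⟨h.le, ?_, ?_⟩
  · have h2 : idx hom 0 = k.castSucc := h
    rw [Fin.le_def]
    change (k : ℕ) + 1 ≤ (idx hom (Fin.last 1) : ℕ)
    rw [h1, h2]
    rfl
  · have := Elem.sub_hom (levelElem ⟨⟨1, arr, hact, root⟩, hU, hom, hom_inert⟩ _ h) x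
    exact this ▸ rfl

theorem level_pt {T : CTree C} (e : Elem T) (k : Fin T.height) (a) (h : e.pt = (⟨k, a⟩ : T.Vertex)) :
    idx e.hom 0 = k.castSucc := by
  have h' := pt_eq_of_level e ⟨_, idx_zero_lt e⟩ rfl
  rw [h] at h'
  rw [(Vertex.mk.inj h').1]
  rfl

theorem isFrame_nil {T : CTree C} (hT : T.height = 0) : IsFrame ([] : List (Elem T)) :=
  (isFrame_iff _).2 ⟨fun a => (finZeroElim (α := fun _ => False) (hT ▸ a.level)).elim, by simp⟩

variable {U A B : C} {hU : IsUnitObj U} {u : U ⟶ A} {f : A ⟶ B} {hu : act u} {hf : act f}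

theorem corolla_isUnit : IsUnitObj (corolla hU u hu) := isUnitObj_of_height rfl

/-- The root being a unit, there is a single vertex at level `0`; the vertices at level `1` are the
elements of `γ(A)`, that is, the pieces in a frame of `f`. -/
theorem isFrame_triangle {l : List (Piece f)} (hl : IsFrame (l.map Piece.toElem)) :
    IsFrame (rootVertex hU u f hu hf corolla_isUnit ::
      l.map fun p => pieceVertex hU u f hu hf p corolla_isUnit) := by
  rw [isFrame_iff] at hl ⊢
  obtain ⟨x, -, hx⟩ := hU.1
  have h0 : (rootVertex hU u f hu hf corolla_isUnit).pt =
      (⟨(0 : Fin 2), x⟩ : (triangle hU u f hu hf).Vertex) := by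
    rw [pt_eq_of_level _ (0 : Fin 2) rfl]
    congr 1
    exact hx _ trivial
  have h1 : ∀ p : Piece f, (pieceVertex hU u f hu hf p corolla_isUnit).pt =
      (⟨(1 : Fin 2), p.toElem.pt⟩ : (triangle hU u f hu hf).Vertex) := by
    intro p
    rw [pt_eq_of_level _ (1 : Fin 2) rfl]
    congr 1
    have e : ∀ (i : p.dom ⟶ A) (hi : HypermomentData.inert i), i = p.hom →
        (⟨p.dom, p.isUnit, i, hi⟩ : Elem A).pt = p.toElem.pt := by
      rintro i hi rfl
      rfl
    refine e _ _ ?_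
    exact (congrArg (p.hom ≫ ·) (mp_refl (triangle hU u f hu hf) (i := (1 : Fin 3)) _)).trans
      (Category.comp_id p.hom)
  constructor
  · rintro ⟨k, a⟩
    obtain rfl | rfl : k = (0 : Fin 2) ∨ k = (1 : Fin 2) := by
      revert k; exact fun k _ => (by decide : ∀ k : Fin 2, k = 0 ∨ k = 1) k
    · exact ⟨_, List.mem_cons_self, h0.trans (congrArg _ (hx a trivial).symm)⟩
    · obtain ⟨e, he, rfl⟩ := hl.1 a
      obtain ⟨p, hp, rfl⟩ := List.mem_map.1 he
      exact ⟨_, List.mem_cons_of_mem _ (List.mem_map_of_mem hp), h1 p⟩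
  · rw [List.map_cons, List.nodup_cons]
    constructor
    · intro hm
      obtain ⟨_, he, hp⟩ := List.mem_map.1 hm
      obtain ⟨p, -, rfl⟩ := List.mem_map.1 he
      have := (h1 p).symm.trans (hp.trans h0)
      exact absurd (congrArg Fin.val (Vertex.mk.inj this).1) Nat.one_ne_zero
    · have h2 := hl.2.map (f := fun a => (⟨(1 : Fin 2), a⟩ : (triangle hU u f hu hf).Vertex))
        fun a b h => eq_of_heq (Vertex.mk.inj h).2
      have h3 : ∀ l : List (Piece f),
          ((l.map fun p => pieceVertex hU u f hu hf p corolla_isUnit).map Elem.pt) =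
            ((l.map Piece.toElem).map Elem.pt).map
              fun a => (⟨(1 : Fin 2), a⟩ : (triangle hU u f hu hf).Vertex) := by
        intro l
        induction l with
        | nil => rfl
        | cons p l ih => exact congrArg₂ List.cons (h1 p) ih
      exact (congrArg List.Nodup (h3 l)).mpr h2

/-- The morphism `(φ, (a, b, c)) : ([2], U ⟶ A ⟶ B) ⟶ T` of `C`-trees with `φ(0) = k`, `φ(1) = l`
and `φ(2) = m`. -/
def ofTriangle (hU : IsUnitObj U) (u : U ⟶ A) (f : A ⟶ B) (hu : act u) (hf : act f) (T : CTree C)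
    (k l m : Fin (T.height + 1)) (hkl : k ≤ l) (hlm : l ≤ m) (a : U ⟶ T.arrows.obj k)
    (b : A ⟶ T.arrows.obj l) (c : B ⟶ T.arrows.obj m) (ha : HypermomentData.inert a)
    (hb : HypermomentData.inert b) (hc : HypermomentData.inert c)
    (w : u ≫ b = a ≫ T.mp hkl) (w' : f ≫ c = b ≫ T.mp hlm) : triangle hU u f hu hf ⟶ T :=
  show Hom _ _ from
  { idx := ⟨fun i : Fin 3 => match i with
        | 0 => k
        | 1 => l
        | 2 => m, by
      intro i j hij
      fin_cases i <;> fin_cases j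
      · exact le_refl k
      · exact hkl
      · exact hkl.trans hlm
      · exact absurd (show (1 : Fin 3) ≤ 0 from hij) (by decide)
      · exact le_refl l
      · exact hlm
      · exact absurd (show (2 : Fin 3) ≤ 0 from hij) (by decide)
      · exact absurd (show (2 : Fin 3) ≤ 1 from hij) (by decide)
      · exact le_refl m⟩
    app := fun i : Fin 3 => match i with
      | 0 => a
      | 1 => b
      | 2 => c
    inert_app := fun i : Fin 3 => match i with
      | 0 => ha
      | 1 => hb
      | 2 => hc
    naturality := by
      intro i j h
      fin_cases i <;> fin_cases j
      · exact (Category.id_comp a).trans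
          ((Category.comp_id a).symm.trans (congrArg (a ≫ ·) (T.arrows.map_id k).symm))
      · exact w
      · exact (Category.assoc u f c).trans ((congrArg (u ≫ ·) w').trans
          (comp_comp_eq w (T.mp_mp hkl hlm)))
      · exact absurd (show (1 : Fin 3) ≤ 0 from h) (by decide)
      · exact (Category.id_comp b).trans
          ((Category.comp_id b).symm.trans (congrArg (b ≫ ·) (T.arrows.map_id l).symm))
      · exact w'
      · exact absurd (show (2 : Fin 3) ≤ 0 from h) (by decide)
      · exact absurd (show (2 : Fin 3) ≤ 1 from h) (by decide)
      · exact (Category.id_comp c).trans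
          ((Category.comp_id c).symm.trans (congrArg (c ≫ ·) (T.arrows.map_id m).symm)) }

section

variable {T : CTree C} {k l m : Fin (T.height + 1)} {hkl : k ≤ l} {hlm : l ≤ m}
  {a : U ⟶ T.arrows.obj k} {b : A ⟶ T.arrows.obj l} {c : B ⟶ T.arrows.obj m}
  {ha : HypermomentData.inert a} {hb : HypermomentData.inert b} {hc : HypermomentData.inert c}
  {w : u ≫ b = a ≫ T.mp hkl} {w' : f ≫ c = b ≫ T.mp hlm}

theorem ofTriangle_isAct (hk : k = 0) (hm : m = Fin.last _) (hia : IsIso a) (hib : IsIso b)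
    (hic : IsIso c) : IsAct (ofTriangle hU u f hu hf T k l m hkl hlm a b c ha hb hc w w') :=
  ⟨hk, hm, fun i : Fin 3 => match i with
    | 0 => hia
    | 1 => hib
    | 2 => hic⟩

theorem ofTriangle_isInert (hl : (l : ℕ) = k + 1) (hm : (m : ℕ) = l + 1) :
    IsInert (ofTriangle hU u f hu hf T k l m hkl hlm a b c ha hb hc w w') :=
  fun i : Fin 2 => match i with
    | 0 => hl
    | 1 => hm

end

/-- Morphisms with the same components from a corolla are equal. -/
theorem corolla_hom_ext {T : CTree C} {g g' : corolla hU u hu ⟶ T} {k l : Fin (T.height + 1)}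
    (h0 : idx g (0 : Fin 2) = k) (h1 : idx g (1 : Fin 2) = l) (h0' : idx g' (0 : Fin 2) = k)
    (h1' : idx g' (1 : Fin 2) = l)
    (e0 : app g (0 : Fin 2) ≫ T.mp h0.le = app g' (0 : Fin 2) ≫ T.mp h0'.le)
    (e1 : app g (1 : Fin 2) ≫ T.mp h1.le = app g' (1 : Fin 2) ≫ T.mp h1'.le) : g = g' := by
  have e : ∀ (i : Fin 2) (k : Fin (T.height + 1)) (h : idx g i = k) (h' : idx g' i = k),
      app g i ≫ T.mp h.le = app g' i ≫ T.mp h'.le → ∀ h'' : idx g i ≤ idx g' i,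
      app g i ≫ T.mp h'' = app g' i := by
    rintro i k h rfl H h''
    exact H.trans ((congrArg (app g' i ≫ ·) (T.mp_refl (le_refl _))).trans (Category.comp_id _))
  exact hom_ext_one rfl (h0.trans h0'.symm) (h1.trans h1'.symm) (e _ _ h0 h0' e0 _)
    (e _ _ h1 h1' e1 _)

end

end CTree

namespace CTree

section

variable {C : Type u} [Category.{v} C] [HypermomentData C] [IsHypermoment C]

/-- The morphism `([0], U) ⟶ T` given by an inert morphism `U ⟶ T_k`. -/
def ofEdge {U : C} (hU : IsUnitObj U) (T : CTree C) (k : Fin (T.height + 1))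
    (a : U ⟶ T.arrows.obj k) (ha : HypermomentData.inert a) : edge U hU ⟶ T :=
  show Hom _ _ from
  { idx := ⟨fun _ => k, fun _ _ _ => le_refl k⟩
    app := fun _ => a
    inert_app := fun _ => ha
    naturality := fun i j h => by
      obtain rfl : i = (0 : Fin 1) := Subsingleton.elim (α := Fin 1) _ _
      obtain rfl : j = (0 : Fin 1) := Subsingleton.elim (α := Fin 1) _ _
      exact (Category.id_comp a).trans
        ((Category.comp_id a).symm.trans (congrArg (a ≫ ·) (T.arrows.map_id k).symm)) }

theorem ofEdge_isInert {U : C} (hU : IsUnitObj U) (T : CTree C) (k : Fin (T.height + 1))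
    (a : U ⟶ T.arrows.obj k) (ha : HypermomentData.inert a) : IsInert (ofEdge hU T k a ha) :=
  fun i : Fin 0 => i.elim0

variable {U A U' A' : C} {hU : IsUnitObj U} {u : U ⟶ A} {hu : act u} {hU' : IsUnitObj U'}
  {u' : U' ⟶ A'} {hu' : act u'} {s : U ≅ U'} {t : A ≅ A'} {w : u ≫ t.hom = s.hom ≫ u'}

theorem topIso_corollaMap (h : IsAct (corollaMap hU u hu hU' u' hu' s t w)) :
    topIso (corollaMap hU u hu hU' u' hu' s t w) h = t :=
  Iso.ext ((congrArg (t.hom ≫ ·) ((corolla hU' u' hu').mp_refl (i := (1 : Fin 2)) _)).trans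
    (Category.comp_id t.hom))

end

end CTree

section Words

variable {E : Type u'} [Category.{v'} E] [MonoidalCategory E] [SymmetricCategory E]

open Word

theorem Canon.tensUnit {ι κ : Type w} (F : ι → E) (l : List κ) :
    Canon F (big l fun _ => one) one (tensUnit l) := by
  induction l with
  | nil => exact .nilComp (.id _)
  | cons a l ih => exact .consComp ((Canon.leftUnit _).comp ih)

variable {C : Type u} [Category.{v} C] [HypermomentData C] [IsHypermoment C]

namespace Mon

variable {X : Mon C E}

theorem mapW_of {U U' : C} {hU : IsUnitObj U} {hU' : IsUnitObj U'} {f : U ⟶ U'} {hf : act f}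
    {i : U' ⟶ U'} {hi : HypermomentData.inert i} (e : i = 𝟙 U')
    (H : IsFrame (of (⟨U', hU', i, hi⟩ : Elem U')).labels) :
    X.mapW hU f hf (of (⟨U', hU', i, hi⟩ : Elem U')) H = X.act1 hU hU' f hf := by
  subst e
  rfl

end Mon

end Words

/-! ### Units and multiplications of the operad underlying a normalised monoid -/

section MulT

variable {C : Type u} [Category.{v} C] [HypermomentData C] [IsUnitalHypermoment C]
variable {E : Type u'} [Category.{v'} E] [MonoidalCategory E] [SymmetricCategory E]

open Word CTree

namespace TreeMon

variable (S : TreeMon C E)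

theorem act1_corollaMap {U A U' A' : C} (hU : IsUnitObj U) (u : U ⟶ A) (hu : act u)
    (hU' : IsUnitObj U') (u' : U' ⟶ A') (hu' : act u') (s : U ≅ U') (t : A ≅ A')
    (w : u ≫ t.hom = s.hom ≫ u') :
    S.str.toMon.act1 corolla_isUnit corolla_isUnit (corollaMap hU u hu hU' u' hu' s t w)
      (corollaMap_act _ _ _ _ _ _ _ _ _) = S.coll.map ⟨t.symm⟩ :=
  (S.act1_eq _ _ _ _).trans (congrArg (fun i : A ≅ A' => S.coll.map ⟨i.symm⟩)
    (topIso_corollaMap (w := w) (corollaMap_act _ _ _ _ _ _ _ _ _)))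

/-- The unit of the operad given by a normalized monoid. -/
noncomputable def unitT {U : C} (hU : IsUnitObj U) : 𝟙_ E ⟶ S.coll.obj ⟨U⟩ :=
  S.str.toMon.mapW corolla_isUnit (degeneracy hU) (degeneracy_act hU) one (isFrame_nil rfl)

variable {U A B : C} (hU : IsUnitObj U) (u : U ⟶ A) (f : A ⟶ B) (hu : act u) (hf : act f)

/-- The vertex of a tree of height two given by a piece. -/
abbrev pv (p : Piece f) : Elem (triangle hU u f hu hf) :=
  pieceVertex hU u f hu hf p corolla_isUnit

/-- The lowest vertex of a tree of height two. -/
abbrev rv : Elem (triangle hU u f hu hf) := rootVertex hU u f hu hf corolla_isUnit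

theorem isFrame_vertices {κ : Type (max u v)} (π : κ → Piece f) (l : List κ)
    (h : IsFrame (l.map fun i => (π i).toElem)) :
    IsFrame (mul (of (rv hU u f hu hf)) (list (fun i => pv hU u f hu hf (π i)) l)).labels := by
  have := isFrame_triangle (hU := hU) (u := u) (hu := hu) (hf := hf) (l := l.map π)
    (by rwa [List.map_map])
  rw [List.map_map] at this
  change IsFrame ([_] ++ (list _ l).labels)
  rw [labels_list]
  exact this

/-- The multiplication of the operad given by a normalized monoid. -/
noncomputable def mulT {κ : Type (max u v)} (π : κ → Piece f) (l : List κ)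
    (h : IsFrame (l.map fun i => (π i).toElem)) :
    S.coll.obj ⟨A⟩ ⊗ tens (fun i => S.coll.obj ⟨(π i).cod⟩) l ⟶ S.coll.obj ⟨B⟩ :=
  S.str.toMon.mapW corolla_isUnit (innerFace hU u f hu hf) (innerFace_act hU u f hu hf)
    (mul (of (rv hU u f hu hf)) (list (fun i => pv hU u f hu hf (π i)) l))
    (isFrame_vertices hU u f hu hf π l h)

variable {hU u f hu hf}

theorem canon_mulT {κ κ' : Type (max u v)} {π : κ → Piece f} {l : List κ} {π' : κ' → Piece f}
    {l' : List κ'} {θ : tens (fun i => S.coll.obj ⟨(π i).cod⟩) l ⟶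
      tens (fun i => S.coll.obj ⟨(π' i).cod⟩) l'}
    (hθ : Canon S.str.toMon.val (list (fun i => pv hU u f hu hf (π i)) l)
      (list (fun i => pv hU u f hu hf (π' i)) l') θ)
    (h : IsFrame (l.map fun i => (π i).toElem)) (h' : IsFrame (l'.map fun i => (π' i).toElem)) :
    S.coll.obj ⟨A⟩ ◁ θ ≫ S.mulT hU u f hu hf π' l' h' = S.mulT hU u f hu hf π l h :=
  Mon.canon_mapW (hθ.whiskerLeft (of (rv hU u f hu hf))) _ _

theorem mulT_map {κ κ' : Type (max u v)} (c : κ → κ') (π : κ' → Piece f) (l : List κ)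
    (h : IsFrame (l.map fun i => (π (c i)).toElem))
    (h' : IsFrame ((l.map c).map fun i => (π i).toElem)) :
    S.coll.obj ⟨A⟩ ◁ tensMap (G := fun i => S.coll.obj ⟨(π i).cod⟩) c (fun _ => 𝟙 _) l ≫
      S.mulT hU u f hu hf π (l.map c) h' = S.mulT hU u f hu hf (fun i => π (c i)) l h :=
  S.canon_mulT (Canon.bigMap c (fun i => of (pv hU u f hu hf (π i))) l) h h'

/-- The isomorphisms assemble to an active morphism of trees of height two, which commutes with the
inner faces up to an isomorphism of corollas. Functoriality along the two ways round the square is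
the assertion; by contravariance it comes out with inverses. -/
theorem mulT_iso_aux {U' A' B' : C} {hU' : IsUnitObj U'} {u' : U' ⟶ A'} {f' : A' ⟶ B'} {hu' : act u'}
    {hf' : act f'} (s : U ≅ U') (σ : A ≅ A') (ρ : B ≅ B') (w : u ≫ σ.hom = s.hom ≫ u')
    (w' : f ≫ ρ.hom = σ.hom ≫ f') {κ : Type (max u v)} {π : κ → Piece f} {π' : κ → Piece f'}
    (τ : ∀ i, PieceIso σ ρ (π i) (π' i)) (l : List κ) (h : IsFrame (l.map fun i => (π i).toElem))
    (h' : IsFrame (l.map fun i => (π' i).toElem)) :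
    S.mulT hU' u' f' hu' hf' π' l h' ≫ S.coll.map ⟨ρ.symm⟩ =
      (S.coll.map ⟨σ.symm⟩ ⊗ₘ tensHom (fun i => S.coll.map ⟨(τ i).codIso.symm⟩) l) ≫
        S.mulT hU u f hu hf π l h := by
  have w2 : (u ≫ f) ≫ ρ.hom = s.hom ≫ u' ≫ f' := by
    rw [Category.assoc, w', reassoc_of% w]
  have i1 := fun {A B : C} (f : A ⟶ B) [IsIso f] => IsHypermoment.inert_of_isIso f
  let T' := triangle hU' u' f' hu' hf'
  have m1 : T'.mp (i := (0 : Fin 3)) (j := (1 : Fin 3)) (show (0 : Fin 3) ≤ 1 by decide) = u' := rfl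
  let g : triangle hU u f hu hf ⟶ T' := ofTriangle hU u f hu hf T' (0 : Fin 3) (1 : Fin 3)
    (2 : Fin 3) (show (0 : Fin 3) ≤ 1 by decide) (show (1 : Fin 3) ≤ 2 by decide) s.hom σ.hom ρ.hom
    (i1 s.hom) (i1 σ.hom) (i1 ρ.hom) w w'
  have hg : act g := ofTriangle_isAct rfl rfl (inferInstanceAs (IsIso s.hom))
    (inferInstanceAs (IsIso σ.hom)) (inferInstanceAs (IsIso ρ.hom))
  let b := corollaMap hU (u ≫ f) (act_comp _ _ hu hf) hU' (u' ≫ f') (act_comp _ _ hu' hf') s ρ w2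
  have e : b ≫ innerFace hU' u' f' hu' hf' = innerFace hU u f hu hf ≫ g := by
    refine corolla_hom_ext (k := (0 : Fin 3)) (l := (2 : Fin 3)) rfl rfl rfl rfl ?_ ?_
    · exact congrArg (· ≫ _) ((Category.comp_id s.hom).trans (Category.id_comp s.hom).symm)
    · exact congrArg (· ≫ _) ((Category.comp_id ρ.hom).trans (Category.id_comp ρ.hom).symm)
  have w0 : corollaMap hU u hu hU' u' hu' s σ w ≫ (rv hU' u' f' hu' hf').hom =
      (rv hU u f hu hf).hom ≫ g := by
    refine corolla_hom_ext (k := (0 : Fin 3)) (l := (1 : Fin 3)) rfl rfl rfl rfl ?_ ?_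
    · exact congrArg (· ≫ _) ((Category.comp_id s.hom).trans (Category.id_comp s.hom).symm)
    · exact congrArg (· ≫ _) ((Category.comp_id σ.hom).trans (Category.id_comp σ.hom).symm)
  have w1 : ∀ i, corollaMap (π i).isUnit (π i).res (π i).res_act (π' i).isUnit (π' i).res
      (π' i).res_act (τ i).domIso (τ i).codIso (τ i).res_comm.symm ≫
        (pv hU' u' f' hu' hf' (π' i)).hom = (pv hU u f hu hf (π i)).hom ≫ g := by
    intro i
    refine corolla_hom_ext (k := (1 : Fin 3)) (l := (2 : Fin 3)) rfl rfl rfl rfl ?_ ?_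
    · exact congrArg (· ≫ _) (τ i).hom_comm
    · exact congrArg (· ≫ _) (τ i).incl_comm
  -- The vertices of the tree are indexed by `none` for the root vertex and `some i` for the piece
  -- `π i`.
  let V : Option κ → CTree C := fun i => match i with
    | none => corolla hU' u' hu'
    | some i => corolla (π' i).isUnit (π' i).res (π' i).res_act
  let c : Option κ → Elem (triangle hU u f hu hf) := fun i => match i with
    | none => rv hU u f hu hf
    | some i => pv hU u f hu hf (π i)
  have := Mon.mapW_unary (X := S.str.toMon) (hU := corolla_isUnit) (f := innerFace hU u f hu hf)
    (g := g) (hf := innerFace_act _ _ _ _ _) (hg := hg) (k := innerFace hU u f hu hf ≫ g)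
    (hk := act_comp _ _ (innerFace_act _ _ _ _ _) hg) rfl (mul (of none) (list some l)) c
    (V := V) (hV := fun i => match i with
      | none => corolla_isUnit
      | some i => corolla_isUnit)
    (h := fun i => match i with
      | none => (rv hU' u' f' hu' hf').hom
      | some i => (pv hU' u' f' hu' hf' (π' i)).hom)
    (hh := fun i => match i with
      | none => (rv hU' u' f' hu' hf').inert
      | some i => (pv hU' u' f' hu' hf' (π' i)).inert)
    (fun i => match i with
      | none => corollaMap hU u hu hU' u' hu' s σ w
      | some i => corollaMap (π i).isUnit (π i).res (π i).res_act (π' i).isUnit (π' i).res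
          (π' i).res_act (τ i).domIso (τ i).codIso (τ i).res_comm.symm)
    (fun i => match i with
      | none => corollaMap_act _ _ _ _ _ _ _ _ _
      | some i => corollaMap_act _ _ _ _ _ _ _ _ _)
    (fun i => match i with
      | none => w0
      | some i => w1 i)
    (isFrame_vertices hU u f hu hf π l h) (isFrame_vertices hU' u' f' hu' hf' π' l h')
  have h2 := Mon.mapW_precomp (X := S.str.toMon) (hU := corolla_isUnit)
    (hb := corollaMap_act _ _ _ _ _ _ _ _ _)
    (hk := act_comp _ _ (innerFace_act hU u f hu hf) hg) e corolla_isUnit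
    (mul (of (rv hU' u' f' hu' hf')) (list (fun i => pv hU' u' f' hu' hf' (π' i)) l))
    (hf := innerFace_act _ _ _ _ _) (isFrame_vertices hU' u' f' hu' hf' π' l h')
  have a0 := S.act1_corollaMap hU u hu hU' u' hu' s σ w
  have a1 := fun i => S.act1_corollaMap (π i).isUnit (π i).res (π i).res_act (π' i).isUnit (π' i).res
          (π' i).res_act (τ i).domIso (τ i).codIso (τ i).res_comm.symm
  have a2 := S.act1_corollaMap hU (u ≫ f) (act_comp _ _ hu hf) hU' (u' ≫ f') (act_comp _ _ hu' hf')
    s ρ w2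
  refine (congrArg (S.mulT hU' u' f' hu' hf' π' l h' ≫ ·) a2.symm).trans (h2.symm.trans
    (this.trans ?_))
  exact congrArg (· ≫ S.mulT hU u f hu hf π l h)
    (congrArg₂ (fun x y => x ⊗ₘ tensHom y l) a0 (funext a1))

/-- Equivariance of the multiplications. -/
theorem mulT_iso {U' A' B' : C} {hU' : IsUnitObj U'} {u' : U' ⟶ A'} {f' : A' ⟶ B'} {hu' : act u'}
    {hf' : act f'} (σ : A ≅ A') (ρ : B ≅ B')
    (w' : f ≫ ρ.hom = σ.hom ≫ f') {κ : Type (max u v)} {π : κ → Piece f} {π' : κ → Piece f'}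
    (τ : ∀ i, PieceIso σ ρ (π i) (π' i)) (l : List κ) (h : IsFrame (l.map fun i => (π i).toElem))
    (h' : IsFrame (l.map fun i => (π' i).toElem)) :
    S.mulT hU u f hu hf π l h ≫ S.coll.map ⟨ρ⟩ =
      (S.coll.map ⟨σ⟩ ⊗ₘ tensHom (fun i => S.coll.map ⟨(τ i).codIso⟩) l) ≫
        S.mulT hU' u' f' hu' hf' π' l h' := by
  -- Unitality extends `σ` to the units below `A` and `A'`, so no compatibility of `u` with `u'` has
  -- to be assumed.
  obtain ⟨s, hs, -⟩ := IsUnitalHypermoment.unital_unique A' U U' (u ≫ σ.hom) u' hU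
    (act_comp _ _ hu (IsHypermoment.act_of_isIso _)) hU' hu'
  have := S.mulT_iso_aux (hU := hU) (hu := hu) (hf := hf) (hU' := hU') (hu' := hu') (hf' := hf') s σ ρ
    hs.symm w' τ l h h'
  have inv : ∀ {A A' : C} (i : A ≅ A'), S.coll.map (⟨i⟩ : (⟨A⟩ : Core C) ⟶ ⟨A'⟩) ≫
      S.coll.map ⟨i.symm⟩ = 𝟙 _ := by
    intro A A' i
    rw [← Functor.map_comp, ← S.coll.map_id]
    congr 1
    exact CoreHom.ext (Iso.ext i.hom_inv_id)
  have inv' : ∀ {A A' : C} (i : A ≅ A'), S.coll.map (⟨i.symm⟩ : (⟨A'⟩ : Core C) ⟶ ⟨A⟩) ≫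
      S.coll.map ⟨i⟩ = 𝟙 _ := by
    intro A A' i
    rw [← Functor.map_comp, ← S.coll.map_id]
    congr 1
    exact CoreHom.ext (Iso.ext i.inv_hom_id)
  have e : (S.coll.map ⟨σ⟩ ⊗ₘ tensHom (fun i => S.coll.map ⟨(τ i).codIso⟩) l) ≫
      (S.coll.map ⟨σ.symm⟩ ⊗ₘ tensHom (F := fun i => S.coll.obj ⟨(π' i).cod⟩)
        (G := fun i => S.coll.obj ⟨(π i).cod⟩)
        (fun i => S.coll.map ⟨(τ i).codIso.symm⟩) l) = 𝟙 _ := by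
    rw [tensorHom_comp_tensorHom, ← tensHom_comp, inv]
    simp only [inv, tensHom_id]
    exact id_tensorHom_id _ _
  have e2 : ∀ {P Q R Z : E} {x : P ⟶ Q} {x' : Q ⟶ P} {y : P ⟶ Z} {z' : R ⟶ Z} {y' : Q ⟶ R}
      {z : Z ⟶ R}, y' ≫ z' = x' ≫ y → x ≫ x' = 𝟙 _ → z' ≫ z = 𝟙 _ → y ≫ z = x ≫ y' := by
    intro P Q R Z x x' y z' y' z h1 h2 h3
    calc y ≫ z = x ≫ (x' ≫ y) ≫ z := by rw [Category.assoc, ← Category.assoc x, h2, Category.id_comp]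
      _ = x ≫ y' := by rw [← h1, Category.assoc, h3, Category.comp_id]
  exact e2 this e (inv' ρ)

-- Equivariance for identities of `A` and `B` with two different units below: the multiplication
-- does not depend on the chosen active `U ⟶ A`.
variable (hU u hu) in
theorem mulT_eq {U' : C} (hU' : IsUnitObj U') (u' : U' ⟶ A) (hu' : act u') {κ : Type (max u v)}
    (π : κ → Piece f) (l : List κ) (h : IsFrame (l.map fun i => (π i).toElem)) :
    S.mulT hU u f hu hf π l h = S.mulT hU' u' f hu' hf π l h := by
  have := S.mulT_iso (hU := hU) (u := u) (hu := hu) (hf := hf) (hU' := hU') (u' := u') (hu' := hu')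
    (hf' := hf) (Iso.refl A) (Iso.refl B) ((Category.comp_id f).trans (Category.id_comp f).symm)
    (π := π) (π' := π)
    (fun i => ⟨Iso.refl _, Iso.refl _, (Category.id_comp _).trans (Category.comp_id _).symm,
      (Category.id_comp _).trans (Category.comp_id _).symm,
      (Category.id_comp _).trans (Category.comp_id _).symm⟩) l h h
  have e : ∀ A : C, S.coll.map (⟨Iso.refl A⟩ : (⟨A⟩ : Core C) ⟶ ⟨A⟩) = 𝟙 _ := fun A =>
    S.coll.map_id ⟨A⟩
  simp only [e, tensHom_id] at this
  rw [Category.comp_id, id_tensorHom_id, Category.id_comp] at this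
  exact this

end TreeMon

end MulT

/-! ### The unit laws from degenerate triangles -/

section UnitLaws

variable {C : Type u} [Category.{v} C] [HypermomentData C] [IsUnitalHypermoment C]
variable {E : Type u'} [Category.{v'} E] [MonoidalCategory E] [SymmetricCategory E]

open Word CTree

namespace TreeMon

variable (S : TreeMon C E)

theorem act1_of_topMap {A U U' : C} {hU : IsUnitObj U} {hU' : IsUnitObj U'} {u : U ⟶ A} {u' : U' ⟶ A}
    {hu : act u} {hu' : act u'} (g : corolla hU u hu ⟶ corolla hU' u' hu') (hg : act g)
    (h : topMap g hg = 𝟙 A) :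
    S.str.toMon.act1 corolla_isUnit corolla_isUnit g hg = 𝟙 (S.coll.obj ⟨A⟩) := by
  have e : topIso g hg = Iso.refl A := Iso.ext h
  exact (S.act1_eq _ _ _ _).trans ((congrArg (fun i : A ≅ A => S.coll.map ⟨i.symm⟩) e).trans
    (S.coll.map_id ⟨A⟩))

/-- The degenerate tree `U = U ⟶ A` collapses onto `U ⟶ A`. Preceded by the inner face, the collapse
acts as the identity; computed vertex by vertex, it is `η` at the lower vertex and the identity at
the upper one, followed by `μ`. -/
theorem left_unitT {U A : C} (hU : IsUnitObj U) (f : U ⟶ A) (hf : act f)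
    (h : IsFrame ([Piece.whole hU f hf].map Piece.toElem)) :
    S.unitT hU ▷ (S.coll.obj ⟨A⟩ ⊗ 𝟙_ E) ≫
        S.mulT hU (𝟙 U) f (act_id U) hf (fun p => p) [Piece.whole hU f hf] h =
      (λ_ (S.coll.obj ⟨A⟩ ⊗ 𝟙_ E)).hom ≫ (ρ_ (S.coll.obj ⟨A⟩)).hom := by
  let T' := corolla hU f hf
  let d : triangle hU (𝟙 U) f (act_id U) hf ⟶ T' := ofTriangle hU (𝟙 U) f (act_id U) hf T'
    (0 : Fin 2) (0 : Fin 2) (1 : Fin 2) (le_refl (0 : Fin 2)) (show (0 : Fin 2) ≤ 1 by decide)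
    (𝟙 U) (𝟙 U) (𝟙 A) (inert_id U) (inert_id U) (inert_id A) rfl
    ((Category.comp_id f).trans (Category.id_comp f).symm)
  have hd : act d := ofTriangle_isAct rfl rfl (inferInstanceAs (IsIso (𝟙 U)))
    (inferInstanceAs (IsIso (𝟙 U))) (inferInstanceAs (IsIso (𝟙 A)))
  let rv' := rv hU (𝟙 U) f (act_id U) hf
  let pv' := pv hU (𝟙 U) f (act_id U) hf
  let r : edge U hU ⟶ T' := ofEdge hU T' (0 : Fin 2) (𝟙 U) (inert_id U)
  have w0 : degeneracy hU ≫ r = rv'.hom ≫ d :=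
    corolla_hom_ext (k := (0 : Fin 2)) (l := (0 : Fin 2)) rfl rfl rfl rfl rfl rfl
  have w1 : 𝟙 T' ≫ 𝟙 T' = (pv' (Piece.whole hU f hf)).hom ≫ d :=
    corolla_hom_ext (k := (0 : Fin 2)) (l := (1 : Fin 2)) rfl rfl rfl rfl rfl rfl
  -- The lower vertex is sent to the tree `([0], U)` by the degeneracy, which contributes `η`. That
  -- tree has no vertices, so the word chosen for it in `s` is empty.
  let P : Option PUnit.{max u v + 1} → Piece d := fun i => match i with
    | none => ⟨rv', ⟨edge U hU, degeneracy hU, degeneracy_act hU, r, ofEdge_isInert _ _ _ _ _, w0⟩⟩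
    | some _ => ⟨pv' (Piece.whole hU f hf), ⟨T', 𝟙 T', act_id T', 𝟙 T', inert_id T', w1⟩⟩
  let W : Word (Option PUnit.{max u v + 1}) := mul (of none) (of (some PUnit.unit))
  have hW : IsFrame (W.map fun i => (P i).toElem).labels :=
    isFrame_triangle (l := [Piece.whole hU f hf]) h
  let s : ∀ i, Word (Elem (P i).cod) := fun i => match i with
    | none => one
    | some _ => of (Elem.refl T' corolla_isUnit)
  have hs : ∀ i, IsFrame (s i).labels := fun i => match i with
    | none => isFrame_nil rfl
    | some _ => isFrame_refl corolla_isUnit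
  have hW' := isFrame_labels_subst hd P W
    (by rwa [labels_map] at hW) s hs
  have h1 := Mon.mapW_comp (X := S.str.toMon) (hU := corolla_isUnit)
    (f := innerFace hU (𝟙 U) f (act_id U) hf) (hf := innerFace_act _ _ _ _ _) (g := d) (hg := hd)
    P W hW s hs hW'
  have hk : IsAct (innerFace hU (𝟙 U) f (act_id U) hf ≫ d) :=
    isAct_comp _ _ (innerFace_act _ _ _ _ _) hd
  have hof : IsFrame (of ((Elem.refl T' corolla_isUnit).push (𝟙 T') (inert_id T'))).labels := hW'
  have h2 := Mon.canon_mapW (X := S.str.toMon) (hU := corolla_isUnit)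
    (f := innerFace hU (𝟙 U) f (act_id U) hf ≫ d) (hf := hk)
    (Canon.leftUnit (of ((Elem.refl T' corolla_isUnit).push (𝟙 T') (inert_id T')))) hW' hof
  have h3 := Mon.mapW_of (X := S.str.toMon) (hU := corolla_isUnit)
    (f := innerFace hU (𝟙 U) f (act_id U) hf ≫ d) (hf := hk) (hU' := corolla_isUnit)
    (i := 𝟙 T' ≫ 𝟙 T') (hi := inert_comp _ _ (inert_id T') (inert_id T')) (Category.id_comp _) hof
  have h4 := S.act1_of_topMap (innerFace hU (𝟙 U) f (act_id U) hf ≫ d) hk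
    ((congrArg₂ (· ≫ ·) (Category.id_comp (𝟙 A)) (T'.mp_refl (i := (1 : Fin 2)) _)).trans
      (Category.comp_id (𝟙 A)))
  have h5 := S.str.toMon.act1_id (U := T') corolla_isUnit (𝟙 T') (act_id T') rfl
  have h6 := Mon.canon_mapW (X := S.str.toMon) (hU := corolla_isUnit)
    (f := innerFace hU (𝟙 U) f (act_id U) hf) (hf := innerFace_act _ _ _ _ _)
    ((Canon.singleton S.str.toMon.val pv' (Piece.whole hU f hf)).whiskerLeft (of rv')) hW
    (isFrame_vertices hU (𝟙 U) f (act_id U) hf (fun p => p) [Piece.whole hU f hf] h)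
  have e : ∀ {X Y : E} {η : 𝟙_ E ⟶ X} {m : X ⊗ (Y ⊗ 𝟙_ E) ⟶ Y} {m2 : X ⊗ Y ⟶ Y} {n : 𝟙_ E ⊗ Y ⟶ Y}
      {t t' a : Y ⟶ Y} {t0 : 𝟙_ E ⟶ 𝟙_ E} (_ : t0 = 𝟙 _) (_ : t = 𝟙 _) (_ : a = 𝟙 _),
      n = ((t0 ≫ η) ⊗ₘ (t ≫ a)) ≫ m2 → (λ_ Y).hom ≫ t' = n → t' = 𝟙 _ → X ◁ (ρ_ Y).inv ≫ m = m2 →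
      η ▷ (Y ⊗ 𝟙_ E) ≫ m = (λ_ (Y ⊗ 𝟙_ E)).hom ≫ (ρ_ Y).hom := by
    rintro X Y η m m2 n t t' a t0 rfl rfl rfl rfl H rfl rfl
    have : m = X ◁ (ρ_ Y).hom ≫ X ◁ (ρ_ Y).inv ≫ m := by
      rw [← MonoidalCategory.whiskerLeft_comp_assoc]; simp
    rw [this, ← whisker_exchange_assoc, ← leftUnitor_naturality]
    refine congrArg (_ ◁ (ρ_ Y).hom ≫ ·) ?_
    rw [← Category.comp_id (λ_ Y).hom, H]
    simp
  exact e (t := 𝟙 _) (t0 := 𝟙 _) rfl rfl h5 h1 h2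
    (h3.trans h4) h6

/-- Here the upper step is the degenerate one: the collapse of `U ⟶ A = A` sends each of its upper
vertices to a tree of height zero, and only the root vertex survives. -/
theorem right_unitT {U A : C} (hU : IsUnitObj U) (u : U ⟶ A) (hu : act u) (l : List (Elem A))
    (h : IsFrame (l.map fun e => (Piece.ofElem e).toElem)) :
    S.coll.obj ⟨A⟩ ◁ tensHom (fun e : Elem A => S.unitT e.isUnit) l ≫
        S.mulT hU u (𝟙 A) hu (act_id A) Piece.ofElem l h =
      S.coll.obj ⟨A⟩ ◁ tensUnit l ≫ (ρ_ (S.coll.obj ⟨A⟩)).hom := by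
  let T' := corolla hU u hu
  let d : triangle hU u (𝟙 A) hu (act_id A) ⟶ T' := ofTriangle hU u (𝟙 A) hu (act_id A) T'
    (0 : Fin 2) (1 : Fin 2) (1 : Fin 2) (show (0 : Fin 2) ≤ 1 by decide) (le_refl (1 : Fin 2))
    (𝟙 U) (𝟙 A) (𝟙 A) (inert_id U) (inert_id A) (inert_id A)
    ((Category.comp_id u).trans (Category.id_comp u).symm)
    (congrArg (𝟙 A ≫ ·) (T'.mp_refl (i := (1 : Fin 2)) (le_refl _)).symm)
  have hd : act d := ofTriangle_isAct rfl rfl (inferInstanceAs (IsIso (𝟙 U)))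
    (inferInstanceAs (IsIso (𝟙 A))) (inferInstanceAs (IsIso (𝟙 A)))
  let rv' := rv hU u (𝟙 A) hu (act_id A)
  let pv' := pv hU u (𝟙 A) hu (act_id A)
  let r : ∀ e : Elem A, edge e.dom e.isUnit ⟶ T' := fun e =>
    ofEdge e.isUnit T' (1 : Fin 2) e.hom e.inert
  have w0 : 𝟙 T' ≫ 𝟙 T' = rv'.hom ≫ d :=
    corolla_hom_ext (k := (0 : Fin 2)) (l := (1 : Fin 2)) rfl rfl rfl rfl rfl rfl
  have w1 : ∀ e, degeneracy e.isUnit ≫ r e = (pv' (Piece.ofElem e)).hom ≫ d := fun e =>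
    corolla_hom_ext (k := (1 : Fin 2)) (l := (1 : Fin 2)) rfl rfl rfl rfl
      (congrArg (· ≫ _) ((Category.id_comp e.hom).trans (Category.comp_id e.hom).symm))
      (congrArg (· ≫ _) ((Category.id_comp e.hom).trans (Category.comp_id e.hom).symm))
  let P : Option (Elem A) → Piece d := fun i => match i with
    | none => ⟨rv', ⟨T', 𝟙 T', act_id T', 𝟙 T', inert_id T', w0⟩⟩
    | some e => ⟨pv' (Piece.ofElem e), ⟨edge e.dom e.isUnit, degeneracy e.isUnit,
        degeneracy_act e.isUnit, r e, ofEdge_isInert _ _ _ _ _, w1 e⟩⟩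
  let W : Word (Option (Elem A)) := mul (of none) (list some l)
  have hW : IsFrame (W.map fun i => (P i).toElem).labels :=
    isFrame_vertices hU u (𝟙 A) hu (act_id A) Piece.ofElem l h
  let s : ∀ i, Word (Elem (P i).cod) := fun i => match i with
    | none => of (Elem.refl T' corolla_isUnit)
    | some _ => one
  have hs : ∀ i, IsFrame (s i).labels := fun i => match i with
    | none => isFrame_refl corolla_isUnit
    | some _ => isFrame_nil rfl
  have hW' := isFrame_labels_subst hd P W
    (by rwa [labels_map] at hW) s hs
  have h1 := Mon.mapW_comp (X := S.str.toMon) (hU := corolla_isUnit)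
    (f := innerFace hU u (𝟙 A) hu (act_id A)) (hf := innerFace_act _ _ _ _ _) (g := d) (hg := hd)
    P W hW s hs hW'
  have hk : IsAct (innerFace hU u (𝟙 A) hu (act_id A) ≫ d) :=
    isAct_comp _ _ (innerFace_act _ _ _ _ _) hd
  have hc := (((Canon.tensUnit S.str.toMon.val l).whiskerLeft
    (of ((Elem.refl T' corolla_isUnit).push (𝟙 T') (inert_id T')))).comp (Canon.rightUnit _))
  have hof : IsFrame (of ((Elem.refl T' corolla_isUnit).push (𝟙 T') (inert_id T'))).labels :=
    hW'.perm hc.perm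
  have h2 := Mon.canon_mapW (X := S.str.toMon) (hU := corolla_isUnit)
    (f := innerFace hU u (𝟙 A) hu (act_id A) ≫ d) (hf := hk) hc hW' hof
  have h3 := Mon.mapW_of (X := S.str.toMon) (hU := corolla_isUnit)
    (f := innerFace hU u (𝟙 A) hu (act_id A) ≫ d) (hf := hk) (hU' := corolla_isUnit)
    (i := 𝟙 T' ≫ 𝟙 T') (hi := inert_comp _ _ (inert_id T') (inert_id T')) (Category.id_comp _) hof
  have h4 := S.act1_of_topMap (innerFace hU u (𝟙 A) hu (act_id A) ≫ d) hk
    ((congrArg₂ (· ≫ ·) (Category.id_comp (𝟙 A)) (T'.mp_refl (i := (1 : Fin 2)) _)).trans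
      (Category.comp_id (𝟙 A)))
  have h5 := S.str.toMon.act1_id (U := T') corolla_isUnit (𝟙 T') (act_id T') rfl
  have h6 : (fun e : Elem A => 𝟙 (𝟙_ E) ≫ S.unitT e.isUnit) = fun e : Elem A => S.unitT e.isUnit :=
    funext fun e => Category.id_comp _
  have h6' := congrArg (fun z : ∀ e : Elem A, 𝟙_ E ⟶ S.coll.obj ⟨e.dom⟩ => tensHom z l) h6
  have e : ∀ {X Y Z : E} {η η' : Z ⟶ Y} {m : X ⊗ Y ⟶ X} {n : X ⊗ Z ⟶ X}
      {t t' a : X ⟶ X} {q : X ⊗ Z ⟶ X} (_ : η' = η) (_ : t = 𝟙 _) (_ : a = 𝟙 _),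
      n = ((t ≫ a) ⊗ₘ η') ≫ m → q ≫ t' = n → t' = 𝟙 _ →
      X ◁ η ≫ m = q := by
    rintro X Y Z η η' m n t t' a q rfl rfl rfl rfl H rfl
    rw [← Category.comp_id q, H]
    simp
  exact e (t := 𝟙 _) h6' rfl h5 h1 h2 (h3.trans h4)

end TreeMon

end UnitLaws

/-! ### Associativity from a tree of height three -/

section Assoc

variable {C : Type u} [Category.{v} C] [HypermomentData C] [IsUnitalHypermoment C]
variable {E : Type u'} [Category.{v'} E] [MonoidalCategory E] [SymmetricCategory E]

open Word CTree

theorem Word.mapMap_mul_list {ι ι' κ : Type w} (F : ι' → E) (c : ι → ι') (a : ι) (d : κ → ι)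
    (l : List κ) : mapMap F c (mul (of a) (list d l)) = 𝟙 (F (c a) ⊗ tens (fun i => F (c (d i))) l) :=
  (congrArg (𝟙 (F (c a)) ⊗ₘ ·) (mapMap_list F c d l)).trans (id_tensorHom_id _ _)

namespace CTree

/-- The `C`-tree `([3], U ⟶ A ⟶ B ⟶ D)`. -/
def tetrahedron {U A B D : C} (hU : IsUnitObj U) (u : U ⟶ A) (f : A ⟶ B) (g : B ⟶ D) (hu : act u)
    (hf : act f) (hg : act g) : CTree C where
  height := 3
  arrows := ComposableArrows.mk₃ u f g
  act_map := by
    intro i j h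
    have hij := leOfHom h
    fin_cases i <;> fin_cases j
    · exact act_id U
    · exact hu
    · exact act_comp u f hu hf
    · exact act_comp u _ hu (act_comp f g hf hg)
    · exact absurd (show (1 : Fin 4) ≤ 0 from hij) (by decide)
    · exact act_id A
    · exact hf
    · exact act_comp f g hf hg
    · exact absurd (show (2 : Fin 4) ≤ 0 from hij) (by decide)
    · exact absurd (show (2 : Fin 4) ≤ 1 from hij) (by decide)
    · exact act_id B
    · exact hg
    · exact absurd (show (3 : Fin 4) ≤ 0 from hij) (by decide)
    · exact absurd (show (3 : Fin 4) ≤ 1 from hij) (by decide)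
    · exact absurd (show (3 : Fin 4) ≤ 2 from hij) (by decide)
    · exact act_id D
  isUnit_root := hU

end CTree

namespace TreeMon

variable (S : TreeMon C E)

/-- Both sides compute the action of the morphism from the corolla `U ⟶ D` to the tree `U ⟶ A ⟶ B ⟶
D`: it passes through `U ⟶ B ⟶ D` on one side and through `U ⟶ A ⟶ D` on the other. -/
theorem assocT {U A B D : C} (hU : IsUnitObj U) (u : U ⟶ A) (f : A ⟶ B) (g : B ⟶ D) (hu : act u)
    (hf : act f) (hg : act g) (l : List (Piece f)) (q : ∀ p : Piece f, Factor (p.incl ≫ g))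
    (m : ∀ p : Piece f, List (Piece (q p).left))
    (hl : IsFrame (l.map fun p => p.toElem))
    (hm : ∀ p, IsFrame ((m p).map fun r => r.toElem))
    (hl'' : IsFrame (l.map fun p => (p.comp (q p)).toElem))
    (h : IsFrame (mul (of (rv hU (u ≫ f) g (act_comp _ _ hu hf) hg))
      (big l fun p => list (fun r => pv hU (u ≫ f) g (act_comp _ _ hu hf) hg (p.push r)) (m p))).labels) :
    S.mulT hU u f hu hf (fun p => p) l hl ▷ _ ≫
      S.str.toMon.mapW corolla_isUnit (innerFace hU (u ≫ f) g (act_comp _ _ hu hf) hg)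
        (innerFace_act hU _ _ _ _) (mul (of (rv hU (u ≫ f) g (act_comp _ _ hu hf) hg))
          (big l fun p => list (fun r => pv hU (u ≫ f) g (act_comp _ _ hu hf) hg (p.push r)) (m p))) h =
    (α_ _ _ _).hom ≫ S.coll.obj ⟨A⟩ ◁ (tensDistrib (fun p : Piece f => S.coll.obj ⟨p.cod⟩)
        (fun p : Piece f => tens (fun r => S.coll.obj ⟨(p.push r).cod⟩) (m p)) l ≫
      tensHom (fun p : Piece f => S.mulT p.isUnit p.res (q p).left p.res_act (q p).act
        (fun r => r) (m p) (hm p)) l) ≫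
      S.mulT hU u (f ≫ g) hu (act_comp _ _ hf hg) (fun p : Piece f => p.comp (q p)) l hl'' := by
  let T := tetrahedron hU u f g hu hf hg
  have hm1 : T.mp (i := (1 : Fin 4)) (j := (2 : Fin 4)) (show (1 : Fin 4) ≤ 2 by decide) = f := rfl
  have hm2 : T.mp (i := (2 : Fin 4)) (j := (3 : Fin 4)) (show (2 : Fin 4) ≤ 3 by decide) = g := rfl
  -- the two decompositions
  let e1 : triangle hU (u ≫ f) g (act_comp _ _ hu hf) hg ⟶ T := ofTriangle _ _ _ _ _ T (0 : Fin 4)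
    (2 : Fin 4) (3 : Fin 4) (show (0 : Fin 4) ≤ 2 by decide) (show (2 : Fin 4) ≤ 3 by decide)
    (𝟙 U) (𝟙 B) (𝟙 D) (inert_id U) (inert_id B) (inert_id D)
    ((Category.comp_id _).trans (Category.id_comp (u ≫ f)).symm)
    ((Category.comp_id _).trans (Category.id_comp g).symm)
  let e2 : triangle hU u (f ≫ g) hu (act_comp _ _ hf hg) ⟶ T := ofTriangle _ _ _ _ _ T (0 : Fin 4)
    (1 : Fin 4) (3 : Fin 4) (show (0 : Fin 4) ≤ 1 by decide) (show (1 : Fin 4) ≤ 3 by decide)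
    (𝟙 U) (𝟙 A) (𝟙 D) (inert_id U) (inert_id A) (inert_id D)
    ((Category.comp_id _).trans (Category.id_comp u).symm)
    ((Category.comp_id _).trans (Category.id_comp (f ≫ g)).symm)
  have he1 : act e1 := ofTriangle_isAct rfl rfl (inferInstanceAs (IsIso (𝟙 U)))
    (inferInstanceAs (IsIso (𝟙 B))) (inferInstanceAs (IsIso (𝟙 D)))
  have he2 : act e2 := ofTriangle_isAct rfl rfl (inferInstanceAs (IsIso (𝟙 U)))
    (inferInstanceAs (IsIso (𝟙 A))) (inferInstanceAs (IsIso (𝟙 D)))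
  -- the vertices of the tree
  let v0 : corolla hU u hu ⟶ T := ofCorolla hU u hu T (0 : Fin 4) (1 : Fin 4)
    (show (0 : Fin 4) ≤ 1 by decide) (𝟙 U) (𝟙 A) (inert_id U) (inert_id A)
    ((Category.comp_id _).trans (Category.id_comp u).symm)
  let v1 : ∀ p : Piece f, corolla p.isUnit p.res p.res_act ⟶ T := fun p =>
    ofCorolla p.isUnit p.res p.res_act T (1 : Fin 4) (2 : Fin 4)
      (show (1 : Fin 4) ≤ 2 by decide) p.hom p.incl p.inert p.incl_inert p.comm
  let v2 : ∀ (p : Piece f) (r : Piece (q p).left), corolla r.isUnit r.res r.res_act ⟶ T :=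
    fun p r => ofCorolla r.isUnit r.res r.res_act T (2 : Fin 4) (3 : Fin 4)
      (show (2 : Fin 4) ≤ 3 by decide) (p.push r).hom (p.push r).incl (p.push r).inert
      (p.push r).incl_inert (p.push r).comm
  have hv0 : HypermomentData.inert v0 := ofCorolla_isInert _ _ _ _ _ _ _ _ _ _ _ _ rfl
  have hv1 : ∀ p, HypermomentData.inert (v1 p) := fun p =>
    ofCorolla_isInert _ _ _ _ _ _ _ _ _ _ _ _ rfl
  have hv2 : ∀ p r, HypermomentData.inert (v2 p r) := fun p r =>
    ofCorolla_isInert _ _ _ _ _ _ _ _ _ _ _ _ rfl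
  -- The vertices at the three levels: the root vertex, the pieces of `f`, and the pieces of the
  -- active parts of `B_α ⟶ D`.
  let ι : Type (max u v) := Option (Piece f ⊕ Σ p : Piece f, Piece (q p).left)
  let V : ι → CTree C := fun i => match i with
    | none => corolla hU u hu
    | some (Sum.inl p) => corolla p.isUnit p.res p.res_act
    | some (Sum.inr r) => corolla r.2.isUnit r.2.res r.2.res_act
  have hV : ∀ i, IsUnitObj (V i) := fun i => match i with
    | none => corolla_isUnit
    | some (Sum.inl p) => corolla_isUnit
    | some (Sum.inr r) => corolla_isUnit
  let v : ∀ i, V i ⟶ T := fun i => match i with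
    | none => v0
    | some (Sum.inl p) => v1 p
    | some (Sum.inr r) => v2 r.1 r.2
  have hv : ∀ i, HypermomentData.inert (v i) := fun i => match i with
    | none => hv0
    | some (Sum.inl p) => hv1 p
    | some (Sum.inr r) => hv2 r.1 r.2
  -- The same vertices are grouped in two ways: the lowest two levels together in `W1`, and every
  -- middle vertex with the vertices above it in `W2`.
  let W1 : Word ι := mul (mul (of none) (list (fun p => some (Sum.inl p)) l))
    (big l fun p => list (fun r => some (Sum.inr ⟨p, r⟩)) (m p))
  let W2 : Word ι := mul (of none)
    (big l fun p => mul (of (some (Sum.inl p))) (list (fun r => some (Sum.inr ⟨p, r⟩)) (m p)))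
  let el : ∀ (x : ∀ i, V i ⟶ T), (∀ i, HypermomentData.inert (x i)) → ι → Elem T :=
    fun x hx i => ⟨V i, hV i, x i, hx i⟩
  let X := S.str.toMon
  let k1 := innerFace hU (u ≫ f) g (act_comp _ _ hu hf) hg ≫ e1
  let k2 := innerFace hU u (f ≫ g) hu (act_comp _ _ hf hg) ≫ e2
  have hk1 : act k1 := act_comp _ _ (innerFace_act _ _ _ _ _) he1
  have hk2 : act k2 := act_comp _ _ (innerFace_act _ _ _ _ _) he2
  -- The two decompositions present the inclusions of the vertices as different composites. Both
  -- families are equal to `v`, and statements about them are moved there.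
  have transport_el : ∀ (x : ∀ i, V i ⟶ T) (hx : ∀ i, HypermomentData.inert (x i)), x = v →
      ∀ Q : (∀ x : ∀ i, V i ⟶ T, (∀ i, HypermomentData.inert (x i)) → Prop), Q x hx → Q v hv := by
    rintro x hx rfl Q H
    exact H
  -- Under `e1`, the root vertex of `U ⟶ B ⟶ D` is expanded to the tree `U ⟶ A ⟶ B`, and the upper
  -- vertices are kept.
  have H1 : ∃ H, X.mapW corolla_isUnit k1 hk1 (W1.map (el v hv)) H =
      S.mulT hU u f hu hf (fun p => p) l hl ▷ _ ≫
        X.mapW corolla_isUnit (innerFace hU (u ≫ f) g (act_comp _ _ hu hf) hg)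
        (innerFace_act hU _ _ _ _) (mul (of (rv hU (u ≫ f) g (act_comp _ _ hu hf) hg))
          (big l fun p => list (fun r => pv hU (u ≫ f) g (act_comp _ _ hu hf) hg (p.push r)) (m p))) h := by
    let r1 : triangle hU u f hu hf ⟶ T := ofTriangle _ _ _ _ _ T (0 : Fin 4)
      (1 : Fin 4) (2 : Fin 4) (show (0 : Fin 4) ≤ 1 by decide) (show (1 : Fin 4) ≤ 2 by decide)
      (𝟙 U) (𝟙 A) (𝟙 B) (inert_id U) (inert_id A) (inert_id B)
      ((Category.comp_id _).trans (Category.id_comp u).symm)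
      ((Category.comp_id _).trans (Category.id_comp f).symm)
    have hr1 : HypermomentData.inert r1 := ofTriangle_isInert rfl rfl
    have w0 : innerFace hU u f hu hf ≫ r1 = (rv hU (u ≫ f) g (act_comp _ _ hu hf) hg).hom ≫ e1 :=
      corolla_hom_ext (k := (0 : Fin 4)) (l := (2 : Fin 4)) rfl rfl rfl rfl rfl rfl
    have w1 : ∀ (p : Piece f) (r : Piece (q p).left),
        𝟙 (corolla r.isUnit r.res r.res_act) ≫ v2 p r =
          (pv hU (u ≫ f) g (act_comp _ _ hu hf) hg (p.push r)).hom ≫ e1 := fun p r =>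
      corolla_hom_ext (k := (2 : Fin 4)) (l := (3 : Fin 4)) rfl rfl rfl rfl
        (congrArg (· ≫ _) ((Category.id_comp _).trans (Category.comp_id _).symm))
        (congrArg (· ≫ _) ((Category.id_comp _).trans (Category.comp_id _).symm))
    let P : Option (Σ p : Piece f, Piece (q p).left) → Piece e1 := fun i => match i with
      | none => ⟨rv hU (u ≫ f) g (act_comp _ _ hu hf) hg, ⟨triangle hU u f hu hf,
          innerFace hU u f hu hf, innerFace_act _ _ _ _ _, r1, hr1, w0⟩⟩
      | some r => ⟨pv hU (u ≫ f) g (act_comp _ _ hu hf) hg (r.1.push r.2),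
          ⟨corolla r.2.isUnit r.2.res r.2.res_act, 𝟙 _, act_id _, v2 r.1 r.2, hv2 _ _, w1 _ _⟩⟩
    let W : Word (Option (Σ p : Piece f, Piece (q p).left)) := mul (of none)
      (big l fun p => list (fun r => some ⟨p, r⟩) (m p))
    let s : ∀ i, Word (Elem (P i).cod) := fun i => match i with
      | none => mul (of (rv hU u f hu hf)) (list (fun p => pv hU u f hu hf p) l)
      | some r => of (Elem.refl (corolla r.2.isUnit r.2.res r.2.res_act) corolla_isUnit)
    have hs : ∀ i, IsFrame (s i).labels := fun i => match i with
      | none => isFrame_vertices hU u f hu hf (fun p => p) l hl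
      | some r => isFrame_refl corolla_isUnit
    have hW' := isFrame_labels_subst he1 P W (by rwa [← labels_map]) s hs
    have c1 := Mon.mapW_comp (X := X) (hU := corolla_isUnit)
      (f := innerFace hU (u ≫ f) g (act_comp _ _ hu hf) hg) (hf := innerFace_act _ _ _ _ _) (g := e1)
      (hg := he1) P W h s hs hW'
    let x : ∀ i, V i ⟶ T := fun i => match i with
      | none => (rv hU u f hu hf).hom ≫ r1
      | some (Sum.inl p) => (pv hU u f hu hf p).hom ≫ r1
      | some (Sum.inr r) => 𝟙 _ ≫ v2 r.1 r.2
    have hx : ∀ i, HypermomentData.inert (x i) := fun i => match i with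
      | none => inert_comp _ _ (rv hU u f hu hf).inert hr1
      | some (Sum.inl p) => inert_comp _ _ (pv hU u f hu hf p).inert hr1
      | some (Sum.inr r) => inert_comp _ _ (inert_id _) (hv2 _ _)
    have hxv : x = v := by
      refine funext fun i => ?_
      exact match i with
      | none => corolla_hom_ext (k := (0 : Fin 4)) (l := (1 : Fin 4)) rfl rfl rfl rfl
          (congrArg (· ≫ _) (Category.id_comp _)) (congrArg (· ≫ _) (Category.id_comp _))
      | some (Sum.inl p) => corolla_hom_ext (k := (1 : Fin 4)) (l := (2 : Fin 4)) rfl rfl rfl rfl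
          (congrArg (· ≫ _) (Category.comp_id _)) (congrArg (· ≫ _) (Category.comp_id _))
      | some (Sum.inr r) => Category.id_comp _
    refine transport_el x hx hxv (fun x hx => ∃ H,
      X.mapW corolla_isUnit k1 hk1 (W1.map (el x hx)) H = _) ⟨hW', ?_⟩
    have c2 : (fun p : Piece f => tensHom (fun r : Piece (q p).left => 𝟙 (S.coll.obj ⟨r.cod⟩) ≫
        X.act1 (corolla_isUnit (hu := r.res_act) (hU := r.isUnit)) corolla_isUnit (𝟙 _) (act_id _)) (m p)) =
          fun p : Piece f => 𝟙 (tens (fun r : Piece (q p).left => S.coll.obj ⟨r.cod⟩) (m p)) := by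
      refine funext fun p => (congrArg (fun z : ∀ r : Piece (q p).left, S.coll.obj ⟨r.cod⟩ ⟶
        S.coll.obj ⟨r.cod⟩ => tensHom z (m p)) (funext fun r => ?_)).trans (tensHom_id _ _)
      exact (Category.id_comp _).trans (X.act1_id _ _ _ rfl)
    have c3 := (congrArg (fun z : ∀ p : Piece f, tens (fun r : Piece (q p).left => S.coll.obj ⟨r.cod⟩) (m p) ⟶
      tens (fun r : Piece (q p).left => S.coll.obj ⟨r.cod⟩) (m p) => tensHom z l) c2).trans (tensHom_id _ _)
    have c4 := mapMap_mul_list X.val (fun e => e.push r1 hr1) (rv hU u f hu hf)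
      (fun p : Piece f => pv hU u f hu hf p) l
    have e : ∀ {P P' Q Z : E} {a : P ⟶ P} {b : P ⟶ P'} {c : Q ⟶ Q} {d : P' ⊗ Q ⟶ Z} {t : P ⊗ Q ⟶ Z},
        t = ((a ≫ b) ⊗ₘ c) ≫ d → a = 𝟙 _ → c = 𝟙 _ → t = b ▷ Q ≫ d := by
      rintro P P' Q Z a b c d t rfl rfl rfl
      simp
    exact e c1 c4 c3
  -- Under `e2`, the root vertex is kept, and the upper vertex at `α` is expanded to the tree `U_α ⟶
  -- B_α ⟶ D_α`.
  have H2 : ∃ H, X.mapW corolla_isUnit k2 hk2 (W2.map (el v hv)) H =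
      S.coll.obj ⟨A⟩ ◁ tensHom (fun p : Piece f => S.mulT p.isUnit p.res (q p).left p.res_act (q p).act
        (fun r => r) (m p) (hm p)) l ≫
      S.mulT hU u (f ≫ g) hu (act_comp _ _ hf hg) (fun p : Piece f => p.comp (q p)) l hl'' := by
    let r2 : ∀ p : Piece f, triangle p.isUnit p.res (q p).left p.res_act (q p).act ⟶ T := fun p =>
      ofTriangle _ _ _ _ _ T (1 : Fin 4) (2 : Fin 4) (3 : Fin 4) (show (1 : Fin 4) ≤ 2 by decide)
      (show (2 : Fin 4) ≤ 3 by decide) p.hom p.incl (q p).right p.inert p.incl_inert (q p).inert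
      p.comm (q p).fac
    have hr2 : ∀ p, HypermomentData.inert (r2 p) := fun p => ofTriangle_isInert rfl rfl
    have w0 : 𝟙 (corolla hU u hu) ≫ v0 = (rv hU u (f ≫ g) hu (act_comp _ _ hf hg)).hom ≫ e2 :=
      corolla_hom_ext (k := (0 : Fin 4)) (l := (1 : Fin 4)) rfl rfl rfl rfl rfl rfl
    have w1 : ∀ p : Piece f, innerFace p.isUnit p.res (q p).left p.res_act (q p).act ≫ r2 p =
          (pv hU u (f ≫ g) hu (act_comp _ _ hf hg) (p.comp (q p))).hom ≫ e2 := fun p =>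
      corolla_hom_ext (k := (1 : Fin 4)) (l := (3 : Fin 4)) rfl rfl rfl rfl
        (congrArg (· ≫ _) ((Category.id_comp _).trans (Category.comp_id _).symm))
        (congrArg (· ≫ _) ((Category.id_comp _).trans (Category.comp_id _).symm))
    let P : Option (Piece f) → Piece e2 := fun i => match i with
      | none => ⟨rv hU u (f ≫ g) hu (act_comp _ _ hf hg),
          ⟨corolla hU u hu, 𝟙 _, act_id _, v0, hv0, w0⟩⟩
      | some p => ⟨pv hU u (f ≫ g) hu (act_comp _ _ hf hg) (p.comp (q p)),
          ⟨triangle p.isUnit p.res (q p).left p.res_act (q p).act,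
            innerFace p.isUnit p.res (q p).left p.res_act (q p).act, innerFace_act _ _ _ _ _, r2 p,
            hr2 p, w1 p⟩⟩
    let W : Word (Option (Piece f)) := mul (of none) (list some l)
    let s : ∀ i, Word (Elem (P i).cod) := fun i => match i with
      | none => of (Elem.refl (corolla hU u hu) corolla_isUnit)
      | some p => mul (of (rv p.isUnit p.res (q p).left p.res_act (q p).act))
          (list (fun r => pv p.isUnit p.res (q p).left p.res_act (q p).act r) (m p))
    have hs : ∀ i, IsFrame (s i).labels := fun i => match i with
      | none => isFrame_refl corolla_isUnit
      | some p => isFrame_vertices p.isUnit p.res (q p).left p.res_act (q p).act (fun r => r) (m p) (hm p)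
    have hW : IsFrame (W.map fun i => (P i).toElem).labels :=
      isFrame_vertices hU u (f ≫ g) hu (act_comp _ _ hf hg) (fun p : Piece f => p.comp (q p)) l hl''
    have hW' := isFrame_labels_subst he2 P W (by rwa [← labels_map]) s hs
    have c1 := Mon.mapW_comp (X := X) (hU := corolla_isUnit)
      (f := innerFace hU u (f ≫ g) hu (act_comp _ _ hf hg)) (hf := innerFace_act _ _ _ _ _) (g := e2)
      (hg := he2) P W hW s hs hW'
    let x : ∀ i, V i ⟶ T := fun i => match i with
      | none => 𝟙 _ ≫ v0
      | some (Sum.inl p) => (rv p.isUnit p.res (q p).left p.res_act (q p).act).hom ≫ r2 p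
      | some (Sum.inr r) => (pv r.1.isUnit r.1.res (q r.1).left r.1.res_act (q r.1).act r.2).hom ≫ r2 r.1
    have hx : ∀ i, HypermomentData.inert (x i) := fun i => match i with
      | none => inert_comp _ _ (inert_id _) hv0
      | some (Sum.inl p) => inert_comp _ _ (rv p.isUnit p.res (q p).left p.res_act (q p).act).inert (hr2 p)
      | some (Sum.inr r) => inert_comp _ _
          (pv r.1.isUnit r.1.res (q r.1).left r.1.res_act (q r.1).act r.2).inert (hr2 r.1)
    have hxv : x = v := by
      refine funext fun i => ?_
      exact match i with
      | none => Category.id_comp _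
      | some (Sum.inl p) => corolla_hom_ext (k := (1 : Fin 4)) (l := (2 : Fin 4)) rfl rfl rfl rfl
          (congrArg (· ≫ _) (Category.id_comp _)) (congrArg (· ≫ _) (Category.id_comp _))
      | some (Sum.inr r) => corolla_hom_ext (k := (2 : Fin 4)) (l := (3 : Fin 4)) rfl rfl rfl rfl
          rfl rfl
    refine transport_el x hx hxv (fun x hx => ∃ H,
      X.mapW corolla_isUnit k2 hk2 (W2.map (el x hx)) H = _) ⟨hW', ?_⟩
    have c2 := X.act1_id (U := corolla hU u hu) corolla_isUnit (𝟙 _) (act_id _) rfl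
    have c3 : (fun p : Piece f => mapMap X.val (fun e => e.push (r2 p) (hr2 p)) (s (some p)) ≫
        S.mulT p.isUnit p.res (q p).left p.res_act (q p).act (fun r => r) (m p) (hm p)) =
        fun p : Piece f => S.mulT p.isUnit p.res (q p).left p.res_act (q p).act (fun r => r) (m p) (hm p) := by
      refine funext fun p => ?_
      have e : ∀ {P Q : E} {a : P ⟶ P} {b : P ⟶ Q}, a = 𝟙 _ → a ≫ b = b := by
        rintro P Q a b rfl
        exact Category.id_comp b
      exact e (mapMap_mul_list _ _ _ _ _)
    have c4 := congrArg (fun z : ∀ p : Piece f, S.coll.obj ⟨p.cod⟩ ⊗ tens (fun r : Piece (q p).left =>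
      S.coll.obj ⟨r.cod⟩) (m p) ⟶ S.coll.obj ⟨(q p).mid⟩ => tensHom z l) c3
    have e : ∀ {P Q Q' Z : E} {a b : P ⟶ P} {c c' : Q ⟶ Q'} {d : P ⊗ Q' ⟶ Z} {t : P ⊗ Q ⟶ Z},
        t = ((a ≫ b) ⊗ₘ c) ≫ d → a = 𝟙 _ → b = 𝟙 _ → c = c' → t = P ◁ c' ≫ d := by
      rintro P Q Q' Z a b c c' d t rfl rfl rfl rfl
      simp
    exact e (a := 𝟙 _) c1 rfl c2 c4
  obtain ⟨H1, H1'⟩ := H1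
  obtain ⟨H2, H2'⟩ := H2
  -- The two total corollas differ by the bracketing of `u ≫ f ≫ g`. The isomorphism between them is
  -- the identity on last objects and acts trivially.
  let b : corolla hU ((u ≫ f) ≫ g) (act_comp _ _ (act_comp _ _ hu hf) hg) ⟶
      corolla hU (u ≫ f ≫ g) (act_comp _ _ hu (act_comp _ _ hf hg)) :=
    corollaMap _ _ _ _ _ _ (Iso.refl U) (Iso.refl D)
      ((Category.comp_id _).trans ((Category.assoc u f g).trans (Category.id_comp _).symm))
  have hb : b ≫ k2 = k1 :=
    corolla_hom_ext (k := (0 : Fin 4)) (l := (3 : Fin 4)) rfl rfl rfl rfl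
      (congrArg (· ≫ _) (Category.id_comp _)) (congrArg (· ≫ _) (Category.id_comp _))
  have h3 := Mon.mapW_precomp (X := X) (hU := corolla_isUnit) (hb := corollaMap_act _ _ _ _ _ _ _ _ _)
    (hf := hk2) (hk := hk1) hb corolla_isUnit (W1.map (el v hv)) H1
  have h4 := S.act1_corollaMap hU ((u ≫ f) ≫ g) (act_comp _ _ (act_comp _ _ hu hf) hg) hU (u ≫ f ≫ g)
    (act_comp _ _ hu (act_comp _ _ hf hg)) (Iso.refl U) (Iso.refl D)
    ((Category.comp_id _).trans ((Category.assoc u f g).trans (Category.id_comp _).symm))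
  have h5 : S.coll.map (⟨(Iso.refl D).symm⟩ : (⟨D⟩ : Core C) ⟶ ⟨D⟩) = 𝟙 _ := S.coll.map_id ⟨D⟩
  have h6 := Mon.canon_mapW (X := X) (hU := corolla_isUnit) (f := k2) (hf := hk2)
    ((Canon.assoc (F := X.val) (of (el v hv none)) (list (fun p => el v hv (some (Sum.inl p))) l)
      (big l fun p => list (fun r => el v hv (some (Sum.inr ⟨p, r⟩))) (m p))).comp
      ((Canon.distrib (F := X.val) (fun p : Piece f => of (el v hv (some (Sum.inl p))))
        (fun p => list (fun r => el v hv (some (Sum.inr ⟨p, r⟩))) (m p)) l).whiskerLeft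
        (of (el v hv none)))) H1 H2
  have e : ∀ {P Q Q' R Z : E} {a b : P ⟶ Z} {x : P ⟶ Q} {y : Q ⟶ Q'} {z : Q' ⟶ R} {w : R ⟶ Z} {i : Z ⟶ Z}
      {b' : P ⟶ Z} {zy : Q ⟶ R} {c : Q' ⟶ Z}, a = b → a = b' ≫ i → i = 𝟙 _ → (x ≫ y) ≫ c = b' →
      c = z ≫ w → y ≫ z = zy → b = x ≫ zy ≫ w := by
    rintro P Q Q' R Z a b x y z w i b' zy c rfl rfl rfl rfl rfl rfl
    simp
  exact e H1' h3 (h4.trans h5) h6 H2' (MonoidalCategory.whiskerLeft_comp _ _ _).symm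

end TreeMon

end Assoc

/-! ### The functor from normalised monoids to operads -/

section Ext

variable {C : Type u} [Category.{v} C] [HypermomentData C] [IsUnitalHypermoment C]
variable {E : Type u'} [Category.{v'} E] [MonoidalCategory E] [SymmetricCategory E]

open Word CTree

theorem Word.mapMap_big_list {ι ι' κ : Type w} {β : κ → Type w} (F : ι' → E) (c : ι → ι')
    (d : ∀ k, β k → ι) (m : ∀ k, List (β k)) (l : List κ) :
    mapMap F c (big l fun k => list (d k) (m k)) =
      𝟙 (tens (fun k => tens (fun i => F (c (d k i))) (m k)) l) :=
  (congrArg (fun z : ∀ k, tens (fun i => F (c (d k i))) (m k) ⟶ tens (fun i => F (c (d k i))) (m k) =>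
    tensHom z l) (funext fun k => mapMap_list F c (d k) (m k))).trans (tensHom_id _ _)

theorem Canon.map_list_list {ι ι' κ κ' : Type w} {F : ι' → E} {c : ι → ι'} {d : κ → ι} {d' : κ' → ι}
    {l : List κ} {l' : List κ'} {φ : tens (fun i => F (c (d i))) l ⟶ tens (fun i => F (c (d' i))) l'}
    (h : Canon (fun a => F (c a)) (list d l) (list d' l') φ) :
    Canon F (list (fun i => c (d i)) l) (list (fun i => c (d' i)) l') φ := by
  obtain ⟨φ', h1, h2⟩ := h.exists_map c
  have e : ∀ {P Q : E} {φ φ' : P ⟶ Q} {a b}, φ' ≫ a = b ≫ φ → a = 𝟙 _ → b = 𝟙 _ → φ' = φ := by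
    rintro P Q φ φ' a b H rfl rfl
    rwa [Category.comp_id, Category.id_comp] at H
  exact h1.of_eq (e h2 (mapMap_list F c d' l') (mapMap_list F c d l))

theorem Canon.map_list_big {ι ι' κ κ' : Type w} {F : ι' → E} {c : ι → ι'} {d : κ → ι}
    {β : κ' → Type w} {d' : ∀ k, β k → ι} {m : ∀ k, List (β k)} {l : List κ} {l' : List κ'}
    {φ : tens (fun i => F (c (d i))) l ⟶ tens (fun k => tens (fun i => F (c (d' k i))) (m k)) l'}
    (h : Canon (fun a => F (c a)) (list d l) (big l' fun k => list (d' k) (m k)) φ) :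
    Canon F (list (fun i => c (d i)) l) (big l' fun k => list (fun i => c (d' k i)) (m k)) φ := by
  obtain ⟨φ', h1, h2⟩ := h.exists_map c
  have e : ∀ {P Q : E} {φ φ' : P ⟶ Q} {a b}, φ' ≫ a = b ≫ φ → a = 𝟙 _ → b = 𝟙 _ → φ' = φ := by
    rintro P Q φ φ' a b H rfl rfl
    rwa [Category.comp_id, Category.id_comp] at H
  exact h1.of_eq (e h2 (mapMap_big_list F c d' m l') (mapMap_list F c d l))

namespace TreeMon

/-- A unit with an active morphism to `A`. -/
theorem root_isUnit (A : C) : IsUnitObj (exists_corolla A).choose :=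
  (exists_corolla A).choose_spec.choose

/-- An active morphism to `A` from a unit. -/
noncomputable def root (A : C) : (exists_corolla A).choose ⟶ A :=
  (exists_corolla A).choose_spec.choose_spec.choose

theorem root_act (A : C) : act (root A) := (exists_corolla A).choose_spec.choose_spec.choose_spec

variable (S : TreeMon C E)

/-- The operad given by a normalized monoid. -/
noncomputable def operad : Operad C E where
  coll := S.coll
  unit U hU := S.unitT hU
  mul f hf l h := S.mulT (root_isUnit _) (root _) f (root_act _) hf (fun p => p) l h
  mul_swap f hf l₁ l₂ x y h h' := by
    exact (S.canon_mulT (Canon.bigSwap (fun p => of (pv _ _ f _ hf p)) x y l₂ l₁) h h').symm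
  left_unit hU f hf h := by
    refine Eq.trans ?_ (S.left_unitT hU f hf h)
    exact congrArg (S.unitT hU ▷ _ ≫ ·) (S.mulT_eq _ _ _ hU (𝟙 _) (act_id _) (fun p => p) _ h)
  right_unit A l h := by
    have h1 : IsFrame (l.map fun e => (Piece.ofElem e).toElem) := by rwa [List.map_map] at h
    refine Eq.trans ?_ (S.right_unitT (root_isUnit A) (root A) (root_act A) l h1)
    have h2 := S.mulT_map (hU := root_isUnit A) (u := root A) (hu := root_act A) (hf := act_id A)
      Piece.ofElem (fun p => p) l h1 h
    have h3 := tensMap_eq (F := fun _ : Elem A => 𝟙_ E) (G := fun p : Piece (𝟙 A) => S.coll.obj ⟨p.cod⟩)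
      Piece.ofElem (fun e => S.unitT e.isUnit) l
    have e : ∀ {X P Q R Z : E} {a : P ⟶ R} {b : P ⟶ Q} {c : Q ⟶ R} {m : X ⊗ R ⟶ Z} {m' : X ⊗ Q ⟶ Z},
        a = b ≫ c → X ◁ c ≫ m = m' → X ◁ a ≫ m = X ◁ b ≫ m' := by
      rintro X P Q R Z a b c m m' rfl rfl
      rw [MonoidalCategory.whiskerLeft_comp, Category.assoc]
    exact e h3 h2
  assoc {A B D} f g hf hg l q m hl hm hl' hl'' := by
    obtain ⟨l', rfl⟩ : ∃ l', l = List.map (fun p => p) l' := ⟨l, (List.map_id' l).symm⟩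
    obtain ⟨JK, J, J', h1, h2, h3, h4⟩ := exists_tensZip (fun p : Piece f => S.coll.obj ⟨p.cod⟩)
      (fun r : Piece g => S.coll.obj ⟨r.cod⟩) (fun s : Piece (f ≫ g) => S.coll.obj ⟨s.cod⟩)
      (fun p => p.comp (q p)) m (fun p => p.push) (fun p => S.mulT (root_isUnit _) (root _) (q p).left
        (root_act _) (q p).act (fun r => r) (m p) (hm p)) (fun p => p) l'
    have k1 : IsFrame (l'.map fun p => p.toElem) := by rwa [List.map_map] at hl
    have k3 : IsFrame (l'.map fun p => (p.comp (q p)).toElem) := by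
      rwa [List.map_map, List.map_map] at hl''
    have h5 := S.canon_mulT (π := fun p => p) (π' := fun p => p) (hU := root_isUnit A) (u := root A)
      (f := f) (hu := root_act A) (hf := hf) (Canon.map_list_list (c := pv _ _ f _ hf) h1) hl k1
    have h2' := Canon.map_list_big (F := S.str.toMon.val) (c := pv (root_isUnit A) (root A ≫ f) g
      (act_comp _ _ (root_act A) hf) hg) h2
    have f1 := isFrame_vertices (root_isUnit A) (root A ≫ f) g (act_comp _ _ (root_act A) hf) hg
      (fun p => p) _ hl'
    have c6 := h2'.whiskerLeft (of (rv (root_isUnit A) (root A ≫ f) g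
      (act_comp _ _ (root_act A) hf) hg))
    have f2 := f1.perm c6.perm
    have h6 := Mon.canon_mapW (X := S.str.toMon) (hU := corolla_isUnit)
      (f := innerFace (root_isUnit A) (root A ≫ f) g (act_comp _ _ (root_act A) hf) hg)
      (hf := innerFace_act _ _ _ _ _) c6 f1 f2
    have h7 := S.canon_mulT (π := fun p : Piece f => p.comp (q p)) (π' := fun p => p)
      (hU := root_isUnit A) (u := root A) (f := f ≫ g) (hu := root_act A) (hf := act_comp _ _ hf hg)
      (Canon.map_list_list (c := pv _ _ (f ≫ g) _ (act_comp _ _ hf hg)) h3) k3 hl''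
    have h8 := S.assocT (root_isUnit A) (root A) f g (root_act A) hf hg l' q m k1 hm k3 f2
    -- The operad uses the chosen unit below `B`, but the tree of height three has `root A ≫ f`
    -- there. Independence of the unit reconciles the two; `h10` does the same for each `B_α`.
    have h9 := S.mulT_eq (root_isUnit B) (root B) (root_act B) (f := g) (hf := hg) (root_isUnit A)
      (root A ≫ f) (act_comp _ _ (root_act A) hf) (fun p => p) _ hl'
    have h10 : (fun p : Piece f => S.mulT p.isUnit p.res (q p).left p.res_act (q p).act
        (fun r => r) (m p) (hm p)) = fun p => S.mulT (root_isUnit _) (root _) (q p).left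
        (root_act _) (q p).act (fun r => r) (m p) (hm p) := funext fun p => S.mulT_eq _ _ _ _ _ _ _ _ _
    rw [h10] at h8
    have e : ∀ {X Y P P' R R' K K' Q' Z : E} {m1 : X ⊗ P ⟶ Y} {m1' : X ⊗ P' ⟶ Y} {m2 m2' : Y ⊗ R ⟶ Z}
        {b2 : Y ⊗ R' ⟶ Z} {jk : P ⟶ P'} {j : R ⟶ R'} {d : P' ⊗ R' ⟶ K} {t : K ⟶ K'} {j' : K' ⟶ Q'}
        {m3 : X ⊗ K' ⟶ Z} {m3' : X ⊗ Q' ⟶ Z} {z : P ⊗ R ⟶ Q'}, X ◁ jk ≫ m1' = m1 →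
        Y ◁ j ≫ b2 = m2' → X ◁ j' ≫ m3' = m3 → m2 = m2' → z = (jk ⊗ₘ j) ≫ d ≫ t ≫ j' →
        m1' ▷ _ ≫ b2 = (α_ _ _ _).hom ≫ X ◁ (d ≫ t) ≫ m3 →
        (α_ _ _ _).inv ≫ m1 ▷ _ ≫ m2 = X ◁ z ≫ m3' := by
      rintro X Y P P' R R' K K' Q' Z m1 m1' m2 m2' b2 jk j d t j' m3 m3' z rfl rfl rfl rfl rfl H
      rw [← whisker_exchange_assoc, comp_whiskerRight, Category.assoc, H]
      simp [MonoidalCategory.tensorHom_def']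
    exact e h5 h6 h7 h9 h4 h8
  equivariance {A B A' B'} f f' hf hf' σ ρ w c τ l h h' := by
    have k : IsFrame (l.map fun p => (c p).toElem) := by rwa [List.map_map] at h'
    have h1 := S.mulT_iso (hU := root_isUnit A) (u := root A) (hu := root_act A) (hf := hf)
      (hU' := root_isUnit A') (u' := root A') (hu' := root_act A') (hf' := hf') σ ρ w
      (π := fun p => p) (π' := fun p => c p) τ l h k
    have h2 := S.mulT_map (hU := root_isUnit A') (u := root A') (hu := root_act A') (hf := hf')
      c (fun p => p) l k h'
    have h3 := tensMap_eq (F := fun p : Piece f => S.coll.obj ⟨p.cod⟩)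
      (G := fun p : Piece f' => S.coll.obj ⟨p.cod⟩) c (fun p => S.coll.map ⟨(τ p).codIso⟩) l
    have e : ∀ {X Y P Q R Z : E} {s : X ⟶ Y} {a : P ⟶ R} {b : P ⟶ Q} {c : Q ⟶ R} {m : Y ⊗ R ⟶ Z}
        {m' : Y ⊗ Q ⟶ Z} {n : X ⊗ P ⟶ Z}, n = (s ⊗ₘ b) ≫ m' → Y ◁ c ≫ m = m' → a = b ≫ c →
        n = (s ⊗ₘ a) ≫ m := by
      rintro X Y P Q R Z s a b c m m' n rfl rfl rfl
      rw [← id_tensorHom, tensorHom_comp_tensorHom_assoc, Category.comp_id]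
    exact e h1 h2 h3

/-- The functor from normalized monoids to operads. -/
noncomputable def ext : TreeMon C E ⥤ Operad C E where
  obj S := S.operad
  map {S S'} φ := show Operad.Hom _ _ from ⟨Hom.app φ, fun U hU =>
      (Mon.Hom.mapW_naturality (toMon.map φ) _ _ _ _ _).trans (Category.id_comp _),
    fun f hf l h => Mon.Hom.mapW_naturality (toMon.map φ) _ _ _ _ _⟩

instance : (ext : TreeMon C E ⥤ _).Faithful where
  map_injective {S S'} φ ψ h := Hom.ext (congrArg Operad.Hom.app h)

end TreeMon

end Ext

section

variable {C : Type u} [Category.{v} C] [HypermomentData C] [IsHypermoment C]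

theorem exists_frame_list {A B : C} (g : A ⟶ B) : ∃ l : List (Piece g), IsFrame (l.map fun p => p.toElem) := by
  obtain ⟨l, hl⟩ := exists_isFrame A
  refine ⟨l.map fun e => ⟨e, (Factor.exists _).some⟩, ?_⟩
  rw [List.map_map]
  exact (List.map_id l).symm ▸ hl

end

/-! ### Morphisms of operads are morphisms of monoids -/

section Full

variable {C : Type u} [Category.{v} C] [HypermomentData C] [IsUnitalHypermoment C]
variable {E : Type u'} [Category.{v'} E] [MonoidalCategory E] [SymmetricCategory E]

open Word CTree

/-- Active morphisms to `B` from unit trees are determined by last objects, so any two of them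
differ by an active morphism between the unit trees. It is therefore enough to test naturality on
one of them. -/
theorem CTree.exists_comp_eq {T T₀ B : CTree C} (hT : T.height = 1) {f : T ⟶ B}
    {f₀ : T₀ ⟶ B} (hf : IsAct f) (hf₀ : IsAct f₀) : ∃ b : T ⟶ T₀, IsAct b ∧ b ≫ f₀ = f := by
  obtain ⟨b, hb, h⟩ := exists_topIso_eq hT (topIso f hf ≪≫ (topIso f₀ hf₀).symm)
  refine ⟨b, hb, eq_of_topIso_eq hT (isAct_comp _ _ hb hf₀) hf ?_⟩
  rw [topIso_comp _ _ hb hf₀, h]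
  simp

/-- The active part of a piece preserves endpoints and the inert part is a translation, so the tree
of a piece fills exactly the interval spanned by the image of its vertex. -/
theorem CTree.height_cod {A B : CTree C} {g : A ⟶ B} (p : Piece g) :
    (idx g (idx p.hom 0) : ℕ) + p.cod.height = idx g (idx p.hom (Fin.last _)) := by
  have h0 : idx p.incl (idx p.res 0) = idx g (idx p.hom 0) :=
    congrArg (fun k : p.dom ⟶ B => idx k 0) p.comm
  have h1 : idx p.incl (idx p.res (Fin.last _)) = idx g (idx p.hom (Fin.last _)) :=
    congrArg (fun k : p.dom ⟶ B => idx k (Fin.last _)) p.comm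
  have h2 : IsAct p.res := p.res_act
  rw [h2.1] at h0
  rw [h2.2.1] at h1
  rw [← h0, ← h1]
  exact (isInert_idx p.incl_inert (Fin.last _)).symm

/-- Frames only differ by the choice of representatives. -/
theorem exists_representatives {A : C} {l l' : List (Elem A)} (h : IsFrame l) (h' : IsFrame l') :
    ∃ c : Elem A → Elem A, (∀ e : Elem A, e.Equiv (c e)) ∧ (l.map c).Perm l' := by
  choose c hc hc' using h'.1
  have hpt : ∀ e, (c e).pt = e.pt := fun e => ((Elem.equiv_iff _ _).1 (hc' e)).symm
  have hf : IsFrame (l.map c) := h.of_map_pt (by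
    rw [List.map_map]
    exact List.Perm.of_eq (List.map_congr_left fun e _ => (hpt e).symm))
  refine ⟨c, hc', (List.perm_ext_iff_of_nodup hf.nodup h'.nodup).2 fun e => ?_⟩
  constructor
  · intro he
    obtain ⟨e', -, rfl⟩ := List.mem_map.1 he
    exact hc e'
  · intro he
    obtain ⟨e', he', h2⟩ := hf.1 e
    obtain ⟨e'', -, rfl⟩ := List.mem_map.1 he'
    rw [Elem.equiv_iff] at h2
    have := List.inj_on_of_nodup_map ((isFrame_iff _).1 h').2 he (hc e'') h2
    rwa [this]

namespace TreeMon

variable {S S' : TreeMon C E} (α : S.coll ⟶ S'.coll)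

/-- The compatibility of a map of collections with the action of a morphism on a formal tensor
product. -/
def NatOn {T B : CTree C} (hT : IsUnitObj T) (f : T ⟶ B) (hf : act f) (W : Word (Elem B))
    (h : IsFrame W.labels) : Prop :=
  S.str.toMon.mapW hT f hf W h ≫ α.app ⟨T.top⟩ =
    evalMap (F := S.str.toMon.val) (G := S'.str.toMon.val) (fun e : Elem B => α.app ⟨e.dom.top⟩) W ≫
      S'.str.toMon.mapW hT f hf W h

variable {α}

theorem NatOn.perm {T B : CTree C} {hT : IsUnitObj T} {f : T ⟶ B} {hf : act f} {W W' : Word (Elem B)}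
    {h : IsFrame W.labels} (H : NatOn α hT f hf W h) (h' : IsFrame W'.labels)
    (hp : W'.labels.Perm W.labels) : NatOn α hT f hf W' h' := by
  have hc := can_canon S.str.toMon.val hp
  obtain ⟨θ, h1, h2⟩ := hc.exists_evalMap (G := S'.str.toMon.val)
    fun e : Elem B => α.app ⟨e.dom.top⟩
  have h3 := Mon.canon_mapW (hU := hT) (hf := hf) hc h' h
  have h4 := Mon.canon_mapW (hU := hT) (hf := hf) h1 h' h
  have e : ∀ {P Q R R' Z Z' : E} {c : P ⟶ Q} {m : Q ⟶ Z} {m' : P ⟶ Z} {a : Z ⟶ Z'} {t : Q ⟶ R}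
      {n : R ⟶ Z'} {t' : P ⟶ R'} {θ : R' ⟶ R} {n' : R' ⟶ Z'}, c ≫ m = m' → m ≫ a = t ≫ n →
      c ≫ t = t' ≫ θ → θ ≫ n = n' → m' ≫ a = t' ≫ n' := by
    rintro P Q R R' Z Z' c m m' a t n t' θ n' rfl H1 H2 rfl
    rw [Category.assoc, H1, reassoc_of% H2]
  exact e h3 H h2 h4

theorem act1_nat {T T' : CTree C} (hT : IsUnitObj T) (hT' : IsUnitObj T') (g : T ⟶ T') (hg : act g) :
    S.str.toMon.act1 hT hT' g hg ≫ α.app ⟨T.top⟩ = α.app ⟨T'.top⟩ ≫ S'.str.toMon.act1 hT hT' g hg := by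
  have e : ∀ {P Q R R' : E} {a a' : P ⟶ Q} {b : Q ⟶ R'} {c : P ⟶ R} {d d' : R ⟶ R'}, a = a' → d = d' →
      a' ≫ b = c ≫ d' → a ≫ b = c ≫ d := by
    rintro P Q R R' a a' b c d d' rfl rfl H
    exact H
  exact e (S.act1_eq _ _ _ _) (S'.act1_eq _ _ _ _) (α.naturality _)

/-- Two frames differ by a permutation and by isomorphisms of representatives. Isomorphisms of units
act through the underlying collections, and `α` is natural there. -/
theorem NatOn.all {T B : CTree C} {hT : IsUnitObj T} {f : T ⟶ B} {hf : act f} {W W' : Word (Elem B)}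
    {h : IsFrame W.labels} (H : NatOn α hT f hf W h) (h' : IsFrame W'.labels) :
    NatOn α hT f hf W' h' := by
  obtain ⟨c, hc, hp⟩ := exists_representatives h h'
  have h1 : IsFrame (list (fun e => e) W.labels).labels := by rwa [labels_list, List.map_id']
  have h2 : IsFrame (list c W.labels).labels := by
    rw [labels_list]
    exact h'.perm hp.symm
  have H1 : NatOn α hT f hf (list (fun e => e) W.labels) h1 :=
    H.perm h1 (by rw [labels_list, List.map_id'])
  refine NatOn.perm (W := list c W.labels) (h := h2) ?_ h' (by rw [labels_list]; exact hp.symm)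
  choose j hj using hc
  have h3 : ∀ S : TreeMon C E, _ := fun S => Mon.mapW_unary (X := S.str.toMon) (hU := hT) (f := f) (g := 𝟙 B) (hf := hf)
    (hg := act_id B) (k := f) (hk := hf) (Category.comp_id f) (list (fun e => e) W.labels)
    (fun e => e) (V := fun e => (c e).dom) (hV := fun e => (c e).isUnit) (h := fun e => (c e).hom)
    (hh := fun e => (c e).inert) (fun e => (j e).hom) (fun e => IsHypermoment.act_of_isIso _)
    (fun e => (hj e).trans (Category.comp_id _).symm) h1 h2
  have h4 : tensHom (fun e : Elem B => S.str.toMon.act1 e.isUnit (c e).isUnit (j e).hom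
        (IsHypermoment.act_of_isIso _)) W.labels ≫
      tensHom (fun e : Elem B => α.app ⟨e.dom.top⟩) W.labels =
      tensHom (fun e : Elem B => α.app ⟨(c e).dom.top⟩) W.labels ≫
        tensHom (fun e : Elem B => S'.str.toMon.act1 e.isUnit (c e).isUnit (j e).hom
        (IsHypermoment.act_of_isIso _)) W.labels := by
    refine (tensHom_comp _ _ _).symm.trans (Eq.trans ?_ (tensHom_comp _ _ _))
    exact congrArg (fun z : ∀ e : Elem B, S.coll.obj ⟨(c e).dom.top⟩ ⟶ S'.coll.obj ⟨e.dom.top⟩ =>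
      tensHom z W.labels) (funext fun e => act1_nat _ _ _ _)
  have e : ∀ {P Q R R' Z Z' : E} {c : P ⟶ Q} {m : Q ⟶ Z} {m' : P ⟶ Z} {a : Z ⟶ Z'} {t : Q ⟶ R}
      {n : R ⟶ Z'} {t' : P ⟶ R'} {θ : R' ⟶ R} {n' : R' ⟶ Z'}, m' = c ≫ m → m ≫ a = t ≫ n →
      c ≫ t = t' ≫ θ → n' = θ ≫ n → m' ≫ a = t' ≫ n' := by
    rintro P Q R R' Z Z' c m m' a t n t' θ n' rfl H1 H2 rfl
    rw [Category.assoc, H1, reassoc_of% H2]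
  exact e (h3 S) H1 h4 (h3 S')

theorem NatOn.precomp {T T₀ B : CTree C} (hT : IsUnitObj T) {hT₀ : IsUnitObj T₀} {f₀ : T₀ ⟶ B}
    {hf₀ : act f₀} {W : Word (Elem B)} {h : IsFrame W.labels} (H : NatOn α hT₀ f₀ hf₀ W h)
    (f : T ⟶ B) (hf : act f) : NatOn α hT f hf W h := by
  obtain ⟨b, hb, rfl⟩ := exists_comp_eq (height_of_isUnitObj hT) hf hf₀
  have h1 : ∀ S : TreeMon C E, _ := fun S => Mon.mapW_precomp (X := S.str.toMon) (hU := hT)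
    (hb := hb) (hf := hf₀) (hk := hf) rfl hT₀ W h
  have e : ∀ {P Q Z Z' R R' : E} {m : P ⟶ Z} {x : P ⟶ Q} {a : Q ⟶ Z} {y : Z ⟶ Z'} {y' : Q ⟶ R} {t : P ⟶ R'} {n : R' ⟶ Z'}
      {n' : R' ⟶ R} {a' : R ⟶ Z'}, m = x ≫ a → a ≫ y = y' ≫ a' → x ≫ y' = t ≫ n' → n = n' ≫ a' →
      m ≫ y = t ≫ n := by
    rintro P Q Z Z' R R' m x a y y' t n n' a' rfl H1 H2 rfl
    rw [Category.assoc, H1, reassoc_of% H2]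
  exact e (h1 S) (act1_nat _ _ _ _) H (h1 S')

theorem NatOn.comp {T A B : CTree C} {hT : IsUnitObj T} {f : T ⟶ A} {hf : act f} (g : A ⟶ B)
    (hg : act g) (Hf : ∀ W h, NatOn α hT f hf W h)
    (Hg : ∀ p : Piece g, ∀ W h, NatOn α p.isUnit p.res p.res_act W h) :
    ∃ W h, NatOn α hT (f ≫ g) (act_comp _ _ hf hg) W h := by
  obtain ⟨l, hl⟩ := exists_frame_list g
  choose m hm using fun p : Piece g => exists_isFrame p.cod
  have hs : ∀ p : Piece g, IsFrame (list (fun e => e) (m p)).labels := fun p => by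
    rw [labels_list, List.map_id']
    exact hm p
  have hW : IsFrame (list (fun p : Piece g => p.toElem) l).labels := by rwa [labels_list]
  have hW' := isFrame_labels_subst hg (fun p : Piece g => p) (list (fun p => p) l)
    (by rwa [labels_list, List.map_map]) (fun p => list (fun e => e) (m p)) hs
  refine ⟨_, hW', ?_⟩
  have h1 : ∀ S : TreeMon C E, _ := fun S => Mon.mapW_comp (X := S.str.toMon) (hU := hT) (hf := hf)
    (hg := hg) (fun p : Piece g => p) (list (fun p => p) l) hW (fun p => list (fun e => e) (m p)) hs hW'
  have h2 : tensHom (fun p : Piece g => mapMap S.str.toMon.val (fun e => e.push p.incl p.incl_inert)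
        (list (fun e => e) (m p)) ≫
        S.str.toMon.mapW p.isUnit p.res p.res_act (list (fun e => e) (m p)) (hs p)) l ≫
      tensHom (fun p : Piece g => α.app ⟨p.dom.top⟩) l =
      tensHom (fun p : Piece g => tensHom (fun e : Elem p.cod => α.app ⟨e.dom.top⟩) (m p)) l ≫
      tensHom (fun p : Piece g => mapMap S'.str.toMon.val (fun e => e.push p.incl p.incl_inert)
        (list (fun e => e) (m p)) ≫
        S'.str.toMon.mapW p.isUnit p.res p.res_act (list (fun e => e) (m p)) (hs p)) l := by
    refine (tensHom_comp _ _ _).symm.trans (Eq.trans ?_ (tensHom_comp _ _ _))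
    refine congrArg (fun z : ∀ p : Piece g, tens (fun e : Elem p.cod => S.coll.obj ⟨e.dom.top⟩) (m p) ⟶
      S'.coll.obj ⟨p.dom.top⟩ => tensHom z l) (funext fun p => ?_)
    have e : ∀ {P Q Q' R : E} {i : P ⟶ P} {a : P ⟶ Q} {b : Q ⟶ R} {c : P ⟶ Q'} {i' : Q' ⟶ Q'} {d : Q' ⟶ R},
        i = 𝟙 _ → i' = 𝟙 _ → a ≫ b = c ≫ d → (i ≫ a) ≫ b = c ≫ i' ≫ d := by
      rintro P Q Q' R i a b c i' d rfl rfl H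
      rwa [Category.id_comp, Category.id_comp]
    exact e (mapMap_list _ _ _ _) (mapMap_list _ _ _ _) (Hg p _ _)
  have e : ∀ {P Q R R' Z Z' : E} {c : P ⟶ Q} {m : Q ⟶ Z} {m' : P ⟶ Z} {a : Z ⟶ Z'} {t : Q ⟶ R}
      {n : R ⟶ Z'} {t' : P ⟶ R'} {θ : R' ⟶ R} {n' : R' ⟶ Z'}, m' = c ≫ m → m ≫ a = t ≫ n →
      c ≫ t = t' ≫ θ → n' = θ ≫ n → m' ≫ a = t' ≫ n' := by
    rintro P Q R R' Z Z' c m m' a t n t' θ n' rfl H1 H2 rfl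
    rw [Category.assoc, H1, reassoc_of% H2]
  exact e (h1 S) (Hf _ hW) h2 (h1 S')

/-- A map of collections compatible with the operad structures is compatible with the monoid
structures. -/
theorem natOn_of_hom (φ : Operad.Hom S.operad S'.operad) (n : ℕ) :
    ∀ {T B : CTree C} (_ : B.height = n) (hT : IsUnitObj T) (f : T ⟶ B) (hf : act f) (W : Word (Elem B))
      (h : IsFrame W.labels), NatOn φ.app hT f hf W h := by
  induction n using Nat.strong_induction_on with
  | _ n ih =>
    intro T B hB hT f hf W h
    -- By `precomp` and `all`, one active morphism and one word suffice for each `B`.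
    suffices H : ∃ (T₀ : CTree C) (hT₀ : IsUnitObj T₀) (f₀ : T₀ ⟶ B) (hf₀ : act f₀) (W₀ : _)
        (h₀ : _), NatOn φ.app hT₀ f₀ hf₀ W₀ h₀ by
      obtain ⟨T₀, hT₀, f₀, hf₀, W₀, h₀, H⟩ := H
      exact (H.precomp hT f hf).all h
    rcases n with _ | _ | n
    · obtain ⟨m, arr, hact, root⟩ := B
      obtain rfl : m = 0 := hB
      obtain ⟨U, rfl⟩ := ComposableArrows.mk₀_surjective arr
      exact ⟨_, corolla_isUnit, degeneracy root, degeneracy_act root, one, isFrame_nil rfl,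
        (Operad.Hom.unit_app φ U root).trans (Category.id_comp _).symm⟩
    · have hB' := isUnitObj_of_height hB
      exact ⟨B, hB', 𝟙 B, act_id B, of (Elem.refl B hB'), isFrame_refl hB', act1_nat hB' hB' _ _⟩
    -- Cut `B`, of height `n + 2`, at level `n + 1`. The triangle `B_0 ⟶ B_{n+1} ⟶ B_{n+2}` maps
    -- actively to `B`, and the trees replacing its vertices have heights `n + 1` and `1`, to which
    -- induction applies. For the triangle itself, naturality is compatibility with `μ`.
    · have i1 : n + 1 < B.height + 1 := by omega
      have l1 : (0 : Fin (B.height + 1)) ≤ ⟨n + 1, i1⟩ := Fin.zero_le _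
      have l2 : (⟨n + 1, i1⟩ : Fin (B.height + 1)) ≤ Fin.last _ := Fin.le_last _
      let g : triangle B.isUnit_root (B.mp l1) (B.mp l2) (B.mp_act _) (B.mp_act _) ⟶ B :=
        ofTriangle _ _ _ _ _ B 0 ⟨n + 1, i1⟩ (Fin.last _) l1 l2 (𝟙 _) (𝟙 _) (𝟙 _) (inert_id _)
          (inert_id _) (inert_id _) ((Category.comp_id _).trans (Category.id_comp _).symm)
          ((Category.comp_id _).trans (Category.id_comp _).symm)
      have hg : act g := ofTriangle_isAct rfl rfl (inferInstanceAs (IsIso (𝟙 _)))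
        (inferInstanceAs (IsIso (𝟙 _))) (inferInstanceAs (IsIso (𝟙 _)))
      obtain ⟨l, hl⟩ := exists_frame_list (B.mp l2)
      have hmul : NatOn φ.app corolla_isUnit (innerFace B.isUnit_root (B.mp l1) (B.mp l2) (B.mp_act _)
          (B.mp_act _)) (innerFace_act _ _ _ _ _) _
          (isFrame_vertices B.isUnit_root (B.mp l1) (B.mp l2) (B.mp_act _) (B.mp_act _) (fun p => p) l hl) := by
        have h1 : ∀ S : TreeMon C E, _ := fun S => S.mulT_eq B.isUnit_root (B.mp l1) (B.mp_act _)
          (f := B.mp l2) (hf := B.mp_act _) (root_isUnit _) (root _) (root_act _) (fun p => p) l hl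
        have e : ∀ {P Q R Z : E} {a a' : P ⟶ Q} {b : Q ⟶ Z} {c : P ⟶ R} {d d' : R ⟶ Z}, a = a' →
            d = d' → a' ≫ b = c ≫ d' → a ≫ b = c ≫ d := by
          rintro P Q R Z a a' b c d d' rfl rfl H
          exact H
        exact e (h1 S) (h1 S') (Operad.Hom.mul_app φ (B.mp l2) (B.mp_act _) l hl)
      obtain ⟨W₀, h₀, H⟩ := NatOn.comp g hg (fun W h => hmul.all h) fun p W h =>
        ih p.cod.height (by
          have h1 := height_cod p
          have h2 := idx_zero_lt p.toElem
          have h3 := idx_last_of_elem p.toElem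
          have h2' : (idx p.hom 0 : ℕ) = 0 ∨ (idx p.hom 0 : ℕ) = 1 := by
            have : (idx p.hom 0 : ℕ) < 2 := h2
            omega
          rcases h2' with h2' | h2'
          · have e0 : idx p.hom 0 = (0 : Fin 3) := Fin.ext h2'
            have e1 : idx p.hom (Fin.last _) = (1 : Fin 3) := Fin.ext (h3.trans (congrArg (· + 1) h2'))
            rw [e0, e1] at h1
            have h4 : 0 + p.cod.height = n + 1 := h1
            omega
          · have e0 : idx p.hom 0 = (1 : Fin 3) := Fin.ext h2'
            have e1 : idx p.hom (Fin.last _) = (2 : Fin 3) := Fin.ext (h3.trans (congrArg (· + 1) h2'))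
            rw [e0, e1] at h1
            have h4 : (n + 1) + p.cod.height = B.height := h1
            omega) rfl p.isUnit p.res p.res_act W h
      exact ⟨_, corolla_isUnit, _, _, W₀, h₀, H⟩

instance : (ext : TreeMon C E ⥤ _).Full where
  map_surjective {S S'} φ := by
    refine ⟨(⟨Operad.Hom.app φ, fun {T B} hT f hf l h => ?_⟩ : Hom S S'), rfl⟩
    have h1 : ∀ S : TreeMon C E, _ := fun S =>
      Mon.mapW_list (X := S.str.toMon) (hU := hT) (f := f) (hf := hf) h
    have h2 := natOn_of_hom (S := S) (S' := S') φ B.height rfl hT f hf (list (fun e => e) l)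
      (by rwa [labels_list, List.map_id'])
    have e : ∀ {P Q R Z : E} {a a' : P ⟶ Q} {b : Q ⟶ Z} {c : P ⟶ R} {d d' : R ⟶ Z}, a' = a →
        d' = d → a' ≫ b = c ≫ d' → a ≫ b = c ≫ d := by
      rintro P Q R Z a a' b c d d' rfl rfl H
      exact H
    exact e (h1 S) (h1 S') h2

end TreeMon

end Full

/-! ### Operad multiplications on formal tensor products -/

section OperadWords

variable {C : Type u} [Category.{v} C] [HypermomentData C] [IsHypermoment C]
variable {E : Type u'} [Category.{v'} E] [MonoidalCategory E] [SymmetricCategory E]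

open Word

theorem tensMap_tensMap {ι κ μ : Type*} {F : κ → E} {G : μ → E} (d : ι → κ) (c : κ → μ)
    (φ : ∀ a, F a ⟶ G (c a)) (l : List ι) :
    tensMap d (fun i => 𝟙 (F (d i))) l ≫ tensMap c φ (l.map d) =
      tensHom (fun i => φ (d i)) l ≫ tensMap (F := fun i => G (c (d i))) (G := fun k => G (c k)) d
        (fun i => 𝟙 (G (c (d i)))) l ≫ tensMap c (fun k => 𝟙 (G (c k))) (l.map d) := by
  induction l with
  | nil => exact (congrArg (𝟙 (𝟙_ E) ≫ ·) (Category.id_comp (𝟙 (𝟙_ E)))).symm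
  | cons a l ih =>
    have e : ∀ {A B P P' Q R S : E} {f : A ⟶ B} {x : P ⟶ Q} {y : Q ⟶ S} {z : P ⟶ P'} {w : P' ⟶ R}
        {u : R ⟶ S}, x ≫ y = z ≫ w ≫ u →
        (𝟙 A ⊗ₘ x) ≫ (f ⊗ₘ y) = (f ⊗ₘ z) ≫ (𝟙 B ⊗ₘ w) ≫ (𝟙 B ⊗ₘ u) := by
      intro A B P P' Q R S f x y z w u H
      rw [tensorHom_comp_tensorHom, tensorHom_comp_tensorHom, tensorHom_comp_tensorHom, H]
      simp
    exact e ih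

theorem tensMap_tensUnit {ι κ : Type*} (d : ι → κ) (l : List ι) :
    tensMap (E := E) (F := fun _ => 𝟙_ E) (G := fun _ => 𝟙_ E) d (fun _ => 𝟙 (𝟙_ E)) l ≫
      tensUnit (l.map d) = tensUnit l := by
  induction l with
  | nil => exact Category.id_comp (𝟙 (𝟙_ E))
  | cons a l ih =>
    have e : ∀ {P Q : E} {x : P ⟶ Q} {y : Q ⟶ 𝟙_ E} {z : P ⟶ 𝟙_ E}, x ≫ y = z →
        (𝟙 (𝟙_ E) ⊗ₘ x) ≫ (λ_ Q).hom ≫ y = (λ_ P).hom ≫ z := by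
      intro P Q x y z H
      rw [← H]
      simp
    exact e ih

namespace Operad

variable (O : Operad C E)

/-- The factor of the multiplications corresponding to a piece. -/
abbrev val {A B : C} {f : A ⟶ B} (p : Piece f) : E := O.coll.obj ⟨p.cod⟩

theorem isPerm_mul {A B : C} {f : A ⟶ B} (hf : act f) {l l' : List (Piece f)}
    (hl : IsFrame (l.map Piece.toElem)) (hl' : IsFrame (l'.map Piece.toElem))
    {θ : tens O.val l ⟶ tens O.val l'} (h : IsPerm O.val l l' θ) :
    O.coll.obj ⟨A⟩ ◁ θ ≫ O.mul f hf l' hl' = O.mul f hf l hl := by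
  induction h with
  | refl => rw [MonoidalCategory.whiskerLeft_id, Category.id_comp]
  | step l₁ x y l₂ φ h ih =>
    rw [MonoidalCategory.whiskerLeft_comp, Category.assoc, ← ih (hl.perm (h.perm.map _)),
      O.mul_swap f hf l₁ l₂ x y _ hl']

/-- The multiplication, on a formal tensor product. -/
noncomputable def mulW {A B : C} (f : A ⟶ B) (hf : act f) (W : Word (Piece f))
    (h : IsFrame (W.labels.map Piece.toElem)) :
    O.coll.obj ⟨A⟩ ⊗ W.eval O.val ⟶ O.coll.obj ⟨B⟩ :=
  O.coll.obj ⟨A⟩ ◁ can O.val (X := W) (Y := list (fun e => e) W.labels) (by simp [labels_list]) ≫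
    O.mul f hf W.labels h

variable {O}

/-- As for monoids: the labels form a frame, so coherence replaces the canonical morphism by
adjacent symmetries, which `mul_swap` absorbs. -/
theorem canon_mulW {A B : C} {f : A ⟶ B} {hf : act f} {W W' : Word (Piece f)}
    {φ : W.eval O.val ⟶ W'.eval O.val} (hφ : Canon O.val W W' φ)
    (h : IsFrame (W.labels.map Piece.toElem)) (h' : IsFrame (W'.labels.map Piece.toElem)) :
    O.coll.obj ⟨A⟩ ◁ φ ≫ O.mulW f hf W' h' = O.mulW f hf W h := by
  obtain ⟨θ, hθ⟩ := IsPerm.exists_of_perm (F := O.val) hφ.perm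
  have h1 := Canon.unique h.nodup.of_map (hφ.comp (can_canon O.val (X := W')
    (Y := list (fun e => e) W'.labels) (by simp [labels_list])))
    ((can_canon O.val (X := W) (Y := list (fun e => e) W.labels) (by simp [labels_list])).comp
      (hθ.canon fun e => of e))
  have h2 := O.isPerm_mul hf h h' hθ
  have e : ∀ {X P Q R S Z : E} {φ : P ⟶ Q} {c : Q ⟶ R} {x : X ⊗ R ⟶ Z} {c' : P ⟶ S} {θ : S ⟶ R}
      {y : X ⊗ S ⟶ Z}, φ ≫ c = c' ≫ θ → X ◁ θ ≫ x = y → X ◁ φ ≫ X ◁ c ≫ x = X ◁ c' ≫ y := by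
    rintro X P Q R S Z φ c x c' θ y H rfl
    rw [← MonoidalCategory.whiskerLeft_comp_assoc, H, MonoidalCategory.whiskerLeft_comp_assoc]
  exact e h1 h2

theorem canon_mul {A B : C} {f : A ⟶ B} {hf : act f} {W : Word (Piece f)} {l : List (Piece f)}
    {φ : W.eval O.val ⟶ tens O.val l} (hφ : Canon O.val W (list (fun e => e) l) φ)
    (h : IsFrame (W.labels.map Piece.toElem)) (h' : IsFrame (l.map Piece.toElem)) :
    O.coll.obj ⟨A⟩ ◁ φ ≫ O.mul f hf l h' = O.mulW f hf W h := by
  have hp : W.labels.Perm l := by simpa [labels_list] using hφ.perm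
  obtain ⟨θ, hθ⟩ := IsPerm.exists_of_perm (F := O.val) hp
  have h1 := Canon.unique h.nodup.of_map hφ ((can_canon O.val (X := W)
    (Y := list (fun e => e) W.labels) (by simp [labels_list])).comp (hθ.canon fun e => of e))
  have h2 := O.isPerm_mul hf h h' hθ
  have e : ∀ {X P R S Z : E} {φ : P ⟶ R} {x : X ⊗ R ⟶ Z} {c' : P ⟶ S} {θ : S ⟶ R}
      {y : X ⊗ S ⟶ Z}, φ = c' ≫ θ → X ◁ θ ≫ x = y → X ◁ φ ≫ x = X ◁ c' ≫ y := by
    rintro X P R S Z φ x c' θ y rfl rfl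
    rw [MonoidalCategory.whiskerLeft_comp_assoc]
  exact e h1 h2

theorem mulW_list {A B : C} {f : A ⟶ B} {hf : act f} {l : List (Piece f)}
    (h' : IsFrame (l.map Piece.toElem))
    (h : IsFrame ((list (fun p : Piece f => p) l).labels.map Piece.toElem)) :
    O.mulW f hf (list (fun p => p) l) h = O.mul f hf l h' := by
  refine (canon_mul (.id _) h h').symm.trans ?_
  have e : ∀ {X P Z : E} {x : X ⊗ P ⟶ Z}, X ◁ 𝟙 P ≫ x = x := by
    intros
    rw [MonoidalCategory.whiskerLeft_id, Category.id_comp]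
  exact e

/-- Pieces cut out of a tree involve composites with structure maps that are identities only after
rewriting. Comparing the pieces field by field avoids casts between their types. -/
theorem mulW_list_congr {A B : C} {f f' : A ⟶ B} (e : f = f') {hf : act f} {hf' : act f'}
    {κ : Type (max u v)} {D V : κ → C} {hD : ∀ i, IsUnitObj (D i)} {h h' : ∀ i, D i ⟶ A}
    {hh : ∀ i, HypermomentData.inert (h i)} {hh' : ∀ i, HypermomentData.inert (h' i)}
    {s s' : ∀ i, D i ⟶ V i} {hs : ∀ i, act (s i)} {hs' : ∀ i, act (s' i)} {r r' : ∀ i, V i ⟶ B}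
    {hr : ∀ i, HypermomentData.inert (r i)} {hr' : ∀ i, HypermomentData.inert (r' i)}
    {w : ∀ i, s i ≫ r i = h i ≫ f} {w' : ∀ i, s' i ≫ r' i = h' i ≫ f'} (eh : ∀ i, h i = h' i)
    (es : ∀ i, s i = s' i) (er : ∀ i, r i = r' i) (l : List κ)
    (H : IsFrame ((list (fun i => (⟨⟨D i, hD i, h i, hh i⟩, ⟨V i, s i, hs i, r i, hr i, w i⟩⟩ :
      Piece f)) l).labels.map Piece.toElem))
    (H' : IsFrame ((list (fun i => (⟨⟨D i, hD i, h' i, hh' i⟩, ⟨V i, s' i, hs' i, r' i, hr' i, w' i⟩⟩ :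
      Piece f')) l).labels.map Piece.toElem)) :
    O.mulW f hf (list (fun i => (⟨⟨D i, hD i, h i, hh i⟩, ⟨V i, s i, hs i, r i, hr i, w i⟩⟩ :
      Piece f)) l) H = O.mulW f' hf' (list (fun i => (⟨⟨D i, hD i, h' i, hh' i⟩,
        ⟨V i, s' i, hs' i, r' i, hr' i, w' i⟩⟩ : Piece f')) l) H' := by
  subst e
  obtain rfl : h = h' := funext eh
  obtain rfl : s = s' := funext es
  obtain rfl : r = r' := funext er
  rfl

theorem mulW_big_congr {A B : C} {f : A ⟶ B} {hf : act f}
    {κ : Type (max u v)} {β : κ → Type (max u v)} {D V : ∀ i, β i → C}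
    {hD : ∀ i b, IsUnitObj (D i b)} {h h' : ∀ i b, D i b ⟶ A}
    {hh : ∀ i b, HypermomentData.inert (h i b)} {hh' : ∀ i b, HypermomentData.inert (h' i b)}
    {s s' : ∀ i b, D i b ⟶ V i b} {hs : ∀ i b, act (s i b)} {hs' : ∀ i b, act (s' i b)}
    {r r' : ∀ i b, V i b ⟶ B} {hr : ∀ i b, HypermomentData.inert (r i b)}
    {hr' : ∀ i b, HypermomentData.inert (r' i b)} {w : ∀ i b, s i b ≫ r i b = h i b ≫ f}
    {w' : ∀ i b, s' i b ≫ r' i b = h' i b ≫ f} (eh : ∀ i b, h i b = h' i b)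
    (es : ∀ i b, s i b = s' i b) (er : ∀ i b, r i b = r' i b) (m : ∀ i, List (β i)) (l : List κ)
    (H : IsFrame ((big l fun i => list (fun b => (⟨⟨D i b, hD i b, h i b, hh i b⟩,
      ⟨V i b, s i b, hs i b, r i b, hr i b, w i b⟩⟩ : Piece f)) (m i)).labels.map Piece.toElem)) :
    ∃ H', O.mulW f hf (big l fun i => list (fun b => (⟨⟨D i b, hD i b, h i b, hh i b⟩,
      ⟨V i b, s i b, hs i b, r i b, hr i b, w i b⟩⟩ : Piece f)) (m i)) H =
      O.mulW f hf (big l fun i => list (fun b => (⟨⟨D i b, hD i b, h' i b, hh' i b⟩,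
      ⟨V i b, s' i b, hs' i b, r' i b, hr' i b, w' i b⟩⟩ : Piece f)) (m i)) H' := by
  obtain rfl : h = h' := funext fun i => funext (eh i)
  obtain rfl : s = s' := funext fun i => funext (es i)
  obtain rfl : r = r' := funext fun i => funext (er i)
  exact ⟨H, rfl⟩

/-- The image of a piece under isomorphisms of the source and of the target. -/
theorem exists_pieceIso {A B A' B' : C} {f : A ⟶ B} {f' : A' ⟶ B'} (σ : A ≅ A') (ρ : B ≅ B')
    (w : f ≫ ρ.hom = σ.hom ≫ f') (p : Piece f) : Nonempty (Σ' p' : Piece f', PieceIso σ ρ p p') :=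
  ⟨⟨⟨⟨p.dom, p.isUnit, p.hom ≫ σ.hom,
      inert_comp _ _ p.inert (IsHypermoment.inert_of_isIso σ.hom)⟩,
    ⟨p.cod, p.res, p.res_act, p.incl ≫ ρ.hom,
      inert_comp _ _ p.incl_inert (IsHypermoment.inert_of_isIso ρ.hom), by
        rw [← Category.assoc, p.comm, Category.assoc, w, Category.assoc]⟩⟩,
    ⟨Iso.refl p.dom, Iso.refl p.cod, Category.id_comp _,
      (Category.id_comp _).trans (Category.comp_id _).symm, Category.id_comp _⟩⟩⟩

theorem injective_of_isFrame {A B : C} {f : A ⟶ B} {κ : Type (max u v)} {π : κ → Piece f}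
    {l : List κ} (hl : ∀ i, i ∈ l) (h : IsFrame ((list π l).labels.map Piece.toElem)) :
    Function.Injective π := by
  rw [labels_list] at h
  exact fun i j e => List.inj_on_of_nodup_map h.nodup.of_map (hl i) (hl j) e

/-- Equivariance of the multiplications. -/
theorem mulW_iso {A B A' B' : C} {f : A ⟶ B} {f' : A' ⟶ B'} {hf : act f} {hf' : act f'}
    (σ : A ≅ A') (ρ : B ≅ B') (w : f ≫ ρ.hom = σ.hom ≫ f') {κ : Type (max u v)} {π : κ → Piece f}
    {π' : κ → Piece f'} (τ : ∀ i, PieceIso σ ρ (π i) (π' i)) {l : List κ} (hl : ∀ i, i ∈ l)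
    (h : IsFrame ((list π l).labels.map Piece.toElem))
    (h' : IsFrame ((list π' l).labels.map Piece.toElem)) :
    O.mulW f hf (list π l) h ≫ O.coll.map ⟨ρ⟩ =
      (O.coll.map ⟨σ⟩ ⊗ₘ tensHom (F := fun i => O.coll.obj ⟨(π i).cod⟩)
        (G := fun i => O.coll.obj ⟨(π' i).cod⟩) (fun i => O.coll.map ⟨(τ i).codIso⟩) l) ≫
        O.mulW f' hf' (list π' l) h' := by
  -- Each target piece is bundled with its isomorphism, so that both can be extended together from
  -- the given family to all pieces of `f`, as the equivariance axiom demands.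
  suffices H : ∀ (z : ∀ i, Σ' p' : Piece f', PieceIso σ ρ (π i) p')
      (h' : IsFrame ((list (fun i => (z i).1) l).labels.map Piece.toElem)),
      O.mulW f hf (list π l) h ≫ O.coll.map ⟨ρ⟩ =
      (O.coll.map ⟨σ⟩ ⊗ₘ tensHom (F := fun i => O.coll.obj ⟨(π i).cod⟩)
        (G := fun i => O.coll.obj ⟨(z i).1.cod⟩) (fun i => O.coll.map ⟨(z i).2.codIso⟩) l) ≫
        O.mulW f' hf' (list (fun i => (z i).1) l) h' from H (fun i => ⟨π' i, τ i⟩) h'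
  intro z h'
  have := exists_pieceIso (f := f) (f' := f') σ ρ w
  obtain ⟨y, hy⟩ := exists_extension (T := fun p : Piece f => Σ' p' : Piece f', PieceIso σ ρ p p')
    (injective_of_isFrame hl h) z
  obtain rfl : (fun i => y (π i)) = z := funext hy
  have h1 := Canon.bigMap (F := O.val) π (fun e => of e) l
  have h2 := (Canon.bigMap (F := O.val) π (fun e => of (y e).1) l).comp
    (Canon.bigMap (F := O.val) (fun p => (y p).1) (fun e => of e) (l.map π))
  have f1 : IsFrame ((l.map π).map Piece.toElem) := by
    rwa [labels_list] at h
  have f2 : IsFrame (((l.map π).map fun p => (y p).1).map Piece.toElem) := by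
    rw [labels_list, List.map_map] at h'
    rw [List.map_map, List.map_map]
    exact h'
  have e1 := canon_mul (hf := hf) h1 h f1
  have e2 := canon_mul (hf := hf') h2 h' f2
  have e3 := O.equivariance f f' hf hf' σ ρ w (fun p => (y p).1) (fun p => (y p).2) (l.map π) f1 f2
  have e4 := tensMap_tensMap (F := O.val) (G := O.val) π (fun p => (y p).1)
    (fun p => O.coll.map ⟨(y p).2.codIso⟩) l
  have e : ∀ {X X' P P' Q Q' Y Y' : E} {j : P ⟶ Q} {a : X ⊗ Q ⟶ Y} {a' : X ⊗ P ⟶ Y} {r : Y ⟶ Y'}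
      {s : X ⟶ X'} {t : Q ⟶ Q'} {b : X' ⊗ Q' ⟶ Y'} {j' : P' ⟶ Q'} {b' : X' ⊗ P' ⟶ Y'} {t' : P ⟶ P'},
      X ◁ j ≫ a = a' → X' ◁ j' ≫ b = b' → a ≫ r = (s ⊗ₘ t) ≫ b → j ≫ t = t' ≫ j' →
      a' ≫ r = (s ⊗ₘ t') ≫ b' := by
    rintro X X' P P' Q Q' Y Y' j a _ r s t b j' _ t' rfl rfl H H'
    rw [Category.assoc, H, ← MonoidalCategory.id_tensorHom, ← MonoidalCategory.id_tensorHom,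
      tensorHom_comp_tensorHom_assoc, tensorHom_comp_tensorHom_assoc, H', Category.id_comp,
      Category.comp_id]
  exact e e1 e2 e3 e4

/-- The right unit law for morphisms merely equal to identities, such as the structure map of a tree
from a level to itself. -/
theorem right_unitW {A : C} {f : A ⟶ A} (e : f = 𝟙 A) {hf : act f} {κ : Type (max u v)}
    {D : κ → C} {hD : ∀ i, IsUnitObj (D i)} {h : ∀ i, D i ⟶ A}
    {hh : ∀ i, HypermomentData.inert (h i)} {s : ∀ i, D i ⟶ D i} {hs : ∀ i, act (s i)}
    {r : ∀ i, D i ⟶ A} {hr : ∀ i, HypermomentData.inert (r i)} {w : ∀ i, s i ≫ r i = h i ≫ f}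
    (es : ∀ i, s i = 𝟙 _) (er : ∀ i, r i = h i) (l : List κ)
    (H : IsFrame ((list (fun i => (⟨⟨D i, hD i, h i, hh i⟩, ⟨D i, s i, hs i, r i, hr i, w i⟩⟩ :
      Piece f)) l).labels.map Piece.toElem)) :
    O.coll.obj ⟨A⟩ ◁ tensHom (fun i => O.unit (D i) (hD i)) l ≫
        O.mulW f hf (list (fun i => (⟨⟨D i, hD i, h i, hh i⟩, ⟨D i, s i, hs i, r i, hr i, w i⟩⟩ :
          Piece f)) l) H =
      O.coll.obj ⟨A⟩ ◁ tensUnit l ≫ (ρ_ (O.coll.obj ⟨A⟩)).hom := by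
  subst e
  obtain rfl : s = fun i => 𝟙 (D i) := funext es
  obtain rfl : r = h := funext er
  let c : κ → Elem A := fun i => ⟨D i, hD i, r i, hh i⟩
  have h2 := (Canon.bigMap (F := O.val) c (fun e => of (Piece.ofElem e)) l).comp
    (Canon.bigMap (F := O.val) Piece.ofElem (fun e => of e) (l.map c))
  have f2 : IsFrame (((l.map c).map Piece.ofElem).map Piece.toElem) := by
    rw [labels_list, List.map_map] at H
    rw [List.map_map, List.map_map]
    exact H
  have e2 := canon_mul (hf := hf) h2 H f2
  have e3 := O.right_unit A (l.map c) f2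
  have e4 := tensMap_tensMap (F := fun _ => 𝟙_ E) (G := O.val) c Piece.ofElem
    (fun e => O.unit e.dom e.isUnit) l
  have e5 := tensMap_tensUnit (E := E) c l
  have e : ∀ {X P P' Q Q' Y Y' : E} {j : P ⟶ Q} {t : Q ⟶ Q'} {b : X ⊗ Q' ⟶ Y'} {x : Q ⟶ Y}
      {y : X ⊗ Y ⟶ Y'} {j' : P' ⟶ Q'} {b' : X ⊗ P' ⟶ Y'} {t' : P ⟶ P'} {x' : P ⟶ Y},
      X ◁ j' ≫ b = b' → X ◁ t ≫ b = X ◁ x ≫ y → j ≫ t = t' ≫ j' → j ≫ x = x' →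
      X ◁ t' ≫ b' = X ◁ x' ≫ y := by
    rintro X P P' Q Q' Y Y' j t b x y j' _ t' _ rfl H H' rfl
    rw [← MonoidalCategory.whiskerLeft_comp_assoc, ← H', MonoidalCategory.whiskerLeft_comp_assoc,
      H, MonoidalCategory.whiskerLeft_comp_assoc]
  exact e e2 e3 e4 e5

theorem left_unitW {U A : C} {hU : IsUnitObj U} {f : U ⟶ A} {hf : act f} {hU' : IsUnitObj U}
    {h : U ⟶ U} {hh : HypermomentData.inert h} {s : U ⟶ A} {hs : act s} {r : A ⟶ A}
    {hr : HypermomentData.inert r} {w : s ≫ r = h ≫ f} (eh : h = 𝟙 U) (er : r = 𝟙 A)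
    (H : IsFrame ((list (fun _ : PUnit => (⟨⟨U, hU', h, hh⟩, ⟨A, s, hs, r, hr, w⟩⟩ : Piece f))
      [⟨⟩]).labels.map Piece.toElem)) :
    O.unit U hU ▷ (O.coll.obj ⟨A⟩ ⊗ 𝟙_ E) ≫ O.mulW f hf (list (fun _ : PUnit =>
        (⟨⟨U, hU', h, hh⟩, ⟨A, s, hs, r, hr, w⟩⟩ : Piece f)) [⟨⟩]) H =
      (λ_ (O.coll.obj ⟨A⟩ ⊗ 𝟙_ E)).hom ≫ (ρ_ (O.coll.obj ⟨A⟩)).hom := by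
  subst eh er
  obtain rfl : s = f := by simpa using w
  refine Eq.trans ?_ (O.left_unit hU s hf H)
  have h1 := canon_mul (hf := hf) (Canon.bigMap (F := O.val) (κ := PUnit)
    (fun _ => Piece.whole hU s hf) (fun e => of e) [⟨⟩]) H H
  have e : ∀ {I X P Y : E} {η : I ⟶ X} {j : P ⟶ P} {a b : X ⊗ P ⟶ Y}, j = 𝟙 _ →
      X ◁ j ≫ a = b → η ▷ P ≫ b = η ▷ P ≫ a := by
    rintro I X P Y η _ a _ rfl rfl
    rw [MonoidalCategory.whiskerLeft_id, Category.id_comp]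
  exact e (id_tensorHom_id _ _) h1

/-- Associativity of the multiplications, for families of pieces and of pieces of pieces which
extend to all pieces. -/
theorem assocW_of_total {A B D : C} {f : A ⟶ B} {g : B ⟶ D} {hf : act f} {hg : act g}
    {κ : Type (max u v)} (l : List κ) (P : κ → Piece f)
    (y : ∀ p : Piece f, Σ' q : Factor (p.incl ≫ g),
      {M : List (Piece q.left) // IsFrame (M.map Piece.toElem)})
    (h1 : IsFrame ((list P l).labels.map Piece.toElem))
    (h3 : IsFrame ((big l fun i => list (P i).push (y (P i)).2.1).labels.map Piece.toElem))
    (h4 : IsFrame ((list (fun i => (P i).comp (y (P i)).1) l).labels.map Piece.toElem)) :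
    O.mulW f hf (list P l) h1 ▷ _ ≫
        O.mulW g hg (big l fun i => list (P i).push (y (P i)).2.1) h3 =
      (α_ _ _ _).hom ≫ O.coll.obj ⟨A⟩ ◁ (tensDistrib (fun i => O.coll.obj ⟨(P i).cod⟩)
          (fun i => tens (fun r : Piece (y (P i)).1.left => O.coll.obj ⟨r.cod⟩) (y (P i)).2.1) l ≫
        tensHom (G := fun i => O.coll.obj ⟨(y (P i)).1.mid⟩)
          (fun i => O.mul (y (P i)).1.left (y (P i)).1.act (y (P i)).2.1 (y (P i)).2.2) l) ≫
      O.mulW (f ≫ g) (act_comp f g hf hg) (list (fun i => (P i).comp (y (P i)).1) l) h4 := by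
  obtain ⟨JK, J, J', k1, k2, k3, k4⟩ := exists_tensZip (O.val (f := f)) (O.val (f := g))
    (O.val (f := f ≫ g)) (fun p => p.comp (y p).1) (fun p => (y p).2.1) (fun p => p.push)
    (fun p => O.mul (y p).1.left (y p).1.act (y p).2.1 (y p).2.2) P l
  have f1 : IsFrame ((l.map P).map Piece.toElem) := by
    rwa [labels_list] at h1
  have f3 : IsFrame (((l.map P).flatMap fun p => (y p).2.1.map p.push).map Piece.toElem) := by
    have := h3.perm (k2.perm.symm.map Piece.toElem)
    rwa [labels_list, List.map_id'] at this
  have f4 : IsFrame (((l.map P).map fun p => p.comp (y p).1).map Piece.toElem) := by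
    have := h4.perm (k3.perm.map Piece.toElem)
    rwa [labels_list, List.map_id'] at this
  have H := O.assoc f g hf hg (l.map P) (fun p => (y p).1) (fun p => (y p).2.1) f1
    (fun p => (y p).2.2) f3 f4
  have f1' : IsFrame ((list (fun p : Piece f => p) (l.map P)).labels.map Piece.toElem) :=
    h1.perm (k1.perm.symm.map _)
  have f3' : IsFrame ((list (fun p : Piece g => p)
      ((l.map P).flatMap fun p => (y p).2.1.map p.push)).labels.map Piece.toElem) :=
    h3.perm (k2.perm.symm.map _)
  have g1 := (canon_mulW (hf := hf) k1 f1' h1).trans (mulW_list f1 f1')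
  have g2 := (canon_mulW (hf := hg) k2 f3' h3).trans (mulW_list f3 f3')
  have g3 := canon_mul (hf := act_comp f g hf hg) k3 h4 f4
  have i1 := k1.isIso
  have i2 := k2.isIso
  have e : ∀ {X P P' Q Q' Y Z S T T' : E} {jk : P ⟶ P'} [IsIso jk] {j : Q ⟶ Q'} [IsIso j]
      {a : X ⊗ P ⟶ Y} {a' : X ⊗ P' ⟶ Y} {b : Y ⊗ Q ⟶ Z} {b' : Y ⊗ Q' ⟶ Z} {z : P ⊗ Q ⟶ T'}
      {d : P' ⊗ Q' ⟶ S} {t : S ⟶ T} {j' : T ⟶ T'} {c : X ⊗ T' ⟶ Z} {c' : X ⊗ T ⟶ Z},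
      X ◁ jk ≫ a' = a → Y ◁ j ≫ b' = b → X ◁ j' ≫ c = c' →
      (α_ X P Q).inv ≫ a ▷ Q ≫ b = X ◁ z ≫ c → z = (jk ⊗ₘ j) ≫ d ≫ t ≫ j' →
      a' ▷ Q' ≫ b' = (α_ X P' Q').hom ≫ X ◁ (d ≫ t) ≫ c' := by
    rintro X P P' Q Q' Y Z S T T' jk _ j _ _ a' _ b' _ d t j' c _ rfl rfl rfl H rfl
    have : IsIso (jk ⊗ₘ j) := inferInstance
    rw [← cancel_epi (X ◁ (jk ⊗ₘ j) ≫ (α_ X P' Q').inv)]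
    have e1 : (X ◁ (jk ⊗ₘ j) ≫ (α_ X P' Q').inv) ≫ a' ▷ Q' ≫ b' =
        (α_ X P Q).inv ≫ (X ◁ jk ≫ a') ▷ Q ≫ Y ◁ j ≫ b' := by
      rw [← MonoidalCategory.id_tensorHom, Category.assoc, associator_inv_naturality_assoc,
        ← tensorHom_id, tensorHom_comp_tensorHom_assoc, Category.comp_id,
        MonoidalCategory.tensorHom_def, Category.assoc, MonoidalCategory.id_tensorHom]
    rw [e1, H]
    simp
  exact e g1 g2 g3 H k4

/-- Associativity of the multiplications. -/
theorem assocW {A B D : C} {f : A ⟶ B} {g : B ⟶ D} {hf : act f} {hg : act g} {k : A ⟶ D}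
    (hfg : f ≫ g = k) {hk : act k}
    {κ : Type (max u v)} {l : List κ} (hl : ∀ i, i ∈ l) (P : κ → Piece f)
    (q : ∀ i, Factor ((P i).incl ≫ g)) {β : κ → Type (max u v)}
    (R : ∀ i, β i → Piece (q i).left) (m : ∀ i, List (β i))
    (h1 : IsFrame ((list P l).labels.map Piece.toElem))
    (h2 : ∀ i, IsFrame ((list (R i) (m i)).labels.map Piece.toElem))
    (h3 : IsFrame ((big l fun i => list (fun b => (P i).push (R i b)) (m i)).labels.map
      Piece.toElem))
    (w : ∀ i, ((P i).res ≫ (q i).left) ≫ (q i).right = (P i).hom ≫ k)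
    (h4 : IsFrame ((list (fun i => (⟨(P i).toElem, ⟨(q i).mid, (P i).res ≫ (q i).left,
      act_comp _ _ (P i).res_act (q i).act, (q i).right, (q i).inert, w i⟩⟩ : Piece k)) l).labels.map
        Piece.toElem)) :
    O.mulW f hf (list P l) h1 ▷ _ ≫
        O.mulW g hg (big l fun i => list (fun b => (P i).push (R i b)) (m i)) h3 =
      (α_ _ _ _).hom ≫ O.coll.obj ⟨A⟩ ◁ (tensDistrib (fun i => O.coll.obj ⟨(P i).cod⟩)
          (fun i => tens (fun b => O.coll.obj ⟨(R i b).cod⟩) (m i)) l ≫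
        tensHom (G := fun i => O.coll.obj ⟨(q i).mid⟩)
          (fun i => O.mulW (q i).left (q i).act (list (R i) (m i)) (h2 i)) l) ≫
      O.mulW k hk (list (fun i => (⟨(P i).toElem, ⟨(q i).mid, (P i).res ≫ (q i).left,
      act_comp _ _ (P i).res_act (q i).act, (q i).right, (q i).inert, w i⟩⟩ : Piece k)) l) h4 := by
  subst hfg
  have key : ∀ (z : ∀ i, Σ' q : Factor ((P i).incl ≫ g),
      {M : List (Piece q.left) // IsFrame (M.map Piece.toElem)})
      (h3 : IsFrame ((big l fun i => list (P i).push (z i).2.1).labels.map Piece.toElem))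
      (h4 : IsFrame ((list (fun i => (P i).comp (z i).1) l).labels.map Piece.toElem)),
      O.mulW f hf (list P l) h1 ▷ _ ≫ O.mulW g hg (big l fun i => list (P i).push (z i).2.1) h3 =
      (α_ _ _ _).hom ≫ O.coll.obj ⟨A⟩ ◁ (tensDistrib (fun i => O.coll.obj ⟨(P i).cod⟩)
          (fun i => tens (fun r : Piece (z i).1.left => O.coll.obj ⟨r.cod⟩) (z i).2.1) l ≫
        tensHom (G := fun i => O.coll.obj ⟨(z i).1.mid⟩)
          (fun i => O.mul (z i).1.left (z i).1.act (z i).2.1 (z i).2.2) l) ≫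
      O.mulW (f ≫ g) hk (list (fun i => (P i).comp (z i).1) l) h4 := by
    intro z h3 h4
    have : ∀ p : Piece f, Nonempty (Σ' q : Factor (p.incl ≫ g),
        {M : List (Piece q.left) // IsFrame (M.map Piece.toElem)}) := by
      intro p
      obtain ⟨q⟩ := Factor.exists (p.incl ≫ g)
      obtain ⟨M, hM⟩ := exists_frame_list q.left
      exact ⟨⟨q, M, hM⟩⟩
    obtain ⟨y, hy⟩ := exists_extension (T := fun p : Piece f => Σ' q : Factor (p.incl ≫ g),
      {M : List (Piece q.left) // IsFrame (M.map Piece.toElem)}) (injective_of_isFrame hl h1) z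
    obtain rfl : (fun i => y (P i)) = z := funext hy
    exact assocW_of_total l P y h1 h3 h4
  have f2 : ∀ i, IsFrame (((m i).map (R i)).map Piece.toElem) := by
    intro i
    have := h2 i
    rwa [labels_list] at this
  have hJ : ∀ i, Canon O.val (list (fun b => (P i).push (R i b)) (m i))
      (list (P i).push ((m i).map (R i)))
      (tensMap (F := fun b => O.coll.obj ⟨(R i b).cod⟩)
        (G := fun r : Piece (q i).left => O.coll.obj ⟨r.cod⟩) (R i) (fun b => 𝟙 _) (m i)) := fun i =>
    Canon.bigMap (F := O.val) (R i) (fun r => of ((P i).push r)) (m i)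
  have hJ' : Canon O.val (big l fun i => list (fun b => (P i).push (R i b)) (m i))
      (big l fun i => list (P i).push ((m i).map (R i))) _ := Canon.bigCongr l fun i _ => hJ i
  have f3 := h3.perm (hJ'.perm.map Piece.toElem)
  have e1 := key (fun i => ⟨q i, (m i).map (R i), f2 i⟩) f3 h4
  have e2 := canon_mulW (hf := hg) hJ' h3 f3
  have e3 := tensDistrib_naturality (fun i => 𝟙 (O.coll.obj ⟨(P i).cod⟩))
    (fun i => tensMap (F := fun b => O.coll.obj ⟨(R i b).cod⟩)
        (G := fun r : Piece (q i).left => O.coll.obj ⟨r.cod⟩) (R i) (fun b => 𝟙 _) (m i)) l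
  have e4 : ∀ i, (𝟙 (O.coll.obj ⟨(P i).cod⟩) ⊗ₘ tensMap (F := fun b => O.coll.obj ⟨(R i b).cod⟩)
        (G := fun r : Piece (q i).left => O.coll.obj ⟨r.cod⟩) (R i) (fun b => 𝟙 _) (m i)) ≫
      O.mul (q i).left (q i).act ((m i).map (R i)) (f2 i) =
      O.mulW (q i).left (q i).act (list (R i) (m i)) (h2 i) := by
    intro i
    rw [MonoidalCategory.id_tensorHom]
    exact canon_mul (hf := (q i).act) (Canon.bigMap (F := O.val) (R i) (fun r => of r) (m i)) (h2 i)
      (f2 i)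
  have e5 := (tensHom_comp _ _ l).symm.trans
    (congrArg (fun φ : ∀ i, O.coll.obj ⟨(P i).cod⟩ ⊗ tens (fun b => O.coll.obj ⟨(R i b).cod⟩) (m i) ⟶
      O.coll.obj ⟨(q i).mid⟩ => tensHom φ l) (funext e4))
  have e : ∀ {X P Q Q' Y Z S S' T : E} {a : X ⊗ P ⟶ Y} {b : Y ⊗ Q' ⟶ Z} {b' : Y ⊗ Q ⟶ Z}
      {d : P ⊗ Q ⟶ S} {d' : P ⊗ Q' ⟶ S'} {t : S ⟶ T} {t' : S' ⟶ T} {c : X ⊗ T ⟶ Z} {j : Q ⟶ Q'}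
      {n : P ⟶ P} {x : S ⟶ S'},
      n = 𝟙 P → Y ◁ j ≫ b = b' → (n ⊗ₘ j) ≫ d' = d ≫ x → x ≫ t' = t →
      a ▷ Q' ≫ b = (α_ X P Q').hom ≫ X ◁ (d' ≫ t') ≫ c →
      a ▷ Q ≫ b' = (α_ X P Q).hom ≫ X ◁ (d ≫ t) ≫ c := by
    rintro X P Q Q' Y Z S S' T a b _ d d' _ t' c j _ x rfl rfl H rfl H'
    rw [← whisker_exchange_assoc, H', ← Category.assoc d, ← H]
    simp
  exact e (tensHom_id _ _) e2 e3 e5 e1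

end Operad

end OperadWords

/-! ### Evaluating an operad on a tree level by level -/

section Levels

variable {C : Type u} [Category.{v} C] [HypermomentData C] [IsHypermoment C]
variable {E : Type u'} [Category.{v'} E] [MonoidalCategory E] [SymmetricCategory E]

open Word

namespace CTree

/-- The vertices of height `k` of a `C`-tree. -/
abbrev LElem (B : CTree C) (k : ℕ) : Type (max u v) := {e : Elem B // (idx e.hom 0 : ℕ) = k}

/-- The object of height `k` of a `C`-tree. -/
abbrev ob (B : CTree C) (k : ℕ) (hk : k ≤ B.height) : C := B.arrows.obj ⟨k, Nat.lt_succ_of_le hk⟩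

/-- The structural morphisms of a `C`-tree. -/
abbrev st (B : CTree C) (j k : ℕ) (h : j ≤ k) (hk : k ≤ B.height) :
    B.ob j (h.trans hk) ⟶ B.ob k hk :=
  B.mp (i := ⟨j, Nat.lt_succ_of_le (h.trans hk)⟩) (j := ⟨k, Nat.lt_succ_of_le hk⟩) h

/-- Push a vertex of height `k` forward along an inert morphism. -/
def LElem.push {Z B : CTree C} {k : ℕ} (e : LElem Z k) (z : Z ⟶ B) (hz : IsInert z) {n : ℕ}
    (h : (idx z 0 : ℕ) = n) : LElem B (n + k) :=
  ⟨e.1.push z hz, by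
    have h1 : (idx (e.1.hom ≫ z) 0 : ℕ) = idx z 0 + idx e.1.hom 0 := isInert_idx hz _
    have h2 := e.2
    change (idx (e.1.hom ≫ z) 0 : ℕ) = _
    omega⟩

/-- The piece of `B_k ⟶ B_{k+1}` given by a vertex of height `k`. -/
def LElem.toPiece {B : CTree C} {k : ℕ} (hk : k + 1 ≤ B.height) (e : LElem B k) :
    Piece (B.st k (k + 1) (Nat.le_succ k) hk) where
  dom := e.1.dom.arrows.obj 0
  isUnit := e.1.dom.isUnit_root
  hom := app e.1.hom 0 ≫ B.mp (j := ⟨k, Nat.lt_succ_of_le ((Nat.le_succ k).trans hk)⟩) e.2.le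
  inert := inert_comp _ _ (app_inert _ _)
    (haveI := B.mp_isIso (i := idx e.1.hom 0)
      (j := ⟨k, Nat.lt_succ_of_le ((Nat.le_succ k).trans hk)⟩) (Fin.ext e.2)
     IsHypermoment.inert_of_isIso _)
  factor :=
    { mid := e.1.dom.top
      left := e.1.dom.mp (Fin.zero_le (Fin.last _))
      act := mp_act _ _
      right := app e.1.hom (Fin.last _) ≫ B.mp (j := ⟨k + 1, Nat.lt_succ_of_le hk⟩)
        ((idx_last_of_elem e.1).trans (congrArg (· + 1) e.2)).le
      inert := inert_comp _ _ (app_inert _ _)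
        (haveI := B.mp_isIso (i := idx e.1.hom (Fin.last _)) (j := ⟨k + 1, Nat.lt_succ_of_le hk⟩)
          (Fin.ext ((idx_last_of_elem e.1).trans (congrArg (· + 1) e.2)))
         IsHypermoment.inert_of_isIso _)
      fac := by
        rw [mp_app_assoc, mp_mp, Category.assoc, mp_mp] }

/-- A family of lists of vertices contains each vertex once. -/
def IsLevelFrame {B : CTree C} (ls : ∀ k, List (B.LElem k)) : Prop :=
  ∀ k (hk : k + 1 ≤ B.height), IsFrame ((list (LElem.toPiece hk) (ls k)).labels.map Piece.toElem)

/-- The formal tensor product over the vertices of height less than `k`. -/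
def levelWord {B : CTree C} (ls : ∀ k, List (B.LElem k)) : ℕ → Word (Elem B)
  | 0 => one
  | k + 1 => mul (levelWord ls k) (list Subtype.val (ls k))

end CTree

namespace Operad

open CTree

variable (O : Operad C E)

/-- The factor of the composition along a `C`-tree corresponding to a vertex. -/
abbrev treeVal {B : CTree C} (e : Elem B) : E := O.coll.obj ⟨e.dom.top⟩

/-- The composition in an operad along a `C`-tree, up to height `k`. -/
noncomputable def evalTo {B : CTree C} (ls : ∀ k, List (B.LElem k)) (h : IsLevelFrame ls) :
    ∀ (k : ℕ) (hk : k ≤ B.height), (levelWord ls k).eval O.treeVal ⟶ O.coll.obj ⟨B.ob k hk⟩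
  | 0, _ => O.unit _ B.isUnit_root
  | k + 1, hk => (evalTo ls h k ((Nat.le_succ k).trans hk) ⊗ₘ
      𝟙 (tens (fun e : B.LElem k => O.coll.obj ⟨e.1.dom.top⟩) (ls k))) ≫
    O.mulW (B.st k (k + 1) (Nat.le_succ k) hk) (mp_act _ _) (list (LElem.toPiece hk) (ls k)) (h k hk)

variable {O}

theorem evalTo_perm {B : CTree C} {ls ls' : ∀ k, List (B.LElem k)} (h : IsLevelFrame ls)
    (h' : IsLevelFrame ls') {n : ℕ} (hn : n ≤ B.height) (hp : ∀ k < n, (ls k).Perm (ls' k)) :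
    ∃ φ, Canon O.treeVal (levelWord ls n) (levelWord ls' n) φ ∧
      φ ≫ O.evalTo ls' h' n hn = O.evalTo ls h n hn := by
  induction n with
  | zero => exact ⟨_, .id _, Category.id_comp _⟩
  | succ n ih =>
    obtain ⟨φ, h1, h2⟩ := ih ((Nat.le_succ n).trans hn) fun k hk => hp k (hk.trans n.lt_succ_self)
    obtain ⟨χ, h3⟩ := Canon.exists_of_perm (F := fun e : B.LElem n => O.coll.obj ⟨e.1.dom.top⟩)
      (X := list (fun e => e) (ls n)) (Y := list (fun e => e) (ls' n))
      (by rw [labels_list, labels_list]; exact (hp n n.lt_succ_self).map _)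
    have h4 := Canon.map_list_list (F := O.treeVal) (c := Subtype.val) h3
    have h5 := Canon.map_list_list (F := O.val) (c := LElem.toPiece hn) h3
    have h6 := canon_mulW (hf := mp_act _ _) h5 (h n hn) (h' n hn)
    refine ⟨φ ⊗ₘ χ, h1.tensor h4, ?_⟩
    have e : ∀ {P P' X Q Q' Z : E} {p : P ⟶ P'} {a : P' ⟶ X} {a' : P ⟶ X} {c : Q ⟶ Q'}
        {x : X ⊗ Q' ⟶ Z} {y : X ⊗ Q ⟶ Z}, p ≫ a = a' → X ◁ c ≫ x = y →
        (p ⊗ₘ c) ≫ (a ⊗ₘ 𝟙 Q') ≫ x = (a' ⊗ₘ 𝟙 Q) ≫ y := by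
      rintro P P' X Q Q' Z p a _ c x _ rfl rfl
      rw [← MonoidalCategory.id_tensorHom, tensorHom_comp_tensorHom_assoc,
        tensorHom_comp_tensorHom_assoc, Category.comp_id, Category.id_comp, Category.comp_id]
    exact e h2 h6

end Operad

end Levels

/-! ### Distributing the levels of a tree over subtrees -/

section Decomposition

variable {C : Type u} [Category.{v} C] [HypermomentData C] [IsHypermoment C]
variable {E : Type u'} [Category.{v'} E] [MonoidalCategory E] [SymmetricCategory E]

open Word

namespace CTree

/-- The piece of `B_n ⟶ B_{n+j}` given by a `C`-tree of height at least `j` included into `B` at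
height `n`. -/
def spanPiece {B Z : CTree C} (z : Z ⟶ B) (hz : IsInert z) {n j r : ℕ} (hn : (idx z 0 : ℕ) = n)
    (hj : r = j) (hr : r ≤ Z.height) (hb : n + j ≤ B.height) :
    Piece (B.st n (n + j) (Nat.le_add_right n j) hb) where
  dom := Z.arrows.obj 0
  isUnit := Z.isUnit_root
  hom := app z 0 ≫ B.mp (j := ⟨n, Nat.lt_succ_of_le ((Nat.le_add_right n j).trans hb)⟩) hn.le
  inert := inert_comp _ _ (app_inert _ _)
    (haveI := B.mp_isIso (i := idx z 0)
      (j := ⟨n, Nat.lt_succ_of_le ((Nat.le_add_right n j).trans hb)⟩) (Fin.ext hn)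
     IsHypermoment.inert_of_isIso _)
  factor :=
    have h : (idx z ⟨r, Nat.lt_succ_of_le hr⟩ : ℕ) = n + j :=
      (isInert_idx hz _).trans (congrArg₂ (· + ·) hn hj)
    { mid := Z.ob r hr
      left := Z.mp (Fin.zero_le _)
      act := mp_act _ _
      right := app z ⟨r, Nat.lt_succ_of_le hr⟩ ≫ B.mp (j := ⟨n + j, Nat.lt_succ_of_le hb⟩) h.le
      inert := inert_comp _ _ (app_inert _ _)
        (haveI := B.mp_isIso (j := ⟨n + j, Nat.lt_succ_of_le hb⟩) (Fin.ext h)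
         IsHypermoment.inert_of_isIso _)
      fac := by
        rw [mp_app_assoc, mp_mp, Category.assoc, mp_mp] }

theorem app_push {B Z : CTree C} (e : Elem Z) (z : Z ⟶ B) (i : Fin (e.dom.height + 1))
    {k : Fin (Z.height + 1)} {m : Fin (B.height + 1)} (h : idx e.hom i ≤ k) (h' : idx z k ≤ m)
    (h'' : idx (e.hom ≫ z) i ≤ m) :
    app (e.hom ≫ z) i ≫ B.mp h'' = (app e.hom i ≫ Z.mp h) ≫ app z k ≫ B.mp h' := by
  rw [Category.assoc, mp_app_assoc, mp_mp]
  exact Category.assoc _ _ _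

end CTree

namespace Operad

open CTree

variable {O : Operad C E}

/-- Only the elementary parts of the pieces enter, and these do not depend on how many levels are
spanned. -/
theorem frame_spanPiece {B : CTree C} {κ : Type (max u v)} {lκ : List κ} {Z : κ → CTree C}
    {z : ∀ i, Z i ⟶ B} {hz : ∀ i, IsInert (z i)} {n : ℕ} {hn : ∀ i, (idx (z i) 0 : ℕ) = n}
    {j j' : ℕ} {ρ ρ' : κ → ℕ} {hρ : ∀ i, ρ i = j} {hρ' : ∀ i, ρ' i = j'}
    {hj : ∀ i, ρ i ≤ (Z i).height} {hj' : ∀ i, ρ' i ≤ (Z i).height} {hb : n + j ≤ B.height}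
    {hb' : n + j' ≤ B.height}
    (h : IsFrame ((list (fun i => spanPiece (z i) (hz i) (hn i) (hρ i) (hj i) hb) lκ).labels.map
      Piece.toElem)) :
    IsFrame ((list (fun i => spanPiece (z i) (hz i) (hn i) (hρ' i) (hj' i) hb') lκ).labels.map
      Piece.toElem) := by
  rw [labels_list, List.map_map] at h ⊢
  exact h

/-- Decomposition of the composition along a `C`-tree: the levels `n`, …, `n + j - 1` of `B` are
distributed over the `C`-trees `Z i` included into `B` at height `n`. -/
theorem evalTo_decomp {B : CTree C} {ls : ∀ k, List (B.LElem k)} (hls : IsLevelFrame ls)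
    {κ : Type (max u v)} {lκ : List κ} (hκ : ∀ i, i ∈ lκ) {Z : κ → CTree C} {z : ∀ i, Z i ⟶ B}
    (hz : ∀ i, IsInert (z i)) {n : ℕ} (hn : ∀ i, (idx (z i) 0 : ℕ) = n)
    {zs : ∀ i k, List ((Z i).LElem k)} (hzs : ∀ i, IsLevelFrame (zs i)) (j : ℕ) :
    ∀ (hp : ∀ k < j, (ls (n + k)).Perm (lκ.flatMap fun i => (zs i k).map
        fun e => e.push (z i) (hz i) (hn i)))
      (ρ : κ → ℕ) (hρ : ∀ i, ρ i = j) (hj : ∀ i, ρ i ≤ (Z i).height) (hb : n + j ≤ B.height)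
      (h : IsFrame ((list (fun i => spanPiece (z i) (hz i) (hn i) (hρ i) (hj i) hb) lκ).labels.map
        Piece.toElem)),
    ∃ φ, Canon O.treeVal (levelWord ls (n + j)) (Word.mul (levelWord ls n) (big lκ fun i =>
        (levelWord (zs i) (ρ i)).map fun e => e.push (z i) (hz i))) φ ∧
      O.evalTo ls hls (n + j) hb = φ ≫
        (O.evalTo ls hls n ((Nat.le_add_right n j).trans hb) ⊗ₘ
          tensHom (G := fun i => O.coll.obj ⟨(Z i).ob (ρ i) (hj i)⟩)
            (fun i => mapMap O.treeVal (fun e => e.push (z i) (hz i)) (levelWord (zs i) (ρ i)) ≫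
              O.evalTo (zs i) (hzs i) (ρ i) (hj i)) lκ) ≫
        O.mulW (B.st n (n + j) (Nat.le_add_right n j) hb) (mp_act _ _)
          (list (fun i => spanPiece (z i) (hz i) (hn i) (hρ i) (hj i) hb) lκ) h := by
  induction j with
  | zero =>
    intro hp ρ hρ hj hb h
    -- `ρ` records the numbers of levels used, each equal to `j` only by a proof; this permits
    -- taking the heights of the trees themselves later. With no level used, each tree contributes a
    -- unit, and the right unit law applies.
    obtain rfl : ρ = fun _ => 0 := funext hρ
    have h1 := (Canon.whiskerLeft (levelWord ls n) (Canon.tensUnit O.treeVal lκ)).comp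
      (Canon.rightUnit _)
    obtain ⟨φ, h2, h3, h4⟩ := h1.exists_inv
    have h5 := right_unitW (O := O) (D := fun i => (Z i).arrows.obj 0)
      (hD := fun i => (Z i).isUnit_root) (B.mp_refl (i := ⟨n, Nat.lt_succ_of_le hb⟩) (le_refl _))
      (hf := mp_act _ _) (fun i => (Z i).mp_refl (i := 0) (le_refl _)) (fun i => rfl) lκ h
    refine ⟨φ, h2, ?_⟩
    have h6 : tensHom (fun i => mapMap O.treeVal (fun e : Elem (Z i) => e.push (z i) (hz i)) (one : Word (Elem (Z i))) ≫
        O.unit _ (Z i).isUnit_root) lκ = tensHom (fun i => O.unit _ (Z i).isUnit_root) lκ :=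
      congrArg (fun x : ∀ i, 𝟙_ E ⟶ O.coll.obj ⟨(Z i).arrows.obj 0⟩ => tensHom x lκ)
        (funext fun i => Category.id_comp _)
    have e : ∀ {W X T Z : E} {φ : W ⟶ W ⊗ T} {t : T ⟶ 𝟙_ E} {M : W ⟶ X} {x x' : T ⟶ Z}
        {μ : X ⊗ Z ⟶ X}, φ ≫ W ◁ t ≫ (ρ_ W).hom = 𝟙 W → x = x' →
        X ◁ x' ≫ μ = X ◁ t ≫ (ρ_ X).hom → M = φ ≫ (M ⊗ₘ x) ≫ μ := by
      rintro W X T Z φ t M x _ μ H rfl H'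
      rw [MonoidalCategory.tensorHom_def, Category.assoc, H', ← whisker_exchange_assoc,
        rightUnitor_naturality, reassoc_of% H]
    exact e h4 h6 h5
  | succ j ih =>
    intro hp ρ hρ hj hb h
    obtain rfl : ρ = fun _ => j + 1 := funext hρ
    have hj' : ∀ i, j ≤ (Z i).height := fun i => (Nat.le_succ j).trans (hj i)
    have hb' : n + j ≤ B.height := (Nat.le_succ (n + j)).trans hb
    have h' := frame_spanPiece (hρ' := fun _ => rfl) (hj' := hj') (hb' := hb') h
    obtain ⟨φ, h1, h2⟩ := ih (fun k hk => hp k (hk.trans j.lt_succ_self)) (fun _ => j)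
      (fun _ => rfl) hj' hb' h'
    obtain ⟨χ, h3⟩ := Canon.exists_of_perm (F := fun e : B.LElem (n + j) => O.coll.obj ⟨e.1.dom.top⟩)
      (X := list (fun e => e) (ls (n + j)))
      (Y := big lκ fun i => list (fun e => e.push (z i) (hz i) (hn i)) (zs i j))
      (by
        rw [labels_list, List.map_id']
        refine (hp j j.lt_succ_self).trans (List.Perm.of_eq ?_)
        exact congrArg (fun x => lκ.flatMap x) (funext fun i => (labels_list _ _).symm))
    have h4 := Canon.map_list_big (F := O.treeVal) (c := Subtype.val) h3
    have h5 := Canon.map_list_big (F := O.val) (c := LElem.toPiece hb) h3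
    have h6 := (hls (n + j) hb).perm (h5.perm.map Piece.toElem)
    have h7 := canon_mulW (hf := mp_act _ _) h5 (hls (n + j) hb) h6
    have w1 : ∀ i, (spanPiece (z i) (hz i) (hn i) rfl (hj' i) hb').incl ≫
        B.st (n + j) (n + j + 1) (Nat.le_succ _) hb = (Z i).st j (j + 1) (Nat.le_succ j) (hj i) ≫
          (spanPiece (z i) (hz i) (hn i) rfl (hj i) hb).incl := by
      intro i
      change (app (z i) _ ≫ B.mp _) ≫ B.mp _ = (Z i).mp _ ≫ app (z i) _ ≫ B.mp _
      rw [mp_app_assoc, mp_mp, Category.assoc, mp_mp]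
    -- The next level of `Z i` is the middle object when the inclusion of its level `j` is followed
    -- by the next structure map of `B`. Associativity, in `h10`, therefore performs the new
    -- multiplication inside each `Z i`.
    let q : ∀ i, Factor ((spanPiece (z i) (hz i) (hn i) rfl (hj' i) hb').incl ≫
        B.st (n + j) (n + j + 1) (Nat.le_succ _) hb) := fun i =>
      ⟨(Z i).ob (j + 1) (hj i), (Z i).st j (j + 1) (Nat.le_succ j) (hj i), mp_act _ _,
        (spanPiece (z i) (hz i) (hn i) rfl (hj i) hb).incl,
        (spanPiece (z i) (hz i) (hn i) rfl (hj i) hb).incl_inert, (w1 i).symm⟩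
    obtain ⟨h8, h9⟩ : ∃ h8, O.mulW (B.st (n + j) (n + j + 1) (Nat.le_succ _) hb) (mp_act _ _)
        (big lκ fun i => list (fun e : (Z i).LElem j =>
          (e.push (z i) (hz i) (hn i)).toPiece hb) (zs i j)) h6 =
        O.mulW (B.st (n + j) (n + j + 1) (Nat.le_succ _) hb) (mp_act _ _)
        (big lκ fun i => list (fun e : (Z i).LElem j =>
          (spanPiece (z i) (hz i) (hn i) rfl (hj' i) hb').push (q := q i) (e.toPiece (hj i)))
            (zs i j)) h8 := by
      refine mulW_big_congr (D := fun i (e : (Z i).LElem j) => e.1.dom.arrows.obj 0)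
        (V := fun i (e : (Z i).LElem j) => e.1.dom.top) ?_ ?_ ?_ (fun i => zs i j) lκ h6
      · intro i e
        exact app_push e.1 (z i) 0 _ _ _
      · intro i e
        rfl
      · intro i e
        exact app_push e.1 (z i) (Fin.last _) _ _ _
    have w2 : ∀ i, ((Z i).mp (Fin.zero_le ⟨j, Nat.lt_succ_of_le (hj' i)⟩) ≫
        (Z i).st j (j + 1) (Nat.le_succ j) (hj i)) ≫
          (spanPiece (z i) (hz i) (hn i) rfl (hj i) hb).incl =
        (spanPiece (z i) (hz i) (hn i) rfl (hj' i) hb').hom ≫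
          B.st n (n + (j + 1)) (Nat.le_add_right n _) hb := by
      intro i
      rw [mp_mp]
      exact (spanPiece (z i) (hz i) (hn i) rfl (hj i) hb).comm
    have h10 := assocW (O := O) (hf := mp_act _ _) (hg := mp_act _ _) (k := B.st n (n + (j + 1))
      (Nat.le_add_right n _) hb) (hk := mp_act _ _) (B.mp_mp _ _) hκ
      (fun i => spanPiece (z i) (hz i) (hn i) rfl (hj' i) hb') q
      (fun i (e : (Z i).LElem j) => e.toPiece (hj i)) (fun i => zs i j) h'
      (fun i => hzs i j (hj i)) h8 w2 (by rw [labels_list, List.map_map] at h ⊢; exact h)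
    have h11 := mulW_list_congr (O := O) (e := rfl) (hf := mp_act _ _) (hf' := mp_act _ _)
      (D := fun i => (Z i).arrows.obj 0) (V := fun i => (Z i).ob (j + 1) (hj i))
      (hs := fun i => act_comp _ _ (mp_act _ _) (mp_act _ _))
      (hr := fun i => (spanPiece (z i) (hz i) (hn i) rfl (hj i) hb).incl_inert)
      (w := w2) (w' := fun i => (spanPiece (z i) (hz i) (hn i) rfl (hj i) hb).comm)
      (fun i => rfl) (fun i => (Z i).mp_mp _ _) (fun i => rfl) lκ
      (by rw [labels_list, List.map_map] at h ⊢; exact h) h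
    have h12 := tensDistrib_naturality (fun i => mapMap O.treeVal (fun e => e.push (z i) (hz i))
        (levelWord (zs i) j) ≫ O.evalTo (zs i) (hzs i) j (hj' i))
      (fun i => 𝟙 (tens (fun e : (Z i).LElem j => O.coll.obj ⟨e.1.dom.top⟩) (zs i j))) lκ
    have h13 : ∀ i, ((mapMap O.treeVal (fun e => e.push (z i) (hz i)) (levelWord (zs i) j) ≫
          O.evalTo (zs i) (hzs i) j (hj' i)) ⊗ₘ
          𝟙 (tens (fun e : (Z i).LElem j => O.coll.obj ⟨e.1.dom.top⟩) (zs i j))) ≫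
        O.mulW _ (q i).act (list (fun e : (Z i).LElem j => e.toPiece (hj i)) (zs i j)) (hzs i j (hj i)) =
        mapMap O.treeVal (fun e => e.push (z i) (hz i)) (levelWord (zs i) (j + 1)) ≫
          O.evalTo (zs i) (hzs i) (j + 1) (hj i) := by
      intro i
      have e : ∀ {P Q R S Z : E} {a : P ⟶ Q} {b : Q ⟶ R} {n : S ⟶ S} {x : R ⊗ S ⟶ Z}, n = 𝟙 S →
          ((a ≫ b) ⊗ₘ 𝟙 S) ≫ x = (a ⊗ₘ n) ≫ (b ⊗ₘ 𝟙 S) ≫ x := by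
        rintro P Q R S Z a b _ x rfl
        rw [tensorHom_comp_tensorHom_assoc, Category.comp_id]
      exact e (mapMap_list O.treeVal (fun e : Elem (Z i) => e.push (z i) (hz i)) Subtype.val (zs i j))
    have h14 := (tensHom_comp _ _ lκ).symm.trans (congrArg (fun x : ∀ i,
      ((levelWord (zs i) (j + 1)).map fun e => e.push (z i) (hz i)).eval O.treeVal ⟶
        O.coll.obj ⟨(Z i).ob (j + 1) (hj i)⟩ => tensHom x lκ) (funext h13))
    have h15 := tensHom_id (fun i => tens (fun e : (Z i).LElem j => O.coll.obj ⟨e.1.dom.top⟩) (zs i j)) lκ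
    refine ⟨_, (h1.tensor h4).comp ((Canon.assoc _ _ _).comp
      (Canon.whiskerLeft _ (Canon.distrib _ _ lκ))), ?_⟩
    have e : ∀ {V W A P P' X R S Z D D' D₀ : E} {φ : V ⟶ W ⊗ P} {M : W ⟶ A} {T : P ⟶ P'}
        {μ : A ⊗ P' ⟶ X} {χ : R ⟶ S} {b₁ b : X ⊗ S ⟶ Z} {b' : X ⊗ R ⟶ Z} {d' : P' ⊗ S ⟶ D'}
        {m : D' ⟶ D} {μ₁ μ' : A ⊗ D ⟶ Z} {d₀ : P ⊗ S ⟶ D₀} {t : D₀ ⟶ D'} {n : S ⟶ S} {T₂ : D₀ ⟶ D}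
        {a : V ⟶ X}, a = φ ≫ (M ⊗ₘ T) ≫ μ → X ◁ χ ≫ b₁ = b' → b₁ = b →
        μ ▷ S ≫ b = (α_ A P' S).hom ≫ A ◁ (d' ≫ m) ≫ μ₁ → μ₁ = μ' → n = 𝟙 S →
        (T ⊗ₘ n) ≫ d' = d₀ ≫ t → t ≫ m = T₂ →
        (a ⊗ₘ 𝟙 R) ≫ b' = ((φ ⊗ₘ χ) ≫ (α_ W P S).hom ≫ W ◁ d₀) ≫ (M ⊗ₘ T₂) ≫ μ' := by
      rintro V W A P P' X R S Z D D' D₀ φ M T μ χ b₁ _ b' d' m μ₁ _ d₀ t n T₂ _ rfl rfl rfl H rfl rfl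
        H' rfl
      have e1 : ((φ ≫ (M ⊗ₘ T) ≫ μ) ⊗ₘ 𝟙 R) ≫ X ◁ χ ≫ b₁ =
          (φ ⊗ₘ χ) ≫ ((M ⊗ₘ T) ⊗ₘ 𝟙 S) ≫ μ ▷ S ≫ b₁ := by
        rw [← MonoidalCategory.id_tensorHom, ← tensorHom_id, tensorHom_comp_tensorHom_assoc,
          tensorHom_comp_tensorHom_assoc, tensorHom_comp_tensorHom_assoc]
        simp
      have e2 : W ◁ d₀ ≫ (M ⊗ₘ (t ≫ m)) = (M ⊗ₘ (T ⊗ₘ 𝟙 S)) ≫ A ◁ (d' ≫ m) := by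
        rw [← MonoidalCategory.id_tensorHom, ← MonoidalCategory.id_tensorHom,
          tensorHom_comp_tensorHom, tensorHom_comp_tensorHom, reassoc_of% H', Category.comp_id,
          Category.id_comp]
      rw [e1, H, associator_naturality_assoc, Category.assoc, Category.assoc, reassoc_of% e2]
    exact e h2 h7 h9 h10 h11 h15 h12 h14

end Operad

end Decomposition

/-! ### Sorting a list by levels -/

section LevelLists

/-- The elements of a list of level `k`. -/
def levels {α : Type*} (lvl : α → ℕ) (l : List α) (k : ℕ) : List {a // lvl a = k} :=
  l.filterMap fun a => if h : lvl a = k then some ⟨a, h⟩ else none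

theorem mem_levels {α : Type*} {lvl : α → ℕ} {l : List α} {k : ℕ} {x : {a // lvl a = k}} :
    x ∈ levels lvl l k ↔ x.1 ∈ l := by
  simp only [levels, List.mem_filterMap]
  constructor
  · rintro ⟨a, ha, h⟩
    split_ifs at h with h'
    cases h
    exact ha
  · intro h
    exact ⟨x.1, h, by rw [dif_pos x.2]⟩

theorem levels_cons {α : Type*} (lvl : α → ℕ) (a : α) (l : List α) (k : ℕ) :
    levels lvl (a :: l) k = (if h : lvl a = k then [⟨a, h⟩] else []) ++ levels lvl l k := by
  by_cases h : lvl a = k <;> simp [levels, h]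

theorem levels_append {α : Type*} (lvl : α → ℕ) (l l' : List α) (k : ℕ) :
    levels lvl (l ++ l') k = levels lvl l k ++ levels lvl l' k :=
  List.filterMap_append

theorem levels_map_val {α : Type*} (lvl : α → ℕ) (l : List α) (k : ℕ) :
    (levels lvl l k).map Subtype.val = l.filter fun a => lvl a = k := by
  induction l with
  | nil => rfl
  | cons a l ih =>
    rw [levels_cons, List.map_append, ih]
    by_cases h : lvl a = k <;> simp [h]

theorem levels_perm {α : Type*} {lvl : α → ℕ} {l l' : List α} (h : l.Perm l') (k : ℕ) :
    (levels lvl l k).Perm (levels lvl l' k) :=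
  h.filterMap _

theorem flatMap_levels_perm {α : Type*} (lvl : α → ℕ) (l : List α) (n : ℕ)
    (h : ∀ a ∈ l, lvl a < n) :
    ((List.range n).flatMap fun k => (levels lvl l k).map Subtype.val).Perm l := by
  have key : ∀ n, ((List.range n).flatMap fun k => (levels lvl l k).map Subtype.val).Perm
      (l.filter fun a => lvl a < n) := by
    intro n
    induction n with
    | zero => simp
    | succ n ih =>
      rw [List.range_succ, List.flatMap_append]
      refine (ih.append_right _).trans ?_
      simp only [List.flatMap_cons, List.flatMap_nil, List.append_nil, levels_map_val]
      have h1 := List.filter_append_perm (fun a => decide (lvl a < n))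
        (l.filter fun a => lvl a < n + 1)
      rw [List.filter_filter, List.filter_filter] at h1
      refine List.Perm.trans (List.Perm.of_eq ?_) h1
      congr 1
      · refine List.filter_congr fun a _ => ?_
        rw [Bool.eq_iff_iff]
        simp
        omega
      · refine List.filter_congr fun a _ => ?_
        rw [Bool.eq_iff_iff]
        simp
        omega
  refine (key n).trans (List.Perm.of_eq (List.filter_eq_self.2 fun a ha => ?_))
  simpa using h a ha

theorem levels_map {α β : Type*} {lvl : α → ℕ} {lvl' : β → ℕ} (c : α → β)
    (h : ∀ a, lvl' (c a) = lvl a) (l : List α) (k : ℕ) :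
    levels lvl' (l.map c) k = (levels lvl l k).map fun a => ⟨c a.1, (h a.1).trans a.2⟩ := by
  induction l with
  | nil => rfl
  | cons a l ih =>
    rw [List.map_cons, levels_cons, levels_cons, List.map_append, ih]
    by_cases h' : lvl a = k <;> simp [h, h']

theorem levels_map_add {α β : Type*} {lvl : α → ℕ} {lvl' : β → ℕ} (c : α → β) {n : ℕ}
    (h : ∀ a, lvl' (c a) = n + lvl a) (l : List α) (k : ℕ) :
    levels lvl' (l.map c) (n + k) =
      (levels lvl l k).map fun a => ⟨c a.1, (h a.1).trans (congrArg (n + ·) a.2)⟩ := by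
  induction l with
  | nil => rfl
  | cons a l ih =>
    rw [List.map_cons, levels_cons, levels_cons, List.map_append, ih]
    by_cases h' : lvl a = k <;> simp [h, h']

theorem levels_eq_nil {α : Type*} {lvl : α → ℕ} {l : List α} {k : ℕ}
    (h : ∀ a ∈ l, lvl a ≠ k) : levels lvl l k = [] :=
  List.eq_nil_iff_forall_not_mem.2 fun x hx => h x.1 (mem_levels.1 hx) x.2

/-- The levels of a concatenation, if the levels of the parts are disjoint. -/
theorem levels_flatMap {α β : Type*} {lvl : α → ℕ} {lvl' : β → ℕ} {k k' : ℕ} (m : α → List β)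
    (l : List α) (h : ∀ a ∈ l, lvl a ≠ k → ∀ b ∈ m a, lvl' b ≠ k') :
    levels lvl' (l.flatMap m) k' = (levels lvl l k).flatMap fun a => levels lvl' (m a.1) k' := by
  induction l with
  | nil => rfl
  | cons a l ih =>
    rw [List.flatMap_cons, levels_append, levels_cons, List.flatMap_append,
      ih fun a ha => h a (List.mem_cons_of_mem _ ha)]
    congr 1
    by_cases h' : lvl a = k
    · simp [h']
    · rw [dif_neg h', levels_eq_nil (h a List.mem_cons_self h')]
      rfl

end LevelLists

/-! ### Frames of a tree sorted by height -/

section LevelFrames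

variable {C : Type u} [Category.{v} C] [HypermomentData C] [IsHypermoment C]

open Word

namespace CTree

/-- The height of a vertex. -/
abbrev lvl {B : CTree C} (e : Elem B) : ℕ := idx e.hom 0

/-- The vertices of height `k` in a frame of `B` are sent bijectively to `γ(B_k)` by their root
components (`pt_eq_of_level`). -/
theorem isLevelFrame_levels {B : CTree C} {l : List (Elem B)} (h : IsFrame l) :
    IsLevelFrame (levels lvl l) := by
  intro k hk
  rw [isFrame_iff] at h ⊢
  have key : ∀ x : B.LElem k, x.1.pt = (⟨⟨k, hk⟩, (x.toPiece hk).toElem.pt⟩ : B.Vertex) := fun x =>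
    pt_eq_of_level x.1 ⟨k, hk⟩ (Fin.ext x.2)
  rw [labels_list, List.map_map]
  constructor
  · intro a
    obtain ⟨e, he, h1⟩ := h.1 (⟨⟨k, hk⟩, a⟩ : B.Vertex)
    have hx : (idx e.hom 0 : ℕ) = k := by
      rw [level_pt e ⟨k, hk⟩ a h1]
      rfl
    refine ⟨_, List.mem_map_of_mem ((mem_levels (x := ⟨e, hx⟩)).2 he), ?_⟩
    have h2 := (key ⟨e, hx⟩).symm.trans h1
    exact eq_of_heq (Vertex.mk.inj h2).2
  · have h1 : ((levels lvl l k).map fun x => x.1.pt).Nodup := by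
      have h2 : ((levels lvl l k).map fun x => x.1.pt) =
          ((levels lvl l k).map Subtype.val).map Elem.pt := by
        rw [List.map_map]
        rfl
      rw [h2, levels_map_val]
      exact h.2.sublist (List.filter_sublist.map _)
    have h2 : ((levels lvl l k).map fun x => x.1.pt) =
        (((levels lvl l k).map (Piece.toElem ∘ LElem.toPiece hk)).map Elem.pt).map
          fun a => (⟨⟨k, hk⟩, a⟩ : B.Vertex) := by
      rw [List.map_map, List.map_map]
      exact List.map_congr_left fun x _ => key x
    rw [h2] at h1
    exact h1.of_map

theorem labels_levelWord {B : CTree C} (ls : ∀ k, List (B.LElem k)) (n : ℕ) :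
    (levelWord ls n).labels = (List.range n).flatMap fun k => (ls k).map Subtype.val := by
  induction n with
  | zero => rfl
  | succ n ih =>
    rw [List.range_succ, List.flatMap_append, ← ih, List.flatMap_cons, List.flatMap_nil,
      List.append_nil, ← labels_list]
    rfl

theorem levelWord_levels_perm {B : CTree C} (l : List (Elem B)) :
    (levelWord (levels lvl l) B.height).labels.Perm l := by
  rw [labels_levelWord]
  exact flatMap_levels_perm lvl l B.height fun e _ => idx_zero_lt e

end CTree

variable {E : Type u'} [Category.{v'} E] [MonoidalCategory E] [SymmetricCategory E]

namespace Operad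

open CTree

variable {O : Operad C E}

/-- Invariance of the units under isomorphisms. -/
theorem unit_iso {U U' : C} (hU : IsUnitObj U) (hU' : IsUnitObj U') (σ : U ≅ U') :
    O.unit U hU ≫ O.coll.map ⟨σ⟩ = O.unit U' hU' := by
  have hσ : act σ.hom := IsHypermoment.act_of_isIso _
  let p : PUnit.{max u v + 1} → Piece σ.hom := fun _ => Piece.whole hU σ.hom hσ
  let p' : PUnit.{max u v + 1} → Piece (𝟙 U') := fun _ => Piece.ofElem (Elem.refl U' hU')
  let τ : ∀ i, PieceIso σ (Iso.refl U') (p i) (p' i) := fun _ =>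
    { domIso := σ
      codIso := Iso.refl U'
      hom_comm := (Category.comp_id σ.hom).trans (Category.id_comp σ.hom).symm
      res_comm := rfl
      incl_comm := rfl }
  have f1 : IsFrame ((list p [⟨⟩]).labels.map Piece.toElem) := isFrame_refl hU
  have f2 : IsFrame ((list p' [⟨⟩]).labels.map Piece.toElem) := isFrame_refl hU'
  -- The left unit law recovers `η` of `U` from the multiplication of `σ`, and the right unit law
  -- treats `η` of `U'` with the multiplication of the identity. Equivariance compares these two
  -- multiplications.
  have h1 := left_unitW (O := O) (hU := hU) (hf := hσ) rfl rfl f1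
  have h2 := mulW_iso (O := O) (hf := hσ) (hf' := act_id U') σ (Iso.refl U') rfl τ (l := [⟨⟩])
    (fun i => List.mem_singleton.2 rfl) f1 f2
  have h3 := right_unitW (O := O) (D := fun _ : PUnit.{max u v + 1} => U') (f := 𝟙 U')
    (hD := fun _ => hU') rfl
    (hf := act_id U') (fun _ => rfl) (fun _ => rfl) [⟨⟩] f2
  have h4 : O.coll.map ⟨Iso.refl U'⟩ = 𝟙 _ := O.coll.map_id ⟨U'⟩
  have e : ∀ {X Y : E} {η : 𝟙_ E ⟶ X} {η' : 𝟙_ E ⟶ Y} {s : X ⟶ Y} {i : Y ⟶ Y} {m : X ⊗ Y ⊗ 𝟙_ E ⟶ Y}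
      {m' : Y ⊗ Y ⊗ 𝟙_ E ⟶ Y}, i = 𝟙 Y → η ▷ (Y ⊗ 𝟙_ E) ≫ m = (λ_ (Y ⊗ 𝟙_ E)).hom ≫ (ρ_ Y).hom →
      m ≫ i = (s ⊗ₘ (i ⊗ₘ 𝟙 (𝟙_ E))) ≫ m' →
      Y ◁ (η' ⊗ₘ 𝟙 (𝟙_ E)) ≫ m' = Y ◁ ((λ_ (𝟙_ E)).hom ≫ 𝟙 (𝟙_ E)) ≫ (ρ_ Y).hom → η ≫ s = η' := by
    rintro X Y η η' s _ m m' rfl H1 H2 H3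
    have e0 : (𝟙_ E) ◁ (λ_ (𝟙_ E)).hom = (λ_ (𝟙_ E ⊗ 𝟙_ E)).hom := by
      rw [← cancel_mono (λ_ (𝟙_ E)).hom, leftUnitor_naturality]
    rw [Category.comp_id, id_tensorHom_id, tensorHom_id] at H2
    rw [Category.comp_id] at H3
    have e1 : (𝟙_ E) ◁ (η' ⊗ₘ 𝟙 (𝟙_ E)) ≫ η ▷ (Y ⊗ 𝟙_ E) ≫ m =
        (𝟙_ E) ◁ (λ_ (𝟙_ E)).hom ≫ (ρ_ (𝟙_ E)).hom ≫ η' := by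
      rw [H1, leftUnitor_naturality_assoc, tensorHom_id, rightUnitor_naturality, e0]
    have e2 : (𝟙_ E) ◁ (η' ⊗ₘ 𝟙 (𝟙_ E)) ≫ η ▷ (Y ⊗ 𝟙_ E) ≫ m =
        (𝟙_ E) ◁ (λ_ (𝟙_ E)).hom ≫ (ρ_ (𝟙_ E)).hom ≫ η ≫ s := by
      rw [H2, whisker_exchange_assoc, whisker_exchange_assoc, H3, ← whisker_exchange_assoc,
        ← whisker_exchange_assoc, rightUnitor_naturality, rightUnitor_naturality_assoc]
    rw [e1] at e2
    exact ((cancel_epi _).1 ((cancel_epi _).1 e2)).symm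
  exact e h4 h1 h2 h3

end Operad

end LevelFrames

/-! ### Evaluation and active morphisms of trees -/

section TreeAct

variable {C : Type u} [Category.{v} C] [HypermomentData C] [IsUnitalHypermoment C]
variable {E : Type u'} [Category.{v'} E] [MonoidalCategory E] [SymmetricCategory E]

open Word

/-- Transport of frames along isomorphisms. -/
theorem isFrame_of_iso {A A' : C} (σ : A ≅ A') {κ : Type*} {e : κ → Elem A} {e' : κ → Elem A'}
    (d : ∀ i, (e i).dom ≅ (e' i).dom) (w : ∀ i, (d i).hom ≫ (e' i).hom = (e i).hom ≫ σ.hom)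
    {l : List κ} (h : IsFrame (l.map e)) : IsFrame (l.map e') := by
  constructor
  · intro x
    obtain ⟨y, hy, k, hk⟩ := h.1 (x.push σ.inv (IsHypermoment.inert_of_isIso _))
    obtain ⟨i, hi, rfl⟩ := List.mem_map.1 hy
    obtain ⟨k, hk⟩ : ∃ k : x.dom ≅ (e i).dom, k.hom ≫ (e i).hom = x.hom ≫ σ.inv := ⟨k, hk⟩
    refine ⟨_, List.mem_map_of_mem hi, k ≪≫ d i, ?_⟩
    rw [Iso.trans_hom, Category.assoc, w, reassoc_of% hk, Iso.inv_hom_id, Category.comp_id]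
  · refine List.pairwise_map.2 ((List.pairwise_map.1 h.2).imp fun {i j} hij => ?_)
    rintro ⟨k, hk⟩
    refine hij ⟨d i ≪≫ k ≪≫ (d j).symm, ?_⟩
    have hj : (d j).inv ≫ (e j).hom = (e' j).hom ≫ σ.inv := by
      rw [Iso.inv_comp_eq, reassoc_of% (w j), Iso.hom_inv_id, Category.comp_id]
    simp only [Iso.trans_hom, Iso.symm_hom, Category.assoc]
    rw [hj, reassoc_of% hk, reassoc_of% (w i), Iso.hom_inv_id, Category.comp_id]

namespace CTree

/-- The components of an active morphism of `C`-trees, as isomorphisms. -/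
noncomputable def isoAt {A B : CTree C} {g : A ⟶ B} (hg : IsAct g) {i : Fin (A.height + 1)}
    {k : Fin (B.height + 1)} (h : idx g i = k) : A.arrows.obj i ≅ B.arrows.obj k :=
  haveI := hg.2.2 i
  haveI := B.mp_isIso h
  asIso (app g i ≫ B.mp h.le)

variable {A B : CTree C} {g : A ⟶ B}

/-- The height of a piece. -/
abbrev plvl (p : Piece g) : ℕ := lvl p.toElem

theorem idx_incl (p : Piece g) : (idx p.incl 0 : ℕ) = idx g (idx p.hom 0) := by
  have h0 : idx p.incl (idx p.res 0) = idx g (idx p.hom 0) :=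
    congrArg (fun k : p.dom ⟶ B => idx k 0) p.comm
  have h1 : IsAct p.res := p.res_act
  rw [h1.1] at h0
  exact congrArg Fin.val h0

/-- The formal tensor product over a list of pieces, ordered by their heights. -/
def pieceWord (l : List (Piece g)) : ℕ → Word (Piece g)
  | 0 => one
  | k + 1 => mul (pieceWord l k)
      (list (fun i : {x // x ∈ levels plvl l k} => i.1.1) (levels plvl l k).attach)

theorem pieceWord_perm (l : List (Piece g)) : (pieceWord l A.height).labels.Perm l := by
  have key : ∀ n, (pieceWord l n).labels =
      (List.range n).flatMap fun k => (levels plvl l k).map Subtype.val := by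
    intro n
    induction n with
    | zero => rfl
    | succ n ih =>
      rw [List.range_succ, List.flatMap_append, ← ih, List.flatMap_cons, List.flatMap_nil,
        List.append_nil]
      refine congrArg ((pieceWord l n).labels ++ ·) ?_
      rw [labels_list]
      conv_rhs => rw [← List.attach_map_subtype_val (levels plvl l n), List.map_map]
      rfl
  rw [key]
  exact flatMap_levels_perm plvl l A.height fun p _ => idx_zero_lt p.toElem

/-- The formal tensor product over the vertices of the target of a piece. -/
def codWord (p : Piece g) (m : List (Elem p.cod)) : Word (Elem B) :=
  (levelWord (levels lvl m) p.cod.height).map fun e => e.push p.incl p.incl_inert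

/-- The tree of a piece of height `K'` occupies the levels from `φ(K')` up to, but not including,
`φ(K'+1)`. So the levels `n, …, n + j - 1` with `n = φ(K)` and `n + j = φ(K+1)` receive vertices
from the pieces of height `K` only. -/
theorem levels_flatMap_push (l : List (Piece g)) (m : ∀ p : Piece g, List (Elem p.cod))
    {K n j : ℕ} (hK : K + 1 ≤ A.height) (hn : (idx g ⟨K, by omega⟩ : ℕ) = n)
    (hn' : (idx g ⟨K + 1, by omega⟩ : ℕ) = n + j)
    (hi : ∀ i : {x // x ∈ levels plvl l K}, (idx i.1.1.incl 0 : ℕ) = n) {k : ℕ} (hk : k < j) :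
    levels lvl (l.flatMap fun p => (m p).map fun e => e.push p.incl p.incl_inert) (n + k) =
      (levels plvl l K).attach.flatMap fun i => (levels lvl (m i.1.1) k).map
        fun e => LElem.push e i.1.1.incl i.1.1.incl_inert (hi i) := by
  have hlvl : ∀ (p : Piece g) (e : Elem p.cod),
      lvl (e.push p.incl p.incl_inert) = idx p.incl 0 + lvl e := fun p e =>
    isInert_idx p.incl_inert _
  rw [levels_flatMap (lvl := plvl) (k := K)]
  · conv_lhs => rw [← List.attach_map_subtype_val (levels plvl l K), List.flatMap_map]
    refine congrArg (fun x => (levels plvl l K).attach.flatMap x) (funext fun i => ?_)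
    exact levels_map_add _ (fun e => (hlvl i.1.1 e).trans (congrArg (· + lvl e) (hi i))) _ _
  · rintro p - hp b hb
    obtain ⟨e, -, rfl⟩ := List.mem_map.1 hb
    rw [hlvl]
    have h1 := idx_zero_lt e
    have h2 := height_cod p
    have h3 := idx_last_of_elem p.toElem
    have h4 := idx_incl p
    have h5 := idx_zero_lt p.toElem
    change (idx p.hom 0 : ℕ) ≠ K at hp
    change (idx p.hom (Fin.last _) : ℕ) = idx p.hom 0 + 1 at h3
    change (idx e.hom 0 : ℕ) < p.cod.height at h1
    change (idx p.incl 0 : ℕ) + (idx e.hom 0 : ℕ) ≠ n + k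
    rcases Nat.lt_or_gt_of_ne hp with h | h
    · have h6 : (idx g (idx p.hom (Fin.last _)) : ℕ) ≤ idx g ⟨K, by omega⟩ :=
        (idx g).monotone (Fin.le_def.2 (by rw [h3]; exact h))
      omega
    · have h6 : (idx g ⟨K + 1, by omega⟩ : ℕ) ≤ idx g (idx p.hom 0) :=
        (idx g).monotone (Fin.le_def.2 h)
      omega

end CTree

namespace Operad

open CTree

variable (O : Operad C E)

/-- The composition along the target of a piece. -/
noncomputable def pieceEval {A B : CTree C} {g : A ⟶ B} (p : Piece g) (m : List (Elem p.cod))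
    (hm : IsFrame m) : (codWord p m).eval O.treeVal ⟶ O.coll.obj ⟨p.dom.top⟩ :=
  mapMap O.treeVal (fun e => e.push p.incl p.incl_inert) (levelWord (levels lvl m) p.cod.height) ≫
    O.evalTo (levels lvl m) (isLevelFrame_levels hm) p.cod.height le_rfl ≫
      O.coll.map ⟨(topIso p.res p.res_act).symm⟩

variable {O}

/-- Compatibility of the composition along `C`-trees with active morphisms. -/
theorem evalTo_act {A B : CTree C} {g : A ⟶ B} (hg : IsAct g) (l : List (Piece g))
    (m : ∀ p : Piece g, List (Elem p.cod)) (hl : IsFrame (l.map Piece.toElem))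
    (hm : ∀ p, IsFrame (m p))
    (hl' : IsFrame (l.flatMap fun p => (m p).map fun e => e.push p.incl p.incl_inert)) (K : ℕ) :
    ∀ (hK : K ≤ A.height) (n : ℕ) (hb : n ≤ B.height)
      (hn : idx g ⟨K, Nat.lt_succ_of_le hK⟩ = ⟨n, Nat.lt_succ_of_le hb⟩),
    ∃ φ φ', Canon O.treeVal (levelWord (levels lvl
          (l.flatMap fun p => (m p).map fun e => e.push p.incl p.incl_inert)) n)
        ((pieceWord l K).subst fun p => codWord p (m p)) φ ∧
      Canon O.treeVal ((pieceWord l K).map Piece.toElem)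
        (levelWord (levels lvl (l.map Piece.toElem)) K) φ' ∧
      O.evalTo _ (isLevelFrame_levels hl') n hb =
        φ ≫ substTo (fun p => codWord p (m p)) Piece.toElem (fun p => O.pieceEval p (m p) (hm p))
            (pieceWord l K) ≫
          φ' ≫ O.evalTo _ (isLevelFrame_levels hl) K hK ≫ O.coll.map ⟨isoAt hg hn⟩ := by
  induction K with
  | zero =>
    intro hK n hb hn
    obtain rfl : n = 0 := congrArg Fin.val (hn.symm.trans hg.1)
    refine ⟨_, _, .id _, .id _, ?_⟩
    have h1 := O.unit_iso A.isUnit_root B.isUnit_root (isoAt hg hn)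
    have e : ∀ {P Q : E} {Q' : E} {x : P ⟶ Q} {y : Q ⟶ Q'} {z : P ⟶ Q'}, x ≫ y = z →
        z = 𝟙 P ≫ 𝟙 P ≫ 𝟙 P ≫ x ≫ y := by
      rintro P Q Q' x y _ rfl
      simp
    exact e h1
  | succ K ih =>
    intro hK n' hb hn'
    have hK' : K ≤ A.height := (Nat.le_succ K).trans hK
    obtain ⟨n, hn⟩ : ∃ n, idx g ⟨K, Nat.lt_succ_of_le hK'⟩ = n := ⟨_, rfl⟩
    obtain ⟨n, hn''⟩ := n
    have hle : n ≤ n' := by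
      have h1 := (idx g).monotone (Fin.le_def.2 (Nat.le_succ K) :
        (⟨K, Nat.lt_succ_of_le hK'⟩ : Fin (A.height + 1)) ≤ ⟨K + 1, Nat.lt_succ_of_le hK⟩)
      rw [hn, hn'] at h1
      exact h1
    obtain ⟨j, rfl⟩ := Nat.exists_eq_add_of_le hle
    have hb' : n ≤ B.height := hle.trans hb
    obtain ⟨φ, φ', h1, h2, h3⟩ := ih hK' n hb' hn
    have hlast : ∀ i : {x // x ∈ levels plvl l K}, idx i.1.1.hom (Fin.last _) =
        ⟨K + 1, Nat.lt_succ_of_le hK⟩ := fun i =>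
      Fin.ext ((idx_last_of_elem i.1.1.toElem).trans (congrArg (· + 1) i.1.2))
    have hzero : ∀ i : {x // x ∈ levels plvl l K}, idx i.1.1.hom 0 =
        ⟨K, Nat.lt_succ_of_le hK'⟩ := fun i => Fin.ext i.1.2
    have hi : ∀ i : {x // x ∈ levels plvl l K}, (idx i.1.1.incl 0 : ℕ) = n := fun i => by
      rw [idx_incl, hzero, hn]
    have hj : ∀ i : {x // x ∈ levels plvl l K}, i.1.1.cod.height = j := fun i => by
      have := height_cod i.1.1
      rw [hzero, hlast, hn, hn'] at this
      exact Nat.add_left_cancel this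
    -- A piece of `g` of height `K` gives a piece of `A_K ⟶ A_{K+1}`, and its tree spans a piece of
    -- `B_n ⟶ B_{n+j}`. The components of `g` and of the active part `res` identify the two, so that
    -- equivariance of `μ` applies.
    let π : {x // x ∈ levels plvl l K} → Piece (A.st K (K + 1) (Nat.le_succ K) hK) := fun i =>
      LElem.toPiece hK ⟨i.1.1.toElem, i.1.2⟩
    let π' : {x // x ∈ levels plvl l K} → Piece (B.st n (n + j) (Nat.le_add_right n j) hb) := fun i =>
      spanPiece i.1.1.incl i.1.1.incl_inert (hi i) (hj i) le_rfl hb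
    let τ : ∀ i, PieceIso (isoAt hg hn) (isoAt hg hn') (π i) (π' i) := fun i =>
      { domIso := isoAt i.1.1.res_act (show IsAct i.1.1.res from i.1.1.res_act).1
        codIso := topIso i.1.1.res i.1.1.res_act
        hom_comm := by
          change (app i.1.1.res 0 ≫ i.1.1.cod.mp _) ≫ app i.1.1.incl _ ≫ B.mp _ =
            (app i.1.1.hom 0 ≫ A.mp _) ≫ app g _ ≫ B.mp _
          rw [Category.assoc, Category.assoc, mp_app_assoc, mp_app_assoc, mp_mp, mp_mp]
          exact comp_app_comp_mp i.1.1.comm _ _ _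
        res_comm := by
          change (app i.1.1.res 0 ≫ i.1.1.cod.mp _) ≫ i.1.1.cod.mp _ =
            i.1.1.dom.mp _ ≫ app i.1.1.res _ ≫ i.1.1.cod.mp _
          rw [Category.assoc, mp_app_assoc, mp_mp, mp_mp]
        incl_comm := by
          change (app i.1.1.res _ ≫ i.1.1.cod.mp _) ≫ app i.1.1.incl _ ≫ B.mp _ =
            (app i.1.1.hom _ ≫ A.mp _) ≫ app g _ ≫ B.mp _
          rw [Category.assoc, Category.assoc, mp_app_assoc, mp_app_assoc, mp_mp, mp_mp]
          exact comp_app_comp_mp i.1.1.comm _ _ _ }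
    have hF := isLevelFrame_levels hl K hK
    obtain ⟨χ, h4⟩ := Canon.exists_of_perm (F := fun e : A.LElem K => O.coll.obj ⟨e.1.dom.top⟩)
      (X := list (fun i : {x // x ∈ levels plvl l K} => (⟨i.1.1.toElem, i.1.2⟩ : A.LElem K))
        (levels plvl l K).attach)
      (Y := list (fun e => e) (levels lvl (l.map Piece.toElem) K))
      (by
        rw [labels_list, labels_list, List.map_id', levels_map (lvl := plvl) Piece.toElem fun _ => rfl]
        conv_rhs => rw [← List.attach_map_subtype_val (levels plvl l K), List.map_map]
        exact List.Perm.refl _)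
    have h5 := Canon.map_list_list (F := O.treeVal) (c := Subtype.val) h4
    have h6 : Canon O.val (list π (levels plvl l K).attach)
        (list (LElem.toPiece hK) (levels lvl (l.map Piece.toElem) K)) χ :=
      Canon.map_list_list (F := O.val) (c := LElem.toPiece hK) h4
    have hF' := hF.perm (h6.perm.symm.map Piece.toElem)
    have h7 := canon_mulW (hf := mp_act _ _) h6 hF' hF
    have hF'' : IsFrame ((list π' (levels plvl l K).attach).labels.map Piece.toElem) := by
      rw [labels_list, List.map_map] at hF' ⊢
      exact isFrame_of_iso (isoAt hg hn) (fun i => (τ i).domIso) (fun i => (τ i).hom_comm) hF'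
    -- The new levels of `B` are first evaluated inside the trees of the pieces; one multiplication
    -- over `B_n ⟶ B_{n+j}` remains, and by `h10` it is that of `A_K ⟶ A_{K+1}`.
    obtain ⟨ψ, h8, h9⟩ := evalTo_decomp (O := O) (isLevelFrame_levels hl')
      (fun i => List.mem_attach (levels plvl l K) i) (fun i => i.1.1.incl_inert) hi
      (fun i => isLevelFrame_levels (hm i.1.1)) j
      (fun k hk => List.Perm.of_eq (levels_flatMap_push l m hK (congrArg Fin.val hn)
        (congrArg Fin.val hn') hi hk))
      (fun i => i.1.1.cod.height) hj (fun i => le_rfl) hb hF''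
    have h10 := mulW_iso (O := O) (hf := mp_act _ _) (hf' := mp_act _ _) (isoAt hg hn)
      (isoAt hg hn') (by
        change A.mp _ ≫ app g _ ≫ B.mp _ = (app g _ ≫ B.mp _) ≫ B.mp _
        rw [mp_app_assoc, mp_mp, Category.assoc, mp_mp]) τ
      (fun i => List.mem_attach (levels plvl l K) i) hF' hF''
    refine ⟨_, _, h8.comp (h1.tensor (.id _)), h2.tensor h5, ?_⟩
    have h11 : ∀ i : {x // x ∈ levels plvl l K}, O.pieceEval i.1.1 (m i.1.1) (hm i.1.1) ≫
        O.coll.map ⟨topIso i.1.1.res i.1.1.res_act⟩ = mapMap O.treeVal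
          (fun e => e.push i.1.1.incl i.1.1.incl_inert)
            (levelWord (levels lvl (m i.1.1)) i.1.1.cod.height) ≫
          O.evalTo (levels lvl (m i.1.1)) (isLevelFrame_levels (hm i.1.1)) i.1.1.cod.height le_rfl := by
      intro i
      have e : ∀ {P Q R S : E} {a : P ⟶ Q} {b : Q ⟶ R} {c : R ⟶ S} {d : S ⟶ R}, c ≫ d = 𝟙 R →
          (a ≫ b ≫ c) ≫ d = a ≫ b := by
        rintro P Q R S a b c d H
        rw [Category.assoc, Category.assoc, H, Category.comp_id]
      refine e ?_
      rw [← O.coll.map_comp, ← O.coll.map_id]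
      exact congrArg O.coll.map (CoreHom.ext (Iso.symm_self_id _))
    have h12 := (tensHom_comp _ _ (levels plvl l K).attach).symm.trans
      (congrArg (fun x => tensHom x (levels plvl l K).attach) (funext h11))
    have e : ∀ {W₁ W₂ W₃ W₄ W₅ X X' Y Y' T T' T₁ T₂ : E} {b : W₁ ⟶ Y'} {χ : W₁ ⟶ W₂ ⊗ T} {a : W₂ ⟶ X'}
        {t : T ⟶ T'} {μ' : X' ⊗ T' ⟶ Y'} {φ : W₂ ⟶ W₃} {s : W₃ ⟶ W₄} {φ' : W₄ ⟶ W₅} {M : W₅ ⟶ X}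
        {σ : X ⟶ X'} {σ₁ : Y ⟶ Y'} {t' : T ⟶ T₁} {c : T₁ ⟶ T'} {χ₂ : T₁ ⟶ T₂} {μ₀ : X ⊗ T₂ ⟶ Y}
        {μ : X ⊗ T₁ ⟶ Y}, b = χ ≫ (a ⊗ₘ t) ≫ μ' → a = φ ≫ s ≫ φ' ≫ M ≫ σ → t' ≫ c = t →
        X ◁ χ₂ ≫ μ₀ = μ → μ ≫ σ₁ = (σ ⊗ₘ c) ≫ μ' →
        b = (χ ≫ (φ ⊗ₘ 𝟙 T)) ≫ (s ⊗ₘ t') ≫ (φ' ⊗ₘ χ₂) ≫ ((M ⊗ₘ 𝟙 T₂) ≫ μ₀) ≫ σ₁ := by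
      rintro W₁ W₂ W₃ W₄ W₅ X X' Y Y' T T' T₁ T₂ b χ a t μ' φ s φ' M σ σ₁ t' c χ₂ μ₀ μ rfl rfl rfl rfl H
      have h1 : (M ⊗ₘ χ₂) ≫ μ₀ ≫ σ₁ = (M ⊗ₘ 𝟙 T₁) ≫ (σ ⊗ₘ c) ≫ μ' := by
        rw [← H, Category.assoc, ← MonoidalCategory.id_tensorHom, tensorHom_comp_tensorHom_assoc,
          Category.comp_id, Category.id_comp]
      simp only [Category.assoc]
      rw [tensorHom_comp_tensorHom_assoc φ', Category.comp_id, tensorHom_comp_tensorHom_assoc s,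
        tensorHom_comp_tensorHom_assoc φ, Category.id_comp]
      have h2 : ((φ ≫ s ≫ φ' ≫ M) ⊗ₘ (t' ≫ χ₂)) = ((φ ≫ s ≫ φ') ⊗ₘ t') ≫ (M ⊗ₘ χ₂) := by
        rw [tensorHom_comp_tensorHom, Category.assoc, Category.assoc]
      rw [h2, Category.assoc, h1, tensorHom_comp_tensorHom_assoc, tensorHom_comp_tensorHom_assoc]
      simp only [Category.assoc, Category.comp_id]
    exact e h9 h3 h12 h7 h10

end Operad

end TreeAct

/-! ### The monoid of an operad -/

section OfOperad

variable {C : Type u} [Category.{v} C] [HypermomentData C] [IsUnitalHypermoment C]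
variable {E : Type u'} [Category.{v'} E] [MonoidalCategory E] [SymmetricCategory E]

open Word

namespace Operad

open CTree

variable (O : Operad C E)

theorem list_perm_levelWord {B : CTree C} (l : List (Elem B)) :
    (list (fun e => e) l).labels.Perm (levelWord (levels lvl l) B.height).labels := by
  rw [labels_list, List.map_id']
  exact (levelWord_levels_perm l).symm

/-- The composition along a `C`-tree. -/
noncomputable def eval {B : CTree C} (l : List (Elem B)) (h : IsFrame l) :
    tens O.treeVal l ⟶ O.coll.obj ⟨B.top⟩ :=
  can O.treeVal (list_perm_levelWord l) ≫
    O.evalTo (levels lvl l) (isLevelFrame_levels h) B.height le_rfl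

variable {O}

theorem _root_.Hypermoment.IsFrame.nodup_list {B : CTree C} {l : List (Elem B)} (h : IsFrame l) :
    (list (fun e => e) l).labels.Nodup := by
  rw [labels_list, List.map_id']
  exact h.nodup

theorem canon_eval {B : CTree C} {l l' : List (Elem B)} {θ : tens O.treeVal l ⟶ tens O.treeVal l'}
    (hθ : Canon O.treeVal (list (fun e => e) l) (list (fun e => e) l') θ) (h : IsFrame l)
    (h' : IsFrame l') : θ ≫ O.eval l' h' = O.eval l h := by
  have hp : l.Perm l' := by
    have := hθ.perm
    rwa [labels_list, labels_list, List.map_id', List.map_id'] at this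
  obtain ⟨φ, h1, h2⟩ := evalTo_perm (O := O) (isLevelFrame_levels h) (isLevelFrame_levels h')
    (n := B.height) le_rfl (fun k _ => levels_perm hp k)
  have h3 := Canon.unique h.nodup_list (hθ.comp (can_canon O.treeVal (list_perm_levelWord l')))
    ((can_canon O.treeVal (list_perm_levelWord l)).comp h1)
  have e : ∀ {P Q R S Z : E} {θ : P ⟶ Q} {c : Q ⟶ R} {d : P ⟶ S} {φ : S ⟶ R} {x : R ⟶ Z} {y : S ⟶ Z},
      θ ≫ c = d ≫ φ → φ ≫ x = y → θ ≫ c ≫ x = d ≫ y := by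
    rintro P Q R S Z θ c d φ x y H rfl
    rw [reassoc_of% H]
  exact e h3 h2

/-- The first stage of an evaluation, spelled out when level `0` lists one vertex: the unit is
inserted at the root and the structure map `B_0 ⟶ B_1` is applied. In this form the left unit law
can cancel it. -/
theorem evalTo_one {B : CTree C} {ls : ∀ k, List (B.LElem k)} (hls : IsLevelFrame ls)
    (hb : 1 ≤ B.height) {x : B.LElem 0} (hx : ls 0 = [x]) :
    ∃ θ H, Canon O.treeVal (of x.1) (levelWord ls 1) θ ∧
      θ ≫ O.evalTo ls hls 1 hb = (ρ_ (O.treeVal x.1)).inv ≫ (λ_ (O.treeVal x.1 ⊗ 𝟙_ E)).inv ≫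
        O.unit _ B.isUnit_root ▷ (O.treeVal x.1 ⊗ 𝟙_ E) ≫
          O.mulW (B.st 0 1 (Nat.le_succ 0) hb) (mp_act _ _)
            (list (fun _ : PUnit.{max u v + 1} => x.toPiece hb) [⟨⟩]) H := by
  obtain ⟨χ, h4⟩ := Canon.exists_of_perm (F := fun e : B.LElem 0 => O.coll.obj ⟨e.1.dom.top⟩)
    (X := list (fun _ : PUnit.{max u v + 1} => x) [⟨⟩]) (Y := list (fun e => e) (ls 0))
    (by rw [labels_list, labels_list, List.map_id', hx]; exact List.Perm.refl _)
  have h5 := Canon.map_list_list (F := O.treeVal) (c := Subtype.val) h4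
  have h6 : Canon O.val (list (fun _ : PUnit.{max u v + 1} => x.toPiece hb) [⟨⟩])
      (list (LElem.toPiece hb) (ls 0)) χ :=
    Canon.map_list_list (F := O.val) (c := LElem.toPiece hb) h4
  have hF := hls 0 hb
  have hF' := hF.perm (h6.perm.symm.map Piece.toElem)
  have h7 := canon_mulW (hf := mp_act _ _) h6 hF' hF
  refine ⟨_, hF', ((Canon.singleton O.treeVal (fun _ : PUnit.{max u v + 1} => x.1) ⟨⟩).comp
    h5).comp (Canon.leftUnitInv _), ?_⟩
  have e : ∀ {P Q R X Z : E} {r : P ⟶ Q} {χ : Q ⟶ R} {v : 𝟙_ E ⟶ X} {M : X ⊗ R ⟶ Z} {M' : X ⊗ Q ⟶ Z},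
      X ◁ χ ≫ M = M' →
      ((r ≫ χ) ≫ (λ_ R).inv) ≫ (v ⊗ₘ 𝟙 R) ≫ M = r ≫ (λ_ Q).inv ≫ v ▷ Q ≫ M' := by
    rintro P Q R X Z r χ v M _ rfl
    rw [tensorHom_id, ← whisker_exchange_assoc]
    simp
  exact e h7

/-- At height one, evaluation is `η` followed by a single multiplication, which the left unit law
makes trivial. -/
theorem eval_refl {T : CTree C} (hT : IsUnitObj T) (h : IsFrame [Elem.refl T hT]) :
    O.eval [Elem.refl T hT] h = (ρ_ _).hom := by
  have hh := (isUnitObj_iff T).1 hT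
  obtain ⟨n, arr, hact, hroot⟩ := T
  obtain rfl : n = 1 := hh
  set T : CTree C := ⟨1, arr, hact, hroot⟩
  obtain ⟨θ, H, h1, h2⟩ := evalTo_one (O := O) (isLevelFrame_levels h) (B := T) le_rfl
    (x := ⟨Elem.refl T hT, rfl⟩) rfl
  have eh : app (𝟙 T) 0 ≫ T.mp (i := 0) (j := 0) (le_refl _) = 𝟙 _ :=
    (Category.id_comp _).trans (T.mp_refl _)
  have er : app (𝟙 T) (Fin.last _) ≫ T.mp (i := Fin.last _) (j := Fin.last _) (le_refl _) = 𝟙 _ :=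
    (Category.id_comp _).trans (T.mp_refl _)
  let p : Piece (T.st 0 1 (Nat.le_succ 0) le_rfl) := LElem.toPiece le_rfl ⟨Elem.refl T hT, rfl⟩
  have h3 := left_unitW (O := O) (hU := T.isUnit_root) (f := T.st 0 1 (Nat.le_succ 0) le_rfl)
    (hf := mp_act T _) (hU' := T.isUnit_root) (hh := p.inert) (hs := p.res_act) (hr := p.incl_inert)
    (w := p.comm) eh er H
  have h4 := Canon.unique (X := of (Elem.refl T hT)) (List.nodup_singleton _) ((Canon.singleton O.treeVal (fun e => e)
    (Elem.refl T hT)).comp (can_canon O.treeVal (list_perm_levelWord [Elem.refl T hT]))) h1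
  have e : ∀ {P Q R Z : E} {r : P ≅ Q} {c : Q ⟶ R} {θ : P ⟶ R} {x : R ⟶ Z} {y : P ⟶ Z} {z : Q ⟶ Z}
      {i : Q ≅ 𝟙_ E ⊗ Q} {M : 𝟙_ E ⊗ Q ⟶ Z}, r.hom ≫ c = θ → θ ≫ x = r.hom ≫ i.hom ≫ M →
      M = i.inv ≫ z → c ≫ x = z := by
    rintro P Q R Z r c _ x y z i _ rfl H rfl
    simpa using H
  exact e (r := (ρ_ _).symm) (i := (λ_ _).symm) (y := 𝟙 _) h4 h2 h3

/-- Compatibility of the composition along `C`-trees with active morphisms. -/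
theorem eval_comp {A B : CTree C} {g : A ⟶ B} (hg : IsAct g) (l : List (Piece g))
    (m : ∀ p : Piece g, List (Elem p.cod)) (hl : IsFrame (l.map Piece.toElem))
    (hm : ∀ p, IsFrame (m p))
    (hl' : IsFrame (l.flatMap fun p => (m p).map fun e => e.push p.incl p.incl_inert)) :
    O.eval _ hl' = tensFlat O.treeVal O.treeVal Piece.toElem m (fun p e => e.push p.incl p.incl_inert)
        (fun p => O.eval (m p) (hm p) ≫ O.coll.map ⟨(topIso p.res p.res_act).symm⟩) l ≫
      O.eval _ hl ≫ O.coll.map ⟨topIso g hg⟩ := by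
  -- The case of all levels of `A`. It remains to replace the formal tensor products sorted by
  -- height by the lists of the monoid axiom; all morphisms involved are canonical, and `h15` and
  -- `h16` compare them.
  obtain ⟨φ, φ', h1, h2, h3⟩ := evalTo_act (O := O) hg l m hl hm hl' A.height le_rfl B.height le_rfl
    hg.2.1
  have h0 := exists_tensFlat O.treeVal O.treeVal Piece.toElem m
    (fun (p : Piece g) e => e.push p.incl p.incl_inert)
    (fun p => O.eval (m p) (hm p) ≫ O.coll.map ⟨(topIso p.res p.res_act).symm⟩) (fun p => p) l
  rw [List.map_id'] at h0
  obtain ⟨J, J', h4, h5, h6⟩ := h0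
  obtain ⟨ξ, ξ', h7, h8, h9⟩ := Canon.exists_substTo (F := O.treeVal) (F' := O.treeVal)
    (fun p : Piece g => codWord p (m p)) Piece.toElem (fun p => O.pieceEval p (m p) (hm p))
    (X := list (fun p => p) l) (Y := pieceWord l A.height)
    (by rw [labels_list, List.map_id']; exact (pieceWord_perm l).symm)
  have h10 : ∀ p : Piece g, ∃ ζ, Canon O.treeVal (list (fun e => e.push p.incl p.incl_inert) (m p))
      (codWord p (m p)) ζ ∧ ζ ≫ O.pieceEval p (m p) (hm p) =
        O.eval (m p) (hm p) ≫ O.coll.map ⟨(topIso p.res p.res_act).symm⟩ := by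
    intro p
    obtain ⟨ζ, h11, h12⟩ := Canon.exists_map (F := O.treeVal)
      (fun e : Elem p.cod => e.push p.incl p.incl_inert)
      (can_canon O.treeVal (list_perm_levelWord (m p)))
    refine ⟨ζ, h11, ?_⟩
    have h13 := mapMap_list O.treeVal (fun e : Elem p.cod => e.push p.incl p.incl_inert)
      (fun e => e) (m p)
    have e : ∀ {P Q R S Z : E} {ζ : P ⟶ Q} {a : Q ⟶ R} {i : P ⟶ P} {c : P ⟶ R} {x : R ⟶ S} {y : S ⟶ Z},
        ζ ≫ a = i ≫ c → i = 𝟙 P → ζ ≫ a ≫ x ≫ y = (c ≫ x) ≫ y := by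
      rintro P Q R S Z ζ a _ c x y H rfl
      rw [reassoc_of% H, Category.assoc]
    exact e h12 h13
  choose ζ h11 h12 using h10
  have h13 := Canon.bigCongr l fun p _ => h11 p
  have h14 := (congrArg (fun x => tensHom x l) (funext h12)).symm.trans (tensHom_comp _ _ l)
  have h15 := Canon.unique hl'.nodup_list ((can_canon O.treeVal (list_perm_levelWord _)).comp h1)
    ((h4.comp h13).comp h7)
  have hn : (list Piece.toElem l).labels.Nodup := by rw [labels_list]; exact hl.nodup
  have h16 := Canon.unique hn (h8.comp h2)
    (h5.comp (can_canon O.treeVal (list_perm_levelWord _)))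
  have e : ∀ {P₁ P₂ P₃ P₄ P₅ P₆ P₇ P₈ P₉ Z Z' : E} {c₁ : P₁ ⟶ P₂} {φ : P₂ ⟶ P₃} {Y : P₃ ⟶ P₄}
      {φ' : P₄ ⟶ P₅} {x : P₂ ⟶ Z'} {y : P₅ ⟶ Z} {t : Z ⟶ Z'} {J : P₁ ⟶ P₆} {ζ : P₆ ⟶ P₇}
      {ξ : P₇ ⟶ P₃} {X : P₇ ⟶ P₈} {ξ' : P₈ ⟶ P₄} {J' : P₈ ⟶ P₉} {c₂ : P₉ ⟶ P₅} {w : P₆ ⟶ P₈}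
      {T : P₁ ⟶ P₉},
      x = φ ≫ Y ≫ φ' ≫ y ≫ t → c₁ ≫ φ = (J ≫ ζ) ≫ ξ → ξ ≫ Y = X ≫ ξ' → ξ' ≫ φ' = J' ≫ c₂ →
      w = ζ ≫ X → T = J ≫ w ≫ J' → c₁ ≫ x = T ≫ (c₂ ≫ y) ≫ t := by
    rintro P₁ P₂ P₃ P₄ P₅ P₆ P₇ P₈ P₉ Z Z' c₁ φ Y φ' x y t J ζ ξ X ξ' J' c₂ w T rfl H1 H2 H3 rfl rfl
    rw [reassoc_of% H1, reassoc_of% H2, reassoc_of% H3]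
    simp only [Category.assoc]
  exact e h3 h15 h9 h16 h14 h6

theorem map_symm_comp {A A' A'' : C} (i : A ≅ A') (j : A' ≅ A'') :
    O.coll.map (⟨j⟩ : (⟨A'⟩ : Core C) ⟶ ⟨A''⟩) ≫ O.coll.map ⟨(i ≪≫ j).symm⟩ = O.coll.map ⟨i.symm⟩ := by
  rw [← O.coll.map_comp]
  refine congrArg O.coll.map (CoreHom.ext (Iso.ext ?_))
  change j.hom ≫ j.inv ≫ i.inv = i.inv
  rw [Iso.hom_inv_id_assoc]

variable (O)

/-- The structure of a monoid over the plus construction given by an operad. -/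
noncomputable def treeStr : MonStr (E := E) (CTree C) fun T _ => O.coll.obj ⟨T.top⟩ where
  map hU f hf l h := O.eval l h ≫ O.coll.map ⟨(topIso f hf).symm⟩
  map_swap hU f hf l₁ l₂ x y h h' :=
    ((congrArg (· ≫ _) (canon_eval (Canon.bigSwap (fun e => of e) x y l₂ l₁) h h')).symm).trans
      (Category.assoc _ _ _)
  map_id T hT h := by
    have h1 : O.coll.map (⟨(topIso (𝟙 T) (act_id T)).symm⟩ : (⟨T.top⟩ : Core C) ⟶ ⟨T.top⟩) = 𝟙 _ := by
      rw [← O.coll.map_id]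
      exact congrArg (fun i : T.top ≅ T.top => O.coll.map (⟨i.symm⟩ : (⟨T.top⟩ : Core C) ⟶ ⟨T.top⟩))
        (topIso_id T _)
    exact (congrArg (_ ≫ ·) h1).trans ((Category.comp_id _).trans (eval_refl hT h))
  map_comp hU f g hf hg l m hl hm hl' := by
    have h1 := eval_comp (O := O) hg l m hl hm hl'
    have h2 := map_symm_comp (O := O) (topIso f hf) (topIso g hg)
    rw [← topIso_comp f g hf hg (act_comp f g hf hg)] at h2
    have e : ∀ {P Q R S Z : E} {x : P ⟶ R} {t : P ⟶ Q} {y : Q ⟶ S} {i : S ⟶ R} {j : R ⟶ Z}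
        {k : S ⟶ Z}, x = t ≫ y ≫ i → i ≫ j = k → x ≫ j = t ≫ y ≫ k := by
      rintro P Q R S Z _ t y i j _ rfl rfl
      simp only [Category.assoc]
    exact e h1 h2

/-- The monoid over the plus construction given by an operad. -/
noncomputable def toTreeMon : TreeMon C E where
  coll := O.coll
  str := O.treeStr
  act1_eq hT hT' g hg := by
    have h := isFrame_refl hT'
    have e : ∀ {P Q R : E} {r : P ≅ Q} {x : Q ⟶ P} {y : P ⟶ R}, x = r.inv →
        r.hom ≫ x ≫ y = y := by
      rintro P Q R r _ y rfl
      simp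
    exact (Mon.act1_eq (X := O.treeStr.toMon) hT hT' g hg h).trans
      (e (r := (ρ_ _).symm) (eval_refl hT' h))

end Operad

end OfOperad

/-! ### Recovering an operad from its monoid -/

section EssSurj

variable {C : Type u} [Category.{v} C] [HypermomentData C] [IsUnitalHypermoment C]
variable {E : Type u'} [Category.{v'} E] [MonoidalCategory E] [SymmetricCategory E]

open Word

namespace Operad

open CTree TreeMon

variable (O : Operad C E)

/-- Evaluation on the tree `([0], U)` stops at its initial value `η`; the isomorphism of last
objects attached to the degeneracy is absorbed by invariance of the units. -/
theorem toTreeMon_unitT {U : C} (hU : IsUnitObj U) : O.toTreeMon.unitT hU = O.unit U hU := by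
  have h := isFrame_nil (T := edge U hU) rfl
  have h1 := Mon.canon_map (X := O.treeStr.toMon) (hU := corolla_isUnit) (f := degeneracy hU)
    (hf := degeneracy_act hU) (W := one) (l := []) (Canon.nilInv (F := O.treeVal) _) h h
  have h2 := Canon.unique (F := O.treeVal) (X := list (fun e => e) []) List.nodup_nil
    (can_canon O.treeVal (list_perm_levelWord (B := edge U hU) [])) (Canon.nil _)
  have h3 := O.unit_iso (edge U hU).isUnit_root hU
    (topIso (degeneracy hU) (degeneracy_act hU)).symm
  have e : ∀ {P Q : E} {a b : P ⟶ P} {c t : P ⟶ Q} {i : Q ⟶ Q} {w : P ⟶ Q},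
      a ≫ (b ≫ c) ≫ i = w → a = 𝟙 P → b = 𝟙 P → c ≫ i = t → w = t := by
    rintro P Q _ _ c _ i _ rfl rfl rfl rfl
    simp
  exact e h1 rfl h2 h3

variable {U A B : C} (hU : IsUnitObj U) (u : U ⟶ A) (f : A ⟶ B) (hu : act u) (hf : act f)

/-- On a tree of height two, the first stage is cancelled by the left unit law, the second is the
multiplication of `f`, and the inner face is the identity on last objects. -/
theorem toTreeMon_mulT (l : List (Piece f)) (h : IsFrame (l.map Piece.toElem)) :
    O.toTreeMon.mulT hU u f hu hf (fun p => p) l h = O.mul f hf l h := by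
  let T := triangle hU u f hu hf
  let W : Word (Elem T) := Word.mul (of (rv hU u f hu hf)) (list (fun p => pv hU u f hu hf p) l)
  have hW : IsFrame W.labels := isFrame_vertices hU u f hu hf (fun p => p) l h
  have hL : W.labels = rv hU u f hu hf :: l.map fun p => pv hU u f hu hf p :=
    congrArg (_ :: ·) (labels_list _ _)
  have hls := isLevelFrame_levels hW
  have h0 : levels lvl W.labels 0 = [⟨rv hU u f hu hf, rfl⟩] := by
    rw [hL, levels_cons, levels_eq_nil]
    · rfl
    · intro a ha
      obtain ⟨p, -, rfl⟩ := List.mem_map.1 ha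
      exact one_ne_zero
  have h1 : levels lvl W.labels 1 = l.map fun p => ⟨pv hU u f hu hf p, rfl⟩ := by
    rw [hL, levels_cons]
    clear hls h0 hL hW W h
    induction l with
    | nil => rfl
    | cons p l ih => rw [List.map_cons, levels_cons]; exact congrArg (_ :: ·) ih
  obtain ⟨θ, H, h2, h3⟩ := evalTo_one (O := O) hls (Nat.le_succ 1) h0
  let p₀ : Piece (T.st 0 1 (Nat.le_succ 0) (Nat.le_succ 1)) :=
    LElem.toPiece (Nat.le_succ 1) ⟨rv hU u f hu hf, rfl⟩
  have eh : 𝟙 U ≫ T.mp (i := 0) (j := 0) (le_refl _) = 𝟙 U :=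
    (Category.id_comp _).trans (T.mp_refl _)
  have er : 𝟙 A ≫ T.mp (i := (1 : Fin 3)) (j := (1 : Fin 3)) (le_refl _) = 𝟙 A :=
    (Category.id_comp _).trans (T.mp_refl _)
  have h4 := left_unitW (O := O) (hU := T.isUnit_root) (f := T.st 0 1 (Nat.le_succ 0) (Nat.le_succ 1))
    (hf := mp_act T _) (hU' := hU) (hh := p₀.inert) (hs := p₀.res_act) (hr := p₀.incl_inert)
    (w := p₀.comm) eh er H
  obtain ⟨χ, h5⟩ := Canon.exists_of_perm (F := fun e : T.LElem 1 => O.coll.obj ⟨e.1.dom.top⟩)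
    (X := list (fun p : Piece f => (⟨pv hU u f hu hf p, rfl⟩ : T.LElem 1)) l)
    (Y := list (fun e => e) (levels lvl W.labels 1))
    (by rw [labels_list, labels_list, List.map_id', h1])
  let π : Piece f → Piece (T.st 1 2 (Nat.le_succ 1) le_rfl) := fun p =>
    LElem.toPiece le_rfl ⟨pv hU u f hu hf p, rfl⟩
  have h6 := Canon.map_list_list (F := O.treeVal) (c := Subtype.val) h5
  have h7 : Canon O.val (list π l) (list (LElem.toPiece le_rfl) (levels lvl W.labels 1)) χ :=
    Canon.map_list_list (F := O.val) (c := LElem.toPiece (le_refl 2)) h5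
  have hF := hls 1 (le_refl 2)
  have hF' := hF.perm (h7.perm.symm.map Piece.toElem)
  have h8 := canon_mulW (hf := mp_act T _) h7 hF' hF
  have hl : IsFrame ((list (fun p : Piece f => p) l).labels.map Piece.toElem) := by
    rwa [labels_list, List.map_id']
  have h9 := mulW_list_congr (O := O) (f := T.st 1 2 (Nat.le_succ 1) le_rfl) (f' := f) rfl
    (hf := mp_act T _) (hf' := hf) (D := fun p : Piece f => p.dom) (V := fun p => p.cod)
    (hD := fun p => p.isUnit) (hh := fun p => (π p).inert) (hh' := fun p => p.inert)
    (hs := fun p => (π p).res_act) (hs' := fun p => p.res_act) (hr := fun p => (π p).incl_inert)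
    (hr' := fun p => p.incl_inert) (w := fun p => (π p).comm) (w' := fun p => p.comm)
    (fun p => (congrArg (p.hom ≫ ·) (T.mp_refl (i := (1 : Fin 3)) (le_refl _))).trans
      (Category.comp_id _))
    (fun p => rfl)
    (fun p => (congrArg (p.incl ≫ ·) (T.mp_refl (i := (2 : Fin 3)) (le_refl _))).trans
      (Category.comp_id _)) l hF' hl
  have h10 := mulW_list (O := O) (hf := hf) h hl
  have h11 := Canon.unique hW.nodup ((can_canon O.treeVal (X := W) (Y := list (fun e => e) W.labels)
    (by simp [labels_list])).comp (can_canon O.treeVal (list_perm_levelWord W.labels)))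
    (h2.tensor h6)
  have h12 : O.coll.map (⟨(topIso (innerFace hU u f hu hf) (innerFace_act hU u f hu hf)).symm⟩ :
      (⟨B⟩ : Core C) ⟶ ⟨B⟩) = 𝟙 _ := by
    have h13 : topIso (innerFace hU u f hu hf) (innerFace_act hU u f hu hf) = Iso.refl B :=
      Iso.ext ((Category.id_comp _).trans (T.mp_refl (i := (2 : Fin 3)) (le_refl _)))
    rw [← O.coll.map_id]
    exact congrArg (fun i : B ≅ B => O.coll.map (⟨i.symm⟩ : (⟨B⟩ : Core C) ⟶ ⟨B⟩)) h13
  have e : ∀ {P Q R₁ R₂ X V Z : E} {c : X ⊗ P ⟶ Q} {d : Q ⟶ R₁ ⊗ R₂} {θ : X ⟶ R₁} {χ : P ⟶ R₂}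
      {x : R₁ ⟶ X} {M : X ⊗ R₂ ⟶ Z} {μ : X ⊗ P ⟶ Z} {i : Z ⟶ Z} {r : X ≅ V}
      {s : V ≅ 𝟙_ E ⊗ V} {N : 𝟙_ E ⊗ V ⟶ X}, c ≫ d = θ ⊗ₘ χ → θ ≫ x = r.hom ≫ s.hom ≫ N →
      N = s.inv ≫ r.inv → X ◁ χ ≫ M = μ → i = 𝟙 Z → c ≫ (d ≫ (x ⊗ₘ 𝟙 R₂) ≫ M) ≫ i = μ := by
    rintro P Q R₁ R₂ X V Z c d θ χ x M _ _ r s _ H H' rfl rfl rfl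
    rw [Iso.hom_inv_id_assoc, Iso.hom_inv_id] at H'
    rw [Category.comp_id, reassoc_of% H, tensorHom_comp_tensorHom_assoc, H', Category.comp_id,
      id_tensorHom]
  exact (e (r := (ρ_ _).symm) (s := (λ_ _).symm) h11 h3 h4 h8 h12).trans (h9.trans h10)

end Operad

namespace TreeMon

open Operad

/-- An operad is recovered from the corresponding monoid over the plus construction. -/
noncomputable def extIso (O : Operad C E) : ext.obj O.toTreeMon ≅ O where
  hom := show Operad.Hom _ _ from ⟨𝟙 O.coll,
    fun U hU => (Category.comp_id _).trans (O.toTreeMon_unitT hU),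
    fun f hf l h => by
      have e : ∀ {P Q Z : E} {a b : P ⊗ Q ⟶ Z} {t : Q ⟶ Q}, a = b → t = 𝟙 Q →
          a ≫ 𝟙 Z = (𝟙 P ⊗ₘ t) ≫ b := by
        rintro P Q Z a _ t rfl rfl
        simp
      exact e (O.toTreeMon_mulT _ _ _ _ _ l h) (tensHom_id _ _)⟩
  inv := show Operad.Hom _ _ from ⟨𝟙 O.coll,
    fun U hU => (Category.comp_id _).trans (O.toTreeMon_unitT hU).symm,
    fun f hf l h => by
      have e : ∀ {P Q Z : E} {a b : P ⊗ Q ⟶ Z} {t : Q ⟶ Q}, a = b → t = 𝟙 Q →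
          a ≫ 𝟙 Z = (𝟙 P ⊗ₘ t) ≫ b := by
        rintro P Q Z a _ t rfl rfl
        simp
      exact e (O.toTreeMon_mulT _ _ _ _ _ l h).symm (tensHom_id _ _)⟩
  hom_inv_id := Operad.Hom.ext (Category.id_comp _)
  inv_hom_id := Operad.Hom.ext (Category.id_comp _)

instance : (ext : TreeMon C E ⥤ _).EssSurj where
  mem_essImage O := ⟨O.toTreeMon, ⟨extIso O⟩⟩

instance : (ext : TreeMon C E ⥤ _).IsEquivalence where

end TreeMon

end EssSurj

/-! ### The equivalence and its compatibility with units and multiplications -/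

section PlusEquivalence

variable {C : Type u} [Category.{v} C] [HypermomentData C] [IsUnitalHypermoment C]
variable {E : Type u'} [Category.{v'} E] [MonoidalCategory E] [SymmetricCategory E]

open Word CTree TreeMon

namespace TreeMon

/-- The counit of the equivalence between normalized monoids and monoids. -/
noncomputable def counit (X : Mon (CTree C) E) :
    toMon.obj ((toMon : TreeMon C E ⥤ _).asEquivalence.inverse.obj X) ≅ X :=
  (toMon : TreeMon C E ⥤ _).asEquivalence.counitIso.app X

/-- The components of the counit. -/
noncomputable def counitAt (X : Mon (CTree C) E) {U A : C} (hU : IsUnitObj U) (u : U ⟶ A)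
    (hu : act u) : ((toMon : TreeMon C E ⥤ _).asEquivalence.inverse.obj X).coll.obj ⟨A⟩ ≅
      X.obj (corolla hU u hu) corolla_isUnit where
  hom := Mon.Hom.at (counit X).hom (corolla hU u hu) corolla_isUnit
  inv := Mon.Hom.at (counit X).inv (corolla hU u hu) corolla_isUnit
  hom_inv_id := congrArg (fun φ => Mon.Hom.at φ (corolla hU u hu) corolla_isUnit)
    (counit X).hom_inv_id
  inv_hom_id := congrArg (fun φ => Mon.Hom.at φ (corolla hU u hu) corolla_isUnit)
    (counit X).inv_hom_id

end TreeMon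

/-- The equivalence between monoids over the plus construction and operads. -/
noncomputable def plusEquivalence : PlusEquivalence (C := C) isUnitObj_iff E where
  -- The operad of `X` is that of a normalised monoid isomorphic to `X`. Accordingly, the
  -- isomorphisms `O(A) ≅ X([1], U ⟶ A)` are components of the counit, and the compatibilities below
  -- are naturality of a morphism of monoids.
  equiv := (toMon : TreeMon C E ⥤ _).asEquivalence.symm.trans ext.asEquivalence
  iso X _ _ hU u hu := counitAt X hU u hu
  iso_natural {X Y} φ U A hU u hu :=
    congrArg (fun ψ => Mon.Hom.at ψ (corolla hU u hu) corolla_isUnit)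
      ((toMon : TreeMon C E ⥤ _).asEquivalence.counitIso.hom.naturality φ)
  iso_equivariant X U A U' A' hU u hu hU' u' hu' s t w := by
    have h := isFrame_refl (corolla_isUnit (hU := hU') (u := u') (hu := hu'))
    let S := (toMon : TreeMon C E ⥤ _).asEquivalence.inverse.obj X
    have h1 := Mon.Hom.act1_naturality (counit X).hom corolla_isUnit corolla_isUnit
      (corollaMap hU u hu hU' u' hu' s t w) (corollaMap_act _ _ _ _ _ _ _ _ _)
    have h2 := Mon.act1_eq (X := X) corolla_isUnit corolla_isUnit
      (corollaMap hU u hu hU' u' hu' s t w) (corollaMap_act _ _ _ _ _ _ _ _ _) h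
    have h3 := S.act1_corollaMap hU u hu hU' u' hu' s t w
    have h4 : S.coll.map (⟨t⟩ : (⟨A⟩ : Core C) ⟶ ⟨A'⟩) ≫ S.coll.map ⟨t.symm⟩ = 𝟙 _ := by
      rw [← S.coll.map_comp, ← S.coll.map_id]
      exact congrArg S.coll.map (CoreHom.ext (Iso.self_symm_id t))
    have e : ∀ {P Q R Z : E} {m : P ⟶ Q} {c : Q ⟶ R} {x : R ⟶ Z} {y : R ⟶ Z} {a b : Q ⟶ P} {d : P ⟶ Z},
        a ≫ d = c ≫ x → x = y → a = b → m ≫ b = 𝟙 P → m ≫ c ≫ y = d := by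
      rintro P Q R Z m c x _ a _ d H rfl rfl H'
      rw [← H, reassoc_of% H']
    exact ⟨h, e h1 h2 h3 h4⟩
  iso_unit X U hU := by
    have h := isFrame_nil (T := edge U hU) rfl
    have h1 := Mon.Hom.mapW_naturality (counit X).hom corolla_isUnit (degeneracy hU)
      (degeneracy_act hU) one h
    have h2 := Mon.canon_map (X := X) (hU := corolla_isUnit) (f := degeneracy hU)
      (hf := degeneracy_act hU) (W := one) (l := []) (Canon.nilInv (F := X.val) _) h h
    exact ⟨h, h1.trans ((congrArg (_ ≫ ·) h2.symm).trans
      ((Category.id_comp _).trans (Category.id_comp _)))⟩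
  iso_mul X U A B hU u f hu hf l hl := by
    let S := (toMon : TreeMon C E ⥤ _).asEquivalence.inverse.obj X
    have h : IsFrame (rv hU u f hu hf :: l.map fun p => pv hU u f hu hf p) := isFrame_triangle hl
    have h1 := Mon.Hom.mapW_naturality (counit X).hom corolla_isUnit (innerFace hU u f hu hf)
      (innerFace_act hU u f hu hf) _ (isFrame_vertices hU u f hu hf (fun p => p) l hl)
    have h2 := Mon.canon_map (X := X) (hU := corolla_isUnit) (hf := innerFace_act hU u f hu hf)
      (Canon.tensorCons (a := rv hU u f hu hf) (S := fun e => of e)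
        (Canon.id (F := X.val) (of (rv hU u f hu hf)))
        (Canon.bigMap (F := X.val) (fun p => pv hU u f hu hf p) (fun e => of e) l))
      (isFrame_vertices hU u f hu hf (fun p => p) l hl) h
    -- The multiplication was defined with the chosen unit below `A`; the formula is wanted for an
    -- arbitrary one.
    have h3 := S.mulT_eq (root_isUnit _) (root _) (root_act _) hU u hu (f := f) (hf := hf)
      (fun p => p) l hl
    have h4 := tensMap_eq (fun p => pv hU u f hu hf p) (G := X.val)
      (fun p => (counitAt X p.isUnit p.res p.res_act).hom) l
    have e : ∀ {P P' Q R R' Z Z' : E} {m m' : P ⊗ Q ⟶ Z} {c : Z ⟶ Z'} {a : P ⟶ P'} {b : Q ⟶ R}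
        {d : R ⟶ R'} {x : P' ⊗ R' ⟶ Z'} {y : P' ⊗ R ⟶ Z'} {k : Q ⟶ R'},
        m' ≫ c = (a ⊗ₘ b) ≫ y → (𝟙 P' ⊗ₘ d) ≫ x = y → m = m' → k = b ≫ d →
        m ≫ c = (a ⊗ₘ k) ≫ x := by
      rintro P P' Q R R' Z Z' m _ c a b d x _ k H rfl rfl rfl
      rw [H, tensorHom_comp_tensorHom_assoc, Category.comp_id]
    exact ⟨h, e h1 h2 h3 h4⟩

end PlusEquivalence

end Hypermoment

theorem mainTheorem1 (C : Type u) [Category.{v} C] [HypermomentData C]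
    [Hypermoment.IsUnitalHypermoment C] (E : Type u') [Category.{v'} E] [MonoidalCategory E]
    [SymmetricCategory E] :
    Hypermoment.IsUnitalHypermoment (Hypermoment.CTree C) ∧
      ∃ hc : ∀ T : Hypermoment.CTree C, Hypermoment.IsUnitObj T ↔ T.height = 1,
        Nonempty (Hypermoment.PlusEquivalence hc E) :=
  ⟨inferInstance, Hypermoment.CTree.isUnitObj_iff, ⟨Hypermoment.plusEquivalence⟩⟩
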